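/- **Setting.** Let $l\ge 0$, $P\ge 1$, $N=2l+2+P$, $n=\lfloor N/2\rfloor$, $p=\lfloor P/2\rfloor$ (so $n=l+1+p$). Let $q=e^{\hbar}\in\mathbb{C}^{\times}$ be not a root of unity, $q^x=e^{\hbar x}$, $[x]_q=\frac{q^x-q^{-x}}{q-q^{-1}}$. Let $U_q(\mathfrak{g})$, $\mathfrak g=\mathfrak{so}(N)$, be the quantum group generated by $e_{\alpha_i},f_{\alpha_i}$ ($1\le i\le n$) and $q^{\pm h_{\varepsilon_i}}$, with $[e_{\alpha_i},f_{\alpha_j}]=\delta_{ij}[h_{\alpha_i}]_q$, $q^{h_\mu}e_{\alpha}q^{-h_\mu}=q^{(\mu,\alpha)}e_{\alpha}$, $q^{h_\mu}f_{\alpha}q^{-h_\mu}=q^{-(\mu,\alpha)}f_{\alpha}$ and the quantum Serre relations; here $(\varepsilon_i)_{i\le n}$ is orthonormal, $\alpha_i=\varepsilon_i-\varepsilon_{i+1}$ for $i<n$, $\alpha_n=\varepsilon_n$ for odd $N$ and $\alpha_n=\varepsilon_{n-1}+\varepsilon_n$ for even $N$. Let $\lambda\in\mathfrak h^*$, $\lambda_i=(\lambda,\varepsilon_i)$,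 with $\lambda_i=0$ for $i\ge l+2$, and let $M_\lambda$ be the parabolic Verma module with canonical generator $v_\lambda$, relative to the Levi subalgebra $\mathfrak l=\mathfrak h+\mathfrak{so}(P)$. The tensor product $\mathbb{C}^N\otimes M_\lambda$ with the natural representation (basis $w_1,\dots,w_N$ of weights $\varepsilon_1,\dots,\varepsilon_N$, $\varepsilon_i=-\varepsilon_{N+1-i}$) is taken with respect to $\Delta(e_\alpha)=e_\alpha\otimes 1+q^{h_\alpha}\otimes e_\alpha$, $\Delta(q^{h_\mu})=q^{h_\mu}\otimes q^{h_\mu}$. A singular vector is a nonzero weight vector killed by all $e_{\alpha_i}$; the *generating coefficient* of a singular vector $u=\sum_i w_i\otimes y_i$ is $y_1$. **The elements.** Write $f_i=f_{\alpha_i}$. For $1\le m\le p+1$ put $\phi_m=a_mb_m$, where for odd $P$ $$a_m=f_{l+m}\cdots f_{l+1},\qquad b_m=(f_{l+m+1}\cdots f_{l+p+1})(f_{l+p+1}\cdots f_{l+1}),$$ and for even $P$ $$a_m=f_{l+m}\cdots f_{l+1},\quad b_m=(f_{l+m+1}\cdots f_{l+p+1})(f_{l+p-1}\cdots f_{l+1})\quad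 (m\le p),$$ $$a_{p+1}=f_{l+p+1}f_{l+p-1}\cdots f_{l+1},\quad b_{p+1}=f_{l+p}\cdots f_{l+1}.$$ Let $\phi'_m$ be $\phi_m$ without its leftmost factor, and let $d=p+1$ for odd $P$, $d=p$ for even $P$. Put $$f^{(P)}_{2\varepsilon_{l+1}}=\sum_{m=1}^{d}(-1)^{m-1}\big[\tfrac P2-m+1\big]_q\,\phi_m .$$ If $l\ge 1$, put, with $h=h_{\varepsilon_{l+1}}$, $$f^{(P)}_{\varepsilon_l+\varepsilon_{l+1}}=\sum_{m=1}^{d}(-1)^{m+1}f_l\phi_m[h+P-m]_q[h+\tfrac P2]_q+\sum_{m=1}^{p+1}c_m\,a_mf_lb_m[h+\tfrac P2-1]_q[h+\tfrac P2]_q+\sum_{m=1}^{d}(-1)^{m+1}\phi_mf_l[h+m-1]_q[h+\tfrac P2-1]_q,$$ where $c_m=(-1)^m(q^{m-P/2}+q^{P/2-m})$, except that $c_p=c_{p+1}=(-1)^p$ for even $P$. For $1\le k\le l-1$ define inductively the modified commutators $$f^{(P)}_{\varepsilon_k+\varepsilon_{l+1}}=f_kf^{(P)}_{\varepsilon_{k+1}+\varepsilon_{l+1}}[h_{\varepsilon_{k+1}}+h_{\varepsilon_{l+1}}+P+l-k]_q-f^{(P)}_{\varepsilon_{k+1}+\varepsilon_{l+1}}f_k[h_{\varepsilon_{k+1}}+h_{\varepsilon_{l+1}}+P+l-k-1]_q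 .$$ For $k=l+1$, $f^{(P)}_{\varepsilon_{k}+\varepsilon_{l+1}}$ means $f^{(P)}_{2\varepsilon_{l+1}}$. **Proposition.** For all such $l,P,q,\lambda$: 1. For $1\le k\le l$ and $1\le j\le n$, $\;e_{\alpha_j}f^{(P)}_{\varepsilon_k+\varepsilon_{l+1}}v_\lambda=\delta_{jk}[\lambda_k+\lambda_{l+1}+P+l-k]_q\,f^{(P)}_{\varepsilon_{k+1}+\varepsilon_{l+1}}v_\lambda.$ 2. For $1\le j\le n$, $\;e_{\alpha_j}f^{(P)}_{2\varepsilon_{l+1}}v_\lambda=\delta_{j,l+1}[\lambda_{l+1}+\tfrac P2-1]_q\,\phi'_1v_\lambda$, except for $P=2$, $j=l+2=n$, when $e_{\alpha_{l+2}}f^{(2)}_{2\varepsilon_{l+1}}v_\lambda=[\lambda_{l+1}]_q f_{\alpha_{l+1}}v_\lambda$. 3. The vector $f^{(P)}_{\varepsilon_1+\varepsilon_{l+1}}v_\lambda$ is nonzero and is, up to a scalar factor, the unique generating coefficient of a singular vector of weight $\lambda-\varepsilon_{l+1}$ in $\mathbb{C}^N\otimes M_\lambda$; such a singular vector exists and is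 itself unique up to a scalar factor. -/

import Mathlib

noncomputable section

namespace QuantumSO

/-- The nodes `1, …, n` of the Dynkin diagram of `so(N)`, where `n = ⌊N/2⌋`. -/
abbrev Node (N : ℕ) : Type := ↥(Finset.Icc 1 (N / 2))

/-- The index set `1, …, N` of the standard basis `w_1, …, w_N` of `ℂ^N`. -/
abbrev Idx (N : ℕ) : Type := ↥(Finset.Icc 1 N)

/-- The lattice `ℤε_1 ⊕ … ⊕ ℤε_n`. -/
abbrev Lat (N : ℕ) : Type := Node N → ℤ

/-- The basis vector `ε_i`, `1 ≤ i ≤ n` (and `ε_i = 0` for other `i`; this is used only for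
`i = n + 1`). -/
def eps (N i : ℕ) : Lat N := fun k => if (k : ℕ) = i then 1 else 0

/-- The weights `ε_1, …, ε_N` of the natural representation: `ε_i = -ε_{N+1-i}`; in particular
the middle one is zero for odd `N`. -/
def natWeight (N i : ℕ) : Lat N := if i ≤ N / 2 then eps N i else -eps N (N + 1 - i)

/-- The simple roots: `α_i = ε_i - ε_{i+1}` for `i < n`, and `α_n = ε_{n-1} + ε_n` for even `N`,
`α_n = ε_n` for odd `N`. -/
def simpleRoot (N i : ℕ) : Lat N :=
  if i < N / 2 then eps N i - eps N (i + 1)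
  else if Even N then eps N (i - 1) + eps N i
  else eps N i

/-- The canonical inner product on the lattice, for which the `ε_i` are orthonormal. -/
def ip {N : ℕ} (μ ν : Lat N) : ℤ := ∑ k, μ k * ν k

/-- The inner product of a complex weight with a lattice element. -/
def pair {N : ℕ} (lam : Node N → ℂ) (μ : Lat N) : ℂ := ∑ k, lam k * (μ k : ℂ)

/-- `q^x`, where `q = exp hb`. -/
def qpow (hb x : ℂ) : ℂ := Complex.exp (hb * x)

/-- The `q`-number `[x]_q = (q^x - q^{-x}) / (q - q^{-1})`. -/
def qnum (hb x : ℂ) : ℂ := (qpow hb x - qpow hb (-x)) / (qpow hb 1 - qpow hb (-1))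

section Algebra

variable (hb : ℂ) (N : ℕ)

/-- Generators of `U_q(so(N))`: the Chevalley generators, and `K μ = q^{h_μ}`. -/
inductive Gen : Type
  | e (i : Node N) : Gen
  | f (i : Node N) : Gen
  | K (μ : Lat N) : Gen

/-- The free algebra on the generators. -/
abbrev Free : Type := FreeAlgebra ℂ (Gen N)

/-- The quantum Serre polynomial for `(x, y) = (e_i, e_j)` or `(f_i, f_j)`, when `α_i` is
a long root (squared length `2`) and `(α_i, α_j) = -1`. -/
def serreLong (x y : Free N) : Free N :=
  x ^ 2 * y - (qpow hb 1 + qpow hb (-1)) • (x * y * x) + y * x ^ 2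

/-- The quantum Serre polynomial when `α_i` is a short root (squared length `1`) and
`(α_i, α_j) = -1`, so that the Cartan integer is `-2`. The quantum integer `3` at `q^{1/2}` is
`q + 1 + q^{-1}`. -/
def serreShort (x y : Free N) : Free N :=
  x ^ 3 * y - (qpow hb 1 + 1 + qpow hb (-1)) • (x ^ 2 * y * x)
    + (qpow hb 1 + 1 + qpow hb (-1)) • (x * y * x ^ 2) - y * x ^ 3

open FreeAlgebra in
/-- Defining relations of `U_q(so(N))`. -/
inductive Rel : Free N → Free N → Prop
  | K_zero : Rel (ι ℂ (Gen.K 0)) 1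
  | K_add (μ ν : Lat N) :
      Rel (ι ℂ (Gen.K (μ + ν))) (ι ℂ (Gen.K μ) * ι ℂ (Gen.K ν))
  | K_e (μ : Lat N) (i : Node N) :
      Rel (ι ℂ (Gen.K μ) * ι ℂ (Gen.e i))
        (qpow hb (ip μ (simpleRoot N i) : ℤ) • (ι ℂ (Gen.e i) * ι ℂ (Gen.K μ)))
  | K_f (μ : Lat N) (i : Node N) :
      Rel (ι ℂ (Gen.K μ) * ι ℂ (Gen.f i))
        (qpow hb (-(ip μ (simpleRoot N i) : ℤ)) • (ι ℂ (Gen.f i) * ι ℂ (Gen.K μ)))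
  | e_f_same (i : Node N) :
      Rel (ι ℂ (Gen.e i) * ι ℂ (Gen.f i) - ι ℂ (Gen.f i) * ι ℂ (Gen.e i))
        ((qpow hb 1 - qpow hb (-1))⁻¹ •
          (ι ℂ (Gen.K (simpleRoot N i)) - ι ℂ (Gen.K (-simpleRoot N i))))
  | e_f_ne (i j : Node N) (h : i ≠ j) :
      Rel (ι ℂ (Gen.e i) * ι ℂ (Gen.f j)) (ι ℂ (Gen.f j) * ι ℂ (Gen.e i))
  | e_comm (i j : Node N) (h : i ≠ j) (h0 : ip (simpleRoot N i) (simpleRoot N j) = 0) :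
      Rel (ι ℂ (Gen.e i) * ι ℂ (Gen.e j)) (ι ℂ (Gen.e j) * ι ℂ (Gen.e i))
  | f_comm (i j : Node N) (h : i ≠ j) (h0 : ip (simpleRoot N i) (simpleRoot N j) = 0) :
      Rel (ι ℂ (Gen.f i) * ι ℂ (Gen.f j)) (ι ℂ (Gen.f j) * ι ℂ (Gen.f i))
  | e_long (i j : Node N) (h1 : ip (simpleRoot N i) (simpleRoot N j) = -1)
      (h2 : ip (simpleRoot N i) (simpleRoot N i) = 2) :
      Rel (serreLong hb N (ι ℂ (Gen.e i)) (ι ℂ (Gen.e j))) 0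
  | f_long (i j : Node N) (h1 : ip (simpleRoot N i) (simpleRoot N j) = -1)
      (h2 : ip (simpleRoot N i) (simpleRoot N i) = 2) :
      Rel (serreLong hb N (ι ℂ (Gen.f i)) (ι ℂ (Gen.f j))) 0
  | e_short (i j : Node N) (h1 : ip (simpleRoot N i) (simpleRoot N j) = -1)
      (h2 : ip (simpleRoot N i) (simpleRoot N i) = 1) :
      Rel (serreShort hb N (ι ℂ (Gen.e i)) (ι ℂ (Gen.e j))) 0
  | f_short (i j : Node N) (h1 : ip (simpleRoot N i) (simpleRoot N j) = -1)
      (h2 : ip (simpleRoot N i) (simpleRoot N i) = 1) :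
      Rel (serreShort hb N (ι ℂ (Gen.f i)) (ι ℂ (Gen.f j))) 0

/-- The quantized universal enveloping algebra `U_q(so(N))`, `q = exp hb`. -/
abbrev Uq : Type := RingQuot (Rel hb N)

/-- The class of a generator. -/
def gen (g : Gen N) : Uq hb N := RingQuot.mkAlgHom ℂ (Rel hb N) (FreeAlgebra.ι ℂ g)

/-- `e_{α_i}`, `1 ≤ i ≤ n` (zero for other `i`, which do not occur). -/
def eGen (i : ℕ) : Uq hb N :=
  if h : i ∈ Finset.Icc 1 (N / 2) then gen hb N (Gen.e ⟨i, h⟩) else 0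

/-- `f_{α_i}`, `1 ≤ i ≤ n` (zero for other `i`, which do not occur). -/
def fGen (i : ℕ) : Uq hb N :=
  if h : i ∈ Finset.Icc 1 (N / 2) then gen hb N (Gen.f ⟨i, h⟩) else 0

/-- `K μ = q^{h_μ}`. -/
def KGen (μ : Lat N) : Uq hb N := gen hb N (Gen.K μ)

/-- `[h_μ + c]_q = (q^{h_μ + c} - q^{-h_μ - c}) / (q - q^{-1})`. -/
def hnum (μ : Lat N) (c : ℂ) : Uq hb N :=
  (qpow hb 1 - qpow hb (-1))⁻¹ •
    (qpow hb c • KGen hb N μ - qpow hb (-c) • KGen hb N (-μ))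

/-- The Chevalley monomial `f_{α_{i_1}} ⋯ f_{α_{i_r}}` of a word `i_1, …, i_r`. -/
def fWord (w : List ℕ) : Uq hb N := (w.map (fGen hb N)).prod

end Algebra

section Module

variable (hb : ℂ) (l P : ℕ)

/-- Generators of the left ideal of `U_q(so(N))`, `N = 2l + 2 + P`, annihilating the canonical
generator of the parabolic Verma module relative to the Levi subalgebra `𝔩 = 𝔥 + so(P)`. A simple
root belongs to `𝔩` if and only if it has no components along `ε_1, …, ε_{l+1}`. -/
def vermaRel (lam : Node (2 * l + 2 + P) → ℂ) : Set (Uq hb (2 * l + 2 + P)) :=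
  {x | ∃ i : Node (2 * l + 2 + P), x = eGen hb _ i} ∪
  {x | ∃ μ : Lat (2 * l + 2 + P),
    x = KGen hb _ μ - qpow hb (pair lam μ) • (1 : Uq hb (2 * l + 2 + P))} ∪
  {x | ∃ i : Node (2 * l + 2 + P),
    (∀ k : Node (2 * l + 2 + P), (k : ℕ) ≤ l + 1 → simpleRoot (2 * l + 2 + P) i k = 0) ∧
    x = fGen hb _ i}

/-- The left ideal generated by `vermaRel`. -/
def vermaIdeal (lam : Node (2 * l + 2 + P) → ℂ) :
    Submodule (Uq hb (2 * l + 2 + P)) (Uq hb (2 * l + 2 + P)) :=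
  Submodule.span _ (vermaRel hb l P lam)

/-- The parabolic Verma module `M_λ = U_q(𝔤) ⊗_{U_q(𝔭⁺)} ℂ_λ`, as the quotient of `U_q(𝔤)` by the
left ideal generated by the kernel of the character `ℂ_λ` of `U_q(𝔭⁺)`. -/
abbrev Verma (lam : Node (2 * l + 2 + P) → ℂ) : Type :=
  Uq hb (2 * l + 2 + P) ⧸ vermaIdeal hb l P lam

/-- The canonical generator `v_λ`. -/
def vacuum (lam : Node (2 * l + 2 + P) → ℂ) : Verma hb l P lam :=
  Submodule.Quotient.mk 1

/-- The descending word `l + a, …, l + 2, l + 1`. -/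
def down (a : ℕ) : List ℕ := (List.range' (l + 1) a).reverse

/-- The left part of the word of `φ_m`, with `p = ⌊P/2⌋`: it is `l + m, …, l + 1`, except that it is
`l + p + 1, l + p - 1, …, l + 1` when `P` is even and `m = p + 1`. -/
def leftWord (m : ℕ) : List ℕ :=
  if Even P ∧ m = P / 2 + 1 then (l + P / 2 + 1) :: down l (P / 2 - 1) else down l m

/-- The right part of the word of `φ_m`: for odd `P` it is
`l + m + 1, …, l + p + 1, l + p + 1, …, l + 1`; for even `P` it is
`l + m + 1, …, l + p + 1, l + p - 1, …, l + 1` if `m ≤ p`, and `l + p, …, l + 1` if `m = p + 1`. -/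
def rightWord (m : ℕ) : List ℕ :=
  if Even P then
    if m = P / 2 + 1 then down l (P / 2)
    else List.range' (l + m + 1) (P / 2 + 1 - m) ++ down l (P / 2 - 1)
  else List.range' (l + m + 1) (P / 2 + 1 - m) ++ down l (P / 2 + 1)

/-- The monomial `φ_m`, of weight `-2ε_{l+1}`. -/
def phi (m : ℕ) : Uq hb (2 * l + 2 + P) := fWord hb _ (leftWord l P m ++ rightWord l P m)

/-- The monomial `φ'_m`: the leftmost factor of `φ_m` is deleted. -/
def phiDel (m : ℕ) : Uq hb (2 * l + 2 + P) :=
  fWord hb _ (leftWord l P m ++ rightWord l P m).tail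

/-- The monomial `φ_m^2`, of weight `-ε_l-ε_{l+1}`: a factor `f_{α_l}` is put between the two parts
of `φ_m`. Since `f_{α_l}` commutes with `f_{α_i}` for `i ≥ l + 2` (if `P ≠ 2`), this is the same as
putting it just before the rightmost factor `f_{α_{l+1}}`. -/
def phiMid (m : ℕ) : Uq hb (2 * l + 2 + P) :=
  fWord hb _ (leftWord l P m ++ l :: rightWord l P m)

/-- The element `f^{(P)}_{2ε_{l+1}} = ∑_m (-1)^{m-1} [P/2 - m + 1]_q φ_m`, where `m` runs from `1`
to `p + 1` for odd `P`, and to `p` for even `P`. -/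
def fDouble : Uq hb (2 * l + 2 + P) :=
  ∑ m ∈ Finset.Icc 1 ((P + 1) / 2),
    ((-1 : ℂ) ^ (m - 1) * qnum hb ((P : ℂ) / 2 - m + 1)) • phi hb l P m

/-- The numerical factor in the coefficient at `φ_m^2`. -/
def midCoeff (m : ℕ) : ℂ :=
  if Even P ∧ P / 2 ≤ m then (-1 : ℂ) ^ (P / 2)
  else (-1 : ℂ) ^ m * (qpow hb ((m : ℂ) - (P : ℂ) / 2) + qpow hb (-((m : ℂ) - (P : ℂ) / 2)))

/-- The element `f^{(P)}_{ε_l+ε_{l+1}}` of `U_q(𝔟_-)`, `l ≥ 1`. -/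
def fNext : Uq hb (2 * l + 2 + P) :=
  let N := 2 * l + 2 + P
  let h : ℂ → Uq hb N := hnum hb N (eps N (l + 1))
  (∑ m ∈ Finset.Icc 1 ((P + 1) / 2),
    (-1 : ℂ) ^ (m + 1) •
      (fGen hb N l * phi hb l P m * (h ((P : ℂ) - m) * h ((P : ℂ) / 2))))
  + (∑ m ∈ Finset.Icc 1 (P / 2 + 1),
      midCoeff hb P m • (phiMid hb l P m * (h ((P : ℂ) / 2 - 1) * h ((P : ℂ) / 2))))
  + (∑ m ∈ Finset.Icc 1 ((P + 1) / 2),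
      (-1 : ℂ) ^ (m + 1) •
        (phi hb l P m * fGen hb N l * (h ((m : ℂ) - 1) * h ((P : ℂ) / 2 - 1))))

/-- `fDesc d` is the element `f^{(P)}_{ε_k+ε_{l+1}}` with `k = l + 1 - d`, defined by descending
induction on `k` through modified commutators. -/
def fDesc : ℕ → Uq hb (2 * l + 2 + P)
  | 0 => fDouble hb l P
  | 1 => fNext hb l P
  | d + 2 =>
    let N := 2 * l + 2 + P
    let k := l - 1 - d
    let μ : Lat N := eps N (k + 1) + eps N (l + 1)
    fGen hb N k * fDesc (d + 1) * hnum hb N μ ((P : ℂ) + l - k)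
      - fDesc (d + 1) * fGen hb N k * hnum hb N μ ((P : ℂ) + l - k - 1)

/-- The element `f^{(P)}_{ε_k+ε_{l+1}}` of `U_q(𝔟_-)`, `1 ≤ k ≤ l + 1`. -/
def fP (k : ℕ) : Uq hb (2 * l + 2 + P) := fDesc hb l P (l + 1 - k)

/-- The matrix of `e_{α_i}` in the natural representation: the entry at `(a, b)` is the coefficient
of `w_a` in `e_{α_i} w_b`. -/
def natE (N i : ℕ) : Matrix (Idx N) (Idx N) ℂ := fun a b =>
  if i < N / 2 then
    if (a : ℕ) = i ∧ (b : ℕ) = i + 1 then 1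
    else if (a : ℕ) = N - i ∧ (b : ℕ) = N + 1 - i then -1 else 0
  else if Even N then
    if (a : ℕ) + 1 = i ∧ (b : ℕ) = i + 1 then 1
    else if (a : ℕ) = i ∧ (b : ℕ) = i + 2 then -1 else 0
  else
    if (a : ℕ) = i ∧ (b : ℕ) = i + 1 then 1
    else if (a : ℕ) = i + 1 ∧ (b : ℕ) = i + 2 then -1 else 0

/-- The matrix of `K μ` in the natural representation. -/
def natK (N : ℕ) (μ : Lat N) : Matrix (Idx N) (Idx N) ℂ :=
  Matrix.diagonal fun a => qpow hb (ip μ (natWeight N a) : ℤ)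

variable (lam : Node (2 * l + 2 + P) → ℂ)

/-- The vector space `ℂ^N ⊗ M_λ`. -/
abbrev NatTensor : Type := TensorProduct ℂ (Idx (2 * l + 2 + P) → ℂ) (Verma hb l P lam)

/-- The action of an element of `U_q(so(N))` on `M_λ` as a linear operator. -/
def act (x : Uq hb (2 * l + 2 + P)) : Verma hb l P lam →ₗ[ℂ] Verma hb l P lam :=
  Algebra.lsmul ℂ ℂ (Verma hb l P lam) x

/-- The action of `e_{α_i}` on `ℂ^N ⊗ M_λ` through the coproduct
`Δ(e_α) = e_α ⊗ 1 + q^{h_α} ⊗ e_α`. -/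
def tensorE (i : ℕ) : NatTensor hb l P lam →ₗ[ℂ] NatTensor hb l P lam :=
  TensorProduct.map (Matrix.toLin' (natE (2 * l + 2 + P) i)) LinearMap.id
    + TensorProduct.map (Matrix.toLin' (natK hb (2 * l + 2 + P) (simpleRoot _ i)))
        (act hb l P lam (eGen hb _ i))

/-- The action of `K μ` on `ℂ^N ⊗ M_λ` through the coproduct `Δ(K μ) = K μ ⊗ K μ`. -/
def tensorK (μ : Lat (2 * l + 2 + P)) : NatTensor hb l P lam →ₗ[ℂ] NatTensor hb l P lam :=
  TensorProduct.map (Matrix.toLin' (natK hb (2 * l + 2 + P) μ)) (act hb l P lam (KGen hb _ μ))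

/-- `u` is a singular vector of weight `ν` in `ℂ^N ⊗ M_λ`. -/
def IsSingular (ν : Node (2 * l + 2 + P) → ℂ) (u : NatTensor hb l P lam) : Prop :=
  u ≠ 0 ∧ (∀ μ : Lat (2 * l + 2 + P), tensorK hb l P lam μ u = qpow hb (pair ν μ) • u) ∧
    ∀ i : ℕ, 1 ≤ i → i ≤ (2 * l + 2 + P) / 2 → tensorE hb l P lam i u = 0

/-- The coefficient `y_a` of `u = ∑_a w_a ⊗ y_a`. -/
def coeff (a : Idx (2 * l + 2 + P)) (u : NatTensor hb l P lam) : Verma hb l P lam :=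
  TensorProduct.lid ℂ (Verma hb l P lam)
    (LinearMap.rTensor (Verma hb l P lam) (LinearMap.proj a) u)

/-- The weight `λ - ε_{l+1}`. -/
def targetWeight : Node (2 * l + 2 + P) → ℂ :=
  fun k => lam k - (eps (2 * l + 2 + P) (l + 1) k : ℂ)

/-- The index `1`. -/
def firstIdx : Idx (2 * l + 2 + P) := ⟨1, Finset.mem_Icc.mpr ⟨le_refl 1, by omega⟩⟩

/-- `y` is a generating coefficient of a singular vector of weight `λ - ε_{l+1}`, that is,
its coefficient `y_1` at `w_1`. -/
def IsGeneratingCoeff (y : Verma hb l P lam) : Prop :=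
  ∃ u : NatTensor hb l P lam,
    IsSingular hb l P lam (targetWeight l P lam) u ∧ coeff hb l P lam (firstIdx l P) u = y

end Module

end QuantumSO

end

open QuantumSO

/-! The first two assertions are computations on a vector v killed by the e_j with j > l and, unless
P = 2, by the f_j of the Levi part (`HW`). For P ≥ 3 the vector f_{l+1} v generates a copy of the
natural representation of so(P): the a_m v are its upper half, the b_m v its lower half. The Serre
relations alone force every other f_j to vanish on these vectors (`SerreOps.odd_down`,
`SerreOps.even_down`), and the commutator [e_j, f_j] then gives the action of the e_j
(`OddChain.eD`, `EvenChain.eD`). As a result, e_{l+s} with s ≥ 2, away from the end of the diagram,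
sends every φ_m v to a multiple of one and the same vector, and it kills ∑ c_m φ_m v as soon as
c_{s-1} + [2]_q c_s + c_{s+1} = 0 (`Family.e_aSum`). Alternating q-numbers in arithmetic progression
solve this recurrence; the precise coefficients are dictated by the boundary conditions at e_{l+1}
and at the end of the diagram. For k < l the modified commutator is built so that the two
contributions of e_{k+1} cancel, while e_k produces [x][y] - [x-1][y-1] = [x+y-1] (`HW.e_fDesc`).
The cases P = 1 and P = 2 are done by hand.

For the third assertion, write a singular vector as ∑ w_a ⊗ y_a. The equations for the e_j express
each coordinate through an earlier one, so y_1 determines all of them (`IsSing.eq_zero`), and y_1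
has weight λ - ε_1 - ε_{l+1} and is killed by e_j for j > 1 (outside l = 0, P = 2). Everything
therefore reduces to such vectors in M_λ, and a means of detecting nonzero vectors there is needed.
It is provided by linear maps θ_k : M_λ → ℂ^N ⊗ M_λ with θ_k(v) = w_k ⊗ v that intertwine f_i with
Δ(f_i) (`IsTheta`). They exist because M_λ is presented, over the algebra of the f_i, by the Serre
relations and the vanishing of the Levi f_i on v (`Verma.exists_lift`), while the operators Δ(f_i)
satisfy the Serre relations (`isSerre_fHat`). The presentation is a form of the triangular
decomposition; it is obtained by constructing the action of the e_i and q^{h_μ} on the presented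
module (`negRep`).

The component of θ_k at w_{k+1} is a twisted derivation which sends f_{ε_k+ε_{l+1}} v to a multiple
of f_{ε_{k+1}+ε_{l+1}} v. The computation is the one for e_k with q^{-x} in place of [x]_q, so the
factor never vanishes (`IsVacuum.lower_fDesc`), and nonvanishing follows by induction
(`IsVacuum.fDesc_ne_zero`).

Uniqueness (`IsVacuum.sing_unique`) is an induction on l + 1 - k. For k ≤ l the map θ_k intertwines
e_j for j > k, so the component at w_{k+1} of a candidate y is a candidate for k + 1. Subtracting a
multiple of f_{ε_k+ε_{l+1}} v makes this component zero; the equations for the e_j then annihilate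
the components up to w_{N-k}, and a vector of the given weight without such components is zero
(`IsTheta.eq_zero_of_comp`). That last fact comes from writing the vector as ∑ g_a m_a, with g_a the
iterated adjoint images of f_k. At k = l + 1 the weight space is spanned by the φ_m v
(`HW.exists_aSum`), and the recurrence has a one-dimensional solution space (`HW.base_unique`).

For existence, the coordinates of θ_1(y_1) strictly between w_1 and w_N, rescaled, serve as
coordinates of the singular vector; only the first and the last are adjusted
(`IsVacuum.exists_isSing`). -/

noncomputable section
namespace QuantumSO

/-! ### q-numbers when q is not a root of unity -/

section Scalars

variable (hb : ℂ)

/-- `q = exp hb` is not a root of unity. -/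
def NotRoot : Prop := ∀ k : ℕ, 0 < k → Complex.exp hb ^ k ≠ 1

theorem qpow_zero : qpow hb 0 = 1 := by simp [qpow]

theorem qpow_add (x y : ℂ) : qpow hb (x + y) = qpow hb x * qpow hb y := by
  simp [qpow, mul_add, Complex.exp_add]

theorem qpow_neg (x : ℂ) : qpow hb (-x) = (qpow hb x)⁻¹ := by
  simp [qpow, Complex.exp_neg]

theorem qpow_sub (x y : ℂ) : qpow hb (x - y) = qpow hb x * (qpow hb y)⁻¹ := by
  rw [sub_eq_add_neg, qpow_add, qpow_neg]

theorem qpow_ne_zero (x : ℂ) : qpow hb x ≠ 0 := Complex.exp_ne_zero _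

theorem qpow_two : qpow hb 2 = qpow hb 1 ^ 2 := by
  rw [show (2 : ℂ) = 1 + 1 by norm_num, qpow_add, sq]

theorem qpow_natCast (k : ℕ) : qpow hb k = Complex.exp hb ^ k := by
  rw [qpow, mul_comm, Complex.exp_nat_mul]

theorem qnum_zero : qnum hb 0 = 0 := by simp [qnum]

theorem qnum_neg (x : ℂ) : qnum hb (-x) = -qnum hb x := by
  simp only [qnum, neg_neg]; ring

variable {hb}

theorem qpow_one_sub_ne (h : NotRoot hb) : qpow hb 1 - qpow hb (-1) ≠ 0 := by
  intro h0
  apply h 2 two_pos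
  rw [← qpow_natCast]
  have h1 : qpow hb 1 = qpow hb (-1) := sub_eq_zero.mp h0
  have : ((2 : ℕ) : ℂ) = 1 - (-1) := by norm_num
  rw [this, qpow_sub, ← h1, mul_inv_cancel₀ (qpow_ne_zero hb _)]

/-- This is [2]_q, the middle coefficient of the long Serre relation; `qpow_three_ne` treats [3] at
q^{1/2} for the short one. Both have to be cancelled repeatedly. -/
theorem qpow_one_add_ne (h : NotRoot hb) : qpow hb 1 + qpow hb (-1) ≠ 0 := by
  intro h0
  apply h 4 (by norm_num)
  rw [← qpow_natCast]
  have h1 : qpow hb 1 = -qpow hb (-1) := eq_neg_of_add_eq_zero_left h0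
  have : ((4 : ℕ) : ℂ) = (1 - (-1)) + (1 - (-1)) := by norm_num
  rw [this, qpow_add, qpow_sub, h1]
  field_simp [qpow_ne_zero hb (-1)]

theorem qpow_three_ne (h : NotRoot hb) : qpow hb 1 + 1 + qpow hb (-1) ≠ 0 := by
  intro h0
  apply h 3 (by norm_num)
  rw [qpow_neg] at h0
  have hz := qpow_ne_zero hb 1
  have h2 : Complex.exp hb = qpow hb 1 := by simp [qpow]
  rw [h2]
  field_simp at h0
  linear_combination (qpow hb 1 - 1) * h0

theorem qnum_one (h : NotRoot hb) : qnum hb 1 = 1 := div_self (qpow_one_sub_ne h)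

theorem qnum_two (h : NotRoot hb) : qnum hb 2 = qpow hb 1 + qpow hb (-1) := by
  have := qpow_one_sub_ne h
  rw [qnum, div_eq_iff this]
  rw [show (2 : ℂ) = 1 + 1 by norm_num, neg_add, qpow_add, qpow_add]
  ring

theorem qnum_half_ne (h : NotRoot hb) (P : ℕ) (hP : 1 ≤ P) : qnum hb ((P : ℂ) / 2) ≠ 0 := by
  rw [qnum, div_ne_zero_iff]
  refine ⟨fun h0 => ?_, qpow_one_sub_ne h⟩
  apply h P (by omega)
  rw [← qpow_natCast]
  have h1 := sub_eq_zero.mp h0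
  rw [show (P : ℂ) = P / 2 - -(P / 2) by ring, qpow_sub, ← h1,
    mul_inv_cancel₀ (qpow_ne_zero hb _)]

end Scalars

/-! ### Weights, simple roots and the Dynkin diagram in coordinates -/

section Lattice

variable {N : ℕ}

/-- The value of a weight, given by its coordinates, on a lattice element. -/
def wsum (N : ℕ) (ν : ℕ → ℂ) (μ : Lat N) : ℂ := ∑ k : Node N, ν k * (μ k : ℂ)

/-- The coordinates of `α_i`. -/
def rt (N i : ℕ) : ℕ → ℂ :=
  if i < N / 2 then Pi.single i 1 - Pi.single (i + 1) 1
  else if Even N then Pi.single (i - 1) 1 + Pi.single i 1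
  else Pi.single i 1

theorem eps_eq (i : ℕ) (k : Node N) : (eps N i k : ℂ) = (Pi.single i 1 : ℕ → ℂ) k := by
  simp only [eps, Pi.single_apply]; split_ifs <;> simp

theorem simpleRoot_eq (i : ℕ) (k : Node N) : (simpleRoot N i k : ℂ) = rt N i k := by
  simp only [simpleRoot, rt]
  split_ifs <;> simp [eps_eq]

theorem wsum_add (ν : ℕ → ℂ) (μ μ' : Lat N) : wsum N ν (μ + μ') = wsum N ν μ + wsum N ν μ' := by
  simp [wsum, mul_add, Finset.sum_add_distrib]

theorem wsum_neg (ν : ℕ → ℂ) (μ : Lat N) : wsum N ν (-μ) = -wsum N ν μ := by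
  simp [wsum]

theorem wsum_sub (ν : ℕ → ℂ) (μ μ' : Lat N) : wsum N ν (μ - μ') = wsum N ν μ - wsum N ν μ' := by
  rw [sub_eq_add_neg, wsum_add, wsum_neg, sub_eq_add_neg]

theorem wsum_sub_left (ν ν' : ℕ → ℂ) (μ : Lat N) :
    wsum N (ν - ν') μ = wsum N ν μ - wsum N ν' μ := by
  simp [wsum, sub_mul, Finset.sum_sub_distrib]

theorem wsum_add_left (ν ν' : ℕ → ℂ) (μ : Lat N) :
    wsum N (ν + ν') μ = wsum N ν μ + wsum N ν' μ := by
  simp [wsum, add_mul, Finset.sum_add_distrib]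

theorem wsum_congr {ν ν' : ℕ → ℂ} (h : ∀ i, 1 ≤ i → i ≤ N / 2 → ν i = ν' i) (μ : Lat N) :
    wsum N ν μ = wsum N ν' μ := by
  refine Finset.sum_congr rfl fun k _ => ?_
  rw [h k (Finset.mem_Icc.mp k.2).1 (Finset.mem_Icc.mp k.2).2]

theorem wsum_eps (ν : ℕ → ℂ) (i : ℕ) :
    wsum N ν (eps N i) = if 1 ≤ i ∧ i ≤ N / 2 then ν i else 0 := by
  split_ifs with h
  · rw [wsum, Finset.sum_eq_single (⟨i, Finset.mem_Icc.mpr h⟩ : Node N)]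
    · simp [eps]
    · intro b _ hb
      have : (b : ℕ) ≠ i := fun h' => hb (Subtype.ext h')
      simp [eps, this]
    · simp
  · refine Finset.sum_eq_zero fun k _ => ?_
    have : (k : ℕ) ≠ i := fun h' => h (h' ▸ Finset.mem_Icc.mp k.2)
    simp [eps, this]

theorem wsum_rt (i : ℕ) (μ : Lat N) : wsum N (rt N i) μ = (ip μ (simpleRoot N i) : ℤ) := by
  simp only [wsum, ip, Int.cast_sum, Int.cast_mul, simpleRoot_eq]
  exact Finset.sum_congr rfl fun k _ => mul_comm _ _

/-- The value of a weight on the coroot-like element `α_i`. -/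
def dval (N : ℕ) (ν : ℕ → ℂ) (i : ℕ) : ℂ :=
  if i < N / 2 then ν i - ν (i + 1) else if Even N then ν (i - 1) + ν i else ν i

theorem wsum_simpleRoot (hN : 3 ≤ N) (ν : ℕ → ℂ) {i : ℕ} (h1 : 1 ≤ i) (h2 : i ≤ N / 2) :
    wsum N ν (simpleRoot N i) = dval N ν i := by
  simp only [simpleRoot, dval]
  split_ifs with h3 h4
  · rw [wsum_sub, wsum_eps, wsum_eps, if_pos ⟨h1, h2⟩, if_pos (by omega)]
  · obtain ⟨c, rfl⟩ := h4
    rw [wsum_add, wsum_eps, wsum_eps, if_pos (show 1 ≤ i - 1 ∧ i - 1 ≤ (c + c) / 2 by omega),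
      if_pos (show 1 ≤ i ∧ i ≤ (c + c) / 2 from ⟨h1, h2⟩)]
  · rw [wsum_eps, if_pos ⟨h1, h2⟩]

theorem ip_comm (μ ν : Lat N) : ip μ ν = ip ν μ :=
  Finset.sum_congr rfl fun k _ => mul_comm _ _

theorem ip_cast_dval (hN : 3 ≤ N) {i : ℕ} (h1 : 1 ≤ i) (h2 : i ≤ N / 2) (j : ℕ) :
    ((ip (simpleRoot N i) (simpleRoot N j) : ℤ) : ℂ) = dval N (rt N j) i := by
  rw [← wsum_simpleRoot hN _ h1 h2, wsum_rt]

/-- Neighbouring nodes `i < j` of the Dynkin diagram. -/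
def AdjLt (N i j : ℕ) : Prop :=
  (i + 1 = j ∧ ¬(Even N ∧ j = N / 2)) ∨ (Even N ∧ i + 2 = j ∧ j = N / 2)

theorem ip_adjLt (hN : 3 ≤ N) {i j : ℕ} (h1 : 1 ≤ i) (h2 : j ≤ N / 2) (h : AdjLt N i j) :
    ip (simpleRoot N i) (simpleRoot N j) = -1 := by
  have hij : i < j := by rcases h with h | h <;> omega
  have : ((ip (simpleRoot N i) (simpleRoot N j) : ℤ) : ℂ) = ((-1 : ℤ) : ℂ) := by
    rw [ip_cast_dval hN h1 (by omega)]
    simp only [dval, rt, if_pos (show i < N / 2 by omega)]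
    rcases h with ⟨h, h'⟩ | ⟨h, h', h''⟩
    · subst h
      split_ifs with h3 h4
      · simp [show i ≠ i + 1 + 1 by omega]
      · exact absurd ⟨h4, by omega⟩ h'
      · simp
    · subst h'
      rw [if_neg (by omega), if_pos h]
      simp
  exact_mod_cast this

theorem ip_far (hN : 3 ≤ N) {i j : ℕ} (h1 : 1 ≤ i) (h2 : j ≤ N / 2) (hij : i < j)
    (h : ¬AdjLt N i j) : ip (simpleRoot N i) (simpleRoot N j) = 0 := by
  have : ((ip (simpleRoot N i) (simpleRoot N j) : ℤ) : ℂ) = ((0 : ℤ) : ℂ) := by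
    rw [ip_cast_dval hN h1 (by omega)]
    simp only [dval, rt, if_pos (show i < N / 2 by omega)]
    simp only [AdjLt] at h
    split_ifs with h3 h4
    · have : i + 1 ≠ j := fun h' => h (Or.inl ⟨h', fun h5 => by omega⟩)
      simp [Pi.single_apply]; split_ifs <;> first | omega | simp
    · have : i + 2 ≠ j := fun h' => h (Or.inr ⟨h4, h', by omega⟩)
      simp [Pi.single_apply]; split_ifs <;> first | omega | simp
    · have : i + 1 ≠ j := fun h' => h (Or.inl ⟨h', fun h5 => h4 h5.1⟩)
      simp [Pi.single_apply]; split_ifs <;> first | omega | simp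
  exact_mod_cast this

theorem ip_long (hN : 3 ≤ N) {i : ℕ} (h1 : 1 ≤ i) (h2 : i ≤ N / 2) (h : i < N / 2 ∨ Even N) :
    ip (simpleRoot N i) (simpleRoot N i) = 2 := by
  have : ((ip (simpleRoot N i) (simpleRoot N i) : ℤ) : ℂ) = ((2 : ℤ) : ℂ) := by
    rw [ip_cast_dval hN h1 h2]
    simp only [dval, rt]
    split_ifs with h3 h4
    · simp; norm_num
    · have : i ≠ i - 1 := by omega
      simp [this, this.symm]; norm_num
    · tauto
  exact_mod_cast this

theorem ip_short (hN : 3 ≤ N) (h : ¬Even N) :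
    ip (simpleRoot N (N / 2)) (simpleRoot N (N / 2)) = 1 := by
  have : ((ip (simpleRoot N (N / 2)) (simpleRoot N (N / 2)) : ℤ) : ℂ) = ((1 : ℤ) : ℂ) := by
    rw [ip_cast_dval hN (by omega) le_rfl]
    simp [dval, rt, h]
  exact_mod_cast this

end Lattice


/-! ### Natural representations forced by the Serre relations -/

section SerreOperators

variable {hb : ℂ} {N k : ℕ} {X : Type*} [AddCommGroup X] [Module ℂ X]

/-- Operators `φ_j`, `k < j ≤ n`, that satisfy the quantum Serre relations of `U_q(so(N))`. -/
structure SerreOps (hb : ℂ) (N k : ℕ) (φ : ℕ → Module.End ℂ X) : Prop where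
  comm : ∀ i j, k < i → i ≤ N / 2 → k < j → j ≤ N / 2 → i ≠ j →
    ip (simpleRoot N i) (simpleRoot N j) = 0 → ∀ x, φ i (φ j x) = φ j (φ i x)
  long : ∀ i j, k < i → i ≤ N / 2 → k < j → j ≤ N / 2 →
    ip (simpleRoot N i) (simpleRoot N j) = -1 → ip (simpleRoot N i) (simpleRoot N i) = 2 →
    ∀ x, φ i (φ i (φ j x)) - (qpow hb 1 + qpow hb (-1)) • φ i (φ j (φ i x))
      + φ j (φ i (φ i x)) = 0
  short : ∀ i j, k < i → i ≤ N / 2 → k < j → j ≤ N / 2 →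
    ip (simpleRoot N i) (simpleRoot N j) = -1 → ip (simpleRoot N i) (simpleRoot N i) = 1 →
    ∀ x, φ i (φ i (φ i (φ j x))) - (qpow hb 1 + 1 + qpow hb (-1)) • φ i (φ i (φ j (φ i x)))
      + (qpow hb 1 + 1 + qpow hb (-1)) • φ i (φ j (φ i (φ i x))) - φ j (φ i (φ i (φ i x))) = 0

namespace SerreOps

variable {φ : ℕ → Module.End ℂ X}

theorem mono (h : SerreOps hb N k φ) {k' : ℕ} (hk : k ≤ k') : SerreOps hb N k' φ where
  comm i j h1 h2 h3 h4 := h.comm i j (by omega) h2 (by omega) h4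
  long i j h1 h2 h3 h4 := h.long i j (by omega) h2 (by omega) h4
  short i j h1 h2 h3 h4 := h.short i j (by omega) h2 (by omega) h4

variable (h : SerreOps hb N k φ) (hq : NotRoot hb) (hN : 3 ≤ N)
include h hN

theorem comm_of_lt {i j : ℕ} (h1 : k < i) (h2 : j ≤ N / 2) (hij : i < j) (ha : ¬AdjLt N i j)
    (x : X) : φ i (φ j x) = φ j (φ i x) :=
  h.comm i j h1 (by omega) (by omega) h2 hij.ne (ip_far hN (by omega) h2 hij ha) x

theorem long_of_adj {i j : ℕ} (h1 : k < i) (h2 : i ≤ N / 2) (h3 : k < j) (h4 : j ≤ N / 2)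
    (hl : i < N / 2 ∨ Even N) (ha : AdjLt N i j ∨ AdjLt N j i) (x : X) :
    φ i (φ i (φ j x)) - (qpow hb 1 + qpow hb (-1)) • φ i (φ j (φ i x)) + φ j (φ i (φ i x)) = 0 := by
  refine h.long i j h1 h2 h3 h4 ?_ (ip_long hN (by omega) h2 hl) x
  rcases ha with ha | ha
  · exact ip_adjLt hN (by omega) h4 ha
  · rw [ip_comm]; exact ip_adjLt hN (by omega) h2 ha

theorem sq_apply_eq_zero {i j : ℕ} (h1 : k < i) (h2 : i ≤ N / 2) (h3 : k < j) (h4 : j ≤ N / 2)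
    (hl : i < N / 2 ∨ Even N) (ha : AdjLt N i j ∨ AdjLt N j i) {x : X} (hx : φ i x = 0) :
    φ i (φ i (φ j x)) = 0 := by
  simpa [hx] using h.long_of_adj hN h1 h2 h3 h4 hl ha x

include hq in
-- The two outer terms of the long Serre relation vanish on x, which leaves [2]_q times the middle
-- one.
theorem sandwich_eq_zero {i j : ℕ} (h1 : k < i) (h2 : i ≤ N / 2) (h3 : k < j) (h4 : j ≤ N / 2)
    (hl : i < N / 2 ∨ Even N) (ha : AdjLt N i j ∨ AdjLt N j i) {x : X} (hx : φ j x = 0)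
    (hx' : φ i (φ i x) = 0) : φ i (φ j (φ i x)) = 0 := by
  have := h.long_of_adj hN h1 h2 h3 h4 hl ha x
  simp only [hx, hx', map_zero, zero_sub, add_zero, neg_eq_zero] at this
  exact (smul_eq_zero.mp this).resolve_left (qpow_one_add_ne hq)

theorem apply_sq {i j : ℕ} (h1 : k < i) (h2 : i ≤ N / 2) (h3 : k < j) (h4 : j ≤ N / 2)
    (hl : i < N / 2 ∨ Even N) (ha : AdjLt N i j ∨ AdjLt N j i) {x : X} (hx : φ j x = 0) :
    φ j (φ i (φ i x)) = (qpow hb 1 + qpow hb (-1)) • φ i (φ j (φ i x)) := by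
  have := h.long_of_adj hN h1 h2 h3 h4 hl ha x
  simp only [hx, map_zero, zero_sub] at this
  rw [neg_add_eq_zero] at this
  exact this.symm

theorem short_last (ho : ¬Even N) (h1 : k + 1 < N / 2) (x : X) :
    φ (N / 2) (φ (N / 2) (φ (N / 2) (φ (N / 2 - 1) x)))
      - (qpow hb 1 + 1 + qpow hb (-1)) • φ (N / 2) (φ (N / 2) (φ (N / 2 - 1) (φ (N / 2) x)))
      + (qpow hb 1 + 1 + qpow hb (-1)) • φ (N / 2) (φ (N / 2 - 1) (φ (N / 2) (φ (N / 2) x)))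
      - φ (N / 2 - 1) (φ (N / 2) (φ (N / 2) (φ (N / 2) x))) = 0 := by
  refine h.short _ _ (by omega) le_rfl (by omega) (by omega) ?_ (ip_short hN ho) x
  rw [ip_comm]
  exact ip_adjLt hN (by omega) le_rfl (Or.inl ⟨by omega, fun h' => ho h'.1⟩)

include hq

/-- The first half of a chain of the natural representation. -/
theorem chain_up {U : ℕ → X} (hU : ∀ i, k < i → i < N / 2 → U (i + 1) = φ i (U i))
    (h0 : ∀ j, k + 1 < j → j ≤ N / 2 → ¬(Even N ∧ j = N / 2 ∧ k + 2 = N / 2) →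
      φ j (U (k + 1)) = 0)
    (h0' : k + 1 < N / 2 → φ (k + 1) (φ (k + 1) (U (k + 1))) = 0)
    {i j : ℕ} (hi : k < i) (hi' : i ≤ N / 2) (hj : k < j) (hj' : j ≤ N / 2) (hij : j ≠ i)
    (he : ¬(Even N ∧ j = N / 2 ∧ i + 1 = N / 2)) : φ j (U i) = 0 := by
  induction i using Nat.strong_induction_on generalizing j with
  | _ i IH =>
  obtain rfl | hi1 : i = k + 1 ∨ k + 1 < i := by omega
  · exact h0 j (by omega) hj' (fun h' => he ⟨h'.1, h'.2.1, by omega⟩)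
  obtain ⟨i, rfl⟩ : ∃ m, i = m + 1 := ⟨i - 1, by omega⟩
  rw [hU i (by omega) (by omega)]
  rcases lt_trichotomy j i with hlt | rfl | hgt
  -- For j < i only the neighbour j = i - 1 fails to commute with φ_i. In that case U_i = φ_j U_j,
  -- and the vector is the sandwich φ_j φ_i φ_j U_j.
  · by_cases hji : j + 1 = i
    · subst hji
      rw [hU j hj (by omega)]
      refine h.sandwich_eq_zero hq hN hj hj' (by omega) (by omega) (Or.inl (by omega))
        (Or.inl (Or.inl ⟨rfl, fun h' => by omega⟩)) ?_ ?_
      · exact IH j (by omega) hj hj' (by omega) (by omega) (by omega) (fun h' => by omega)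
      · rw [← hU j hj (by omega)]
        exact IH (j + 1) (by omega) (by omega) (by omega) hj hj' (by omega) (fun h' => by omega)
    · rw [h.comm_of_lt hN hj (by omega) hlt (fun h' => by rcases h' with h' | h' <;> omega),
        IH i (by omega) (by omega) (by omega) hj hj' (by omega) (fun h' => by omega), map_zero]
  · obtain rfl | hj1 : j = k + 1 ∨ k + 1 < j := by omega
    · exact h0' (by omega)
    obtain ⟨m, rfl⟩ : ∃ m, j = m + 1 := ⟨j - 1, by omega⟩
    rw [hU m (by omega) (by omega)]
    exact h.sq_apply_eq_zero hN hj hj' (by omega) (by omega) (Or.inl (by omega))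
      (Or.inr (Or.inl ⟨rfl, fun h' => by omega⟩))
      (IH m (by omega) (by omega) (by omega) hj hj' (by omega) (fun h' => by omega))
  · rw [← h.comm_of_lt hN (by omega) hj' hgt (fun h' => by
      rcases h' with h' | h' <;> [skip; exact he ⟨h'.1, h'.2.2, by omega⟩]
      omega), IH i (by omega) (by omega) (by omega) hj hj' (by omega)
        (fun h' => by omega), map_zero]

section Odd

variable (ho : ¬Even N) {U D : ℕ → X} {Z : X}
  (hU : ∀ i, k < i → i < N / 2 → U (i + 1) = φ i (U i))
  (hZ : Z = φ (N / 2) (U (N / 2)))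
  (hD0 : D (N / 2) = φ (N / 2) Z)
  (hD : ∀ i, k < i → i < N / 2 → D i = φ i (D (i + 1)))
  (hk : k < N / 2)
  (h0 : ∀ j, k + 1 < j → j ≤ N / 2 → φ j (U (k + 1)) = 0)
  (h0' : k + 1 < N / 2 → φ (k + 1) (φ (k + 1) (U (k + 1))) = 0)
  (h0'' : k + 1 = N / 2 → φ (k + 1) (φ (k + 1) (φ (k + 1) (U (k + 1)))) = 0)
include ho hU h0 h0'

theorem odd_up {i j : ℕ} (hi : k < i) (hi' : i ≤ N / 2) (hj : k < j) (hj' : j ≤ N / 2)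
    (hij : j ≠ i) : φ j (U i) = 0 :=
  h.chain_up hq hN hU (fun j hj hj' _ => h0 j hj hj') h0' hi hi' hj hj' hij (fun h' => ho h'.1)

include hZ hk

theorem odd_mid {j : ℕ} (hj : k < j) (hj' : j < N / 2) : φ j Z = 0 := by
  have hu := fun i j => h.odd_up hq hN ho hU h0 h0' (i := i) (j := j)
  subst hZ
  by_cases hji : j + 1 = N / 2
  · rw [← hji, hU j hj hj']
    refine h.sandwich_eq_zero hq hN hj (by omega) (by omega) (by omega) (Or.inl hj')
        (Or.inl (Or.inl ⟨rfl, fun h' => ho h'.1⟩)) ?_ ?_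
    · exact hu _ _ hj (by omega) (by omega) (by omega) (by omega)
    · rw [← hU j hj (by omega)]
      exact hu _ _ (by omega) (by omega) hj (by omega) (by omega)
  · rw [h.comm_of_lt hN hj le_rfl hj' (fun h' => by rcases h' with h' | h' <;> [omega; exact ho h'.1]),
        hu _ _ (by omega) (by omega) hj (by omega) (by omega), map_zero]

include hD0 hD h0''

/-- Induction downwards from the short root n. The cubic relation enters twice: when k + 1 < n it
gives φ_n³ U_n = 0, because φ_n kills U_{n-1}; and for φ_n D_{n-1} it collapses to [3] times the
vector in question. The other cases are as in the upper half. -/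
theorem odd_down {i j : ℕ} (hi : k < i) (hi' : i ≤ N / 2) (hj : k < j) (hj' : j ≤ N / 2)
    (hij : j + 1 ≠ i) : φ j (D i) = 0 := by
  have hu := fun i j => h.odd_up hq hN ho hU h0 h0' (i := i) (j := j)
  have hz := fun j => h.odd_mid hq hN ho hU hZ hk h0 h0' (j := j)
  have cube : φ (N / 2) (φ (N / 2) Z) = 0 := by
    rw [hZ]
    by_cases hk1 : k + 1 = N / 2
    · rw [← hk1]; exact h0'' hk1
    · have := h.short_last hN ho (by omega) (U (N / 2 - 1))
      rw [hu (N / 2 - 1) (N / 2) (by omega) (by omega) (by omega) (by omega) (by omega)] at this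
      simp only [map_zero, smul_zero, sub_zero, add_zero] at this
      have e := hU (N / 2 - 1) (by omega) (by omega)
      rw [show N / 2 - 1 + 1 = N / 2 by omega] at e
      rw [e]; exact this
  obtain ⟨t, ht⟩ : ∃ t, t = N / 2 - i := ⟨_, rfl⟩
  induction t using Nat.strong_induction_on generalizing i j with
  | _ t IH =>
  obtain rfl | hi1 : i = N / 2 ∨ i < N / 2 := by omega
  · rw [hD0]
    obtain rfl | hlt : j = N / 2 ∨ j < N / 2 := by omega
    · exact cube
    · rw [h.comm_of_lt hN hj le_rfl hlt
        (fun h' => by rcases h' with h' | h' <;> [omega; exact ho h'.1]), hz j hj hlt, map_zero]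
  rw [hD i hi hi1]
  rcases lt_trichotomy j i with hlt | rfl | hgt
  · rw [h.comm_of_lt hN hj (by omega) hlt
      (fun h' => by rcases h' with h' | h' <;> [omega; exact ho h'.1]),
      IH _ (by omega) (i := i + 1) (by omega) (by omega) hj hj' (by omega) rfl, map_zero]
  · obtain hi2 | hi2 : j + 1 = N / 2 ∨ j + 1 < N / 2 := by omega
    · rw [hi2, hD0]
      exact h.sq_apply_eq_zero hN hj hj' (by omega) (by omega) (Or.inl (by omega))
        (Or.inl (Or.inl ⟨hi2, fun h' => ho h'.1⟩)) (hz j hj hi1)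
    · rw [hD (j + 1) (by omega) hi2]
      exact h.sq_apply_eq_zero hN hj hj' (by omega) (by omega) (Or.inl (by omega))
        (Or.inl (Or.inl ⟨rfl, fun h' => ho h'.1⟩))
        (IH _ (by omega) (i := j + 1 + 1) (by omega) (by omega) hj hj' (by omega) rfl)
  · by_cases hji : j = i + 1
    · subst hji
      obtain hi2 | hi2 : i + 1 = N / 2 ∨ i + 1 < N / 2 := by omega
      · rw [hi2, hD0, hZ]
        have := h.short_last hN ho (by omega) (U (N / 2))
        rw [hu (N / 2) (N / 2 - 1) (by omega) (by omega) (by omega) (by omega) (by omega), ← hZ,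
          hz (N / 2 - 1) (by omega) (by omega), cube] at this
        simp only [map_zero, smul_zero, sub_zero, zero_add] at this
        rw [← hZ, show i = N / 2 - 1 by omega]
        exact (smul_eq_zero.mp this).resolve_left (qpow_three_ne hq)
      · rw [hD (i + 1) (by omega) hi2]
        refine h.sandwich_eq_zero hq hN hj hj' hi (by omega) (Or.inl (by omega))
          (Or.inr (Or.inl ⟨rfl, fun h' => ho h'.1⟩)) ?_ ?_
        · exact IH _ (by omega) (i := i + 1 + 1) (by omega) (by omega) hi (by omega) (by omega) rfl
        · rw [← hD (i + 1) (by omega) hi2]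
          exact IH _ (by omega) (i := i + 1) (by omega) (by omega) hj (by omega) (by omega) rfl
    · rw [← h.comm_of_lt hN hi (by omega) hgt
        (fun h' => by rcases h' with h' | h' <;> [omega; exact ho h'.1]),
        IH _ (by omega) (i := i + 1) (by omega) (by omega) hj hj' (by omega) rfl, map_zero]

end Odd

section Even

variable (he : Even N) {U D : ℕ → X}
  (hU : ∀ i, k < i → i < N / 2 → U (i + 1) = φ i (U i))
  (hD0 : D (N / 2) = φ (N / 2) (U (N / 2 - 1)))
  (hD : ∀ i, k < i → i < N / 2 → D i = φ i (D (i + 1)))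
  (hk : k + 1 < N / 2)
  (h0 : ∀ j, k + 1 < j → j ≤ N / 2 → ¬(j = N / 2 ∧ k + 2 = N / 2) → φ j (U (k + 1)) = 0)
  (h0' : φ (k + 1) (φ (k + 1) (U (k + 1))) = 0)
  (h0'' : k + 2 = N / 2 → φ (N / 2) (φ (N / 2) (U (k + 1))) = 0)
include he hU h0 h0'

theorem even_up {i j : ℕ} (hi : k < i) (hi' : i ≤ N / 2) (hj : k < j) (hj' : j ≤ N / 2)
    (hij : j ≠ i) (hx : ¬(j = N / 2 ∧ i + 1 = N / 2)) : φ j (U i) = 0 :=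
  h.chain_up hq hN hU (fun j hj hj' hc => h0 j hj hj' (fun h' => hc ⟨he, h'⟩)) (fun _ => h0')
    hi hi' hj hj' hij (fun h' => hx h'.2)

include hD0 hD hk

omit hq h0 h0' in
-- The nodes n - 1 and n of the fork commute, so D_{n-1} is reached from U_{n-1} along either
-- branch.
theorem even_last : φ (N / 2) (U (N / 2)) = D (N / 2 - 1) := by
  have e := hU (N / 2 - 1) (by omega) (by omega)
  rw [show N / 2 - 1 + 1 = N / 2 by omega] at e
  have e' := hD (N / 2 - 1) (by omega) (by omega)
  rw [show N / 2 - 1 + 1 = N / 2 by omega] at e'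
  rw [e, e', hD0, h.comm_of_lt hN (by omega) le_rfl (show N / 2 - 1 < N / 2 by omega)]
  rintro (h' | h') <;> [exact h'.2 ⟨he, rfl⟩; omega]

include h0''

/-- Induction downwards from the fork. In the two cases (i, j) = (n-1, n-1) and (n-2, n) the vector
D_{n-1} is replaced by φ_n U_n, its second description from `even_last`; otherwise commutation,
squares and sandwiches suffice. -/
theorem even_down {i j : ℕ} (hi : k < i) (hi' : i ≤ N / 2) (hj : k < j) (hj' : j ≤ N / 2)
    (hij : j + 1 ≠ i) : φ j (D i) = 0 := by
  have hu := fun i j => h.even_up hq hN he hU h0 h0' (i := i) (j := j)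
  have hl := h.even_last hN he hU hD0 hD hk
  have nadj : ¬AdjLt N (N / 2 - 1) (N / 2) := by
    rintro (h' | h') <;> [exact h'.2 ⟨he, rfl⟩; omega]
  have adj : AdjLt N (N / 2 - 2) (N / 2) := Or.inr ⟨he, by omega, rfl⟩
  have eU : U (N / 2) = φ (N / 2 - 1) (U (N / 2 - 1)) := by
    have := hU (N / 2 - 1) (by omega) (by omega)
    rwa [show N / 2 - 1 + 1 = N / 2 by omega] at this
  have eD : D (N / 2 - 1) = φ (N / 2 - 1) (D (N / 2)) := by
    have := hD (N / 2 - 1) (by omega) (by omega)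
    rwa [show N / 2 - 1 + 1 = N / 2 by omega] at this
  have eU' : k + 2 < N / 2 → U (N / 2 - 1) = φ (N / 2 - 2) (U (N / 2 - 2)) := fun _ => by
    have := hU (N / 2 - 2) (by omega) (by omega)
    rwa [show N / 2 - 2 + 1 = N / 2 - 1 by omega] at this
  obtain ⟨t, ht⟩ : ∃ t, t = N / 2 - i := ⟨_, rfl⟩
  induction t using Nat.strong_induction_on generalizing i j with
  | _ t IH =>
  obtain rfl | hi1 : i = N / 2 ∨ i < N / 2 := by omega
  · rw [hD0]
    obtain rfl | hlt : j = N / 2 ∨ j < N / 2 := by omega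
    · obtain hk2 | hk2 : k + 2 = N / 2 ∨ k + 2 < N / 2 := by omega
      · rw [show N / 2 - 1 = k + 1 by omega]; exact h0'' hk2
      · rw [eU' hk2]
        exact h.sq_apply_eq_zero hN hj hj' (by omega) (by omega) (Or.inr he) (Or.inr adj)
          (hu _ _ (by omega) (by omega) (by omega) (by omega) (by omega) (by omega))
    · obtain rfl | hj2 : j = N / 2 - 2 ∨ j < N / 2 - 2 := by omega
      · rw [eU' (by omega)]
        refine h.sandwich_eq_zero hq hN hj (by omega) (by omega) (by omega) (Or.inl hlt)
          (Or.inl adj) ?_ ?_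
        · exact hu _ _ (by omega) (by omega) (by omega) (by omega) (by omega) (by omega)
        · rw [← eU' (by omega)]
          exact hu _ _ (by omega) (by omega) (by omega) (by omega) (by omega) (by omega)
      · rw [h.comm_of_lt hN hj le_rfl hlt (fun h' => by rcases h' with h' | h' <;> omega),
          hu _ _ (by omega) (by omega) (by omega) (by omega) (by omega) (by omega), map_zero]
  have IH' : ∀ i', i < i' → i' ≤ N / 2 → ∀ j, k < j → j ≤ N / 2 → j + 1 ≠ i' → φ j (D i') = 0 :=
    fun i' h1 h2 j h3 h4 h5 => IH (N / 2 - i') (by omega) (by omega) h2 h3 h4 h5 rfl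
  by_cases hin : i = N / 2 - 1
  · subst hin
    rcases lt_trichotomy j (N / 2 - 1) with hlt | rfl | hgt
    · rw [eD, h.comm_of_lt hN hj (by omega) hlt (fun h' => by rcases h' with h' | h' <;> omega),
        IH' _ (by omega) le_rfl j hj hj' (by omega), map_zero]
    · rw [← hl, h.comm_of_lt hN hj le_rfl (by omega) nadj,
        hu _ _ (by omega) (by omega) (by omega) (by omega) (by omega) (by omega), map_zero]
    · obtain rfl : j = N / 2 := by omega
      rw [eD, ← h.comm_of_lt hN (by omega) le_rfl (by omega) nadj,
        IH' _ (by omega) le_rfl _ hj hj' (by omega), map_zero]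
  · by_cases hjn : j = N / 2 ∧ i + 2 = N / 2
    · obtain ⟨rfl, hi2⟩ := hjn
      rw [hD i hi hi1, show i + 1 = N / 2 - 1 by omega, ← hl]
      refine h.sandwich_eq_zero hq hN hj hj' hi (by omega) (Or.inr he)
        (Or.inr (Or.inr ⟨he, hi2, rfl⟩)) ?_ ?_
      · exact hu _ _ (by omega) (by omega) (by omega) (by omega) (by omega) (by omega)
      · rw [hl]; exact IH' _ (by omega) (by omega) _ hj hj' (by omega)
    · rw [hD i hi hi1]
      rcases lt_trichotomy j i with hlt | rfl | hgt
      · rw [h.comm_of_lt hN hj (by omega) hlt (fun h' => by rcases h' with h' | h' <;> omega),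
          IH' _ (by omega) (by omega) j hj hj' (by omega), map_zero]
      · rw [hD (j + 1) (by omega) (by omega)]
        exact h.sq_apply_eq_zero hN hj hj' (by omega) (by omega) (Or.inr he)
          (Or.inl (Or.inl ⟨rfl, by omega⟩)) (IH' _ (by omega) (by omega) j hj hj' (by omega))
      · by_cases hji : j = i + 1
        · subst hji
          rw [hD (i + 1) (by omega) (by omega)]
          refine h.sandwich_eq_zero hq hN hj hj' hi (by omega) (Or.inr he)
            (Or.inr (Or.inl ⟨rfl, by omega⟩)) ?_ ?_
          · exact IH' _ (by omega) (by omega) i hi (by omega) (by omega)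
          · rw [← hD (i + 1) (by omega) (by omega)]
            exact IH' _ (by omega) (by omega) _ hj hj' (by omega)
        · rw [← h.comm_of_lt hN hi (by omega) hgt
            (fun h' => by rcases h' with h' | h' <;> omega),
            IH' _ (by omega) (by omega) j hj hj' (by omega), map_zero]

end Even

end SerreOps
end SerreOperators

/-! ### Relations of the quantum group -/

section Relations

variable (hb : ℂ) (N : ℕ)

theorem gen_rel {x y : Free N} (h : Rel hb N x y) :
    RingQuot.mkAlgHom ℂ (Rel hb N) x = RingQuot.mkAlgHom ℂ (Rel hb N) y :=
  RingQuot.mkAlgHom_rel ℂ h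

theorem KGen_zero : KGen hb N 0 = 1 := by
  simpa [KGen, gen] using gen_rel hb N (Rel.K_zero)

theorem KGen_add (μ ν : Lat N) : KGen hb N (μ + ν) = KGen hb N μ * KGen hb N ν := by
  simpa [KGen, gen] using gen_rel hb N (Rel.K_add μ ν)

theorem KGen_mul_fGen (μ : Lat N) (i : ℕ) : KGen hb N μ * fGen hb N i =
    qpow hb (-(ip μ (simpleRoot N i) : ℤ)) • (fGen hb N i * KGen hb N μ) := by
  unfold fGen
  split_ifs with h
  · simpa [KGen, gen] using gen_rel hb N (Rel.K_f μ ⟨i, h⟩)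
  · simp

theorem KGen_mul_eGen (μ : Lat N) (i : ℕ) : KGen hb N μ * eGen hb N i =
    qpow hb (ip μ (simpleRoot N i) : ℤ) • (eGen hb N i * KGen hb N μ) := by
  unfold eGen
  split_ifs with h
  · simpa [KGen, gen] using gen_rel hb N (Rel.K_e μ ⟨i, h⟩)
  · simp

theorem eGen_mul_fGen_ne {i j : ℕ} (hij : i ≠ j) :
    eGen hb N i * fGen hb N j = fGen hb N j * eGen hb N i := by
  unfold eGen fGen
  split_ifs with h h'
  · simpa [gen] using gen_rel hb N (Rel.e_f_ne ⟨i, h⟩ ⟨j, h'⟩ (by simpa using hij))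
  all_goals simp

theorem eGen_mul_fGen_same {i : ℕ} (h1 : 1 ≤ i) (h2 : i ≤ N / 2) :
    eGen hb N i * fGen hb N i = fGen hb N i * eGen hb N i + hnum hb N (simpleRoot N i) 0 := by
  rw [← sub_eq_iff_eq_add']
  have h : i ∈ Finset.Icc 1 (N / 2) := Finset.mem_Icc.mpr ⟨h1, h2⟩
  simpa [eGen, fGen, h, hnum, KGen, gen, qpow_zero] using gen_rel hb N (Rel.e_f_same ⟨i, h⟩)

theorem fGen_comm {i j : ℕ} (h1 : i ≠ j) (h0 : ip (simpleRoot N i) (simpleRoot N j) = 0) :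
    fGen hb N i * fGen hb N j = fGen hb N j * fGen hb N i := by
  unfold fGen
  split_ifs with h h'
  · simpa [gen] using gen_rel hb N (Rel.f_comm ⟨i, h⟩ ⟨j, h'⟩ (by simpa using h1) h0)
  all_goals simp

theorem fGen_long {i j : ℕ} (hi : i ∈ Finset.Icc 1 (N / 2)) (hj : j ∈ Finset.Icc 1 (N / 2))
    (h1 : ip (simpleRoot N i) (simpleRoot N j) = -1)
    (h2 : ip (simpleRoot N i) (simpleRoot N i) = 2) :
    fGen hb N i ^ 2 * fGen hb N j
      - (qpow hb 1 + qpow hb (-1)) • (fGen hb N i * fGen hb N j * fGen hb N i)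
      + fGen hb N j * fGen hb N i ^ 2 = 0 := by
  simpa [gen, fGen, hi, hj, serreLong] using gen_rel hb N (Rel.f_long ⟨i, hi⟩ ⟨j, hj⟩ h1 h2)

theorem fGen_short {i j : ℕ} (hi : i ∈ Finset.Icc 1 (N / 2)) (hj : j ∈ Finset.Icc 1 (N / 2))
    (h1 : ip (simpleRoot N i) (simpleRoot N j) = -1)
    (h2 : ip (simpleRoot N i) (simpleRoot N i) = 1) :
    fGen hb N i ^ 3 * fGen hb N j
      - (qpow hb 1 + 1 + qpow hb (-1)) • (fGen hb N i ^ 2 * fGen hb N j * fGen hb N i)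
      + (qpow hb 1 + 1 + qpow hb (-1)) • (fGen hb N i * fGen hb N j * fGen hb N i ^ 2)
      - fGen hb N j * fGen hb N i ^ 3 = 0 := by
  simpa [gen, fGen, hi, hj, serreShort] using gen_rel hb N (Rel.f_short ⟨i, hi⟩ ⟨j, hj⟩ h1 h2)

theorem hnum_comm_of_ip_eq_zero {μ : Lat N} {i : ℕ} (h : ip μ (simpleRoot N i) = 0) (c : ℂ) :
    Commute (hnum hb N μ c) (fGen hb N i) ∧ Commute (hnum hb N μ c) (eGen hb N i) := by
  have h' : ip (-μ) (simpleRoot N i) = 0 := by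
    have : ip (-μ) (simpleRoot N i) = -ip μ (simpleRoot N i) := by simp [ip]
    rw [this, h, neg_zero]
  constructor
  · have h1 := KGen_mul_fGen hb N μ i
    have h2 := KGen_mul_fGen hb N (-μ) i
    simp only [h, h', Int.cast_zero, neg_zero, qpow_zero, one_smul] at h1 h2
    exact ((Commute.smul_left h1 _).sub_left (Commute.smul_left h2 _)).smul_left _
  · have h1 := KGen_mul_eGen hb N μ i
    have h2 := KGen_mul_eGen hb N (-μ) i
    simp only [h, h', Int.cast_zero, qpow_zero, one_smul] at h1 h2
    exact ((Commute.smul_left h1 _).sub_left (Commute.smul_left h2 _)).smul_left _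

end Relations

/-! ### Weight vectors and the commutator of e_i with f_i -/

section WeightVectors

variable {hb : ℂ} {N : ℕ} {X : Type*} [AddCommGroup X] [Module ℂ X] [Module (Uq hb N) X]
  [IsScalarTower ℂ (Uq hb N) X]

/-- `x` is a vector of weight `ν`. -/
def IsWt (hb : ℂ) (N : ℕ) {X : Type*} [AddCommGroup X] [Module ℂ X] [Module (Uq hb N) X]
    (ν : ℕ → ℂ) (x : X) : Prop :=
  ∀ μ : Lat N, KGen hb N μ • x = qpow hb (wsum N ν μ) • x

omit [IsScalarTower ℂ (Uq hb N) X] in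
theorem IsWt.congr {ν ν' : ℕ → ℂ} {x : X} (h : IsWt hb N ν x)
    (hν : ∀ i, 1 ≤ i → i ≤ N / 2 → ν i = ν' i) : IsWt hb N ν' x := fun μ => by
  rw [h μ, wsum_congr hν]

theorem smul_smul_comm (c : ℂ) (u : Uq hb N) (x : X) : u • c • x = c • u • x :=
  (Algebra.lsmul ℂ ℂ X u).map_smul c x

theorem IsWt.smul {ν : ℕ → ℂ} {x : X} (h : IsWt hb N ν x) (c : ℂ) : IsWt hb N ν (c • x) :=
  fun μ => by rw [smul_smul_comm, h μ, smul_comm]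

omit [IsScalarTower ℂ (Uq hb N) X] in
theorem IsWt.add {ν : ℕ → ℂ} {x y : X} (h : IsWt hb N ν x) (h' : IsWt hb N ν y) :
    IsWt hb N ν (x + y) := fun μ => by rw [smul_add, h μ, h' μ, smul_add]

omit [IsScalarTower ℂ (Uq hb N) X] in
theorem IsWt.zero (ν : ℕ → ℂ) : IsWt hb N ν (0 : X) := fun μ => by simp

theorem IsWt.neg {ν : ℕ → ℂ} {x : X} (h : IsWt hb N ν x) : IsWt hb N ν (-x) := by
  simpa using h.smul (-1)

theorem IsWt.sub {ν : ℕ → ℂ} {x y : X} (h : IsWt hb N ν x) (h' : IsWt hb N ν y) :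
    IsWt hb N ν (x - y) := by rw [sub_eq_add_neg]; exact h.add h'.neg

omit [IsScalarTower ℂ (Uq hb N) X] in
theorem IsWt.sum {ι : Type*} {s : Finset ι} {ν : ℕ → ℂ} {x : ι → X}
    (h : ∀ i ∈ s, IsWt hb N ν (x i)) : IsWt hb N ν (∑ i ∈ s, x i) := by
  classical
  induction s using Finset.induction_on with
  | empty => simpa using IsWt.zero ν
  | insert a s ha IH =>
    rw [Finset.sum_insert ha]
    exact (h a (by simp)).add (IH fun i hi => h i (by simp [hi]))

theorem IsWt.f {ν : ℕ → ℂ} {x : X} (h : IsWt hb N ν x) (i : ℕ) :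
    IsWt hb N (ν - rt N i) (fGen hb N i • x) := fun μ => by
  rw [← mul_smul, KGen_mul_fGen, smul_assoc, mul_smul, h μ, smul_smul_comm, smul_smul,
    ← qpow_add, wsum_sub_left, wsum_rt]
  ring_nf

theorem IsWt.hnum {ν : ℕ → ℂ} {x : X} (h : IsWt hb N ν x) (μ : Lat N) (c : ℂ) :
    hnum hb N μ c • x = qnum hb (wsum N ν μ + c) • x := by
  rw [QuantumSO.hnum, smul_assoc, sub_smul, smul_assoc, smul_assoc, h, h, qnum, smul_smul,
    smul_smul, ← sub_smul, smul_smul, wsum_neg, ← qpow_add, ← qpow_add]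
  congr 1
  rw [div_eq_inv_mul, add_comm c, neg_add, add_comm (-c)]

theorem IsWt.hnum_eps {ν : ℕ → ℂ} {x : X} (h : IsWt hb N ν x) {i : ℕ} (h1 : 1 ≤ i)
    (h2 : i ≤ N / 2) (c : ℂ) : QuantumSO.hnum hb N (eps N i) c • x = qnum hb (ν i + c) • x := by
  rw [h.hnum, wsum_eps, if_pos ⟨h1, h2⟩]

theorem e_f_smul {ν : ℕ → ℂ} {x : X} (h : IsWt hb N ν x) (hN : 3 ≤ N) {i : ℕ} (h1 : 1 ≤ i)
    (h2 : i ≤ N / 2) : eGen hb N i • fGen hb N i • x =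
      fGen hb N i • eGen hb N i • x + qnum hb (dval N ν i) • x := by
  rw [← mul_smul, eGen_mul_fGen_same hb N h1 h2, add_smul, mul_smul, h.hnum,
    wsum_simpleRoot hN ν h1 h2, add_zero]

omit [Module ℂ X] [IsScalarTower ℂ (Uq hb N) X] in
theorem e_f_smul_ne {i j : ℕ} (hij : i ≠ j) (x : X) : eGen hb N i • fGen hb N j • x =
      fGen hb N j • eGen hb N i • x := by
  rw [← mul_smul, eGen_mul_fGen_ne hb N hij, mul_smul]

/-- The action of the `f_j` on a module. -/
def fOp (hb : ℂ) (N : ℕ) (X : Type*) [AddCommGroup X] [Module ℂ X] [Module (Uq hb N) X]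
    [IsScalarTower ℂ (Uq hb N) X] (j : ℕ) : Module.End ℂ X := Algebra.lsmul ℂ ℂ X (fGen hb N j)

theorem fOp_apply (j : ℕ) (x : X) : fOp hb N X j x = fGen hb N j • x := rfl

theorem fOp_serre : SerreOps hb N 0 (fOp hb N X) where
  comm i j _ _ _ _ hij h0 x := by
    simp only [fOp_apply, ← mul_smul, fGen_comm hb N hij h0]
  long i j h1 h2 h3 h4 h5 h6 x := by
    have := congrArg (· • x) (fGen_long hb N (Finset.mem_Icc.mpr ⟨h1, h2⟩)
      (Finset.mem_Icc.mpr ⟨h3, h4⟩) h5 h6)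
    simpa [fOp_apply, sub_smul, add_smul, smul_assoc, mul_smul, pow_succ] using this
  short i j h1 h2 h3 h4 h5 h6 x := by
    have := congrArg (· • x) (fGen_short hb N (Finset.mem_Icc.mpr ⟨h1, h2⟩)
      (Finset.mem_Icc.mpr ⟨h3, h4⟩) h5 h6)
    simpa only [fOp_apply, sub_smul, add_smul, smul_assoc, mul_smul, pow_succ, pow_zero,
      one_mul, zero_smul] using this

theorem f_comm_smul (hN : 3 ≤ N) {i j : ℕ} (h1 : 1 ≤ i) (h2 : j ≤ N / 2) (hij : i < j)
    (ha : ¬AdjLt N i j) (x : X) : fGen hb N i • fGen hb N j • x = fGen hb N j • fGen hb N i • x :=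
  (fOp_serre (X := X)).comm_of_lt hN h1 h2 hij ha x

end WeightVectors

/-! ### The raising operators on a natural chain -/

section Chains

variable {X : Type*} [AddCommGroup X]

/-- A chain of weight vectors of the natural representation of `U_q(so(N - 2k))`, odd `N`:
the weights are `ω + ε_i` for `U i` and `ω - ε_i` for `D i`, and `D (n + 1)` is of weight `ω`. -/
structure OddChain (hb : ℂ) (N k : ℕ) [Module ℂ X] [Module (Uq hb N) X]
    (ω : ℕ → ℂ) (U D : ℕ → X) : Prop where
  odd : ¬Even N
  lt : k < N / 2
  up : ∀ i, k < i → i < N / 2 → U (i + 1) = fGen hb N i • U i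
  mid : D (N / 2 + 1) = fGen hb N (N / 2) • U (N / 2)
  down : ∀ i, k < i → i ≤ N / 2 → D i = fGen hb N i • D (i + 1)
  weight : ∀ i, k < i → i ≤ N / 2 → ω i = 0
  wt : IsWt hb N (ω + Pi.single (k + 1) 1) (U (k + 1))
  e : ∀ j, k < j → j ≤ N / 2 → eGen hb N j • U (k + 1) = 0
  f : ∀ j, k + 1 < j → j ≤ N / 2 → fGen hb N j • U (k + 1) = 0
  sq : k + 1 < N / 2 → fGen hb N (k + 1) • fGen hb N (k + 1) • U (k + 1) = 0
  cube : k + 1 = N / 2 →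
    fGen hb N (k + 1) • fGen hb N (k + 1) • fGen hb N (k + 1) • U (k + 1) = 0

/-- A chain of weight vectors of the natural representation of `U_q(so(N - 2k))`, even `N`:
the weights are `ω + ε_i` for `U i` and `ω - ε_i` for `D i`. -/
structure EvenChain (hb : ℂ) (N k : ℕ) [Module ℂ X] [Module (Uq hb N) X]
    (ω : ℕ → ℂ) (U D : ℕ → X) : Prop where
  even : Even N
  lt : k + 1 < N / 2
  up : ∀ i, k < i → i < N / 2 → U (i + 1) = fGen hb N i • U i
  mid : D (N / 2) = fGen hb N (N / 2) • U (N / 2 - 1)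
  down : ∀ i, k < i → i < N / 2 → D i = fGen hb N i • D (i + 1)
  weight : ∀ i, k < i → i ≤ N / 2 → ω i = 0
  wt : IsWt hb N (ω + Pi.single (k + 1) 1) (U (k + 1))
  e : ∀ j, k < j → j ≤ N / 2 → eGen hb N j • U (k + 1) = 0
  f : ∀ j, k + 1 < j → j ≤ N / 2 → ¬(j = N / 2 ∧ k + 2 = N / 2) → fGen hb N j • U (k + 1) = 0
  sq : fGen hb N (k + 1) • fGen hb N (k + 1) • U (k + 1) = 0
  sq' : k + 2 = N / 2 → fGen hb N (N / 2) • fGen hb N (N / 2) • U (k + 1) = 0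

variable {hb : ℂ} {N k : ℕ} [Module ℂ X] [Module (Uq hb N) X] [IsScalarTower ℂ (Uq hb N) X]
  {U D : ℕ → X} {ω : ℕ → ℂ}

theorem chain_wt_up (hU : ∀ i, k < i → i < N / 2 → U (i + 1) = fGen hb N i • U i)
    (hw : IsWt hb N (ω + Pi.single (k + 1) 1) (U (k + 1))) {i : ℕ} (hi : k < i) (hi' : i ≤ N / 2) :
    IsWt hb N (ω + Pi.single i 1) (U i) := by
  induction i, (show k + 1 ≤ i from hi) using Nat.le_induction with
  | base => exact hw
  | succ i hi1 IH =>
    rw [hU i (by omega) (by omega)]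
    refine ((IH (by omega) (by omega)).f i).congr fun j _ _ => ?_
    simp only [rt, if_pos (show i < N / 2 by omega), Pi.sub_apply, Pi.add_apply]
    ring

/-- Induction along the chain. For j = i the commutator contributes [1]_q = 1, since ω vanishes
beyond k; for j = i - 1 the term f_i U_{i-1} remains and is zero by `hf`. -/
theorem chain_e_up (hq : NotRoot hb) (hN : 3 ≤ N)
    (hU : ∀ i, k < i → i < N / 2 → U (i + 1) = fGen hb N i • U i)
    (hω : ∀ i, k < i → i ≤ N / 2 → ω i = 0)
    (hw : IsWt hb N (ω + Pi.single (k + 1) 1) (U (k + 1)))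
    (he : ∀ j, k < j → j ≤ N / 2 → eGen hb N j • U (k + 1) = 0)
    (hf : ∀ i, k < i → i + 1 < N / 2 → fGen hb N (i + 1) • U i = 0)
    {i j : ℕ} (hi : k < i) (hi' : i ≤ N / 2) (hj : k < j) (hj' : j ≤ N / 2) :
    eGen hb N j • U i = if j + 1 = i then U j else 0 := by
  induction i, (show k + 1 ≤ i from hi) using Nat.le_induction generalizing j with
  | base => rw [he j hj hj', if_neg (by omega)]
  | succ i hi1 IH =>
    have IH' := fun j => IH (by omega) (by omega) (j := j)
    rw [hU i (by omega) (by omega)]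
    by_cases hji : j = i
    · subst hji
      rw [e_f_smul (chain_wt_up hU hw hj hj') hN (by omega) hj', IH' j hj hj', if_neg (by omega),
        smul_zero, if_pos rfl, zero_add]
      have : dval N (ω + Pi.single j 1) j = 1 := by
        simp [dval, show j < N / 2 by omega, hω j hj hj', hω (j + 1) (by omega) (by omega)]
      rw [this, qnum_one hq, one_smul]
    · rw [e_f_smul_ne hji, IH' j hj hj', if_neg (show ¬j + 1 = i + 1 by omega)]
      split_ifs with h1
      · subst h1; exact hf j hj (by omega)
      · simp

namespace OddChain

variable (hq : NotRoot hb) (hN : 3 ≤ N) (h : OddChain hb N k ω U D)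
include h

theorem wtU {i : ℕ} (hi : k < i) (hi' : i ≤ N / 2) : IsWt hb N (ω + Pi.single i 1) (U i) :=
  chain_wt_up h.up h.wt hi hi'

theorem wtD {i : ℕ} (hi : k < i) (hi' : i ≤ N / 2 + 1) :
    IsWt hb N (ω - Pi.single i 1) (D i) := by
  have hlt := h.lt
  obtain ⟨t, ht⟩ : ∃ t, t = N / 2 + 1 - i := ⟨_, rfl⟩
  induction t generalizing i with
  | zero =>
    obtain rfl : i = N / 2 + 1 := by omega
    rw [h.mid]
    refine ((h.wtU hlt le_rfl).f _).congr fun j _ hj => ?_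
    have := h.odd
    simp [rt, this, show j ≠ N / 2 + 1 by omega]
  | succ t IH =>
    rw [h.down i hi (by omega)]
    refine ((IH (i := i + 1) (by omega) (by omega) (by omega)).f i).congr fun j _ hj => ?_
    have := h.odd
    simp only [rt, this, if_false, Pi.sub_apply]
    split_ifs with h1
    · simp only [Pi.sub_apply]; ring
    · simp [show j ≠ i + 1 by omega]

include hq hN

theorem fU {i j : ℕ} (hi : k < i) (hi' : i ≤ N / 2) (hj : k < j) (hj' : j ≤ N / 2)
    (hij : j ≠ i) : fGen hb N j • U i = 0 :=
  ((fOp_serre (X := X)).mono (Nat.zero_le k)).odd_up hq hN h.odd h.up h.f h.sq hi hi' hj hj' hij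

theorem fMid {j : ℕ} (hj : k < j) (hj' : j < N / 2) : fGen hb N j • D (N / 2 + 1) = 0 :=
  ((fOp_serre (X := X)).mono (Nat.zero_le k)).odd_mid hq hN h.odd h.up h.mid h.lt h.f h.sq hj hj'

theorem fD {i j : ℕ} (hi : k < i) (hi' : i ≤ N / 2 + 1) (hj : k < j) (hj' : j ≤ N / 2)
    (hij : j + 1 ≠ i) : fGen hb N j • D i = 0 := by
  obtain rfl | hi1 : i = N / 2 + 1 ∨ i ≤ N / 2 := by omega
  · exact h.fMid hq hN hj (by omega)
  · exact ((fOp_serre (X := X)).mono (Nat.zero_le k)).odd_down hq hN h.odd h.up h.mid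
      (h.down _ h.lt le_rfl) (fun i hi hi' => h.down i hi hi'.le) h.lt h.f h.sq h.cube
      hi hi1 hj hj' hij

theorem eU {i j : ℕ} (hi : k < i) (hi' : i ≤ N / 2) (hj : k < j) (hj' : j ≤ N / 2) :
    eGen hb N j • U i = if j + 1 = i then U j else 0 :=
  chain_e_up hq hN h.up h.weight h.wt h.e
    (fun i hi hi' => h.fU hq hN hi (by omega) (by omega) (by omega) (by omega)) hi hi' hj hj'

theorem eMid {j : ℕ} (hj : k < j) (hj' : j ≤ N / 2) :
    eGen hb N j • D (N / 2 + 1) = if j = N / 2 then U (N / 2) else 0 := by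
  have hlt := h.lt
  have hodd := h.odd
  rw [h.mid]
  split_ifs with h1
  · subst h1
    rw [e_f_smul (h.wtU hlt le_rfl) hN (by omega) le_rfl, h.eU hq hN hlt le_rfl hj hj',
      if_neg (by omega), smul_zero, zero_add]
    have : dval N (ω + Pi.single (N / 2) 1) (N / 2) = 1 := by
      simp [dval, hodd, h.weight _ hlt le_rfl]
    rw [this, qnum_one hq, one_smul]
  · rw [e_f_smul_ne h1, h.eU hq hN hlt le_rfl hj hj']
    split_ifs with h2
    · exact h.fU hq hN hj (by omega) hlt le_rfl (by omega)
    · simp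

theorem eD {i j : ℕ} (hi : k < i) (hi' : i ≤ N / 2) (hj : k < j) (hj' : j ≤ N / 2) :
    eGen hb N j • D i = if j = i then D (i + 1) else 0 := by
  have hodd := h.odd
  have hlt := h.lt
  obtain ⟨t, ht⟩ : ∃ t, t = N / 2 - i := ⟨_, rfl⟩
  induction t generalizing i j with
  | zero =>
    obtain rfl : i = N / 2 := by omega
    rw [h.down _ hi hi']
    split_ifs with h1
    · subst h1
      rw [e_f_smul (h.wtD (by omega) le_rfl) hN (by omega) le_rfl, h.eMid hq hN hj hj',
        if_pos rfl, ← h.mid]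
      -- The middle vector has weight ω, on which α_n vanishes. So e_n f_n acts on it as f_n e_n,
      -- which returns the middle vector itself.
      have : dval N (ω - Pi.single (N / 2 + 1) 1) (N / 2) = 0 := by
        simp [dval, hodd, h.weight _ hlt le_rfl]
      rw [this, qnum_zero, zero_smul, add_zero]
    · rw [e_f_smul_ne h1, h.eMid hq hN hj hj', if_neg h1, smul_zero]
  | succ t IH =>
    have IH' := fun j => IH (i := i + 1) (j := j) (by omega) (by omega)
    rw [h.down i hi hi']
    split_ifs with h1
    · subst h1
      rw [e_f_smul (h.wtD (by omega) (by omega)) hN (by omega) hj', IH' j hj hj' (by omega),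
        if_neg (by omega), smul_zero, zero_add]
      have : dval N (ω - Pi.single (j + 1) 1) j = 1 := by
        simp [dval, show j < N / 2 by omega, h.weight j hj hj',
          h.weight (j + 1) (by omega) (by omega)]
      rw [this, qnum_one hq, one_smul]
    · rw [e_f_smul_ne h1, IH' j hj hj' (by omega)]
      split_ifs with h2
      · exact h.fD hq hN (by omega) (by omega) hi hi' (by omega)
      · simp

end OddChain

namespace EvenChain

variable (hq : NotRoot hb) (hN : 3 ≤ N) (h : EvenChain hb N k ω U D)
include h

theorem wtU {i : ℕ} (hi : k < i) (hi' : i ≤ N / 2) : IsWt hb N (ω + Pi.single i 1) (U i) :=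
  chain_wt_up h.up h.wt hi hi'

theorem wtD {i : ℕ} (hi : k < i) (hi' : i ≤ N / 2) :
    IsWt hb N (ω - Pi.single i 1) (D i) := by
  have hlt := h.lt
  have hev := h.even
  obtain ⟨t, ht⟩ : ∃ t, t = N / 2 - i := ⟨_, rfl⟩
  induction t generalizing i with
  | zero =>
    obtain rfl : i = N / 2 := by omega
    rw [h.mid]
    refine ((h.wtU (by omega) (by omega)).f _).congr fun j _ hj => ?_
    simp [rt, hev]; ring
  | succ t IH =>
    rw [h.down i hi (by omega)]
    refine ((IH (i := i + 1) (by omega) (by omega) (by omega)).f i).congr fun j _ hj => ?_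
    simp only [rt, if_pos (show i < N / 2 by omega), Pi.sub_apply]
    ring

include hN

theorem f_last : fGen hb N (N / 2) • U (N / 2) = D (N / 2 - 1) :=
  ((fOp_serre (X := X)).mono (Nat.zero_le k)).even_last hN h.even h.up h.mid h.down h.lt

include hq

theorem fU {i j : ℕ} (hi : k < i) (hi' : i ≤ N / 2) (hj : k < j) (hj' : j ≤ N / 2)
    (hij : j ≠ i) (hx : ¬(j = N / 2 ∧ i + 1 = N / 2)) : fGen hb N j • U i = 0 :=
  ((fOp_serre (X := X)).mono (Nat.zero_le k)).even_up hq hN h.even h.up h.f h.sq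
    hi hi' hj hj' hij hx

theorem fD {i j : ℕ} (hi : k < i) (hi' : i ≤ N / 2) (hj : k < j) (hj' : j ≤ N / 2)
    (hij : j + 1 ≠ i) : fGen hb N j • D i = 0 :=
  ((fOp_serre (X := X)).mono (Nat.zero_le k)).even_down hq hN h.even h.up h.mid
      h.down h.lt h.f h.sq h.sq' hi hi' hj hj' hij

theorem eU {i j : ℕ} (hi : k < i) (hi' : i ≤ N / 2) (hj : k < j) (hj' : j ≤ N / 2) :
    eGen hb N j • U i = if j + 1 = i then U j else 0 :=
  chain_e_up hq hN h.up h.weight h.wt h.e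
    (fun i hi hi' => h.fU hq hN hi (by omega) (by omega) (by omega) (by omega) (by omega))
    hi hi' hj hj'

theorem eD_last {j : ℕ} (hj : k < j) (hj' : j ≤ N / 2) :
    eGen hb N j • D (N / 2) = if j = N / 2 then U (N / 2 - 1) else 0 := by
  have hlt := h.lt
  have hev := h.even
  rw [h.mid]
  split_ifs with h1
  · subst h1
    rw [e_f_smul (h.wtU (by omega) (by omega)) hN (by omega) le_rfl,
      h.eU hq hN (by omega) (by omega) hj hj', if_neg (by omega), smul_zero, zero_add]
    have : dval N (ω + Pi.single (N / 2 - 1) 1) (N / 2) = 1 := by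
      simp [dval, hev, h.weight _ hj le_rfl, h.weight (N / 2 - 1) (by omega) (by omega),
        show N / 2 ≠ N / 2 - 1 by omega]
    rw [this, qnum_one hq, one_smul]
  · rw [e_f_smul_ne h1, h.eU hq hN (by omega) (by omega) hj hj']
    split_ifs with h2
    · exact h.fU hq hN hj (by omega) (by omega) le_rfl (by omega) (by omega)
    · simp

/-- The second alternative reflects the fork: D_{n-1} covers both D_n and U_n. -/
theorem eD {i j : ℕ} (hi : k < i) (hi' : i < N / 2) (hj : k < j) (hj' : j ≤ N / 2) :
    eGen hb N j • D i = if j = i then D (i + 1)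
      else if j = N / 2 ∧ i + 1 = N / 2 then U (N / 2) else 0 := by
  have hlt := h.lt
  obtain ⟨t, ht⟩ : ∃ t, t = N / 2 - 1 - i := ⟨_, rfl⟩
  have main : eGen hb N i • D i = fGen hb N i • eGen hb N i • D (i + 1) + D (i + 1) := by
    rw [h.down i hi hi', e_f_smul (h.wtD (by omega) (by omega)) hN (by omega) hi'.le]
    have : dval N (ω - Pi.single (i + 1) 1) i = 1 := by
      simp [dval, hi', h.weight i hi hi'.le, h.weight (i + 1) (by omega) (by omega)]
    rw [this, qnum_one hq, one_smul]
  induction t generalizing i j with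
  | zero =>
    obtain rfl : i = N / 2 - 1 := by omega
    have e1 : N / 2 - 1 + 1 = N / 2 := by omega
    rw [e1] at main ⊢
    by_cases h1 : j = N / 2 - 1
    · rw [if_pos h1, h1, main, h.eD_last hq hN (by omega) (by omega), if_neg (by omega),
        smul_zero, zero_add]
    · rw [if_neg h1, h.down _ hi hi', e1, e_f_smul_ne h1, h.eD_last hq hN hj hj']
      by_cases h2 : j = N / 2
      · rw [if_pos h2, if_pos ⟨h2, rfl⟩, ← h.up _ hi hi', e1]
      · rw [if_neg h2, if_neg (by tauto), smul_zero]
  | succ t IH =>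
    have IH' := fun j hj hj' => IH (i := i + 1) (j := j) (by omega) (by omega) hj hj' (by omega) (by
      rw [h.down (i + 1) (by omega) (by omega),
        e_f_smul (h.wtD (by omega) (by omega)) hN (by omega) (by omega)]
      have : dval N (ω - Pi.single (i + 1 + 1) 1) (i + 1) = 1 := by
        simp [dval, show i + 1 < N / 2 by omega, h.weight (i + 1) (by omega) (by omega),
          h.weight (i + 1 + 1) (by omega) (by omega)]
      rw [this, qnum_one hq, one_smul])
    by_cases h1 : j = i
    · subst h1
      rw [if_pos rfl, main, IH' j hj hj', if_neg (by omega), if_neg (by omega), smul_zero, zero_add]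
    · rw [if_neg h1, if_neg (by omega), h.down i hi hi', e_f_smul_ne h1, IH' j hj hj']
      split_ifs with h2 h3
      · exact h.fD hq hN (by omega) (by omega) hi (by omega) (by omega)
      · exact h.fU hq hN (by omega) (by omega) hi (by omega) (by omega) (by omega)
      · simp

end EvenChain
end Chains

/-! ### The words f_{l+m} … f_{l+1} and their symmetries -/

section Words

variable {hb : ℂ} {N : ℕ}

theorem fWord_nil : fWord hb N [] = 1 := rfl

theorem fWord_cons (i : ℕ) (w : List ℕ) : fWord hb N (i :: w) = fGen hb N i * fWord hb N w := by
  simp [fWord]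

theorem fWord_append (w w' : List ℕ) :
    fWord hb N (w ++ w') = fWord hb N w * fWord hb N w' := by
  simp [fWord]

theorem down_zero (l : ℕ) : down l 0 = [] := rfl

theorem down_succ (l m : ℕ) : down l (m + 1) = (l + 1 + m) :: down l m := by
  simp [down, List.range'_concat]

variable {X : Type*} [AddCommGroup X] [Module (Uq hb N) X]

/-- The action of `f_{l+m} ⋯ f_{l+1}`. -/
def aW (l m : ℕ) (x : X) : X := fWord hb N (down l m) • x

theorem aW_zero (l : ℕ) (x : X) : aW (hb := hb) (N := N) l 0 x = x := by
  simp [aW, down_zero, fWord_nil]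

theorem aW_succ (l m : ℕ) (x : X) :
    aW (hb := hb) (N := N) l (m + 1) x = fGen hb N (l + 1 + m) • aW (hb := hb) (N := N) l m x := by
  rw [aW, down_succ, fWord_cons, mul_smul, aW]

theorem aW_apply_zero (l m : ℕ) : aW (hb := hb) (N := N) l m (0 : X) = 0 := smul_zero _

variable [Module ℂ X] [IsScalarTower ℂ (Uq hb N) X]

theorem aW_smul (l m : ℕ) (c : ℂ) (x : X) :
    aW (hb := hb) (N := N) l m (c • x) = c • aW (hb := hb) (N := N) l m x :=
  smul_smul_comm _ _ _

theorem aW_f_comm (hN : 3 ≤ N) {l m j : ℕ} (h1 : l + m + 1 < j) (h2 : j ≤ N / 2)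
    (h3 : Even N → j = N / 2 → l + m + 2 < j) (x : X) :
    fGen hb N j • aW (hb := hb) (N := N) l m x = aW (hb := hb) (N := N) l m (fGen hb N j • x) := by
  induction m with
  | zero => simp [aW_zero]
  | succ m IH =>
    rw [aW_succ, aW_succ, ← IH (by omega) (fun h h' => by have := h3 h h'; omega),
      f_comm_smul hN (by omega) h2 (by omega)]
    rintro (h' | h')
    · omega
    · have := h3 h'.1 h'.2.2; omega

omit [Module ℂ X] [IsScalarTower ℂ (Uq hb N) X] in
theorem aW_e_comm {l m j : ℕ} (h1 : j ≤ l ∨ l + m < j) (x : X) :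
    eGen hb N j • aW (hb := hb) (N := N) l m x = aW (hb := hb) (N := N) l m (eGen hb N j • x) := by
  induction m with
  | zero => simp [aW_zero]
  | succ m IH => rw [aW_succ, aW_succ, e_f_smul_ne (by omega), IH (by omega)]

theorem IsWt.aW {ν : ℕ → ℂ} {x : X} (h : IsWt hb N ν x) (l m : ℕ)
    (hm : l + m < N / 2 ∨ (¬Even N ∧ l + m ≤ N / 2)) :
    IsWt hb N (ν - Pi.single (l + 1) 1 + Pi.single (l + 1 + m) 1)
      (aW (hb := hb) (N := N) l m x) := by
  induction m with
  | zero => simpa [aW_zero] using h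
  | succ m IH =>
    rw [aW_succ]
    refine ((IH (by omega)).f (l + 1 + m)).congr fun j hj hj' => ?_
    simp only [rt, Pi.sub_apply, Pi.add_apply]
    split_ifs with h1 h2
    · simp only [Pi.sub_apply, show l + 1 + m + 1 = l + 1 + (m + 1) by omega]; ring
    · rcases hm with hm | hm <;> [omega; exact absurd h2 hm.1]
    · simp [show j ≠ l + 1 + (m + 1) by omega]

theorem e_aW_top {ν : ℕ → ℂ} {x : X} (h : IsWt hb N ν x) (hN : 3 ≤ N) (l m : ℕ)
    (hm : l + m < N / 2) :
    eGen hb N (l + 1 + m) • aW (hb := hb) (N := N) l (m + 1) x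
      = aW (hb := hb) (N := N) l (m + 1) (eGen hb N (l + 1 + m) • x)
        + qnum hb (dval N (ν - Pi.single (l + 1) 1 + Pi.single (l + 1 + m) 1) (l + 1 + m)) •
          aW (hb := hb) (N := N) l m x := by
  rw [aW_succ, e_f_smul (h.aW l m (Or.inl hm)) hN (by omega) (by omega), aW_succ,
    aW_e_comm (by omega)]

/-- Removing the second letter of the word frees its first letter, which then commutes with all the
others and reaches x. For even N the freed letter must not be the last node, which is adjacent to
the letter l + m. -/
theorem e_aW_next {ν : ℕ → ℂ} {x : X} (h : IsWt hb N ν x) (hN : 3 ≤ N) (l m : ℕ)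
    (hm : l + m + 1 < N / 2) (he : Even N → l + m + 2 < N / 2) :
    eGen hb N (l + 1 + m) • aW (hb := hb) (N := N) l (m + 2) x
      = aW (hb := hb) (N := N) l (m + 2) (eGen hb N (l + 1 + m) • x)
        + qnum hb (dval N (ν - Pi.single (l + 1) 1 + Pi.single (l + 1 + m) 1) (l + 1 + m)) •
          aW (hb := hb) (N := N) l m (fGen hb N (l + 2 + m) • x) := by
  rw [aW_succ _ (m + 1), e_f_smul_ne (by omega), e_aW_top h hN l m (by omega), smul_add,
    ← aW_succ, smul_smul_comm, aW_f_comm hN (by omega) (by omega) (fun h h' => by have := he h; omega)]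
  congr 5; omega

theorem e_aW_far {x : X} (hN : 3 ≤ N) (l s m : ℕ) {ν : ℕ → ℂ} (h : IsWt hb N ν x)
    (hm : s + 2 ≤ m) (hn : l + m ≤ N / 2) (he : Even N → l + m < N / 2)
    (hx : fGen hb N (l + 2 + s) • x = 0) :
    eGen hb N (l + 1 + s) • aW (hb := hb) (N := N) l m x
      = aW (hb := hb) (N := N) l m (eGen hb N (l + 1 + s) • x) := by
  induction m, hm using Nat.le_induction with
  | base => rw [e_aW_next h hN l s (by omega) (fun h => by have := he h; omega), hx,
      aW_apply_zero, smul_zero, add_zero]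
  | succ m hm IH => rw [aW_succ, e_f_smul_ne (by omega), IH (by omega) (fun h => by
      have := he h; omega), ← aW_succ]

section Symmetry

variable (hq : NotRoot hb) (hN : 3 ≤ N) {l : ℕ} {v : X}
  (hf : ∀ j, l + 2 ≤ j → j ≤ N / 2 → fGen hb N j • v = 0)

include hN hf

theorem f_aW_eq_zero {m j : ℕ} (h1 : l + m + 1 < j) (h2 : j ≤ N / 2)
    (h3 : Even N → j = N / 2 → l + m + 2 < j) :
    fGen hb N j • aW (hb := hb) (N := N) l m v = 0 := by
  rw [aW_f_comm hN h1 h2 h3, hf j (by omega) h2, aW_apply_zero]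

include hq

/-- A q-doubling rule, by induction on the length. If u is the top letter, the Serre relation gives
f_t f_u² = [2] f_u f_t f_u on the square of the shorter word, because f_t kills that vector. The
inductive hypothesis pulls one f_u inside on both sides at the cost of the same factor [2]_q, which
cancels. -/
theorem f_aW_aW {r t : ℕ} (hr : l + r + 1 < N / 2) (ht : t ≤ N / 2) (ha : AdjLt N (l + r + 1) t) :
    fGen hb N t • aW (hb := hb) (N := N) l (r + 1) (aW (hb := hb) (N := N) l (r + 1) v)
      = (qpow hb 1 + qpow hb (-1)) •
        aW (hb := hb) (N := N) l (r + 1) (fGen hb N t • aW (hb := hb) (N := N) l (r + 1) v) := by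
  have hS := fOp_serre (hb := hb) (N := N) (X := X)
  have hlt : l + r + 1 < t := by rcases ha with ha | ha <;> omega
  induction r generalizing t with
  | zero =>
    simp only [aW_succ, aW_zero]
    have := hS.apply_sq hN (i := l + 1) (j := t) (by omega) (by omega) (by omega) ht (by omega)
      (Or.inl ha) (x := v) (hf t (by omega) ht)
    simpa [fOp_apply] using this
  | succ r IH =>
    have IH' := IH (t := l + 1 + (r + 1)) (by omega) (by omega) (Or.inl ⟨by omega, by omega⟩)
      (by omega)
    have hc : Even N → t = N / 2 → l + (r + 1) + 2 < t := fun _ h' => by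
      rcases ha with ha | ha <;> [exact absurd ⟨‹_›, h'⟩ ha.2; omega]
    rw [aW_succ l (r + 1) v]
    set u := l + 1 + (r + 1) with hu
    set w := aW (hb := hb) (N := N) l (r + 1) v with hw
    rw [aW_succ l (r + 1), aW_succ l (r + 1), ← hu]
    have hz : fGen hb N t • aW (hb := hb) (N := N) l (r + 1) w = 0 := by
      rw [aW_f_comm hN (by omega) ht hc, hw, f_aW_eq_zero hN hf (by omega) ht hc, aW_apply_zero]
    have h2 := hS.apply_sq hN (i := u) (j := t) (by omega) (by omega) (by omega) ht (by omega)
      (Or.inl (by rwa [hu, show l + 1 + (r + 1) = l + (r + 1) + 1 by omega])) hz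
    simp only [fOp_apply] at h2
    rw [IH'] at h2
    simp only [smul_smul_comm] at h2
    have h3 := smul_right_injective X (qpow_one_add_ne hq) h2
    rw [h3, aW_f_comm hN (by omega) ht hc]

/-- The two statements feed each other. Applying f_t to the first and doubling each term by
`f_aW_aW` gives the second after division by [2]_q. The second, with t the next letter u, gives the
first for the longer word through the Serre relation for u, whose square term vanishes. The
induction starts from the Serre relation between f_{l+1} and f_l. -/
theorem aW_f_aW (hl : 1 ≤ l) (hc : Even N → l + 2 < N / 2) {r : ℕ} (hr : l + r + 1 < N / 2) :
    (qpow hb 1 + qpow hb (-1)) •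
        aW (hb := hb) (N := N) l (r + 1) (fGen hb N l • aW (hb := hb) (N := N) l (r + 1) v)
      = aW (hb := hb) (N := N) l (r + 1) (aW (hb := hb) (N := N) l (r + 1) (fGen hb N l • v))
        + fGen hb N l • aW (hb := hb) (N := N) l (r + 1) (aW (hb := hb) (N := N) l (r + 1) v) ∧
    ∀ t, t ≤ N / 2 → AdjLt N (l + r + 1) t →
      fGen hb N t • aW (hb := hb) (N := N) l (r + 1)
        (fGen hb N l • aW (hb := hb) (N := N) l (r + 1) v)
      = fGen hb N l • aW (hb := hb) (N := N) l (r + 1)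
          (fGen hb N t • aW (hb := hb) (N := N) l (r + 1) v)
        + aW (hb := hb) (N := N) l (r + 1)
          (fGen hb N t • aW (hb := hb) (N := N) l (r + 1) (fGen hb N l • v)) := by
  have hS := fOp_serre (hb := hb) (N := N) (X := X)
  have hlc : ∀ j, l + 2 ≤ j → j ≤ N / 2 → ∀ x : X,
      fGen hb N l • fGen hb N j • x = fGen hb N j • fGen hb N l • x := fun j h1 h2 x => by
    refine f_comm_smul hN hl h2 (by omega) ?_ x
    rintro (h' | h') <;> [omega; (have := hc h'.1; omega)]
  have hf' : ∀ j, l + 2 ≤ j → j ≤ N / 2 → fGen hb N j • fGen hb N l • v = 0 := fun j h1 h2 => by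
    rw [← hlc j h1 h2, hf j h1 h2, smul_zero]
  have second : ∀ r, l + r + 1 < N / 2 → ((qpow hb 1 + qpow hb (-1)) •
        aW (hb := hb) (N := N) l (r + 1) (fGen hb N l • aW (hb := hb) (N := N) l (r + 1) v)
      = aW (hb := hb) (N := N) l (r + 1) (aW (hb := hb) (N := N) l (r + 1) (fGen hb N l • v))
        + fGen hb N l • aW (hb := hb) (N := N) l (r + 1) (aW (hb := hb) (N := N) l (r + 1) v)) →
    ∀ t, t ≤ N / 2 → AdjLt N (l + r + 1) t →
      fGen hb N t • aW (hb := hb) (N := N) l (r + 1)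
        (fGen hb N l • aW (hb := hb) (N := N) l (r + 1) v)
      = fGen hb N l • aW (hb := hb) (N := N) l (r + 1)
          (fGen hb N t • aW (hb := hb) (N := N) l (r + 1) v)
        + aW (hb := hb) (N := N) l (r + 1)
          (fGen hb N t • aW (hb := hb) (N := N) l (r + 1) (fGen hb N l • v)) := by
    intro r hr hC t ht ha
    have hlt : l + r + 1 < t := by rcases ha with ha | ha <;> omega
    apply smul_right_injective X (qpow_one_add_ne hq)
    have := congrArg (fGen hb N t • ·) hC
    simp only [smul_add, smul_smul_comm] at this ⊢
    rw [this, f_aW_aW hq hN hf' hr ht ha, ← hlc t (by omega) ht, f_aW_aW hq hN hf hr ht ha,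
      smul_smul_comm, add_comm]
  suffices hC : (qpow hb 1 + qpow hb (-1)) •
        aW (hb := hb) (N := N) l (r + 1) (fGen hb N l • aW (hb := hb) (N := N) l (r + 1) v)
      = aW (hb := hb) (N := N) l (r + 1) (aW (hb := hb) (N := N) l (r + 1) (fGen hb N l • v))
        + fGen hb N l • aW (hb := hb) (N := N) l (r + 1) (aW (hb := hb) (N := N) l (r + 1) v) from
    ⟨hC, second r hr hC⟩
  induction r with
  | zero =>
    simp only [aW_succ, aW_zero, add_zero]
    have := hS.long_of_adj hN (i := l + 1) (j := l) (by omega) (by omega) (by omega) (by omega)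
      (by omega) (Or.inr (Or.inl ⟨rfl, by omega⟩)) v
    simp only [fOp_apply] at this
    rw [sub_add_eq_add_sub, sub_eq_zero] at this
    exact this.symm
  | succ r IH =>
    have hB := second r (by omega) (IH (by omega)) (l + 1 + (r + 1)) (by omega)
      (Or.inl ⟨by omega, by omega⟩)
    set u := l + 1 + (r + 1) with hu
    set w := aW (hb := hb) (N := N) l (r + 1) v with hw
    have hcm : ∀ x : X, fGen hb N u • aW (hb := hb) (N := N) l r x
        = aW (hb := hb) (N := N) l r (fGen hb N u • x) := fun x =>
      aW_f_comm hN (by omega) (by omega) (fun _ _ => by omega) x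
    have hadj : AdjLt N (l + 1 + r) u := Or.inl ⟨by omega, by omega⟩
    have huw : fGen hb N u • fGen hb N u • w = 0 := by
      rw [hw, aW_succ]
      refine hS.sq_apply_eq_zero hN (i := u) (j := l + 1 + r) (by omega) (by omega) (by omega)
        (by omega) (by omega) (Or.inr hadj) ?_
      rw [fOp_apply, hcm, hf u (by omega) (by omega), aW_apply_zero]
    have hz : fGen hb N u • fGen hb N u • aW (hb := hb) (N := N) l r (fGen hb N l • w) = 0 := by
      rw [hcm, hcm, ← hlc u (by omega) (by omega), ← hlc u (by omega) (by omega), huw, smul_zero,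
        aW_apply_zero]
    have h2 := hS.long_of_adj hN (i := u) (j := l + 1 + r) (by omega) (by omega) (by omega)
        (by omega) (by omega) (Or.inr hadj) (aW (hb := hb) (N := N) l r (fGen hb N l • w))
    simp only [fOp_apply] at h2
    rw [hz, smul_zero, add_zero, sub_eq_zero, ← aW_succ, hB] at h2
    simp only [aW_succ l (r + 1), ← hu, ← hw]
    rw [hlc u (by omega) (by omega), aW_succ l r (fGen hb N u • fGen hb N l • w), ← hcm, ← h2,
      smul_add, ← hlc u (by omega) (by omega), add_comm]

end Symmetry
end Words

/-! ### Combinations of the φ_m and three-term recurrences -/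

section Families

variable {hb : ℂ} {N l M : ℕ} {X : Type*} [AddCommGroup X] [Module ℂ X] [Module (Uq hb N) X]
  [IsScalarTower ℂ (Uq hb N) X] {ω : ℕ → ℂ} {y : ℕ → X}

/-- Vectors `y m` of weights `ω - ε_{l+1+m}`, `1 ≤ m ≤ M`, on which `e_j` and `f_j` act as on
the lower half of the natural representation of `so(P)`. -/
structure Family (hb : ℂ) (N l M : ℕ) {X : Type*} [AddCommGroup X] [Module ℂ X]
    [Module (Uq hb N) X] (ω : ℕ → ℂ) (y : ℕ → X) : Prop where
  wt : ∀ m, 1 ≤ m → m ≤ M → IsWt hb N (ω - Pi.single (l + 1 + m) 1) (y m)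
  zero : ∀ i, l + 2 ≤ i → i ≤ N / 2 → ω i = 0
  f : ∀ m s, 1 ≤ m → m ≤ M → 2 ≤ s → l + s ≤ N / 2 →
    fGen hb N (l + s) • y m = if s = m then y (m - 1) else 0
  e : ∀ m s, 1 ≤ m → m ≤ M → 2 ≤ s → l + 1 + s ≤ N / 2 →
    eGen hb N (l + s) • y m = if s = m + 1 then y (m + 1) else 0
  e_one : ∀ m, 1 ≤ m → m ≤ M → eGen hb N (l + 1) • y m = 0
  le : ∀ m, m ≤ M → l + m ≤ N / 2
  even_le : Even N → ∀ m, m ≤ M → l + m < N / 2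

/-- The combination `∑ c_m f_{l+m} ⋯ f_{l+1} y_m`. -/
def aSum (hb : ℂ) (N l M : ℕ) {X : Type*} [AddCommGroup X] [Module ℂ X]
    [Module (Uq hb N) X] (c : ℕ → ℂ) (y : ℕ → X) : X :=
  ∑ m ∈ Finset.Icc 1 M, c m • aW (hb := hb) (N := N) l m (y m)

namespace Family

variable (hq : NotRoot hb) (hN : 3 ≤ N) (h : Family hb N l M ω y)
include hN h

/-- The monomials with f_l in the middle are a_m applied to f_l b_m v, so they are handled as a
second family. -/
theorem f_smul_left (hl : 1 ≤ l) (hc : Even N → l + 2 < N / 2) (hn : l < N / 2) :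
    Family hb N l M (ω - rt N l) (fun m => fGen hb N l • y m) where
  wt m h1 h2 := ((h.wt m h1 h2).f l).congr fun i _ _ => by
    simp only [Pi.sub_apply]; ring
  zero i h1 h2 := by
    simp [h.zero i h1 h2, rt, hn, show i ≠ l by omega,
      show i ≠ l + 1 by omega]
  f m s h1 h2 h3 h4 := by
    rw [← f_comm_smul hN hl h4 (by omega), h.f m s h1 h2 h3 h4]
    · split_ifs <;> simp
    · rintro (h' | h') <;> [omega; (have := hc h'.1; omega)]
  e m s h1 h2 h3 h4 := by
    rw [e_f_smul_ne (by omega), h.e m s h1 h2 h3 h4]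
    split_ifs <;> simp
  e_one m h1 h2 := by rw [e_f_smul_ne (by omega), h.e_one m h1 h2, smul_zero]
  le := h.le
  even_le := h.even_le

include hq

/-- Three values of m contribute, each in its own way. For m = s - 1 the operator passes the word
and turns y_{s-1} into y_s; for m = s it removes the top letter with weight factor [2]_q; for m = s
+ 1 it removes the second letter and the freed f_{l+s+1} turns y_{s+1} into y_s. -/
theorem e_aW {m s : ℕ} (h1 : 1 ≤ m) (h2 : m ≤ M) (h3 : 2 ≤ s) (h4 : l + 1 + s ≤ N / 2) :
    eGen hb N (l + s) • aW (hb := hb) (N := N) l m (y m) =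
      (if m = s - 1 then 1 else if m = s then qpow hb 1 + qpow hb (-1) else
        if m = s + 1 then 1 else (0 : ℂ)) • aW (hb := hb) (N := N) l (s - 1) (y s) := by
  have hle := h.le m h2
  have hev := fun he => h.even_le he m h2
  obtain ⟨s, rfl⟩ : ∃ t, s = t + 1 := ⟨s - 1, by omega⟩
  have hE := h.e m (s + 1) h1 h2 h3 h4
  have hF := fun h5 => h.f m (s + 2) h1 h2 (by omega) h5
  simp only [show l + (s + 1) = l + 1 + s by omega, show l + (s + 2) = l + 2 + s by omega,
    Nat.add_sub_cancel] at hE hF ⊢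
  by_cases c1 : m = s
  · subst c1
    rw [aW_e_comm (by omega), hE, if_pos rfl, if_pos rfl, one_smul]
  rw [if_neg c1]
  rw [if_neg (by omega)] at hE
  by_cases c2 : m = s + 1
  · subst c2
    rw [e_aW_top (h.wt _ h1 h2) hN l s (by omega), hE, aW_apply_zero, zero_add, if_pos rfl]
    congr 1
    rw [← qnum_two hq]
    congr 1
    have e1 := h.zero (l + 1 + s) (by omega) (by omega)
    have e2 := h.zero (l + 1 + s + 1) (by omega) (by omega)
    simp only [dval, if_pos (show l + 1 + s < N / 2 by omega), Pi.sub_apply, Pi.add_apply,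
      Pi.single_apply, e1, e2]
    split_ifs <;> first | omega | norm_num
  rw [if_neg c2]
  by_cases c3 : m = s + 2
  · subst c3
    rw [e_aW_next (h.wt _ h1 h2) hN l s (by omega) (fun he => by have := hev he; omega), hE,
      aW_apply_zero, zero_add, if_pos rfl]
    have hF' : fGen hb N (l + 2 + s) • y (s + 2) = y (s + 1) := by
      rw [hF (by omega), if_pos rfl]; rfl
    rw [hF']
    congr 1
    refine (congrArg (qnum hb) ?_).trans (qnum_one hq)
    have e1 := h.zero (l + 1 + s) (by omega) (by omega)
    have e2 := h.zero (l + 1 + s + 1) (by omega) (by omega)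
    simp only [dval, if_pos (show l + 1 + s < N / 2 by omega), Pi.sub_apply, Pi.add_apply,
      Pi.single_apply, e1, e2]
    split_ifs <;> first | omega | norm_num
  · rw [if_neg c3, zero_smul]
    rcases lt_or_gt_of_ne c1 with c4 | c4
    · rw [aW_e_comm (by omega), hE, aW_apply_zero]
    · rw [e_aW_far hN l s m (h.wt _ h1 h2) (by omega) (by omega) hev ?_, hE, aW_apply_zero]
      rw [hF (by omega), if_neg (by omega)]

/-- The action of `e_{l+s}`, `s ≥ 2`, away from the end of the diagram. -/
theorem e_aSum (c : ℕ → ℂ) {s : ℕ} (h3 : 2 ≤ s) (h4 : l + 1 + s ≤ N / 2) (h5 : s + 1 ≤ M) :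
    eGen hb N (l + s) • aSum hb N l M c y =
      (c (s - 1) + (qpow hb 1 + qpow hb (-1)) * c s + c (s + 1)) •
        aW (hb := hb) (N := N) l (s - 1) (y s) := by
  have key : ∀ m ∈ Finset.Icc 1 M, eGen hb N (l + s) • c m • aW (hb := hb) (N := N) l m (y m) =
      ((if m = s - 1 then c m else 0) + (if m = s then c m * (qpow hb 1 + qpow hb (-1)) else 0)
        + (if m = s + 1 then c m else 0)) • aW (hb := hb) (N := N) l (s - 1) (y s) := by
    intro m hm
    rw [Finset.mem_Icc] at hm
    rw [smul_smul_comm, h.e_aW hq hN hm.1 hm.2 h3 h4, smul_smul]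
    congr 1
    by_cases c1 : m = s - 1
    · rw [if_pos c1, if_pos c1, if_neg (by omega), if_neg (by omega)]; ring
    by_cases c2 : m = s
    · rw [if_neg c1, if_neg c1, if_pos c2, if_pos c2, if_neg (by omega)]; ring
    by_cases c3 : m = s + 1
    · rw [if_neg c1, if_neg c2, if_pos c3, if_neg c1, if_neg c2, if_pos c3]; ring
    · simp [c1, c2, c3]
  rw [aSum, Finset.smul_sum, Finset.sum_congr rfl key, ← Finset.sum_smul]
  congr 1
  simp only [Finset.sum_add_distrib, Finset.sum_ite_eq', Finset.mem_Icc]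
  rw [if_pos (by omega), if_pos (by omega), if_pos (by omega)]
  ring

/-- The action of the last generator with a long root, when `M = p` is even type. -/
theorem e_aSum_top (c : ℕ → ℂ) (h3 : 2 ≤ M) (h4 : l + 1 + M ≤ N / 2) :
    eGen hb N (l + M) • aSum hb N l M c y =
      (c (M - 1) + (qpow hb 1 + qpow hb (-1)) * c M) •
        aW (hb := hb) (N := N) l (M - 1) (y M) := by
  have key : ∀ m ∈ Finset.Icc 1 M, eGen hb N (l + M) • c m • aW (hb := hb) (N := N) l m (y m) =
      ((if m = M - 1 then c m else 0) + (if m = M then c m * (qpow hb 1 + qpow hb (-1)) else 0))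
        • aW (hb := hb) (N := N) l (M - 1) (y M) := by
    intro m hm
    rw [Finset.mem_Icc] at hm
    rw [smul_smul_comm, h.e_aW hq hN hm.1 hm.2 h3 h4, smul_smul]
    congr 1
    by_cases c1 : m = M - 1
    · rw [if_pos c1, if_pos c1, if_neg (by omega)]; ring
    by_cases c2 : m = M
    · rw [if_neg c1, if_neg c1, if_pos c2, if_pos c2]; ring
    · simp [c1, c2, show m ≠ M + 1 by omega]
  rw [aSum, Finset.smul_sum, Finset.sum_congr rfl key, ← Finset.sum_smul]
  congr 1
  simp only [Finset.sum_add_distrib, Finset.sum_ite_eq', Finset.mem_Icc]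
  rw [if_pos (by omega), if_pos (by omega)]
  ring

omit hq in
theorem e_one_aW {m : ℕ} (h1 : 1 ≤ m) (h2 : m ≤ M) (hM : 2 ≤ M) :
    eGen hb N (l + 1) • aW (hb := hb) (N := N) l m (y m) =
      (if m = 1 then qnum hb (ω (l + 1) + 1) else
        if m = 2 then qnum hb (ω (l + 1)) else 0) • y 1 := by
  have hle := h.le m h2
  have hev := fun he => h.even_le he m h2
  have hle2 := h.le 2 hM
  have hE := h.e_one m h1 h2
  have e2 := h.zero (l + 1 + 1) (by omega) (by omega)
  by_cases c1 : m = 1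
  · subst c1
    have := e_aW_top (h.wt _ h1 h2) hN l 0 (by omega)
    rw [add_zero, aW_zero] at this
    rw [this, hE, aW_apply_zero, zero_add, if_pos rfl]
    congr 2
    simp only [dval, if_pos (show l + 1 < N / 2 by omega), Pi.sub_apply, Pi.add_apply,
      Pi.single_apply, e2]
    split_ifs <;> first | omega | ring
  by_cases c2 : m = 2
  · subst c2
    have := e_aW_next (h.wt _ h1 h2) hN l 0 (by omega) (fun he => by have := hev he; omega)
    rw [add_zero, add_zero, aW_zero] at this
    rw [this, hE, aW_apply_zero, zero_add, if_neg c1, if_pos rfl,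
      h.f 2 2 h1 h2 le_rfl (by omega), if_pos rfl]
    congr 2
    simp only [dval, if_pos (show l + 1 < N / 2 by omega), Pi.sub_apply, Pi.add_apply,
      Pi.single_apply, e2]
    split_ifs <;> first | omega | ring
  · have := e_aW_far hN l 0 m (h.wt _ h1 h2) (by omega) (by omega) hev
      (by rw [add_zero, h.f m 2 h1 h2 le_rfl (by omega), if_neg (by omega)])
    rw [add_zero] at this
    rw [this, hE, aW_apply_zero, if_neg c1, if_neg c2, zero_smul]

omit hq in
theorem e_one_aSum (c : ℕ → ℂ) (hM : 2 ≤ M) :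
    eGen hb N (l + 1) • aSum hb N l M c y =
      (c 1 * qnum hb (ω (l + 1) + 1) + c 2 * qnum hb (ω (l + 1))) • y 1 := by
  have key : ∀ m ∈ Finset.Icc 1 M, eGen hb N (l + 1) • c m • aW (hb := hb) (N := N) l m (y m) =
      ((if m = 1 then c m * qnum hb (ω (l + 1) + 1) else 0)
        + (if m = 2 then c m * qnum hb (ω (l + 1)) else 0)) • y 1 := by
    intro m hm
    rw [Finset.mem_Icc] at hm
    rw [smul_smul_comm, h.e_one_aW hN hm.1 hm.2 hM, smul_smul]
    congr 1
    by_cases c1 : m = 1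
    · simp [c1]
    by_cases c2 : m = 2 <;> simp [c1, c2]
  rw [aSum, Finset.smul_sum, Finset.sum_congr rfl key, ← Finset.sum_smul]
  congr 1
  simp only [Finset.sum_add_distrib, Finset.sum_ite_eq', Finset.mem_Icc]
  rw [if_pos (by omega), if_pos (by omega)]

/-- The action of `e_n` for odd `N`. -/
theorem e_last_odd (c : ℕ → ℂ) (hM : 2 ≤ M) (ho : ¬Even N) (hn : l + M = N / 2) {z : X}
    (hz : ∀ m, 1 ≤ m → m ≤ M → eGen hb N (N / 2) • y m =
      if m + 1 = M then y M else if m = M then z else 0) :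
    eGen hb N (N / 2) • aSum hb N l M c y =
      (c (M - 1) + c M) • aW (hb := hb) (N := N) l (M - 1) (y M)
        + c M • fGen hb N (N / 2) • aW (hb := hb) (N := N) l (M - 1) z := by
  have key : ∀ m ∈ Finset.Icc 1 M, eGen hb N (N / 2) • c m • aW (hb := hb) (N := N) l m (y m) =
      ((if m = M - 1 then c m else 0) + (if m = M then c m else 0))
        • aW (hb := hb) (N := N) l (M - 1) (y M) +
      (if m = M then c m else 0) • fGen hb N (N / 2) • aW (hb := hb) (N := N) l (M - 1) z := by
    intro m hm
    rw [Finset.mem_Icc] at hm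
    rw [smul_smul_comm]
    by_cases c2 : m = M
    · obtain ⟨t, rfl⟩ : ∃ t, m = t + 1 := ⟨m - 1, by omega⟩
      have e0 := hz _ hm.1 hm.2
      rw [if_neg (by omega), if_pos c2] at e0
      have ew := (h.wt _ hm.1 hm.2).aW l t (Or.inl (by omega))
      have e1 := h.zero (N / 2) (by omega) (by omega)
      rw [aW_succ, show l + 1 + t = N / 2 by omega, e_f_smul ew hN (by omega) le_rfl,
        aW_e_comm (by omega), e0, if_neg (by omega), if_pos c2, zero_add, smul_add, ← c2,
        Nat.add_sub_cancel, add_comm]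
      congr 1
      rw [show dval N _ (N / 2) = (1 : ℂ) from ?_, qnum_one hq, one_smul]
      simp only [dval, lt_irrefl, if_false, ho, Pi.sub_apply, Pi.add_apply, Pi.single_apply, e1]
      split_ifs <;> first | omega | ring
    · rw [aW_e_comm (by omega), hz m hm.1 hm.2, if_neg c2, if_neg c2, zero_smul,
        add_zero, add_zero]
      by_cases c1 : m = M - 1
      · rw [if_pos (by omega), if_pos c1, c1]
      · rw [if_neg (by omega), if_neg c1, aW_apply_zero, smul_zero, zero_smul]
  rw [aSum, Finset.smul_sum, Finset.sum_congr rfl key, Finset.sum_add_distrib, ← Finset.sum_smul,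
    ← Finset.sum_smul]
  simp only [Finset.sum_add_distrib, Finset.sum_ite_eq', Finset.mem_Icc]
  rw [if_pos (by omega), if_pos (by omega)]

omit hN hq h in
/-- The action of `e_n` for even `N`. -/
theorem e_last_even (c : ℕ → ℂ) (hM : 2 ≤ M) (hn : l + 1 + M = N / 2) {z z' : X}
    (hz : ∀ m, 1 ≤ m → m ≤ M → eGen hb N (N / 2) • y m =
      if m + 1 = M then z else if m = M then z' else 0) :
    eGen hb N (N / 2) • aSum hb N l M c y =
      c (M - 1) • aW (hb := hb) (N := N) l (M - 1) z
        + c M • aW (hb := hb) (N := N) l M z' := by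
  have key : ∀ m ∈ Finset.Icc 1 M, eGen hb N (N / 2) • c m • aW (hb := hb) (N := N) l m (y m) =
      (if m = M - 1 then c m else 0) • aW (hb := hb) (N := N) l (M - 1) z +
      (if m = M then c m else 0) • aW (hb := hb) (N := N) l M z' := by
    intro m hm
    rw [Finset.mem_Icc] at hm
    rw [smul_smul_comm, aW_e_comm (by omega), hz m hm.1 hm.2]
    by_cases c1 : m = M - 1
    · rw [if_pos (by omega), if_pos c1, if_neg (by omega), zero_smul, add_zero, c1]
    by_cases c2 : m = M
    · rw [if_neg (by omega), if_pos c2, if_neg c1, if_pos c2, zero_smul, zero_add, c2]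
    · rw [if_neg (by omega), if_neg c2, if_neg c1, if_neg c2, aW_apply_zero]; simp
  rw [aSum, Finset.smul_sum, Finset.sum_congr rfl key, Finset.sum_add_distrib, ← Finset.sum_smul,
    ← Finset.sum_smul]
  simp only [Finset.sum_ite_eq', Finset.mem_Icc]
  rw [if_pos (by omega), if_pos (by omega)]

end Family
end Families

/-! ### Identities between q-numbers -/

section QNumIdentities

variable {hb : ℂ}

theorem qnum_mul_sub (hq : NotRoot hb) (x y : ℂ) :
    qnum hb x * qnum hb y - qnum hb (x - 1) * qnum hb (y - 1) = qnum hb (x + y - 1) := by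
  have h := qpow_one_sub_ne hq
  simp only [qnum]
  rw [div_mul_div_comm, div_mul_div_comm, ← sub_div, div_eq_div_iff (mul_ne_zero h h) h]
  have h1 := qpow_ne_zero hb 1
  have hx := qpow_ne_zero hb x
  have hy := qpow_ne_zero hb y
  simp only [qpow_add, qpow_sub, qpow_neg, neg_sub, mul_inv]
  field_simp
  ring

theorem qnum_mid_one (hq : NotRoot hb) (g a : ℂ) :
    qnum hb (g - a) * qnum hb g * qnum hb (g + a - 1)
      - qnum hb (g - a - 1) * qnum hb g * qnum hb (g + a - 1 - 1)
      - (qpow hb a + qpow hb (-a)) * (qnum hb (g - 1) * qnum hb g) * qnum hb (g + a - 1 + 1)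
      + (qpow hb (a + 1) + qpow hb (-(a + 1))) * (qnum hb (g - 1) * qnum hb g)
        * qnum hb (g + a - 1) = 0 := by
  have h := qpow_one_sub_ne hq
  simp only [qnum]
  rw [qpow_neg] at *
  have h1 := qpow_ne_zero hb 1
  have hx := qpow_ne_zero hb g
  have hy := qpow_ne_zero hb a
  simp only [qpow_add, qpow_sub, qpow_neg, neg_add, neg_sub, mul_inv, inv_inv] at *
  field_simp
  ring

/-- The identity behind e_l f_{ε_l+ε_{l+1}} v ∼ f_{2ε_{l+1}} v. The three products belong to f_l
standing left of, inside and right of φ_m. Only a depends on m, so the factorisation makes the first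
factor on the right common to all m and leaves the coefficient of φ_m in f_{2ε_{l+1}}, up to sign.
-/
theorem qnum_raise (hq : NotRoot hb) (z g a : ℂ) :
    qnum hb (z + 2) * (qnum hb (g - a) * qnum hb g)
      - qnum hb (z + 1) * ((qpow hb a + qpow hb (-a)) * (qnum hb (g - 1) * qnum hb g))
      + qnum hb z * (qnum hb (g + a - 1) * qnum hb (g - 1))
      = qnum hb (z + 2 * g) * qnum hb (1 - a) := by
  have h := qpow_one_sub_ne hq
  have e2 : qpow hb (z + 2 * g) = qpow hb z * qpow hb g ^ 2 := by
    rw [two_mul, qpow_add, qpow_add, sq]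
  have e2' : qpow hb (-(z + 2 * g)) = (qpow hb z)⁻¹ * (qpow hb g)⁻¹ ^ 2 := by
    rw [qpow_neg, e2, mul_inv, inv_pow]
  obtain ⟨d, hd⟩ : ∃ d, d = qpow hb 1 - qpow hb (-1) := ⟨_, rfl⟩
  rw [← hd] at h
  simp only [qnum, e2, e2', ← hd]
  have h1 := qpow_ne_zero hb 1
  have hx := qpow_ne_zero hb g
  have hy := qpow_ne_zero hb a
  have hz := qpow_ne_zero hb z
  simp only [qpow_add, qpow_sub, qpow_neg, neg_add, neg_sub, mul_inv, qpow_two] at *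
  field_simp
  rw [hd]
  field_simp
  ring

end QNumIdentities

/-! ### The natural representation of so(P) over a highest weight vector -/

section HighestWeight

variable {hb : ℂ} {l P : ℕ} {X : Type*} [AddCommGroup X] [Module ℂ X]
  [Module (Uq hb (2 * l + 2 + P)) X] [IsScalarTower ℂ (Uq hb (2 * l + 2 + P)) X]

/-- A weight vector killed by `e_j`, `j ≥ l + 1`, and by the `f_j` of the Levi subalgebra. -/
structure HW (hb : ℂ) (l P : ℕ) {X : Type*} [AddCommGroup X] [Module ℂ X]
    [Module (Uq hb (2 * l + 2 + P)) X] (ν : ℕ → ℂ) (v : X) : Prop where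
  wt : IsWt hb (2 * l + 2 + P) ν v
  e : ∀ j, l + 1 ≤ j → j ≤ (2 * l + 2 + P) / 2 → eGen hb (2 * l + 2 + P) j • v = 0
  f : P ≠ 2 → ∀ j, l + 2 ≤ j → j ≤ (2 * l + 2 + P) / 2 → fGen hb (2 * l + 2 + P) j • v = 0
  zero : ∀ i, l + 2 ≤ i → i ≤ (2 * l + 2 + P) / 2 → ν i = 0

/-- The right part of `φ_m` applied to a vector. -/
def bW (hb : ℂ) (l P m : ℕ) {X : Type*} [AddCommGroup X] [Module (Uq hb (2 * l + 2 + P)) X]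
    (v : X) : X := fWord hb (2 * l + 2 + P) (rightWord l P m) • v

theorem even_iff (l P : ℕ) : Even (2 * l + 2 + P) ↔ Even P := by
  rw [Nat.even_add, Nat.even_add]; simp

theorem rightWord_step_odd (l : ℕ) {P m : ℕ} (ho : ¬Even P) (hm : m ≤ P / 2) :
    rightWord l P m = (l + 1 + m) :: rightWord l P (m + 1) := by
  simp only [rightWord, if_neg ho]
  rw [show P / 2 + 1 - m = P / 2 + 1 - (m + 1) + 1 by omega, List.range'_succ]
  simp [show l + m + 1 = l + 1 + m by omega, show l + 1 + m + 1 = l + (m + 1) + 1 by omega]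

theorem rightWord_top_odd (l : ℕ) {P : ℕ} (ho : ¬Even P) :
    rightWord l P (P / 2 + 1) = down l (P / 2 + 1) := by
  simp [rightWord, ho]

theorem rightWord_step_even (l : ℕ) {P m : ℕ} (he : Even P) (hm : m < P / 2) :
    rightWord l P m = (l + 1 + m) :: rightWord l P (m + 1) := by
  simp only [rightWord, if_pos he]
  rw [if_neg (by omega), if_neg (by omega),
    show P / 2 + 1 - m = P / 2 + 1 - (m + 1) + 1 by omega, List.range'_succ]
  simp [show l + m + 1 = l + 1 + m by omega, show l + 1 + m + 1 = l + (m + 1) + 1 by omega]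

theorem rightWord_last_even (l : ℕ) {P : ℕ} (he : Even P) :
    rightWord l P (P / 2) = (l + 1 + P / 2) :: down l (P / 2 - 1) := by
  simp [rightWord, he, show l + P / 2 + 1 = l + 1 + P / 2 by omega]

theorem rightWord_extra_even (l : ℕ) {P : ℕ} (he : Even P) :
    rightWord l P (P / 2 + 1) = down l (P / 2) := by
  simp [rightWord, he]

theorem leftWord_eq (l : ℕ) {P m : ℕ} (h : Even P → m ≤ P / 2) : leftWord l P m = down l m := by
  rw [leftWord, if_neg]
  rintro ⟨he, h'⟩
  have := h he
  omega

omit [Module ℂ X] [IsScalarTower ℂ (Uq hb (2 * l + 2 + P)) X] in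
theorem phi_smul (m : ℕ) (h : Even P → m ≤ P / 2) (v : X) :
    phi hb l P m • v = aW (hb := hb) (N := 2 * l + 2 + P) l m (bW hb l P m v) := by
  rw [phi, leftWord_eq l h, fWord_append, mul_smul]; rfl

omit [Module ℂ X] [IsScalarTower ℂ (Uq hb (2 * l + 2 + P)) X] in
theorem phiMid_smul (m : ℕ) (h : Even P → m ≤ P / 2) (v : X) :
    phiMid hb l P m • v = aW (hb := hb) (N := 2 * l + 2 + P) l m
      (fGen hb (2 * l + 2 + P) l • bW hb l P m v) := by
  rw [phiMid, leftWord_eq l h, fWord_append, mul_smul, fWord_cons, mul_smul]; rfl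

omit [Module ℂ X] [IsScalarTower ℂ (Uq hb (2 * l + 2 + P)) X] in
theorem phiDel_one_smul (h : 2 ≤ P ∨ ¬Even P) (v : X) : phiDel hb l P 1 • v = bW hb l P 1 v := by
  rw [phiDel, leftWord_eq l (fun he => by rcases h with h | h <;> [omega; exact absurd he h]), bW,
    down_succ, down_zero]
  rfl

namespace HW

variable (hq : NotRoot hb) {ν : ℕ → ℂ} {v : X} (h : HW hb l P ν v)
include h

/-- The terms φ_m f_l v are thereby treated as φ_m applied to another vector of the same kind. -/
theorem f_left (hl : 1 ≤ l) : HW hb l P (ν - rt (2 * l + 2 + P) l)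
    (fGen hb (2 * l + 2 + P) l • v) where
  wt := h.wt.f l
  e j h1 h2 := by rw [e_f_smul_ne (by omega), h.e j h1 h2, smul_zero]
  f hP j h1 h2 := by
    rw [← f_comm_smul (by omega) hl h2 (by omega), h.f hP j h1 h2, smul_zero]
    rintro (h' | ⟨⟨c, hc⟩, h'⟩) <;> omega
  zero i h1 h2 := by
    simp [h.zero i h1 h2, rt, show l < (2 * l + 2 + P) / 2 by omega, show i ≠ l by omega,
      show i ≠ l + 1 by omega]

theorem wt_up (hP : 3 ≤ P) : IsWt hb (2 * l + 2 + P)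
    (ν - Pi.single (l + 1) 1 + Pi.single (l + 1 + 1) 1)
    (aW (hb := hb) (N := 2 * l + 2 + P) l 1 v) :=
  h.wt.aW l 1 (Or.inl (by omega))

/-- The operator e_{l+1} can only remove the letter next to v; a Levi letter then meets v and kills
it. -/
theorem e_f_aW (hP : 3 ≤ P) {m j : ℕ} (h1 : 1 ≤ m) (h2 : l + m ≤ (2 * l + 2 + P) / 2)
    (h3 : l + 2 ≤ j) (h4 : j ≤ (2 * l + 2 + P) / 2) :
    eGen hb (2 * l + 2 + P) (l + 1) • fGen hb (2 * l + 2 + P) j •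
      aW (hb := hb) (N := 2 * l + 2 + P) l m v = 0 := by
  induction m, h1 using Nat.le_induction generalizing j with
  | base =>
    rw [e_f_smul_ne (by omega), aW_succ, aW_zero, add_zero,
      e_f_smul h.wt (by omega) (by omega) (by omega), h.e _ le_rfl (by omega), smul_zero, zero_add,
      smul_smul_comm, h.f (by omega) j h3 h4, smul_zero]
  | succ m hm IH =>
    rw [e_f_smul_ne (by omega), aW_succ, IH (by omega) (by omega) (by omega), smul_zero]

/-- The chain starts at f_{l+1} v. Since the Levi f_j kill v, the Serre relations with f_{l+1} say
exactly that f_{l+1} v generates the natural representation and nothing larger. -/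
theorem oddChain (hP : 3 ≤ P) (ho : ¬Even P) : OddChain hb (2 * l + 2 + P) (l + 1)
    (ν - Pi.single (l + 1) 1)
    (fun i => aW (hb := hb) (N := 2 * l + 2 + P) l (i - l - 1) v)
    (fun i => bW hb l P (i - l - 1) v) where
  odd := by rwa [even_iff]
  lt := by omega
  up i h1 h2 := by
    rw [show i + 1 - l - 1 = i - l - 1 + 1 by omega, aW_succ, show l + 1 + (i - l - 1) = i by omega]
  mid := by
    rw [show (2 * l + 2 + P) / 2 + 1 - l - 1 = P / 2 + 1 by omega, bW, rightWord_top_odd l ho,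
      show (2 * l + 2 + P) / 2 - l - 1 = P / 2 by omega, ← aW, aW_succ,
      show l + 1 + P / 2 = (2 * l + 2 + P) / 2 by omega]
  down i h1 h2 := by
    rw [bW, rightWord_step_odd l ho (by omega), fWord_cons, mul_smul,
      show l + 1 + (i - l - 1) = i by omega, show i - l - 1 + 1 = i + 1 - l - 1 by omega, ← bW]
  weight i h1 h2 := by simp [h.zero i h1 h2, show i ≠ l + 1 by omega]
  wt := by
    rw [show l + 1 + 1 - l - 1 = 1 by omega]; exact h.wt_up hP
  e j h1 h2 := by
    rw [show l + 1 + 1 - l - 1 = 1 by omega, aW_e_comm (by omega), h.e j (by omega) h2,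
      aW_apply_zero]
  f j h1 h2 := by
    rw [show l + 1 + 1 - l - 1 = 1 by omega, aW_f_comm (by omega) (by omega) h2
      (fun he => absurd ((even_iff l P).mp he) ho), h.f (by omega) j (by omega) h2, aW_apply_zero]
  sq h1 := by
    rw [show l + 1 + 1 - l - 1 = 1 by omega, aW_succ, aW_zero, add_zero]
    refine (fOp_serre (hb := hb) (X := X)).sq_apply_eq_zero (N := 2 * l + 2 + P) (by omega)
      (i := l + 1 + 1) (j := l + 1) (by omega) (by omega) (by omega) (by omega) (Or.inl h1)
      (Or.inr (Or.inl ⟨rfl, by omega⟩)) ?_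
    exact h.f (by omega) _ le_rfl (by omega)
  cube h1 := by
    rw [show l + 1 + 1 - l - 1 = 1 by omega, aW_succ, aW_zero, add_zero]
    have := (fOp_serre (hb := hb) (X := X)).short_last (N := 2 * l + 2 + P) (by omega)
      (by rwa [even_iff]) (by omega) v
    simpa [fOp_apply, ← h1, h.f (by omega) (l + 1 + 1) le_rfl (by omega)] using this

theorem evenChain (hP : 3 ≤ P) (he : Even P) : EvenChain hb (2 * l + 2 + P) (l + 1)
    (ν - Pi.single (l + 1) 1)
    (fun i => aW (hb := hb) (N := 2 * l + 2 + P) l (i - l - 1) v)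
    (fun i => bW hb l P (i - l - 1) v) where
  even := by rwa [even_iff]
  lt := by obtain ⟨c, hc⟩ := he; omega
  up i h1 h2 := by
    rw [show i + 1 - l - 1 = i - l - 1 + 1 by omega, aW_succ, show l + 1 + (i - l - 1) = i by omega]
  mid := by
    rw [show (2 * l + 2 + P) / 2 - l - 1 = P / 2 by omega, bW, rightWord_last_even l he,
      fWord_cons, mul_smul, show (2 * l + 2 + P) / 2 - 1 - l - 1 = P / 2 - 1 by omega, ← aW,
      show l + 1 + P / 2 = (2 * l + 2 + P) / 2 by omega]
  down i h1 h2 := by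
    rw [bW, rightWord_step_even l he (by omega), fWord_cons, mul_smul,
      show l + 1 + (i - l - 1) = i by omega, show i - l - 1 + 1 = i + 1 - l - 1 by omega, ← bW]
  weight i h1 h2 := by simp [h.zero i h1 h2, show i ≠ l + 1 by omega]
  wt := by
    rw [show l + 1 + 1 - l - 1 = 1 by omega]; exact h.wt_up hP
  e j h1 h2 := by
    rw [show l + 1 + 1 - l - 1 = 1 by omega, aW_e_comm (by omega), h.e j (by omega) h2,
      aW_apply_zero]
  f j h1 h2 h3 := by
    rw [show l + 1 + 1 - l - 1 = 1 by omega, aW_f_comm (by omega) (by omega) h2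
      (fun _ h4 => by omega), h.f (by omega) j (by omega) h2, aW_apply_zero]
  sq := by
    rw [show l + 1 + 1 - l - 1 = 1 by omega, aW_succ, aW_zero, add_zero]
    obtain ⟨c, hc⟩ := id he
    refine (fOp_serre (hb := hb) (X := X)).sq_apply_eq_zero (N := 2 * l + 2 + P) (by omega)
      (i := l + 1 + 1) (j := l + 1) (by omega) (by omega) (by omega) (by omega) (by omega)
      (Or.inr (Or.inl ⟨rfl, by omega⟩)) ?_
    exact h.f (by omega) _ le_rfl (by omega)
  sq' h1 := by
    rw [show l + 1 + 1 - l - 1 = 1 by omega, aW_succ, aW_zero, add_zero]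
    refine (fOp_serre (hb := hb) (X := X)).sq_apply_eq_zero (N := 2 * l + 2 + P) (by omega)
      (i := (2 * l + 2 + P) / 2) (j := l + 1) (by omega) (by omega) (by omega) (by omega)
      (Or.inr (by rwa [even_iff])) (Or.inr (Or.inr ⟨by rwa [even_iff], by omega, rfl⟩)) ?_
    exact h.f (by omega) _ (by omega) (by omega)

include hq

theorem family_odd (hP : 3 ≤ P) (ho : ¬Even P) :
    Family hb (2 * l + 2 + P) l (P / 2 + 1) (ν - Pi.single (l + 1) 1)
      (fun m => bW hb l P m v) := by
  have hc := h.oddChain hP ho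
  have e1 : ∀ m, l + 1 + m - l - 1 = m := fun m => by omega
  refine ⟨fun m h1 h2 => ?_, hc.weight, fun m s h1 h2 h3 h4 => ?_, fun m s h1 h2 h3 h4 => ?_,
    fun m h1 h2 => ?_, fun m h1 => by omega, fun he => absurd ((even_iff l P).mp he) ho⟩
  · have := hc.wtD (i := l + 1 + m) (by omega) (by omega)
    rwa [e1] at this
  · by_cases c : s = m
    · subst c
      have := hc.down (l + s) (by omega) (by omega)
      rw [show l + s + 1 = l + 1 + s by omega, e1] at this
      rw [if_pos rfl, ← this, show l + s - l - 1 = s - 1 by omega]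
    · have := hc.fD hq (by omega) (i := l + 1 + m) (j := l + s) (by omega) (by omega) (by omega)
        (by omega) (by omega)
      rw [e1] at this
      rw [if_neg c, this]
  · obtain h5 | rfl : m ≤ P / 2 ∨ m = P / 2 + 1 := by omega
    · have := hc.eD hq (by omega) (i := l + 1 + m) (j := l + s) (by omega) (by omega) (by omega)
        (by omega)
      rw [e1, show l + 1 + m + 1 - l - 1 = m + 1 by omega] at this
      rw [this]
      by_cases c : s = m + 1
      · rw [if_pos c, if_pos (by omega)]
      · rw [if_neg c, if_neg (by omega)]
    · have := hc.eMid hq (by omega) (j := l + s) (by omega) (by omega)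
      rw [show (2 * l + 2 + P) / 2 + 1 - l - 1 = P / 2 + 1 by omega, if_neg (by omega)] at this
      rw [this, if_neg (by omega)]
  · have : ∀ t m, 1 ≤ m → m + t = P / 2 + 1 → eGen hb (2 * l + 2 + P) (l + 1) • bW hb l P m v = 0 := by
      intro t
      induction t with
      | zero =>
        intro m hm0 hm
        obtain rfl : m = P / 2 + 1 := by omega
        have := hc.mid
        rw [show (2 * l + 2 + P) / 2 + 1 - l - 1 = P / 2 + 1 by omega] at this
        rw [this]
        exact h.e_f_aW hP (by omega) (by omega) (by omega) le_rfl
      | succ t IH =>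
        intro m hm0 hm
        rw [bW, rightWord_step_odd l ho (by omega), fWord_cons, mul_smul, ← bW]
        rw [e_f_smul_ne (by omega), IH (m + 1) (by omega) (by omega), smul_zero]
    exact this (P / 2 + 1 - m) m h1 (by omega)

theorem family_even (hP : 3 ≤ P) (he : Even P) :
    Family hb (2 * l + 2 + P) l (P / 2) (ν - Pi.single (l + 1) 1)
      (fun m => bW hb l P m v) := by
  have hc := h.evenChain hP he
  obtain ⟨r, hr⟩ := id he
  have e1 : ∀ m, l + 1 + m - l - 1 = m := fun m => by omega
  refine ⟨fun m h1 h2 => ?_, hc.weight, fun m s h1 h2 h3 h4 => ?_, fun m s h1 h2 h3 h4 => ?_,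
    fun m h1 h2 => ?_, fun m h1 => by omega, fun _ m h1 => by omega⟩
  · have := hc.wtD (i := l + 1 + m) (by omega) (by omega)
    rwa [e1] at this
  · by_cases c : s = m
    · subst c
      have := hc.down (l + s) (by omega) (by omega)
      rw [show l + s + 1 = l + 1 + s by omega, e1] at this
      rw [if_pos rfl, ← this, show l + s - l - 1 = s - 1 by omega]
    · have := hc.fD hq (by omega) (i := l + 1 + m) (j := l + s) (by omega) (by omega) (by omega)
        (by omega) (by omega)
      rw [e1] at this
      rw [if_neg c, this]
  · obtain h5 | rfl : m < P / 2 ∨ m = P / 2 := by omega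
    · have := hc.eD hq (by omega) (i := l + 1 + m) (j := l + s) (by omega) (by omega) (by omega)
        (by omega)
      rw [e1, show l + 1 + m + 1 - l - 1 = m + 1 by omega,
        if_neg (show ¬(l + s = (2 * l + 2 + P) / 2 ∧ _) by omega)] at this
      rw [this]
      by_cases c : s = m + 1
      · rw [if_pos c, if_pos (by omega)]
      · rw [if_neg c, if_neg (by omega)]
    · have := hc.eD_last hq (by omega) (j := l + s) (by omega) (by omega)
      rw [show (2 * l + 2 + P) / 2 - l - 1 = P / 2 by omega, if_neg (by omega)] at this
      rw [this, if_neg (by omega)]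
  · have : ∀ t m, 1 ≤ m → m + t = P / 2 → eGen hb (2 * l + 2 + P) (l + 1) • bW hb l P m v = 0 := by
      intro t
      induction t with
      | zero =>
        intro m hm0 hm
        obtain rfl : m = P / 2 := by omega
        have := hc.mid
        rw [show (2 * l + 2 + P) / 2 - l - 1 = P / 2 by omega] at this
        rw [this]
        exact h.e_f_aW hP (by omega) (by omega) (by omega) le_rfl
      | succ t IH =>
        intro m hm0 hm
        rw [bW, rightWord_step_even l he (by omega), fWord_cons, mul_smul, ← bW]
        rw [e_f_smul_ne (by omega), IH (m + 1) (by omega) (by omega), smul_zero]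
    exact this (P / 2 - m) m h1 (by omega)

end HW
end HighestWeight

/-! ### The coefficients and their recurrences -/

section Coefficients

variable (hb : ℂ) (P : ℕ) (h : ℂ)

theorem qnum_add_add_qnum_sub (x y : ℂ) :
    qnum hb (x + y) + qnum hb (x - y) = (qpow hb y + qpow hb (-y)) * qnum hb x := by
  simp only [qnum, qpow_add, qpow_sub, qpow_neg, neg_add, neg_sub]
  ring

theorem qpow_add_add_qpow_sub (x y : ℂ) : qpow hb (x + y) + qpow hb (-(x + y)) +
    (qpow hb (x - y) + qpow hb (-(x - y))) =
      (qpow hb y + qpow hb (-y)) * (qpow hb x + qpow hb (-x)) := by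
  simp only [qpow_add, qpow_sub, qpow_neg, neg_add, neg_sub]
  ring

/-- The coefficient of `φ_m` in `f_{2ε_{l+1}}`. -/
def dCoeff (m : ℕ) : ℂ := (-1) ^ (m - 1) * qnum hb ((P : ℂ) / 2 - m + 1)

/-- The coefficient of `f_l φ_m` in `f_{ε_l+ε_{l+1}}`, for the value `h` of `h_{ε_{l+1}}`. -/
def lCoeff (m : ℕ) : ℂ := (-1) ^ (m + 1) * (qnum hb (h + (P - m)) * qnum hb (h + P / 2))

/-- The coefficient of `φ_m^2` in `f_{ε_l+ε_{l+1}}`, for the value `h` of `h_{ε_{l+1}}`. -/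
def mCoeff (m : ℕ) : ℂ := midCoeff hb P m * (qnum hb (h + (P / 2 - 1)) * qnum hb (h + P / 2))

/-- The coefficient of `φ_m f_l` in `f_{ε_l+ε_{l+1}}`, for the value `h` of `h_{ε_{l+1}}`
on the left of `f_l`. -/
def rCoeff (m : ℕ) : ℂ := (-1) ^ (m + 1) * (qnum hb (h + (m - 1)) * qnum hb (h + (P / 2 - 1)))

/-- From [x+1] + [x-1] = [2][x], the alternating signs turning the difference into a sum. This and
the recurrences below are the conditions of `Family.e_aSum`. -/
theorem dCoeff_rec {t : ℕ} (ht : 1 ≤ t) : dCoeff hb P t +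
    (qpow hb 1 + qpow hb (-1)) * dCoeff hb P (t + 1) + dCoeff hb P (t + 2) = 0 := by
  obtain ⟨t, rfl⟩ : ∃ s, t = s + 1 := ⟨t - 1, by omega⟩
  have := qnum_add_add_qnum_sub hb ((P : ℂ) / 2 - (t + 1 : ℕ)) 1
  simp only [dCoeff, Nat.add_sub_cancel, show t + 1 + 2 - 1 = t + 2 by omega, pow_succ]
  rw [show (P : ℂ) / 2 - ((t + 1 : ℕ) + 1 : ℕ) + 1 = P / 2 - (t + 1 : ℕ) by push_cast; ring,
    show (P : ℂ) / 2 - ((t + 1 : ℕ) + 2 : ℕ) + 1 = P / 2 - (t + 1 : ℕ) - 1 by push_cast; ring]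
  linear_combination (-1 : ℂ) ^ t * this

theorem lCoeff_rec (t : ℕ) : lCoeff hb P h t +
    (qpow hb 1 + qpow hb (-1)) * lCoeff hb P h (t + 1) + lCoeff hb P h (t + 2) = 0 := by
  have := qnum_add_add_qnum_sub hb (h + ((P : ℂ) - (t + 1 : ℕ))) 1
  simp only [lCoeff, pow_succ]
  rw [show h + ((P : ℂ) - (t : ℕ)) = h + (P - (t + 1 : ℕ)) + 1 by push_cast; ring,
    show h + ((P : ℂ) - (t + 2 : ℕ)) = h + (P - (t + 1 : ℕ)) - 1 by push_cast; ring]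
  linear_combination - (-1 : ℂ) ^ t * qnum hb (h + P / 2) * this

theorem rCoeff_rec (t : ℕ) : rCoeff hb P h t +
    (qpow hb 1 + qpow hb (-1)) * rCoeff hb P h (t + 1) + rCoeff hb P h (t + 2) = 0 := by
  have := qnum_add_add_qnum_sub hb (h + (((t + 1 : ℕ) : ℂ) - 1)) 1
  simp only [rCoeff, pow_succ]
  rw [show h + (((t : ℕ) : ℂ) - 1) = h + ((t + 1 : ℕ) - 1) - 1 by push_cast; ring,
    show h + (((t + 2 : ℕ) : ℂ) - 1) = h + ((t + 1 : ℕ) - 1) + 1 by push_cast; ring]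
  linear_combination - (-1 : ℂ) ^ t * qnum hb (h + (P / 2 - 1)) * this

theorem mid_rec (t : ℕ) : (-1 : ℂ) ^ t * (qpow hb ((t : ℂ) - P / 2) + qpow hb (-((t : ℂ) - P / 2))) +
    (qpow hb 1 + qpow hb (-1)) * ((-1 : ℂ) ^ (t + 1) *
      (qpow hb (((t + 1 : ℕ) : ℂ) - P / 2) + qpow hb (-(((t + 1 : ℕ) : ℂ) - P / 2)))) +
    (-1 : ℂ) ^ (t + 2) * (qpow hb (((t + 2 : ℕ) : ℂ) - P / 2)
      + qpow hb (-(((t + 2 : ℕ) : ℂ) - P / 2))) = 0 := by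
  have := qpow_add_add_qpow_sub hb ((t + 1 : ℕ) - (P : ℂ) / 2) 1
  simp only [pow_succ]
  rw [show (t : ℂ) - P / 2 = (t + 1 : ℕ) - (P : ℂ) / 2 - 1 by push_cast; ring,
    show ((t + 2 : ℕ) : ℂ) - P / 2 = (t + 1 : ℕ) - (P : ℂ) / 2 + 1 by push_cast; ring]
  linear_combination (-1 : ℂ) ^ t * this

theorem mCoeff_rec {t : ℕ} (ht : Even P → t + 2 < P / 2) : mCoeff hb P h t +
    (qpow hb 1 + qpow hb (-1)) * mCoeff hb P h (t + 1) + mCoeff hb P h (t + 2) = 0 := by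
  have := mid_rec hb P t
  simp only [mCoeff, midCoeff]
  rw [if_neg (fun h => by have := ht h.1; omega), if_neg (fun h => by have := ht h.1; omega),
    if_neg (fun h => by have := ht h.1; omega)]
  linear_combination qnum hb (h + (P / 2 - 1)) * qnum hb (h + P / 2) * this

/-- For even P the value q^0 + q^0 = 2 that the uniform formula takes at m = P/2 is shared equally
by two monomials, hence the fourth term. -/
theorem mCoeff_rec_even {t : ℕ} (he : Even P) (ht : t + 2 = P / 2) : mCoeff hb P h t +
    (qpow hb 1 + qpow hb (-1)) * mCoeff hb P h (t + 1) + mCoeff hb P h (t + 2)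
      + mCoeff hb P h (t + 3) = 0 := by
  have := mid_rec hb P t
  have e : ((t + 2 : ℕ) : ℂ) - P / 2 = 0 := by
    obtain ⟨r, rfl⟩ := he
    rw [show t + 2 = r by omega]; push_cast; ring
  simp only [mCoeff, midCoeff]
  rw [if_neg (by omega), if_neg (by omega), if_pos ⟨he, by omega⟩, if_pos ⟨he, by omega⟩, ← ht]
  rw [e, neg_zero, qpow_zero] at this
  linear_combination qnum hb (h + (P / 2 - 1)) * qnum hb (h + P / 2) * this

theorem mCoeff_top_even (he : Even P) : mCoeff hb P h (P / 2) = mCoeff hb P h (P / 2 + 1) := by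
  simp [mCoeff, midCoeff, he]

variable {P} {p : ℕ}

/-- The recurrence continued one step past the end, where the q-number is [0]. -/
theorem dCoeff_even (hP : P = 2 * (p + 2)) : dCoeff hb P (p + 1) +
    (qpow hb 1 + qpow hb (-1)) * dCoeff hb P (p + 2) = 0 := by
  have := dCoeff_rec hb P (t := p + 1) (by omega)
  rwa [show dCoeff hb P (p + 1 + 2) = 0 from ?_, add_zero] at this
  rw [dCoeff, hP, show (((2 * (p + 2) : ℕ) : ℂ) / 2 - (p + 1 + 2 : ℕ) + 1) = 0 by push_cast; ring,
    qnum_zero, mul_zero]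

/-- The coefficient missing beyond the end is exactly the top coefficient of the middle terms. The
analogous coincidence holds for `rCoeff`. -/
theorem lCoeff_even (hP : P = 2 * (p + 2)) : lCoeff hb P h (p + 1) +
    (qpow hb 1 + qpow hb (-1)) * lCoeff hb P h (p + 2) + mCoeff hb P h (p + 2) = 0 := by
  have := lCoeff_rec hb P h (p + 1)
  convert this using 2
  have he : Even P := ⟨p + 2, by omega⟩
  rw [mCoeff, midCoeff, if_pos ⟨he, by omega⟩, lCoeff,
    show h + ((P : ℂ) - (p + 1 + 2 : ℕ)) = h + (P / 2 - 1) by rw [hP]; push_cast; ring,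
    show P / 2 = p + 2 by omega]
  ring

theorem rCoeff_even (hP : P = 2 * (p + 2)) : rCoeff hb P h (p + 1) +
    (qpow hb 1 + qpow hb (-1)) * rCoeff hb P h (p + 2) + mCoeff hb P h (p + 2) = 0 := by
  have := rCoeff_rec hb P h (p + 1)
  convert this using 2
  have he : Even P := ⟨p + 2, by omega⟩
  rw [mCoeff, midCoeff, if_pos ⟨he, by omega⟩, rCoeff,
    show h + (((p + 1 + 2 : ℕ) : ℂ) - 1) = h + (P / 2 : ℂ) by rw [hP]; push_cast; ring,
    show P / 2 = p + 2 by omega]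
  ring

theorem mCoeff_even (hP : P = 2 * (p + 2)) : mCoeff hb P h (p + 1) +
    (qpow hb 1 + qpow hb (-1)) * mCoeff hb P h (p + 2) = 0 := by
  have he : Even P := ⟨p + 2, by omega⟩
  rw [mCoeff, midCoeff, if_neg (by omega), mCoeff, midCoeff, if_pos ⟨he, by omega⟩,
    show P / 2 = p + 2 by omega,
    show ((p + 1 : ℕ) : ℂ) - P / 2 = -1 by rw [hP]; push_cast; ring, neg_neg]
  ring

/-- Past the end stands [-1/2] = -[1/2], so with the alternating sign the last coefficient repeats;
this is the boundary condition at the short root. -/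
theorem dCoeff_odd (hP : P = 2 * (p + 1) + 1) : dCoeff hb P (p + 1) +
    (1 + (qpow hb 1 + qpow hb (-1))) * dCoeff hb P (p + 2) = 0 := by
  have := dCoeff_rec hb P (t := p + 1) (by omega)
  have e : dCoeff hb P (p + 1 + 2) = dCoeff hb P (p + 2) := by
    rw [dCoeff, dCoeff, hP,
      show (((2 * (p + 1) + 1 : ℕ) : ℂ) / 2 - (p + 1 + 2 : ℕ) + 1) = -(1 / 2) by push_cast; ring,
      show (((2 * (p + 1) + 1 : ℕ) : ℂ) / 2 - (p + 2 : ℕ) + 1) = 1 / 2 by push_cast; ring,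
      qnum_neg, show p + 1 + 2 - 1 = p + 2 by omega, show p + 2 - 1 = p + 1 by omega]
    ring
  rw [e] at this
  linear_combination this

theorem mCoeff_odd (hP : P = 2 * (p + 1) + 1) : mCoeff hb P h (p + 1) + mCoeff hb P h (p + 2) = 0 := by
  have he : ¬Even P := by rw [Nat.not_even_iff_odd]; exact ⟨p + 1, hP⟩
  rw [mCoeff, midCoeff, if_neg (fun h => he h.1), mCoeff, midCoeff, if_neg (fun h => he h.1),
    show ((p + 1 : ℕ) : ℂ) - P / 2 = -(1 / 2) by rw [hP]; push_cast; ring,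
    show ((p + 2 : ℕ) : ℂ) - P / 2 = 1 / 2 by rw [hP]; push_cast; ring, neg_neg]
  ring

theorem lCoeff_odd (hP : P = 2 * p + 1) : lCoeff hb P h p +
    (1 + (qpow hb 1 + qpow hb (-1))) * lCoeff hb P h (p + 1) + mCoeff hb P h (p + 1) = 0 := by
  have he : ¬Even P := by rw [Nat.not_even_iff_odd]; exact ⟨p, hP⟩
  have h1 := lCoeff_rec hb P h p
  have h2 := qnum_add_add_qnum_sub hb (h + (P / 2 - 1)) (1 / 2)
  simp only [lCoeff, mCoeff, midCoeff, he, false_and, if_false, pow_succ] at h1 ⊢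
  rw [show ((p + 1 : ℕ) : ℂ) - P / 2 = 1 / 2 by rw [hP]; push_cast; ring]
  rw [show h + ((P : ℂ) / 2 - 1) + 1 / 2 = h + (P - (p + 1 : ℕ)) by rw [hP]; push_cast; ring,
    show h + ((P : ℂ) / 2 - 1) - 1 / 2 = h + (P - (p + 2 : ℕ)) by rw [hP]; push_cast; ring] at h2
  linear_combination h1 + (-1) ^ p * qnum hb (h + P / 2) * h2

theorem rCoeff_odd (hP : P = 2 * p + 1) : rCoeff hb P h p +
    (1 + (qpow hb 1 + qpow hb (-1))) * rCoeff hb P h (p + 1) + mCoeff hb P h (p + 1) = 0 := by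
  have he : ¬Even P := by rw [Nat.not_even_iff_odd]; exact ⟨p, hP⟩
  have h1 := rCoeff_rec hb P h p
  have h2 := qnum_add_add_qnum_sub hb (h + P / 2) (1 / 2)
  simp only [rCoeff, mCoeff, midCoeff, he, false_and, if_false, pow_succ] at h1 ⊢
  rw [show ((p + 1 : ℕ) : ℂ) - P / 2 = 1 / 2 by rw [hP]; push_cast; ring]
  rw [show h + (P : ℂ) / 2 + 1 / 2 = h + ((p + 2 : ℕ) - 1) by rw [hP]; push_cast; ring,
    show h + (P : ℂ) / 2 - 1 / 2 = h + ((p + 1 : ℕ) - 1) by rw [hP]; push_cast; ring] at h2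
  linear_combination h1 + (-1) ^ p * qnum hb (h + (P / 2 - 1)) * h2

variable (P) {hb}

theorem dCoeff_first (hq : NotRoot hb) : dCoeff hb P 1 * qnum hb h + dCoeff hb P 2 * qnum hb (h - 1) =
    qnum hb (h + P / 2 - 1) := by
  have := qnum_mul_sub hq ((P : ℂ) / 2) h
  simp only [dCoeff, Nat.sub_self, show 2 - 1 = 1 from rfl, pow_zero, pow_one]
  rw [show (P : ℂ) / 2 - (1 : ℕ) + 1 = P / 2 by push_cast; ring,
    show (P : ℂ) / 2 - (2 : ℕ) + 1 = P / 2 - 1 by push_cast; ring]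
  rw [show h + (P : ℂ) / 2 - 1 = P / 2 + h - 1 by ring]
  linear_combination this

/-- The boundary condition at e_{l+1}. The coefficients c1 and c2 are kept abstract because for P =
4 the second is the sum of two middle coefficients. -/
theorem midSum_first (hq : NotRoot hb) (c1 c2 : ℂ)
    (h1 : c1 = -(qpow hb (1 - P / 2) + qpow hb (-(1 - P / 2))))
    (h2 : c2 = qpow hb (2 - P / 2) + qpow hb (-(2 - P / 2))) :
    lCoeff hb P h 1 * qnum hb h + lCoeff hb P h 2 * qnum hb (h - 1)
      + c1 * (qnum hb (h + (P / 2 - 1)) * qnum hb (h + P / 2)) * qnum hb (h + 1)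
      + c2 * (qnum hb (h + (P / 2 - 1)) * qnum hb (h + P / 2)) * qnum hb h = 0 := by
  have := qnum_mid_one hq (h + P / 2) (1 - P / 2)
  rw [show h + (P : ℂ) / 2 - (1 - P / 2) = h + (P - (1 : ℕ)) by push_cast; ring,
    show h + (P : ℂ) / 2 + (1 - P / 2) - 1 = h by ring,
    show h + ((P : ℂ) - (1 : ℕ)) - 1 = h + (P - (2 : ℕ)) by push_cast; ring,
    show 1 - (P : ℂ) / 2 + 1 = 2 - P / 2 by ring,
    show h + (P : ℂ) / 2 - 1 = h + (P / 2 - 1) by ring] at this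
  simp only [lCoeff, h1, h2]
  linear_combination this

theorem rCoeff_first : rCoeff hb P h 1 * qnum hb (h + 1) + rCoeff hb P h 2 * qnum hb h = 0 := by
  simp only [rCoeff]
  rw [show h + (((1 : ℕ) : ℂ) - 1) = h by push_cast; ring,
    show h + (((2 : ℕ) : ℂ) - 1) = h + 1 by push_cast; ring]
  ring

theorem raise_coeff (hq : NotRoot hb) (z c : ℂ) {m : ℕ} (hm : 1 ≤ m)
    (hc : c = (-1) ^ m * (qpow hb (m - P / 2) + qpow hb (-(m - P / 2)))) :
    qnum hb (z + 2) * lCoeff hb P h m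
      + qnum hb (z + 1) * (c * (qnum hb (h + (P / 2 - 1)) * qnum hb (h + P / 2)))
      + qnum hb z * rCoeff hb P h m = qnum hb (z + 2 * h + P) * dCoeff hb P m := by
  have := qnum_raise hq z (h + P / 2) (m - P / 2)
  obtain ⟨m, rfl⟩ : ∃ t, m = t + 1 := ⟨m - 1, by omega⟩
  rw [show h + (P : ℂ) / 2 - ((m + 1 : ℕ) - P / 2) = h + (P - (m + 1 : ℕ)) by push_cast; ring,
    show h + (P : ℂ) / 2 + ((m + 1 : ℕ) - P / 2) - 1 = h + ((m + 1 : ℕ) - 1) by push_cast; ring,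
    show h + (P : ℂ) / 2 - 1 = h + (P / 2 - 1) by ring,
    show z + 2 * (h + (P : ℂ) / 2) = z + 2 * h + P by ring,
    show 1 - (((m + 1 : ℕ) : ℂ) - P / 2) = P / 2 - (m + 1 : ℕ) + 1 by push_cast; ring] at this
  simp only [lCoeff, rCoeff, dCoeff, hc, Nat.add_sub_cancel, pow_succ]
  linear_combination (-1) ^ m * this

end Coefficients

/-! ### The raising operators on f_{2ε_{l+1}} v -/

section HighestWeightActions

set_option linter.unusedSectionVars false

variable {hb : ℂ} {l P : ℕ} {X : Type*} [AddCommGroup X] [Module ℂ X]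
  [Module (Uq hb (2 * l + 2 + P)) X] [IsScalarTower ℂ (Uq hb (2 * l + 2 + P)) X]

local notation "fN" => fGen hb (2 * l + 2 + P)
local notation "eN" => eGen hb (2 * l + 2 + P)
local notation "aN" => aW (hb := hb) (N := 2 * l + 2 + P) l
local notation "sN" => aSum hb (2 * l + 2 + P) l

theorem fDouble_smul (v : X) : fDouble hb l P • v =
    sN ((P + 1) / 2) (dCoeff hb P) (fun m => bW hb l P m v) := by
  rw [fDouble, Finset.sum_smul]
  refine Finset.sum_congr rfl fun m hm => ?_
  rw [smul_assoc, phi_smul m (fun he => ?_)]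
  · rfl
  · rw [Finset.mem_Icc] at hm
    obtain ⟨r, rfl⟩ := he
    omega

/-- The Cartan factors stand at the far right of every term, so all of them are evaluated at the
weight of v itself. -/
theorem fNext_smul {ν : ℕ → ℂ} {v : X} (h : IsWt hb (2 * l + 2 + P) ν v) (hl : 1 ≤ l) :
    fNext hb l P • v =
      fN l • sN ((P + 1) / 2) (lCoeff hb P (ν (l + 1))) (fun m => bW hb l P m v)
      + ∑ m ∈ Finset.Icc 1 (P / 2 + 1), mCoeff hb P (ν (l + 1)) m • phiMid hb l P m • v
      + sN ((P + 1) / 2) (rCoeff hb P (ν (l + 1))) (fun m => bW hb l P m (fN l • v)) := by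
  have hh := fun c => h.hnum_eps (i := l + 1) (by omega) (by omega) c
  have hm' : ∀ m ∈ Finset.Icc 1 ((P + 1) / 2), Even P → m ≤ P / 2 := fun m hm ⟨r, hr⟩ => by
    rw [Finset.mem_Icc] at hm; omega
  simp only [fNext, add_smul, Finset.sum_smul, aSum, Finset.smul_sum]
  congr 1
  · congr 1
    · refine Finset.sum_congr rfl fun m hm => ?_
      rw [smul_assoc, mul_smul, mul_smul, mul_smul, hh, smul_smul_comm, hh, smul_smul_comm,
        smul_smul_comm, smul_smul_comm, smul_smul_comm, phi_smul m (hm' m hm), smul_smul_comm,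
        smul_smul, smul_smul, lCoeff]
      congr 1; ring
    · refine Finset.sum_congr rfl fun m hm => ?_
      rw [smul_assoc, mul_smul, mul_smul, hh, smul_smul_comm, hh, smul_smul_comm,
        smul_smul_comm, smul_smul, smul_smul, mCoeff]
      congr 1; ring
  · refine Finset.sum_congr rfl fun m hm => ?_
    have hf := (h.f l)
    rw [smul_assoc, mul_smul, mul_smul, mul_smul, hh, smul_smul_comm, hh, smul_smul_comm,
      smul_smul_comm, smul_smul_comm, smul_smul_comm, phi_smul m (hm' m hm),
      smul_smul, smul_smul, rCoeff]
    congr 1; ring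

theorem phiMid_extra_smul (he : Even P) (v : X) : phiMid hb l P (P / 2 + 1) • v =
    fN (l + 1 + P / 2) • aN (P / 2 - 1) (fN l • aN (P / 2) v) := by
  rw [phiMid, rightWord_extra_even l he, leftWord, if_pos ⟨he, rfl⟩, List.cons_append, fWord_cons,
    mul_smul, fWord_append, mul_smul, fWord_cons, mul_smul, show l + P / 2 + 1 = l + 1 + P / 2 by omega]
  rfl

theorem midSum_odd (ho : ¬Even P) (c : ℕ → ℂ) (v : X) :
    ∑ m ∈ Finset.Icc 1 (P / 2 + 1), c m • phiMid hb l P m • v =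
      sN (P / 2 + 1) c (fun m => fN l • bW hb l P m v) :=
  Finset.sum_congr rfl fun m _ => by rw [phiMid_smul m (fun he => absurd he ho)]

theorem midSum_even (c : ℕ → ℂ) (v : X) :
    ∑ m ∈ Finset.Icc 1 (P / 2 + 1), c m • phiMid hb l P m • v =
      sN (P / 2) c (fun m => fN l • bW hb l P m v)
      + c (P / 2 + 1) • phiMid hb l P (P / 2 + 1) • v := by
  rw [Finset.sum_Icc_succ_top (by omega)]
  congr 1
  refine Finset.sum_congr rfl fun m hm => ?_
  rw [phiMid_smul m (fun _ => (Finset.mem_Icc.mp hm).2)]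

namespace HW

variable (hq : NotRoot hb) {ν : ℕ → ℂ} {v : X} (h : HW hb l P ν v)
include hq h

theorem e_last_bW_odd (hP : 3 ≤ P) (ho : ¬Even P) {m : ℕ} (h1 : 1 ≤ m) (h2 : m ≤ P / 2 + 1) :
    eN ((2 * l + 2 + P) / 2) • bW hb l P m v =
      if m + 1 = P / 2 + 1 then bW hb l P (P / 2 + 1) v else
        if m = P / 2 + 1 then aN (P / 2) v else 0 := by
  have hc := h.oddChain hP ho
  obtain h5 | rfl : m ≤ P / 2 ∨ m = P / 2 + 1 := by omega
  · have := hc.eD hq (by omega) (i := l + 1 + m) (j := (2 * l + 2 + P) / 2) (by omega) (by omega)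
      (by omega) le_rfl
    rw [show l + 1 + m - l - 1 = m by omega, show l + 1 + m + 1 - l - 1 = m + 1 by omega] at this
    rw [this]
    by_cases c : m = P / 2
    · rw [if_pos (by omega), if_pos (by omega), c]
    · rw [if_neg (by omega), if_neg (by omega), if_neg (by omega)]
  · have := hc.eMid hq (by omega) (j := (2 * l + 2 + P) / 2) (by omega) le_rfl
    rw [show (2 * l + 2 + P) / 2 + 1 - l - 1 = P / 2 + 1 by omega, if_pos rfl,
      show (2 * l + 2 + P) / 2 - l - 1 = P / 2 by omega] at this
    rw [this, if_neg (by omega), if_pos rfl]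

theorem e_last_bW_even (hP : 3 ≤ P) (he : Even P) {m : ℕ} (h1 : 1 ≤ m) (h2 : m ≤ P / 2) :
    eN ((2 * l + 2 + P) / 2) • bW hb l P m v =
      if m + 1 = P / 2 then aN (P / 2) v else
        if m = P / 2 then aN (P / 2 - 1) v else 0 := by
  have hc := h.evenChain hP he
  obtain h5 | rfl : m < P / 2 ∨ m = P / 2 := by omega
  · have := hc.eD hq (by omega) (i := l + 1 + m) (j := (2 * l + 2 + P) / 2) (by omega) (by omega)
      (by omega) le_rfl
    rw [show l + 1 + m - l - 1 = m by omega, show l + 1 + m + 1 - l - 1 = m + 1 by omega,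
      if_neg (by omega), show (2 * l + 2 + P) / 2 - l - 1 = P / 2 by omega] at this
    rw [this]
    by_cases c : m + 1 = P / 2
    · rw [if_pos (by omega), if_pos (by omega)]
    · rw [if_neg (by omega), if_neg (by omega), if_neg (by omega)]
  · have := hc.eD_last hq (by omega) (j := (2 * l + 2 + P) / 2) (by omega) le_rfl
    rw [show (2 * l + 2 + P) / 2 - l - 1 = P / 2 by omega, if_pos rfl,
      show (2 * l + 2 + P) / 2 - 1 - l - 1 = P / 2 - 1 by omega] at this
    rw [this, if_neg (by omega), if_pos rfl]

theorem e_aW_up (hP : 3 ≤ P) {j m : ℕ} (h1 : l + 2 ≤ j) (h2 : j ≤ (2 * l + 2 + P) / 2)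
    (h3 : 1 ≤ m) (h4 : l + 1 + m ≤ (2 * l + 2 + P) / 2) :
    eN j • aN m v = if j = l + m then aN (m - 1) v else 0 := by
  have key : eN j • aN (l + 1 + m - l - 1) v =
      if j + 1 = l + 1 + m then aN (j - l - 1) v else 0 := by
    by_cases he : Even P
    · exact (h.evenChain hP he).eU hq (by omega) (by omega) h4 (by omega) h2
    · exact (h.oddChain hP he).eU hq (by omega) (by omega) h4 (by omega) h2
  rw [show l + 1 + m - l - 1 = m by omega] at key
  rw [key]
  by_cases c : j = l + m
  · rw [if_pos c, if_pos (by omega), show j - l - 1 = m - 1 by omega]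
  · rw [if_neg c, if_neg (by omega)]

/-- The action of `e_j`, `j ≥ l + 1`, on `f_{2ε_{l+1}} v`. -/
theorem e_fDouble (hP : 3 ≤ P) {j : ℕ} (h1 : l + 1 ≤ j) (h2 : j ≤ (2 * l + 2 + P) / 2) :
    eN j • fDouble hb l P • v =
      (if j = l + 1 then qnum hb (ν (l + 1) + P / 2 - 1) else 0) • phiDel hb l P 1 • v := by
  rw [fDouble_smul, phiDel_one_smul (by omega)]
  have hone : ∀ M, 2 ≤ M → Family hb (2 * l + 2 + P) l M (ν - Pi.single (l + 1) 1)
      (fun m => bW hb l P m v) → eN (l + 1) • sN M (dCoeff hb P) (fun m => bW hb l P m v) =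
        qnum hb (ν (l + 1) + P / 2 - 1) • bW hb l P 1 v := fun M hM hF => by
    rw [hF.e_one_aSum (by omega) _ hM, ← dCoeff_first P (ν (l + 1)) hq]
    simp
  obtain ⟨s, rfl⟩ : ∃ s, j = l + s := ⟨j - l, by omega⟩
  by_cases he : Even P
  · obtain ⟨p, hp⟩ : ∃ p, P = 2 * (p + 2) := by
      obtain ⟨r, hr⟩ := id he; exact ⟨r - 2, by omega⟩
    have hp2 : P / 2 = p + 2 := by omega
    have hF := h.family_even hq hP he
    rw [hp2] at hF
    rw [show (P + 1) / 2 = p + 2 by omega]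
    obtain rfl | h3 := eq_or_ne s 1
    · rw [if_pos rfl, hone _ (by omega) hF]
    rw [if_neg (by omega), zero_smul]
    obtain h4 | rfl | h4 : s ≤ p + 1 ∨ s = p + 2 ∨ l + s = (2 * l + 2 + P) / 2 := by omega
    · obtain ⟨t, rfl⟩ : ∃ t, s = t + 1 := ⟨s - 1, by omega⟩
      rw [hF.e_aSum hq (by omega) _ (by omega) (by omega) (by omega), Nat.add_sub_cancel,
        dCoeff_rec hb P (by omega), zero_smul]
    · rw [hF.e_aSum_top hq (by omega) _ (by omega) (by omega), show p + 2 - 1 = p + 1 by omega,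
        dCoeff_even hb hp, zero_smul]
    · have hf := fun j hj hj' => h.f (by omega) j hj hj'
      have hz := fun m hm hm' => h.e_last_bW_even hq hP he (m := m) hm hm'
      rw [hp2] at hz
      rw [h4, Family.e_last_even _ (by omega) (by omega) hz, show p + 2 - 1 = p + 1 by omega]
      -- The operator e_n leaves a_{p+1} a_{p+2} v and a_{p+2} a_{p+1} v. Doubling makes the second
      -- [2]_q times the first, and the boundary recurrence applies.
      have := f_aW_aW hq (by omega) hf (r := p) (t := l + 1 + (p + 1)) (by omega) (by omega)
        (Or.inl ⟨by omega, by omega⟩)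
      rw [← aW_succ, ← aW_succ] at this
      rw [this, smul_smul, ← add_smul, mul_comm, dCoeff_even hb hp, zero_smul]
  · obtain ⟨p, hp⟩ : ∃ p, P = 2 * (p + 1) + 1 := by
      obtain ⟨r, hr⟩ := Nat.not_even_iff_odd.mp he; exact ⟨r - 1, by omega⟩
    have hp2 : P / 2 = p + 1 := by omega
    have hF := h.family_odd hq hP he
    rw [hp2] at hF
    rw [show (P + 1) / 2 = p + 2 by omega]
    obtain rfl | h3 := eq_or_ne s 1
    · rw [if_pos rfl, hone _ (by omega) hF]
    rw [if_neg (by omega), zero_smul]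
    obtain h4 | h4 : s ≤ p + 1 ∨ l + s = (2 * l + 2 + P) / 2 := by omega
    · obtain ⟨t, rfl⟩ : ∃ t, s = t + 1 := ⟨s - 1, by omega⟩
      rw [hF.e_aSum hq (by omega) _ (by omega) (by omega) (by omega), Nat.add_sub_cancel,
        dCoeff_rec hb P (by omega), zero_smul]
    · have hf := fun j hj hj' => h.f (by omega) j hj hj'
      have hz := fun m hm hm' => h.e_last_bW_odd hq hP he (m := m) hm hm'
      rw [hp2] at hz
      rw [h4, hF.e_last_odd hq (by omega) _ (by omega) (by rwa [even_iff]) (by omega) hz,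
        show p + 2 - 1 = p + 1 by omega,
        f_aW_aW hq (by omega) hf (r := p) (by omega) le_rfl (Or.inl ⟨by omega, fun h' => he
          ((even_iff l P).mp h'.1)⟩)]
      have : fN ((2 * l + 2 + P) / 2) • aN (p + 1) v = bW hb l P (p + 2) v := by
        have := (h.oddChain hP he).mid
        rw [show (2 * l + 2 + P) / 2 + 1 - l - 1 = p + 2 by omega,
          show (2 * l + 2 + P) / 2 - l - 1 = p + 1 by omega] at this
        exact this.symm
      rw [this, smul_smul, ← add_smul]
      rw [show dCoeff hb P (p + 1) + dCoeff hb P (p + 2) + dCoeff hb P (p + 2) *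
        (qpow hb 1 + qpow hb (-1)) = 0 by linear_combination dCoeff_odd hb hp, zero_smul]

/-- The action of `e_{l+s}`, `l + s ≤ n - 2`, on the extra monomial for even `P`. -/
theorem e_phiMid_extra (hP : 3 ≤ P) (he : Even P) (hl : 1 ≤ l) {s : ℕ} (h1 : 1 ≤ s)
    (h2 : s + 1 ≤ P / 2) :
    eN (l + s) • phiMid hb l P (P / 2 + 1) • v =
      (if s + 1 = P / 2 then qnum hb (if s = 1 then ν (l + 1) else 1) else 0) •
        aN (s - 1) (fN l • bW hb l P (P / 2 - 1) v) := by
  obtain ⟨p, hp⟩ : ∃ p, P / 2 = p + 2 := by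
    obtain ⟨r, hr⟩ := id he; exact ⟨r - 2, by omega⟩
  have hPp : P = 2 * (p + 2) := by obtain ⟨r, hr⟩ := id he; omega
  have hf := fun j hj hj' => h.f (by omega) j hj hj'
  obtain ⟨s, rfl⟩ : ∃ t, s = t + 1 := ⟨s - 1, by omega⟩
  have hx : eN (l + 1 + s) • fN l • aN (p + 2) v = 0 := by
    rw [e_f_smul_ne (by omega)]
    obtain rfl | h3 := Nat.eq_zero_or_pos s
    · have := h.e_f_aW hP (m := p + 1) (j := l + 1 + (p + 1)) (by omega) (by omega) (by omega)
        (by omega)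
      rw [← aW_succ] at this
      rw [add_zero, this, smul_zero]
    · rw [h.e_aW_up hq hP (by omega) (by omega) (by omega) (by omega), if_neg (by omega),
        smul_zero]
  have hw := (h.wt.aW l (p + 2) (Or.inl (by omega))).f l
  rw [phiMid_extra_smul he, hp, show l + (s + 1) = l + 1 + s by omega,
    e_f_smul_ne (by omega), show p + 2 - 1 = p + 1 by omega, Nat.add_sub_cancel]
  by_cases c : s = p
  · subst c
    rw [e_aW_top hw (by omega) l s (by omega), hx, aW_apply_zero, zero_add, if_pos rfl,
      smul_smul_comm, aW_f_comm (by omega) (by omega) (by omega) (fun _ _ => by omega),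
      ← f_comm_smul (by omega) hl (by omega) (by omega) (by rintro (h' | h') <;> omega)]
    congr 2
    · have e1 := h.zero (l + 1 + s) 
      have e2 := h.zero (l + 1 + s + 1) (by omega) (by omega)
      simp only [dval, if_pos (show l + 1 + s < (2 * l + 2 + P) / 2 by omega), Pi.sub_apply,
        Pi.add_apply, Pi.single_apply, e2, rt, if_pos (show l < (2 * l + 2 + P) / 2 by omega)]
      obtain rfl | h3 := Nat.eq_zero_or_pos s
      · simp; omega
      · rw [e1 (by omega) (by omega)]
        split_ifs <;> first | omega | norm_num
    · congr 1
      -- By the fork, f_n a_{P/2} v is b_{P/2-1} v, which brings the extra monomial to the same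
      -- vector as the regular middle terms.
      have h7 := (h.evenChain hP he).f_last (by omega)
      rw [show (2 * l + 2 + P) / 2 - l - 1 = s + 2 by omega,
        show (2 * l + 2 + P) / 2 - 1 - l - 1 = s + 1 by omega] at h7
      rw [← h7]
      congr 2; omega
  · rw [if_neg (by omega), zero_smul]
    have hx0 : fN (l + 2 + s) • fN l • aN (p + 2) v = 0 := by
      rw [← f_comm_smul (by omega) hl (by omega) (by omega) (by rintro (h' | h') <;> omega)]
      have := (h.evenChain hP he).fU hq (by omega) (i := l + 1 + (p + 2)) (j := l + 2 + s)
        (by omega) (by omega) (by omega) (by omega) (by omega)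
      rw [show l + 1 + (p + 2) - l - 1 = p + 2 by omega] at this
      rw [this (by omega), smul_zero]
    rw [e_aW_far (by omega) l s (p + 1) hw (by omega) (by omega) (fun _ => by omega) hx0, hx,
      aW_apply_zero, smul_zero]

end HW
end HighestWeightActions

/-! ### The operators e_j, j > l, on f_{ε_l+ε_{l+1}} v -/

section HighestWeightNext

set_option linter.unusedSectionVars false

variable {hb : ℂ} {l P : ℕ} {X : Type*} [AddCommGroup X] [Module ℂ X]
  [Module (Uq hb (2 * l + 2 + P)) X] [IsScalarTower ℂ (Uq hb (2 * l + 2 + P)) X]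

local notation "fN" => fGen hb (2 * l + 2 + P)
local notation "eN" => eGen hb (2 * l + 2 + P)
local notation "aN" => aW (hb := hb) (N := 2 * l + 2 + P) l
local notation "sN" => aSum hb (2 * l + 2 + P) l

theorem phi_extra_smul (he : Even P) (v : X) : phi hb l P (P / 2 + 1) • v =
    fN (l + 1 + P / 2) • aN (P / 2 - 1) (aN (P / 2) v) := by
  rw [phi, rightWord_extra_even l he, leftWord, if_pos ⟨he, rfl⟩, List.cons_append, fWord_cons,
    mul_smul, fWord_append, mul_smul, show l + P / 2 + 1 = l + 1 + P / 2 by omega]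
  rfl

namespace HW

variable (hq : NotRoot hb) {ν : ℕ → ℂ} {v : X} (h : HW hb l P ν v)
include hq h

/-- For even `P` the monomials `φ_p` and `φ_{p+1}` have the same action. -/
theorem phi_extra (hP : 2 ≤ P) (he : Even P) :
    phi hb l P (P / 2 + 1) • v = phi hb l P (P / 2) • v := by
  obtain ⟨r, hr⟩ := id he
  rw [phi_extra_smul he, phi_smul _ (fun _ => le_rfl), bW, rightWord_last_even l he, fWord_cons,
    mul_smul, ← aW]
  obtain ⟨p, hp⟩ : ∃ p, P / 2 = p + 1 := ⟨r - 1, by omega⟩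
  rw [hp, show p + 1 - 1 = p by omega, aW_succ l p v, aW_succ l p (fN _ • _)]
  have hcomm := f_comm_smul (hb := hb) (X := X) (N := 2 * l + 2 + P) (i := l + 1 + p)
    (j := l + 1 + (p + 1)) (by omega) (by omega) (by omega) (by omega) (by
      rintro (h' | h') <;> [exact h'.2 ⟨(even_iff l P).mpr he, by omega⟩; omega])
  obtain rfl | hp0 := Nat.eq_zero_or_pos p
  · simp only [aW_zero]
    exact (hcomm v).symm
  · obtain ⟨p, rfl⟩ : ∃ t, p = t + 1 := ⟨p - 1, by omega⟩
    have hf := fun j hj hj' => h.f (by omega) j hj hj'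
    -- After multiplication by [2]_q the doubling rule turns both sides into f_{n-1} f_n applied to
    -- the square of the common shorter word, and these two generators commute.
    apply smul_right_injective X (qpow_one_add_ne hq)
    simp only
    rw [← smul_smul_comm, ← f_aW_aW hq (by omega) hf (by omega) (by omega)
      (Or.inl ⟨by omega, by omega⟩), ← hcomm, ← smul_smul_comm (qpow hb 1 + _),
      ← f_aW_aW hq (by omega) hf (by omega) (by omega)
      (Or.inr ⟨(even_iff l P).mpr he, by omega, by omega⟩)]

theorem wt_bW (hP : 1 ≤ P) {m : ℕ} (h1 : 1 ≤ m) (h2 : m ≤ (P + 1) / 2) :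
    IsWt hb (2 * l + 2 + P) (ν - Pi.single (l + 1) 1 - Pi.single (l + 1 + m) 1)
      (bW hb l P m v) := by
  obtain rfl | rfl | hP' : P = 1 ∨ P = 2 ∨ 3 ≤ P := by omega
  · obtain rfl : m = 1 := by omega
    rw [bW, rightWord_top_odd (P := 1) l (by decide), show 1 / 2 + 1 = 1 from rfl, ← aW, aW_succ,
      aW_zero, add_zero]
    refine (h.wt.f (l + 1)).congr fun i _ _ => ?_
    simp [rt, show (2 * l + 2 + 1) / 2 = l + 1 by omega, even_iff, show i ≠ l + 1 + 1 by omega]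
  · obtain rfl : m = 1 := by omega
    rw [bW, rightWord_last_even (P := 2) l (by decide), show 2 / 2 - 1 = 0 from rfl, fWord_cons,
      down_zero, fWord_nil, mul_one]
    refine (h.wt.f _).congr fun i _ _ => ?_
    simp [rt, show (2 * l + 2 + 2) / 2 = l + 2 by omega, even_iff, sub_sub]
  · by_cases he : Even P
    · obtain ⟨r, hr⟩ := id he
      exact (h.family_even hq hP' he).wt m h1 (by omega)
    · exact (h.family_odd hq hP' he).wt m h1 (by omega)

/-- The action of `e_j`, `j ≥ l + 1`, on `f_{ε_l+ε_{l+1}} v`. -/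
theorem e_fNext (hP : 3 ≤ P) (hl : 1 ≤ l) {j : ℕ} (h1 : l + 1 ≤ j)
    (h2 : j ≤ (2 * l + 2 + P) / 2) : eN j • fNext hb l P • v = 0 := by
  rw [fNext_smul h.wt hl]
  have h' := h.f_left hl
  have hf := fun j hj hj' => h.f (by omega) j hj hj'
  have hf' := fun j hj hj' => h'.f (by omega) j hj hj'
  set g := ν (l + 1) with hg
  obtain ⟨s, rfl⟩ : ∃ s, j = l + s := ⟨j - l, by omega⟩
  by_cases he : Even P
  · obtain ⟨p, hp⟩ : ∃ p, P = 2 * (p + 2) := by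
      obtain ⟨r, hr⟩ := id he; exact ⟨r - 2, by omega⟩
    have hp2 : P / 2 = p + 2 := by omega
    have hNe := (even_iff l P).mpr he
    have hF := h.family_even hq hP he
    have hF' := h'.family_even hq hP he
    have hM := hF.f_smul_left (by omega) hl (fun _ => by omega) (by omega)
    rw [hp2] at hF hF' hM
    have hT := fun h1 h2 => h.e_phiMid_extra hq hP he hl (s := s) h1 h2
    have htop := mCoeff_top_even hb P g he
    have hTe := phiMid_extra_smul (hb := hb) (l := l) he v
    rw [midSum_even, show (P + 1) / 2 = p + 2 by omega, smul_add, smul_add, smul_add,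
      smul_smul_comm (mCoeff hb P g _)]
    rw [hp2] at hT htop hTe ⊢
    rw [e_f_smul_ne (by omega)]
    -- Here P/2 = p + 2. The three cases are a node before the fork, the node n - 1 and the node n.
    obtain h3 | rfl | h4 : s ≤ p + 1 ∨ s = p + 2 ∨ l + s = (2 * l + 2 + P) / 2 := by omega
    · rw [hT (by omega) (by omega), smul_smul (mCoeff hb P g _),
        show p + 2 - 1 = p + 1 from rfl]
      obtain rfl | h4 := eq_or_ne s 1
      · rw [hF.e_one_aSum (by omega) _ (by omega), hF'.e_one_aSum (by omega) _ (by omega),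
          hM.e_one_aSum (by omega) _ (by omega)]
        have e1 : (ν - rt (2 * l + 2 + P) l - Pi.single (l + 1) 1 : ℕ → ℂ) (l + 1) = g := by
          simp [rt, show l < (2 * l + 2 + P) / 2 by omega, hg]
        have e2 : (ν - Pi.single (l + 1) 1 - rt (2 * l + 2 + P) l : ℕ → ℂ) (l + 1) = g := by
          simp [rt, show l < (2 * l + 2 + P) / 2 by omega, hg]
        have e3 : (ν - Pi.single (l + 1) 1 : ℕ → ℂ) (l + 1) = g - 1 := by simp [hg]
        rw [e1, e2, e3, rCoeff_first, zero_smul, add_zero, sub_add_cancel, smul_smul_comm,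
          show 1 - 1 = 0 from rfl, aW_zero]
        by_cases hp0 : p = 0
        · subst hp0
          rw [if_pos rfl, if_pos rfl, ← add_smul, ← add_smul]
          -- For P = 4 the extra monomial already reaches e_{l+1} and contributes as much as the
          -- regular one with m = 2, hence the factor 2.
          have := midSum_first P g hq (midCoeff hb P 1) (2 * midCoeff hb P 2)
            (by simp [midCoeff, hp2]) (by
              rw [midCoeff, if_pos ⟨he, by omega⟩, hp2, hp]
              push_cast
              rw [show (2 : ℂ) - 4 / 2 = 0 by norm_num, neg_zero, qpow_zero]; norm_num)
          convert zero_smul ℂ _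
          rw [show mCoeff hb P g (0 + 2 + 1) = mCoeff hb P g 2 from htop.symm]
          simp only [mCoeff]
          linear_combination this
        · rw [if_neg (by omega), mul_zero, zero_smul, add_zero, ← add_smul]
          have := midSum_first P g hq (midCoeff hb P 1) (midCoeff hb P 2)
            (by simp [midCoeff, hp2])
            (by
              rw [midCoeff]
              by_cases hp1 : p = 0
              · exact absurd hp1 hp0
              rw [if_neg (by omega)]; push_cast; ring)
          convert zero_smul ℂ _
          simp only [mCoeff]
          linear_combination this
      · obtain ⟨t, rfl⟩ : ∃ t, s = t + 1 := ⟨s - 1, by omega⟩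
        rw [hF.e_aSum hq (by omega) _ (by omega) (by omega) (by omega),
          hF'.e_aSum hq (by omega) _ (by omega) (by omega) (by omega),
          hM.e_aSum hq (by omega) _ (by omega) (by omega) (by omega), Nat.add_sub_cancel,
          lCoeff_rec, rCoeff_rec, zero_smul, zero_smul, smul_zero, zero_add, add_zero]
        by_cases ht : t = p
        · subst ht
          rw [if_pos rfl, if_neg h4, qnum_one hq, mul_one, ← add_smul,
            mCoeff_rec_even hb P g he (by omega), zero_smul]
        · rw [if_neg (by omega), mul_zero, zero_smul, add_zero,
            mCoeff_rec hb P g (fun _ => by omega), zero_smul]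
    -- At n - 1 the regular middle terms cancel among themselves. The extra monomial splits by
    -- `aW_f_aW` into a part with f_l on the left and one with f_l next to v; these compensate the
    -- boundary defects of `lCoeff` and `rCoeff`.
    · rw [hF.e_aSum_top hq (by omega) _ (by omega) (by omega),
        hF'.e_aSum_top hq (by omega) _ (by omega) (by omega),
        hM.e_aSum_top hq (by omega) _ (by omega) (by omega), hTe, show p + 2 - 1 = p + 1 from rfl,
        mCoeff_even hb g hp, zero_smul, zero_add, e_f_smul_ne (by omega),
        aW_e_comm (by omega), e_f_smul_ne (by omega),
        h.e_aW_up hq hP (by omega) (by omega) (by omega) (by omega), if_pos rfl,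
        show p + 2 - 1 = p + 1 from rfl,
        (aW_f_aW hq (by omega) hf hl (fun _ => by omega) (r := p) (by omega)).2
          (l + 1 + (p + 2)) (by omega) (Or.inr ⟨hNe, by omega, by omega⟩)]
      have hb1 : ∀ w : X, fN (l + 1 + (p + 2)) • aN (p + 1) w = bW hb l P (p + 2) w := fun w => by
        rw [bW, ← hp2, rightWord_last_even l he, fWord_cons, mul_smul, hp2]; rfl
      rw [hb1, hb1, smul_smul_comm, ← htop, smul_add, ← add_assoc, ← add_smul, add_assoc, ← add_smul]
      rw [lCoeff_even hb g hp, add_comm (mCoeff hb P g (p + 2)), rCoeff_even hb g hp, zero_smul,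
        zero_smul, add_zero]
    · have hz := fun m hm hm' => h.e_last_bW_even hq hP he (m := m) hm hm'
      have hz' := fun m hm hm' => h'.e_last_bW_even hq hP he (m := m) hm hm'
      rw [hp2] at hz hz'
      have hzM : ∀ m, 1 ≤ m → m ≤ p + 2 → eN ((2 * l + 2 + P) / 2) • fN l • bW hb l P m v =
          if m + 1 = p + 2 then fN l • aN (p + 2) v else
            if m = p + 2 then fN l • aN (p + 1) v else 0 := fun m hm hm' => by
        rw [e_f_smul_ne (by omega), hz m hm hm']
        split_ifs <;> simp
      rw [h4, Family.e_last_even _ (by omega) (by omega) hz,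
        Family.e_last_even _ (by omega) (by omega) hz',
        Family.e_last_even _ (by omega) (by omega) hzM, show p + 2 - 1 = p + 1 from rfl, hTe,
        show p + 2 - 1 = p + 1 from rfl, show l + 1 + (p + 2) = (2 * l + 2 + P) / 2 by omega,
        e_f_smul (((h.wt.aW l (p + 2) (Or.inl (by omega))).f l).aW l (p + 1) (Or.inl (by omega)))
          (by omega) (by omega) le_rfl, aW_e_comm (by omega), e_f_smul_ne (by omega),
        h.e_aW_up hq hP (by omega) (by omega) (by omega) (by omega), if_neg (by omega),
        smul_zero, aW_apply_zero, smul_zero, zero_add]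
      have hd : dval (2 * l + 2 + P) (ν - Pi.single (l + 1) 1 + Pi.single (l + 1 + (p + 2)) 1
          - rt (2 * l + 2 + P) l - Pi.single (l + 1) 1 + Pi.single (l + 1 + (p + 1)) 1)
          ((2 * l + 2 + P) / 2) = 2 := by
        have e1 := h.zero ((2 * l + 2 + P) / 2) (by omega) le_rfl
        have e2 := h.zero ((2 * l + 2 + P) / 2 - 1) (by omega) (by omega)
        simp only [dval, lt_irrefl, if_false, if_pos hNe, Pi.sub_apply, Pi.add_apply,
          Pi.single_apply, e1, e2, rt, if_pos (show l < (2 * l + 2 + P) / 2 by omega)]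
        split_ifs <;> first | omega | norm_num
      -- Doubling and its version with f_l inside reduce all terms to three vectors, with f_l at the
      -- left, in the middle and at the right. Each coefficient vanishes by one of the boundary
      -- recurrences.
      have k1 := f_aW_aW hq (by omega) hf (r := p) (t := l + 1 + (p + 1)) (by omega) (by omega)
        (Or.inl ⟨by omega, by omega⟩)
      have k2 := f_aW_aW hq (by omega) hf' (r := p) (t := l + 1 + (p + 1)) (by omega) (by omega)
        (Or.inl ⟨by omega, by omega⟩)
      have k3 := (aW_f_aW hq (by omega) hf hl (fun _ => by omega) (r := p) (by omega)).2
          (l + 1 + (p + 1)) (by omega) (Or.inl ⟨by omega, by omega⟩)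
      simp only [← aW_succ] at k1 k2 k3
      have c1 := lCoeff_even hb g hp
      have c2 := rCoeff_even hb g hp
      have c3 := mCoeff_even hb g hp
      rw [hd, qnum_two hq, k1, k2, k3, ← htop]
      simp only [show p + 1 + 1 = p + 2 from rfl]
      simp only [smul_add, smul_smul_comm]
      generalize fN l • aN (p + 1) (aN (p + 2) v) = x1
      linear_combination (norm := module) c1 • x1
        + c2 • aN (p + 1) (aN (p + 2) (fN l • v)) + c3 • aN (p + 1) (fN l • aN (p + 2) v)
  · obtain ⟨p, hp⟩ : ∃ p, P = 2 * (p + 1) + 1 := by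
      obtain ⟨r, hr⟩ := Nat.not_even_iff_odd.mp he; exact ⟨r - 1, by omega⟩
    have hp2 : P / 2 = p + 1 := by omega
    have hNe : ¬Even (2 * l + 2 + P) := by rwa [even_iff]
    have hF := h.family_odd hq hP he
    have hF' := h'.family_odd hq hP he
    have hM := hF.f_smul_left (by omega) hl (fun he' => absurd he' hNe) (by omega)
    rw [midSum_odd he, show (P + 1) / 2 = p + 2 by omega, smul_add, smul_add,
      e_f_smul_ne (by omega)]
    rw [hp2] at hF hF' hM ⊢
    obtain h3 | h4 : s ≤ p + 1 ∨ l + s = (2 * l + 2 + P) / 2 := by omega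
    · obtain rfl | h4 := eq_or_ne s 1
      · rw [hF.e_one_aSum (by omega) _ (by omega), hF'.e_one_aSum (by omega) _ (by omega),
          hM.e_one_aSum (by omega) _ (by omega)]
        have e1 : (ν - rt (2 * l + 2 + P) l - Pi.single (l + 1) 1 : ℕ → ℂ) (l + 1) = g := by
          simp [rt, show l < (2 * l + 2 + P) / 2 by omega, hg]
        have e2 : (ν - Pi.single (l + 1) 1 - rt (2 * l + 2 + P) l : ℕ → ℂ) (l + 1) = g := by
          simp [rt, show l < (2 * l + 2 + P) / 2 by omega, hg]
        have e3 : (ν - Pi.single (l + 1) 1 : ℕ → ℂ) (l + 1) = g - 1 := by simp [hg]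
        rw [e1, e2, e3, rCoeff_first, zero_smul, add_zero, sub_add_cancel, smul_smul_comm,
          ← add_smul]
        have := midSum_first P g hq (midCoeff hb P 1) (midCoeff hb P 2)
          (by simp [midCoeff, he]) (by simp [midCoeff, he])
        convert zero_smul ℂ _
        simp only [mCoeff]
        linear_combination this
      · obtain ⟨t, rfl⟩ : ∃ t, s = t + 1 := ⟨s - 1, by omega⟩
        rw [hF.e_aSum hq (by omega) _ (by omega) (by omega) (by omega),
          hF'.e_aSum hq (by omega) _ (by omega) (by omega) (by omega),
          hM.e_aSum hq (by omega) _ (by omega) (by omega) (by omega), Nat.add_sub_cancel,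
          lCoeff_rec, rCoeff_rec, mCoeff_rec hb P g (fun he' => absurd he' he), zero_smul,
          zero_smul, zero_smul, smul_zero, zero_add, add_zero]
    · have hz := fun m hm hm' => h.e_last_bW_odd hq hP he (m := m) hm hm'
      have hz' := fun m hm hm' => h'.e_last_bW_odd hq hP he (m := m) hm hm'
      rw [hp2] at hz hz'
      have hzM : ∀ m, 1 ≤ m → m ≤ p + 2 → eN ((2 * l + 2 + P) / 2) • fN l • bW hb l P m v =
          if m + 1 = p + 2 then fN l • bW hb l P (p + 2) v else
            if m = p + 2 then fN l • aN (p + 1) v else 0 := fun m hm hm' => by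
        rw [e_f_smul_ne (by omega), hz m hm hm']
        split_ifs <;> simp
      rw [h4, hF.e_last_odd hq (by omega) _ (by omega) hNe (by omega) hz,
        hF'.e_last_odd hq (by omega) _ (by omega) hNe (by omega) hz',
        hM.e_last_odd hq (by omega) _ (by omega) hNe (by omega) hzM,
        show p + 1 + 1 - 1 = p + 1 from rfl]
      have hadj : AdjLt (2 * l + 2 + P) (l + p + 1) ((2 * l + 2 + P) / 2) :=
        Or.inl ⟨by omega, fun h' => hNe h'.1⟩
      -- The same reduction to three vectors, now with the last node as the letter t.
      have k1 := f_aW_aW hq (by omega) hf (r := p) (by omega) le_rfl hadj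
      have k2 := f_aW_aW hq (by omega) hf' (r := p) (by omega) le_rfl hadj
      have k3 := (aW_f_aW hq (by omega) hf hl (fun h' => absurd h' hNe) (r := p) (by omega)).2
        _ le_rfl hadj
      have hb1 : ∀ w : X, fN ((2 * l + 2 + P) / 2) • aN (p + 1) w = bW hb l P (p + 2) w :=
        fun w => by
          have := rightWord_top_odd l he
          rw [hp2] at this
          rw [bW, show p + 2 = p + 1 + 1 from rfl, this,
            show (2 * l + 2 + P) / 2 = l + 1 + (p + 1) by omega, ← aW_succ]; rfl
      simp only [hb1] at k1 k2 k3 ⊢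
      have c1 := lCoeff_odd hb g hp
      have c2 := rCoeff_odd hb g hp
      have c3 := mCoeff_odd hb g hp
      rw [k1, k2, k3]
      simp only [show p + 1 + 1 = p + 2 from rfl] at c1 c2 ⊢
      simp only [smul_add, smul_smul_comm]
      generalize fN l • aN (p + 1) (bW hb l P (p + 2) v) = x1
      linear_combination (norm := module) c1 • x1
        + c2 • aN (p + 1) (bW hb l P (p + 2) (fN l • v)) + c3 • aN (p + 1) (fN l • bW hb l P (p + 2) v)

end HW
end HighestWeightNext

/-! ### Operators that remove f_l from f_{ε_l+ε_{l+1}} v -/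

section HighestWeightLeft

set_option linter.unusedSectionVars false

variable {hb : ℂ} {l P : ℕ} {X : Type*} [AddCommGroup X] [Module ℂ X]
  [Module (Uq hb (2 * l + 2 + P)) X] [IsScalarTower ℂ (Uq hb (2 * l + 2 + P)) X]

local notation "fN" => fGen hb (2 * l + 2 + P)
local notation "eN" => eGen hb (2 * l + 2 + P)
local notation "aN" => aW (hb := hb) (N := 2 * l + 2 + P) l
local notation "sN" => aSum hb (2 * l + 2 + P) l

theorem mem_down {m i : ℕ} (h : i ∈ down l m) : l + 1 ≤ i ∧ i ≤ l + m := by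
  simp only [down, List.mem_reverse, List.mem_range'_1] at h
  omega

theorem mem_leftWord {m i : ℕ} (h : i ∈ leftWord l P m) : l + 1 ≤ i := by
  rw [leftWord] at h
  split_ifs at h
  · rw [List.mem_cons] at h
    rcases h with rfl | h <;> [omega; exact (mem_down h).1]
  · exact (mem_down h).1

theorem mem_rightWord {m i : ℕ} (h : i ∈ rightWord l P m) : l + 1 ≤ i := by
  rw [rightWord] at h
  split_ifs at h
  · exact (mem_down h).1
  all_goals
    rw [List.mem_append, List.mem_range'_1] at h
    rcases h with h | h <;> [omega; exact (mem_down h).1]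

theorem commute_smul {A : Type*} [Monoid A] [MulAction A X] {a b : A} (h : Commute a b) (x : X) :
    a • b • x = b • a • x := by rw [← mul_smul, h.eq, mul_smul]

theorem eGen_commute_fGen {N i j : ℕ} (hij : i ≠ j) : Commute (eGen hb N i) (fGen hb N j) :=
  eGen_mul_fGen_ne hb N hij

theorem aSum_bW_smul (M : ℕ) (c : ℕ → ℂ) (a : ℂ) (v : X) :
    sN M c (fun m => bW hb l P m (a • v)) = a • sN M c (fun m => bW hb l P m v) := by
  rw [aSum, aSum, Finset.smul_sum]
  refine Finset.sum_congr rfl fun m _ => ?_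
  rw [bW, smul_smul_comm, aW_smul, smul_comm]
  rfl

theorem aSum_bW_zero (M : ℕ) (c : ℕ → ℂ) :
    sN M c (fun m => bW hb l P m (0 : X)) = 0 :=
  Finset.sum_eq_zero fun m _ => by simp [bW, aW]

namespace HW

variable (hq : NotRoot hb) {ν : ℕ → ℂ} {v : X} (h : HW hb l P ν v)
include hq h

theorem wt_aSum (hP : 1 ≤ P) (c : ℕ → ℂ) : IsWt hb (2 * l + 2 + P) (ν - Pi.single (l + 1) 2)
    (sN ((P + 1) / 2) c (fun m => bW hb l P m v)) := by
  refine IsWt.sum fun m hm => IsWt.smul ?_ _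
  rw [Finset.mem_Icc] at hm
  refine ((h.wt_bW hq hP hm.1 hm.2).aW l m ?_).congr fun i _ _ => ?_
  · by_cases he : Even P
    · obtain ⟨r, hr⟩ := id he
      exact Or.inl (by omega)
    · exact Or.inr ⟨by rwa [even_iff], by omega⟩
  · simp only [Pi.sub_apply, Pi.add_apply, Pi.single_apply]
    split_ifs <;> first | omega | ring

theorem dval_bW (hP : 1 ≤ P) {m : ℕ} (h1 : 1 ≤ m) (h2 : m ≤ P / 2 + 1) :
    ∃ ω, IsWt hb (2 * l + 2 + P) ω (bW hb l P m v) ∧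
      dval (2 * l + 2 + P) ω l = ν l - ν (l + 1) + 1 := by
  by_cases h3 : m ≤ (P + 1) / 2
  · refine ⟨_, h.wt_bW hq hP h1 h3, ?_⟩
    simp only [dval, if_pos (show l < (2 * l + 2 + P) / 2 by omega), Pi.sub_apply, Pi.single_apply]
    split_ifs <;> first | omega | ring
  · have he : Even P := by
      by_contra ho
      obtain ⟨r, hr⟩ := Nat.not_even_iff_odd.mp ho
      omega
    obtain rfl : m = P / 2 + 1 := by omega
    refine ⟨ν - Pi.single (l + 1) 1 + Pi.single (l + 1 + P / 2) 1, ?_, ?_⟩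
    · rw [bW, rightWord_extra_even l he]
      exact h.wt.aW l _ (Or.inl (by omega))
    · simp only [dval, if_pos (show l < (2 * l + 2 + P) / 2 by omega), Pi.sub_apply,
        Pi.add_apply, Pi.single_apply]
      split_ifs <;> first | omega | ring

/-- Once f_l is removed, φ_{p+1} and φ_p act alike for even P, and their equal coefficients add up
to the value q^0 + q^0 of the uniform formula. -/
theorem midSum_phi (hP : 1 ≤ P) (g : ℂ) :
    ∑ m ∈ Finset.Icc 1 (P / 2 + 1), mCoeff hb P g m • phi hb l P m • v =
      sN ((P + 1) / 2) (fun m => ((-1) ^ m * (qpow hb (m - P / 2) + qpow hb (-(m - P / 2)))) *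
        (qnum hb (g + (P / 2 - 1)) * qnum hb (g + P / 2))) (fun m => bW hb l P m v) := by
  by_cases he : Even P
  · obtain ⟨p, hp⟩ : ∃ p, P = 2 * (p + 1) := by
      obtain ⟨r, hr⟩ := id he; exact ⟨r - 1, by omega⟩
    have hp2 : P / 2 = p + 1 := by omega
    have hx := h.phi_extra hq (by omega) he
    have hm := mCoeff_top_even hb P g he
    rw [hp2] at hx hm
    rw [aSum, show (P + 1) / 2 = p + 1 by omega, hp2, Finset.sum_Icc_succ_top (by omega),
      Finset.sum_Icc_succ_top (by omega), Finset.sum_Icc_succ_top (by omega), add_assoc]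
    congr 1
    · refine Finset.sum_congr rfl fun m hm => ?_
      rw [Finset.mem_Icc] at hm
      rw [phi_smul m (fun _ => by omega), mCoeff, midCoeff, if_neg (by omega)]
    · rw [hx, ← hm, ← add_smul, phi_smul _ (fun _ => by omega)]
      congr 1
      rw [mCoeff, midCoeff, if_pos ⟨he, by omega⟩, hp2,
        show ((p + 1 : ℕ) : ℂ) - P / 2 = 0 by rw [hp]; push_cast; ring, neg_zero, qpow_zero]
      ring
  · have : P / 2 + 1 = (P + 1) / 2 := by
      obtain ⟨r, hr⟩ := Nat.not_even_iff_odd.mp he; omega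
    rw [this]
    refine Finset.sum_congr rfl fun m hm => ?_
    rw [phi_smul m (fun he' => absurd he' he), mCoeff, midCoeff, if_neg (fun h => he h.1)]

/-- A linear operator which commutes with `f_j`, `j ≥ l + 1`, and whose commutator with `f_l` acts
on weight vectors by scalars, applied to `f_{ε_l+ε_{l+1}} v`. -/
theorem map_fNext (hP : 1 ≤ P) (hl : 1 ≤ l) {T : X →ₗ[ℂ] X} {c : ℂ → ℂ}
    (hT : ∀ j, l + 1 ≤ j → ∀ x, T (fN j • x) = fN j • T x)
    (hTl : ∀ ω x, IsWt hb (2 * l + 2 + P) ω x →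
      T (fN l • x) = fN l • T x + c (dval (2 * l + 2 + P) ω l) • x)
    (hv : T v = 0) :
    T (fNext hb l P • v) = sN ((P + 1) / 2) (fun m =>
      c (ν l - ν (l + 1) + 2) * lCoeff hb P (ν (l + 1)) m
      + c (ν l - ν (l + 1) + 1) * (((-1) ^ m * (qpow hb (m - P / 2) + qpow hb (-(m - P / 2)))) *
        (qnum hb (ν (l + 1) + (P / 2 - 1)) * qnum hb (ν (l + 1) + P / 2)))
      + c (ν l - ν (l + 1)) * rCoeff hb P (ν (l + 1)) m) (fun m => bW hb l P m v) := by
  have hW : ∀ w : List ℕ, (∀ i ∈ w, l + 1 ≤ i) → ∀ x,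
      T (fWord hb (2 * l + 2 + P) w • x) = fWord hb (2 * l + 2 + P) w • T x := by
    intro w
    induction w with
    | nil => intro _ x; rw [fWord_nil, one_smul, one_smul]
    | cons i w IH =>
      intro hw x
      rw [fWord_cons, mul_smul, mul_smul, hT i (hw i (by simp)), IH fun j hj => hw j (by simp [hj])]
  have hL : ∀ m x, T (fWord hb (2 * l + 2 + P) (leftWord l P m) • x) =
      fWord hb (2 * l + 2 + P) (leftWord l P m) • T x := fun m => hW _ fun i => mem_leftWord
  have hA : ∀ m x, T (aN m x) = aN m (T x) := fun m => hW _ fun i hi => (mem_down hi).1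
  have hR : ∀ m x, T (bW hb l P m x) = bW hb l P m (T x) := fun m => hW _ fun i => mem_rightWord
  have hS : ∀ M (c : ℕ → ℂ) (x : X), T (sN M c (fun m => bW hb l P m x)) =
      sN M c (fun m => bW hb l P m (T x)) := fun M c x => by
    simp only [aSum, map_sum, map_smul, hA, hR]
  -- The factor f_l stands left of, inside or right of φ_m, so the vector it is applied to has
  -- α_l-weight exceeding that of v by 2, 1 or 0.
  have e2 : dval (2 * l + 2 + P) (ν - Pi.single (l + 1) 2) l = ν l - ν (l + 1) + 2 := by
    simp [dval, show l < (2 * l + 2 + P) / 2 by omega]; ring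
  have e0 : dval (2 * l + 2 + P) ν l = ν l - ν (l + 1) := by
    simp [dval, show l < (2 * l + 2 + P) / 2 by omega]
  rw [fNext_smul h.wt hl, map_add, map_add, hTl _ _ (h.wt_aSum hq hP _), hS, hS, hv,
    hTl _ _ h.wt, hv, aSum_bW_zero, smul_zero, zero_add, zero_add, aSum_bW_smul,
    map_sum, e2, e0]
  have hmid : ∀ m ∈ Finset.Icc 1 (P / 2 + 1),
      T (mCoeff hb P (ν (l + 1)) m • phiMid hb l P m • v) =
        c (ν l - ν (l + 1) + 1) • mCoeff hb P (ν (l + 1)) m • phi hb l P m • v := by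
    intro m hm
    rw [Finset.mem_Icc] at hm
    obtain ⟨ω, hω, hd⟩ := h.dval_bW hq hP hm.1 hm.2
    have e0 : T (bW hb l P m v) = 0 := by rw [hR, hv, bW, smul_zero]
    rw [map_smul, phiMid, fWord_append, fWord_cons, mul_smul, mul_smul, ← bW, hL, hTl _ _ hω, e0,
      smul_zero, zero_add, hd, smul_smul_comm, smul_comm, phi, fWord_append, mul_smul, ← bW]
  rw [Finset.sum_congr rfl hmid, ← Finset.smul_sum, h.midSum_phi hq hP]
  simp only [aSum, Finset.smul_sum, smul_smul, ← Finset.sum_add_distrib, ← add_smul]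

/-- The action of `e_l` on `f_{ε_l+ε_{l+1}} v`. -/
theorem e_left_fNext (hP : 1 ≤ P) (hl : 1 ≤ l) (hv : eN l • v = 0) :
    eN l • fNext hb l P • v = qnum hb (ν l + ν (l + 1) + P) • fDouble hb l P • v := by
  have := h.map_fNext hq hP hl (T := Algebra.lsmul ℂ ℂ X (eN l)) (c := qnum hb)
    (fun j hj x => e_f_smul_ne (by omega) x)
    (fun ω x hx => e_f_smul hx (by omega) hl (by omega)) hv
  refine this.trans ?_
  rw [fDouble_smul, aSum, aSum, Finset.smul_sum]
  refine Finset.sum_congr rfl fun m hm => ?_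
  rw [smul_smul]
  congr 1
  rw [Finset.mem_Icc] at hm
  rw [raise_coeff P (ν (l + 1)) hq (ν l - ν (l + 1)) _ hm.1 rfl]
  ring_nf

end HW

/-! ### The degenerate cases P = 1 and P = 2 -/

section SmallCases

variable (hq : NotRoot hb) {ν : ℕ → ℂ} {v : X}
include hq

theorem HW.e_fDouble_one (h : HW hb l P ν v) (hP : P = 1) :
    eN (l + 1) • fDouble hb l P • v =
      qnum hb (ν (l + 1) + P / 2 - 1) • phiDel hb l P 1 • v := by
  subst hP
  have hw := h.wt.f (l + 1)
  have hn : (2 * l + 2 + 1) / 2 = l + 1 := by omega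
  have hd : ∀ ω, dval (2 * l + 2 + 1) ω (l + 1) = ω (l + 1) := fun ω => by
    simp [dval, hn, even_iff]
  have hr : rt (2 * l + 2 + 1) (l + 1) (l + 1) = 1 := by simp [rt, hn, even_iff]
  rw [phiDel_one_smul (by decide), fDouble_smul, aSum]
  simp only [show (1 + 1) / 2 = 1 from rfl, Finset.Icc_self, Finset.sum_singleton]
  rw [bW, rightWord_top_odd (P := 1) l (by decide), show 1 / 2 + 1 = 1 from rfl, ← aW, aW_succ,
    aW_zero, aW_succ, aW_zero, add_zero, smul_smul_comm,
    e_f_smul hw (by omega) (by omega) (by omega), e_f_smul h.wt (by omega) (by omega) (by omega),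
    h.e _ le_rfl (by omega), smul_zero, zero_add, smul_smul_comm, hd, hd, ← add_smul, smul_smul,
    Pi.sub_apply, hr]
  congr 1
  rw [← dCoeff_first 1 _ hq]
  -- Only m = 1 occurs for P = 1, but the general identity also involves the coefficient at m = 2.
  -- It repeats the first because [-1/2] = -[1/2].
  have : dCoeff hb 1 2 = dCoeff hb 1 1 := by
    simp [dCoeff, ← qnum_neg]
    congr 1; norm_num
  rw [this]; ring

theorem HW.e_fNext_one (h : HW hb l P ν v) (hP : P = 1) (hl : 1 ≤ l) :
    eN (l + 1) • fNext hb l P • v = 0 := by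
  subst hP
  have h' := h.f_left hl
  have hn : (2 * l + 2 + 1) / 2 = l + 1 := by omega
  have hd : ∀ ω, dval (2 * l + 2 + 1) ω (l + 1) = ω (l + 1) := fun ω => by
    simp [dval, hn, even_iff]
  have hr : rt (2 * l + 2 + 1) (l + 1) (l + 1) = 1 := by simp [rt, hn, even_iff]
  have hr' : rt (2 * l + 2 + 1) l (l + 1) = -1 := by simp [rt, hn]
  rw [fNext_smul h.wt hl, aSum, aSum]
  simp only [show (1 + 1) / 2 = 1 from rfl, show 1 / 2 + 1 = 1 from rfl, Finset.Icc_self,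
    Finset.sum_singleton]
  have hbw : ∀ w : X, bW hb l 1 1 w = fGen hb (2 * l + 2 + 1) (l + 1) • w := fun w => by
    rw [bW, rightWord_top_odd (P := 1) l (by decide), show 1 / 2 + 1 = 1 from rfl, ← aW, aW_succ,
      aW_zero, add_zero]
  rw [phiMid_smul 1 (by decide)]
  simp only [hbw, aW_succ, aW_zero, add_zero]
  have e1 := e_f_smul h.wt (by omega) (i := l + 1) (by omega) (by omega)
  have e2 := e_f_smul (h.wt.f (l + 1)) (by omega) (i := l + 1) (by omega) (by omega)
  have e3 := e_f_smul h'.wt (by omega) (i := l + 1) (by omega) (by omega)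
  have e4 := e_f_smul (h'.wt.f (l + 1)) (by omega) (i := l + 1) (by omega) (by omega)
  have e5 := e_f_smul ((h.wt.f (l + 1)).f l) (by omega) (i := l + 1) (by omega) (by omega)
  rw [h.e _ le_rfl (by omega), smul_zero, zero_add, hd] at e1
  rw [h'.e _ le_rfl (by omega), smul_zero, zero_add, hd] at e3
  rw [e1, hd, smul_smul_comm, ← add_smul] at e2
  rw [e3, hd, smul_smul_comm, ← add_smul] at e4
  rw [e_f_smul_ne (i := l + 1) (j := l) (by omega), e1, hd] at e5
  simp only [smul_smul_comm] at e5
  simp only [smul_add, smul_smul_comm]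
  rw [e_f_smul_ne (i := l + 1) (j := l) (by omega), e2, e4, e5]
  simp only [smul_smul_comm, Pi.sub_apply, hr, hr']
  have k1 : lCoeff hb 1 (ν (l + 1)) 1 * (qnum hb (ν (l + 1)) + qnum hb (ν (l + 1) - 1))
      + mCoeff hb 1 (ν (l + 1)) 1 * qnum hb (ν (l + 1)) = 0 := by
    have := qnum_add_add_qnum_sub hb (ν (l + 1) + (1 / 2 - 1)) (1 / 2)
    rw [show ν (l + 1) + (1 / 2 - 1) + 1 / 2 = ν (l + 1) by ring,
      show ν (l + 1) + (1 / 2 - 1) - 1 / 2 = ν (l + 1) - 1 by ring] at this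
    simp only [lCoeff, mCoeff, midCoeff, show ¬Even 1 by decide, false_and, if_false, Nat.cast_one,
      sub_self, add_zero, show (1 : ℂ) - 1 / 2 = 1 / 2 by norm_num]
    rw [this]; ring
  have k2 : rCoeff hb 1 (ν (l + 1)) 1 * (qnum hb (ν (l + 1) + 1) + qnum hb (ν (l + 1)))
      + mCoeff hb 1 (ν (l + 1)) 1 * qnum hb (ν (l + 1)) = 0 := by
    have := qnum_add_add_qnum_sub hb (ν (l + 1) + 1 / 2) (1 / 2)
    rw [show ν (l + 1) + 1 / 2 + 1 / 2 = ν (l + 1) + 1 by ring,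
      show ν (l + 1) + 1 / 2 - 1 / 2 = ν (l + 1) by ring] at this
    simp only [rCoeff, mCoeff, midCoeff, show ¬Even 1 by decide, false_and, if_false, Nat.cast_one,
      sub_self, add_zero, show (1 : ℂ) - 1 / 2 = 1 / 2 by norm_num]
    rw [this]; ring
  rw [show ν (l + 1) - 1 - -1 = ν (l + 1) by ring, show ν (l + 1) - -1 = ν (l + 1) + 1 by ring,
    add_sub_cancel_right]
  generalize fGen hb (2 * l + 2 + 1) l • fGen hb (2 * l + 2 + 1) (l + 1) • v = x1
  generalize fGen hb (2 * l + 2 + 1) (l + 1) • fGen hb (2 * l + 2 + 1) l • v = x2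
  linear_combination (norm := module) k1 • x1 + k2 • x2

theorem f_comm_two (hP : P = 2) (x : X) : fN (l + 1) • fN (l + 2) • x = fN (l + 2) • fN (l + 1) • x := by
  subst hP
  exact f_comm_smul (by omega) (by omega) (by omega) (by omega)
    (by rintro (h | h) <;> [exact h.2 ⟨(even_iff l 2).mpr (by decide), by omega⟩; omega]) x

theorem bW_one_two (hP : P = 2) (x : X) : bW hb l P 1 x = fN (l + 2) • x := by
  subst hP
  rw [bW, rightWord_last_even (P := 2) l (by decide), show 2 / 2 - 1 = 0 from rfl, fWord_cons,
    down_zero, fWord_nil, mul_one]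

theorem HW.e_fDouble_two (h : HW hb l P ν v) (hP : P = 2) :
    eN (l + 1) • fDouble hb l P • v = qnum hb (ν (l + 1)) • fN (l + 2) • v ∧
    eN (l + 2) • fDouble hb l P • v = qnum hb (ν (l + 1)) • fN (l + 1) • v := by
  have hn : (2 * l + 2 + P) / 2 = l + 2 := by omega
  have hNe : Even (2 * l + 2 + P) := by rw [even_iff, hP]; decide
  have h0 := h.zero (l + 2) le_rfl (by omega)
  have e1 := e_f_smul h.wt (by omega) (i := l + 1) (by omega) (by omega)
  have e2 := e_f_smul h.wt (by omega) (i := l + 2) (by omega) (by omega)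
  rw [h.e _ (by omega) (by omega), smul_zero, zero_add] at e1 e2
  have hS : fDouble hb l P • v = fN (l + 1) • fN (l + 2) • v := by
    rw [fDouble_smul, aSum, show (P + 1) / 2 = 1 by omega, Finset.Icc_self, Finset.sum_singleton,
      bW_one_two hq hP, aW_succ, aW_zero, add_zero]
    rw [dCoeff, show (P : ℂ) / 2 - (1 : ℕ) + 1 = 1 by rw [hP]; norm_num, qnum_one hq]
    simp
  constructor
  · rw [hS, f_comm_two hq hP, e_f_smul_ne (by omega), e1, smul_smul_comm]
    congr 2; simp [dval, hn, h0]
  · rw [hS, e_f_smul_ne (by omega), e2, smul_smul_comm]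
    congr 2; simp [dval, hn, h0, hNe]

/-- For P = 2 the nodes l + 1 and l + 2 commute and are interchangeable in the formula, so both
values of j are treated at once with i the other node. -/
theorem HW.e_fNext_two (h : HW hb l P ν v) (hP : P = 2) (hl : 1 ≤ l) {j : ℕ} (h1 : l + 1 ≤ j)
    (h2 : j ≤ l + 2) : eN j • fNext hb l P • v = 0 := by
  have hn : (2 * l + 2 + P) / 2 = l + 2 := by omega
  have hNe : Even (2 * l + 2 + P) := by rw [even_iff, hP]; decide
  have h0 := h.zero (l + 2) le_rfl (by omega)
  have h' := h.f_left hl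
  have h0' := h'.zero (l + 2) le_rfl (by omega)
  have hr : rt (2 * l + 2 + P) l (l + 1) = -1 := by simp [rt, hn]
  obtain ⟨i, hi, hji⟩ : ∃ i, (j = l + 1 ∧ i = l + 2 ∨ j = l + 2 ∧ i = l + 1) ∧ j ≠ i := by
    obtain rfl | rfl : j = l + 1 ∨ j = l + 2 := by omega
    · exact ⟨l + 2, by omega, by omega⟩
    · exact ⟨l + 1, by omega, by omega⟩
  have hcomm : ∀ x : X, fN (l + 1) • fN (l + 2) • x = fN j • fN i • x ∧
      fN (l + 2) • fN (l + 1) • x = fN j • fN i • x := fun x => by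
    rcases hi with ⟨rfl, rfl⟩ | ⟨rfl, rfl⟩ <;> simp [f_comm_two hq hP]
  set g := ν (l + 1) with hg
  have hS : fNext hb l P • v = (qnum hb (g + 1) * qnum hb (g + 1)) • fN l • fN j • fN i • v
      + (-(qnum hb g * qnum hb (g + 1))) • (fN j • fN l • fN i • v + fN i • fN l • fN j • v)
      + (qnum hb g * qnum hb g) • fN j • fN i • fN l • v := by
    have hmid : phiMid hb l P 1 • v + phiMid hb l P 2 • v =
        fN j • fN l • fN i • v + fN i • fN l • fN j • v := by
      have e2 := phiMid_extra_smul (hb := hb) (l := l) (P := P) (by rw [hP]; decide) v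
      have hp : P / 2 = 1 := by omega
      rw [hp, show 1 - 1 = 0 from rfl, aW_zero, aW_succ, aW_zero, add_zero,
        show 1 + 1 = 2 from rfl, show l + 1 + 1 = l + 2 from rfl] at e2
      rw [e2, phiMid_smul 1 (fun _ => by omega), bW_one_two hq hP, aW_succ, aW_zero, add_zero]
      rcases hi with ⟨rfl, rfl⟩ | ⟨rfl, rfl⟩ <;> [rfl; rw [add_comm]]
    rw [fNext_smul h.wt hl, aSum, aSum, show (P + 1) / 2 = 1 by omega,
      show P / 2 + 1 = 1 + 1 by omega, Finset.sum_Icc_succ_top (b := 1) (by omega), Finset.Icc_self,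
      Finset.sum_singleton, Finset.sum_singleton, Finset.sum_singleton,
      bW_one_two hq hP, bW_one_two hq hP, aW_succ, aW_zero, aW_succ, aW_zero, add_zero,
      (hcomm _).1, (hcomm _).1, ← hmid, ← hg, smul_add]
    have c1 : lCoeff hb P g 1 = qnum hb (g + 1) * qnum hb (g + 1) := by
      rw [lCoeff, hP, show g + (((2 : ℕ) : ℂ) - (1 : ℕ)) = g + 1 by norm_num,
        show g + ((2 : ℕ) : ℂ) / 2 = g + 1 by norm_num]
      norm_num
    have c2 : rCoeff hb P g 1 = qnum hb g * qnum hb g := by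
      rw [rCoeff, hP, show g + (((1 : ℕ) : ℂ) - 1) = g by norm_num,
        show g + (((2 : ℕ) : ℂ) / 2 - 1) = g by norm_num]
      norm_num
    have c3 : ∀ m, 1 ≤ m → mCoeff hb P g m = -(qnum hb g * qnum hb (g + 1)) := fun m hm => by
      rw [mCoeff, midCoeff, if_pos ⟨by rw [hP]; decide, by omega⟩, hP,
        show g + (((2 : ℕ) : ℂ) / 2 - 1) = g by norm_num,
        show g + ((2 : ℕ) : ℂ) / 2 = g + 1 by norm_num]
      norm_num
    rw [c1, c2, c3 1 le_rfl, c3 _ (by omega), smul_smul_comm]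
  have ej : ∀ {ω : ℕ → ℂ} {w : X}, HW hb l P ω w → eN j • fN j • w = qnum hb (ω (l + 1)) • w ∧
      eN j • fN j • fN i • w = qnum hb (ω (l + 1)) • fN i • w := fun {ω w} hw => by
    have hj := hw.e j h1 (by omega)
    have h0 := hw.zero (l + 2) le_rfl (by omega)
    have e1 : eN j • fN j • w = qnum hb (ω (l + 1)) • w := by
      rw [e_f_smul hw.wt (by omega) (by omega) (by omega), hj, smul_zero, zero_add]
      congr 2
      rcases hi with ⟨rfl, rfl⟩ | ⟨rfl, rfl⟩ <;> simp [dval, hn, h0, hNe]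
    refine ⟨e1, ?_⟩
    rw [show fN j • fN i • w = fN i • fN j • w by
      rcases hi with ⟨rfl, rfl⟩ | ⟨rfl, rfl⟩ <;> simp [f_comm_two hq hP], e_f_smul_ne hji, e1,
      smul_smul_comm]
  have e3 : eN j • fN j • fN l • fN i • v = qnum hb (g + 1) • fN l • fN i • v := by
    rw [e_f_smul ((h.wt.f i).f l) (by omega) (by omega) (by omega), e_f_smul_ne (by omega),
      e_f_smul_ne hji, h.e j h1 (by omega), smul_zero, smul_zero, smul_zero, zero_add]
    congr 2
    rcases hi with ⟨rfl, rfl⟩ | ⟨rfl, rfl⟩ <;> simp [dval, hn, h0, hNe, rt, hg, show ¬l + 1 + 1 = l by omega]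
  have e4 := (ej h).1
  have e5 := (ej h').2
  rw [show (ν - rt (2 * l + 2 + P) l) (l + 1) = g + 1 by simp [hr, hg]] at e5
  rw [hS, smul_add, smul_add, smul_smul_comm, smul_smul_comm, smul_smul_comm,
    e_f_smul_ne (show j ≠ l by omega), (ej h).2, smul_add, e3, e_f_smul_ne hji, e_f_smul_ne (show j ≠ l by omega),
    e4, e5, smul_smul_comm, smul_smul_comm, smul_smul_comm, ← hg]
  generalize fN l • fN i • v = x1
  generalize fN i • fN l • v = x2
  module

end SmallCases
end HighestWeightLeft

/-! ### Modified commutators for k < l -/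

section Descent

set_option linter.unusedSectionVars false

variable {hb : ℂ} {l P : ℕ} {X : Type*} [AddCommGroup X] [Module ℂ X]
  [Module (Uq hb (2 * l + 2 + P)) X] [IsScalarTower ℂ (Uq hb (2 * l + 2 + P)) X]

local notation "fN" => fGen hb (2 * l + 2 + P)
local notation "eN" => eGen hb (2 * l + 2 + P)
local notation "aN" => aW (hb := hb) (N := 2 * l + 2 + P) l

theorem ip_simpleRoot_eq_zero {N i : ℕ} (h2 : i < N / 2) {μ : Lat N}
    (hμ : ∀ k : Node N, (k : ℕ) ≤ i + 1 → μ k = 0) : ip μ (simpleRoot N i) = 0 := by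
  refine Finset.sum_eq_zero fun k _ => ?_
  by_cases hk : (k : ℕ) ≤ i + 1
  · rw [hμ k hk, zero_mul]
  · simp [simpleRoot, h2, eps, show (k : ℕ) ≠ i by omega, show (k : ℕ) ≠ i + 1 by omega]

/-- Stated in the target of an arbitrary algebra map, so that z may be an e_i or f_i as well as a
linear operator on a module that does not come from the quantum group, such as `lowerOp`. -/
theorem commute_fDesc {S : Type*} [Ring S] [Algebra ℂ S] (ρ : Uq hb (2 * l + 2 + P) →ₐ[ℂ] S) {z : S}
    {d : ℕ} (hd : d ≤ l) (hf : ∀ j, l + 1 - d ≤ j → Commute z (ρ (fN j)))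
    (hh : ∀ (μ : Lat (2 * l + 2 + P)) (c : ℂ),
      (∀ k : Node (2 * l + 2 + P), (k : ℕ) ≤ l + 1 - d → μ k = 0) → Commute z (ρ (hnum hb _ μ c))) :
    Commute z (ρ (fDesc hb l P d)) := by
  have hw : ∀ w : List ℕ, (∀ i ∈ w, l + 1 ≤ i) →
      Commute z (ρ (fWord hb (2 * l + 2 + P) w)) := by
    intro w
    induction w with
    | nil => intro _; rw [fWord_nil, map_one]; exact Commute.one_right z
    | cons i w IH =>
      intro hw
      rw [fWord_cons, map_mul]
      exact (hf i (by have := hw i (by simp); omega)).mul_right (IH fun j hj => hw j (by simp [hj]))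
  have hlw : ∀ m, Commute z (ρ (fWord hb (2 * l + 2 + P) (leftWord l P m))) := fun m =>
    hw _ fun i => mem_leftWord
  have hrw : ∀ m, Commute z (ρ (fWord hb (2 * l + 2 + P) (rightWord l P m))) := fun m =>
    hw _ fun i => mem_rightWord
  have hphi : ∀ m, Commute z (ρ (phi hb l P m)) := fun m => by
    rw [phi, fWord_append, map_mul]; exact (hlw m).mul_right (hrw m)
  induction d with
  | zero =>
    rw [fDesc, fDouble, map_sum]
    refine Commute.sum_right _ _ _ fun m _ => ?_
    rw [map_smul]
    exact (hphi m).smul_right _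
  | succ d IH =>
    obtain rfl | hd0 := Nat.eq_zero_or_pos d
    · have hl := hf l (by omega)
      have hhe : ∀ c, Commute z (ρ (hnum hb (2 * l + 2 + P) (eps _ (l + 1)) c)) := fun c =>
        hh _ c fun k hk => by simp only [eps]; rw [if_neg (by omega)]
      have hmid : ∀ m, Commute z (ρ (phiMid hb l P m)) := fun m => by
        rw [phiMid, fWord_append, fWord_cons, map_mul, map_mul]
        exact (hlw m).mul_right (hl.mul_right (hrw m))
      simp only [fDesc, fNext, map_add, map_sum, map_smul, map_mul]
      refine Commute.add_right (Commute.add_right ?_ ?_) ?_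
      · exact Commute.sum_right _ _ _ fun m _ => Commute.smul_right
          ((hl.mul_right (hphi m)).mul_right ((hhe _).mul_right (hhe _))) _
      · exact Commute.sum_right _ _ _ fun m _ => Commute.smul_right
          ((hmid m).mul_right ((hhe _).mul_right (hhe _))) _
      · exact Commute.sum_right _ _ _ fun m _ => Commute.smul_right
          (((hphi m).mul_right hl).mul_right ((hhe _).mul_right (hhe _))) _
    · obtain ⟨d, rfl⟩ : ∃ t, d = t + 1 := ⟨d - 1, by omega⟩
      have IH' := IH (by omega) (fun j hj => hf j (by omega))
        (fun μ c hμ => hh μ c fun k hk => hμ k (by omega))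
      have hk := hf (l - 1 - d) (by omega)
      have hhe : ∀ c, Commute z (ρ (hnum hb (2 * l + 2 + P)
          (eps _ (l - 1 - d + 1) + eps _ (l + 1)) c)) := fun c =>
        hh _ c fun k hk => by
          simp only [eps, Pi.add_apply]; rw [if_neg (by omega), if_neg (by omega), add_zero]
      simp only [fDesc, map_sub, map_mul]
      exact ((hk.mul_right IH').mul_right (hhe _)).sub_right ((IH'.mul_right hk).mul_right (hhe _))

theorem eGen_commute_fDesc {d i : ℕ} (hd : d ≤ l) (hi : i + d ≤ l) :
    Commute (eN i) (fDesc hb l P d) :=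
  commute_fDesc (AlgHom.id ℂ _) hd (fun j hj => eGen_commute_fGen (by omega)) fun μ c hμ =>
    (hnum_comm_of_ip_eq_zero hb _ (ip_simpleRoot_eq_zero (by omega)
      fun k hk => hμ k (by omega)) c).2.symm

theorem fGen_commute_fDesc (hP : 1 ≤ P) {d i : ℕ} (hd : d ≤ l) (h1 : 1 ≤ i) (hi : i + 1 + d ≤ l) :
    Commute (fN i) (fDesc hb l P d) :=
  commute_fDesc (AlgHom.id ℂ _) hd (fun j hj => by
    by_cases hj' : j ≤ (2 * l + 2 + P) / 2
    · refine fGen_comm hb _ (by omega) (ip_far (by omega) h1 hj' (by omega) ?_)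
      rintro (h | ⟨⟨r, hr⟩, h⟩) <;> omega
    · simp [fGen, Finset.mem_Icc, show ¬(1 ≤ j ∧ j ≤ (2 * l + 2 + P) / 2) by omega]) fun μ c hμ =>
    (hnum_comm_of_ip_eq_zero hb _ (ip_simpleRoot_eq_zero (by omega)
      fun k hk => hμ k (by omega)) c).1.symm

theorem wsum_eps_add_eps {N : ℕ} (ν : ℕ → ℂ) {i j : ℕ} (h1 : 1 ≤ i) (h2 : i ≤ N / 2)
    (h3 : 1 ≤ j) (h4 : j ≤ N / 2) : wsum N ν (eps N i + eps N j) = ν i + ν j := by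
  rw [wsum_add, wsum_eps, wsum_eps, if_pos ⟨h1, h2⟩, if_pos ⟨h3, h4⟩]

theorem fDesc_succ_smul {d : ℕ} (hd : d + 2 ≤ l) {ν : ℕ → ℂ} {v : X}
    (h : IsWt hb (2 * l + 2 + P) ν v) :
    fDesc hb l P (d + 2) • v =
      qnum hb (ν (l - d) + ν (l + 1) + P + d + 1) •
        fN (l - 1 - d) • fDesc hb l P (d + 1) • v
      - qnum hb (ν (l - d) + ν (l + 1) + P + d) •
        fDesc hb l P (d + 1) • fN (l - 1 - d) • v := by
  have hk : l - 1 - d + 1 = l - d := by omega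
  have hc : ((l - 1 - d : ℕ) : ℂ) = l - 1 - d := by
    rw [Nat.cast_sub (by omega), Nat.cast_sub (by omega)]; norm_num
  rw [fDesc]
  simp only [sub_smul, mul_smul, h.hnum, smul_smul_comm, hk]
  rw [wsum_eps_add_eps _ (by omega) (by omega) (by omega) (by omega), hc]
  congr 3 <;> ring

namespace HW

variable (hq : NotRoot hb) {ν : ℕ → ℂ} {v : X}

/-- Lowering a vector by `f_k`, `k ≤ l`. -/
theorem f_low (h : HW hb l P ν v) {k : ℕ} (hk : 1 ≤ k) (hl : k ≤ l) :
    HW hb l P (ν - rt (2 * l + 2 + P) k) (fN k • v) where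
  wt := h.wt.f k
  e j h1 h2 := by rw [e_f_smul_ne (by omega), h.e j h1 h2, smul_zero]
  f hP j h1 h2 := by
    rw [← f_comm_smul (by omega) hk h2 (by omega), h.f hP j h1 h2, smul_zero]
    rintro (h' | ⟨⟨c, hc⟩, h'⟩) <;> omega
  zero i h1 h2 := by
    simp [h.zero i h1 h2, rt, show k < (2 * l + 2 + P) / 2 by omega, show i ≠ k by omega,
      show i ≠ k + 1 by omega]

include hq

theorem wt_fDouble (h : HW hb l P ν v) (hP : 1 ≤ P) :
    IsWt hb (2 * l + 2 + P) (ν - Pi.single (l + 1) 2) (fDouble hb l P • v) := by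
  rw [fDouble_smul]; exact h.wt_aSum hq hP _

theorem wt_fNext (h : HW hb l P ν v) (hP : 1 ≤ P) (hl : 1 ≤ l) :
    IsWt hb (2 * l + 2 + P) (ν - Pi.single l 1 - Pi.single (l + 1) 1) (fNext hb l P • v) := by
  have hr : rt (2 * l + 2 + P) l = Pi.single l 1 - Pi.single (l + 1) 1 := by
    rw [rt, if_pos (by omega)]
  rw [fNext_smul h.wt hl]
  refine ((((h.wt_aSum hq hP _).f l).congr fun i _ _ => ?_).add (IsWt.sum fun m hm => ?_)).add
    (((h.f_left hl).wt_aSum hq hP _).congr fun i _ _ => ?_)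
  · simp only [hr, Pi.sub_apply, Pi.single_apply]; split_ifs <;> first | omega | ring
  · refine IsWt.smul ?_ _
    rw [Finset.mem_Icc] at hm
    by_cases h3 : m ≤ (P + 1) / 2
    · have hle : Even P → m ≤ P / 2 := fun ⟨r, hr⟩ => by omega
      rw [phiMid_smul m hle]
      refine (((h.wt_bW hq hP hm.1 h3).f l).aW l m ?_).congr fun i _ _ => ?_
      · by_cases he : Even P
        · have := hle he
          exact Or.inl (by omega)
        · exact Or.inr ⟨by rwa [even_iff], by omega⟩
      · simp only [hr, Pi.sub_apply, Pi.add_apply, Pi.single_apply]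
        split_ifs <;> first | omega | ring
    · have he : Even P := by
        by_contra ho
        obtain ⟨r, hr⟩ := Nat.not_even_iff_odd.mp ho
        omega
      obtain ⟨r, hr'⟩ := id he
      obtain rfl : m = P / 2 + 1 := by omega
      rw [phiMid_extra_smul he]
      refine ((((h.wt.aW l (P / 2) (Or.inl (by omega))).f l).aW l (P / 2 - 1)
        (Or.inl (by omega))).f _).congr fun i _ _ => ?_
      rw [hr, rt, if_neg (by omega), if_pos ((even_iff l P).mpr he)]
      simp only [Pi.sub_apply, Pi.add_apply, Pi.single_apply]
      split_ifs <;> first | omega | ring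
  · simp only [hr, Pi.sub_apply, Pi.single_apply]; split_ifs <;> first | omega | ring

theorem wt_fDesc {ν : ℕ → ℂ} {v : X} (h : HW hb l P ν v) (hP : 1 ≤ P) {d : ℕ} (hd : d ≤ l) :
    IsWt hb (2 * l + 2 + P) (ν - Pi.single (l + 1 - d) 1 - Pi.single (l + 1) 1)
      (fDesc hb l P d • v) := by
  match d with
  | 0 =>
    refine (h.wt_fDouble hq hP).congr fun i _ _ => ?_
    simp only [Pi.sub_apply, Pi.single_apply]; split_ifs <;> first | omega | ring
  | 1 =>
    rw [Nat.add_sub_cancel]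
    exact h.wt_fNext hq hP (by omega)
  | d + 2 =>
    have hr : rt (2 * l + 2 + P) (l - 1 - d) =
        Pi.single (l - 1 - d) 1 - Pi.single (l - 1 - d + 1) 1 := by
      rw [rt, if_pos (by omega)]
    rw [fDesc_succ_smul hd h.wt]
    refine IsWt.sub (IsWt.smul ?_ _) (IsWt.smul ?_ _)
    · refine ((h.wt_fDesc hP (d := d + 1) (by omega)).f _).congr fun i _ _ => ?_
      simp only [hr, Pi.sub_apply, Pi.single_apply]; split_ifs <;> first | omega | ring
    · refine ((h.f_low (by omega) (by omega)).wt_fDesc hP (d := d + 1) (by omega)).congr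
        fun i _ _ => ?_
      simp only [hr, Pi.sub_apply, Pi.single_apply]; split_ifs <;> first | omega | ring

theorem e_fNext_all (h : HW hb l P ν v) (hP : 1 ≤ P) (hl : 1 ≤ l) {j : ℕ} (h1 : l + 1 ≤ j)
    (h2 : j ≤ (2 * l + 2 + P) / 2) : eN j • fNext hb l P • v = 0 := by
  obtain hP1 | hP2 | hP3 : P = 1 ∨ P = 2 ∨ 3 ≤ P := by omega
  · obtain rfl : j = l + 1 := by omega
    exact h.e_fNext_one hq hP1 hl
  · exact h.e_fNext_two hq hP2 hl h1 (by omega)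
  · exact h.e_fNext hq hP3 hl h1 h2

/-- The action of the `e_j`, `j ≥ k`, on `f_{ε_k+ε_{l+1}} v`, `k = l - d`. -/
theorem e_fDesc (h : HW hb l P ν v) (hP : 1 ≤ P) {d : ℕ} (hd : d + 1 ≤ l)
    (hv : ∀ j, l - d ≤ j → j ≤ l → eN j • v = 0) {j : ℕ} (h1 : l - d ≤ j)
    (h2 : j ≤ (2 * l + 2 + P) / 2) :
    eN j • fDesc hb l P (d + 1) • v =
      (if j = l - d then qnum hb (ν (l - d) + ν (l + 1) + P + d) else 0) •
        fDesc hb l P d • v := by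
  induction d generalizing ν v j with
  | zero =>
    simp only [Nat.sub_zero] at *
    split_ifs with hj
    · subst hj
      rw [Nat.cast_zero, add_zero]
      exact h.e_left_fNext hq hP (by omega) (hv _ le_rfl le_rfl)
    · rw [zero_smul]
      exact h.e_fNext_all hq hP (by omega) (by omega) h2
  | succ d IH =>
    have hk : l - (d + 1) = l - 1 - d := by omega
    rw [hk] at hv h1 ⊢
    have hlow := h.f_low (k := l - 1 - d) (by omega) (by omega)
    have hr : rt (2 * l + 2 + P) (l - 1 - d) = Pi.single (l - 1 - d) 1 - Pi.single (l - d) 1 := by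
      rw [rt, if_pos (by omega), show l - 1 - d + 1 = l - d by omega]
    have hvlow : ∀ j, l - d ≤ j → j ≤ l → eN j • fN (l - 1 - d) • v = 0 := fun j hj hj' => by
      rw [e_f_smul_ne (by omega), hv j (by omega) hj', smul_zero]
    rw [fDesc_succ_smul hd h.wt, smul_sub, smul_smul_comm, smul_smul_comm]
    set A := ν (l - d) + ν (l + 1) + P + d with hA
    by_cases hj : j = l - 1 - d
    · subst hj
      have hcom := eGen_commute_fDesc (hb := hb) (l := l) (P := P) (d := d + 1)
        (i := l - 1 - d) (by omega) (by omega)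
      have hv0 := hv _ le_rfl (by omega)
      rw [if_pos rfl, e_f_smul (h.wt_fDesc hq hP (by omega)) (by omega) (by omega) h2,
        commute_smul hcom, hv0, smul_zero, smul_zero, zero_add, commute_smul hcom,
        e_f_smul h.wt (by omega) (by omega) h2, hv0, smul_zero, zero_add, smul_smul_comm,
        smul_smul, smul_smul, ← sub_smul]
      congr 1
      have hd1 : dval (2 * l + 2 + P) ν (l - 1 - d) = ν (l - 1 - d) - ν (l - d) := by
        rw [dval, if_pos (by omega), show l - 1 - d + 1 = l - d by omega]
      have hd2 : dval (2 * l + 2 + P) (ν - Pi.single (l + 1 - (d + 1)) 1 - Pi.single (l + 1) 1)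
          (l - 1 - d) = ν (l - 1 - d) - ν (l - d) + 1 := by
        rw [dval, if_pos (by omega), show l - 1 - d + 1 = l - d by omega]
        simp only [Pi.sub_apply, Pi.single_apply]
        split_ifs <;> first | omega | ring
      rw [hd1, hd2, show A + 1 = A + 1 from rfl]
      -- The first factors are the Cartan coefficients of the modified commutator, the second the
      -- values of h_{α_k} on the vectors that f_k is applied to.
      have := qnum_mul_sub hq (A + 1) (ν (l - 1 - d) - ν (l - d) + 1)
      rw [add_sub_cancel_right, add_sub_cancel_right] at this
      rw [this, hA]
      congr 1
      push_cast; ring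
    · rw [if_neg hj, zero_smul, e_f_smul_ne hj,
        IH h (by omega) (fun j hj hj' => hv j (by omega) hj') (by omega) h2,
        IH hlow (by omega) hvlow (by omega) h2]
      -- At j = k + 1 both terms produce the shorter element, with which f_k commutes. Since f_k
      -- raises the coordinate ν_{k+1} by one, their coefficients are [A+1][A] and [A][A+1], and
      -- they cancel.
      by_cases hj' : j = l - d
      · rw [if_pos hj', if_pos hj']
        have hcom := fGen_commute_fDesc (hb := hb) (l := l) hP (d := d)
          (i := l - 1 - d) (by omega) (by omega) (by omega)
        rw [smul_smul_comm, commute_smul hcom, smul_smul (qnum hb _), smul_smul (qnum hb _),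
          ← sub_smul]
        rw [hr, Pi.sub_apply, Pi.sub_apply, Pi.sub_apply, Pi.sub_apply, Pi.single_eq_same,
          Pi.single_eq_of_ne (by omega), Pi.single_eq_of_ne (by omega),
          Pi.single_eq_of_ne (by omega),
          show ν (l - d) - (0 - 1) + (ν (l + 1) - (0 - 0)) + P + d = A + 1 by rw [hA]; ring, mul_comm,
          sub_self, zero_smul]
      · rw [if_neg hj', if_neg hj', zero_smul, zero_smul, smul_zero, smul_zero, smul_zero, sub_zero]

end HW
end Descent

/-! ### Serre elements and q-commuting families -/

section SerreElement

variable (hb : ℂ) (N : ℕ) {R S : Type*} [Ring R] [Algebra ℂ R] [Ring S] [Algebra ℂ S]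

/-- The left hand side of the quantum Serre relation between `φ_i` and `φ_j`. -/
def serreEl (φ : ℕ → R) (i j : ℕ) : R :=
  if ip (simpleRoot N i) (simpleRoot N j) = 0 then φ i * φ j - φ j * φ i
  else if ip (simpleRoot N i) (simpleRoot N j) = -1 ∧ ip (simpleRoot N i) (simpleRoot N i) = 2 then
    φ i * (φ i * φ j) - (qpow hb 1 + qpow hb (-1)) • (φ i * (φ j * φ i)) + φ j * (φ i * φ i)
  else if ip (simpleRoot N i) (simpleRoot N j) = -1 ∧ ip (simpleRoot N i) (simpleRoot N i) = 1 then
    φ i * (φ i * (φ i * φ j)) - (qpow hb 1 + 1 + qpow hb (-1)) • (φ i * (φ i * (φ j * φ i)))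
      + (qpow hb 1 + 1 + qpow hb (-1)) • (φ i * (φ j * (φ i * φ i)))
      - φ j * (φ i * (φ i * φ i))
  else 0

/-- The quantum Serre relations for a family of elements of an algebra. -/
def IsSerre (φ : ℕ → R) : Prop :=
  ∀ i j, 1 ≤ i → i ≤ N / 2 → 1 ≤ j → j ≤ N / 2 → i ≠ j → serreEl hb N φ i j = 0

variable {hb N}

theorem map_serreEl (ρ : R →ₐ[ℂ] S) (φ : ℕ → R) (i j : ℕ) :
    ρ (serreEl hb N φ i j) = serreEl hb N (fun i => ρ (φ i)) i j := by
  simp only [serreEl]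
  split_ifs <;> simp

theorem serreEl_of_eq_zero {φ : ℕ → R} {i j : ℕ} (h : φ i = 0 ∨ φ j = 0) :
    serreEl hb N φ i j = 0 := by
  simp only [serreEl]
  rcases h with h | h <;> simp [h]

/-- Operators intertwined by a linear map have intertwined Serre elements. -/
theorem serreEl_intertwine {X Y : Type*} [AddCommGroup X] [Module ℂ X] [AddCommGroup Y]
    [Module ℂ Y] {φ : ℕ → Module.End ℂ X} {ψ : ℕ → Module.End ℂ Y} (T : X →ₗ[ℂ] Y) {i j : ℕ}
    (hi : ∀ x, T (φ i x) = ψ i (T x)) (hj : ∀ x, T (φ j x) = ψ j (T x)) (x : X) :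
    T (serreEl hb N φ i j x) = serreEl hb N ψ i j (T x) := by
  simp only [serreEl]
  split_ifs <;> simp [hi, hj]

theorem serreEl_smul (c : ℕ → ℂ) (φ : ℕ → R) {i j : ℕ} (h : serreEl hb N φ i j = 0) :
    serreEl hb N (fun i => c i • φ i) i j = 0 := by
  simp only [serreEl] at h ⊢
  split_ifs at h ⊢ with h1 h2 h3
  · rw [← smul_zero (c i * c j), ← h]
    simp only [smul_mul_assoc, mul_smul_comm]
    module
  · rw [← smul_zero (c i * c i * c j), ← h]
    simp only [smul_mul_assoc, mul_smul_comm]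
    module
  · rw [← smul_zero (c i * c i * c i * c j), ← h]
    simp only [smul_mul_assoc, mul_smul_comm]
    module
  · rfl

/-- The Serre element of a sum of two families that `q`-commute with each other. -/
theorem serreEl_add {a : ℂ} (ha : a ≠ 0) (haq : qpow hb 1 + qpow hb (-1) = a + a⁻¹)
    {x A : ℕ → R} (h : ∀ i k, A i * x k = a ^ ip (simpleRoot N i) (simpleRoot N k) • (x k * A i))
    (i j : ℕ) :
    serreEl hb N (fun i => x i + A i) i j = serreEl hb N x i j + serreEl hb N A i j := by
  have h3 : qpow hb 1 + 1 + qpow hb (-1) = a + 1 + a⁻¹ := by linear_combination haq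
  have e1 := h i j
  have e2 := h j i
  have e3 := h i i
  rw [ip_comm] at e2
  simp only [serreEl]
  split_ifs with h1 h2 h4
  · rw [h1, zpow_zero, one_smul] at e1 e2
    simp only [mul_add, add_mul, e1, e2]
    abel
  · rw [h2.1, zpow_neg_one] at e1 e2
    rw [h2.2] at e3
    norm_cast at e3
    have e1' : ∀ t, A i * (x j * t) = a⁻¹ • (x j * (A i * t)) := fun t => by
      rw [← mul_assoc, e1, smul_mul_assoc, mul_assoc]
    have e2' : ∀ t, A j * (x i * t) = a⁻¹ • (x i * (A j * t)) := fun t => by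
      rw [← mul_assoc, e2, smul_mul_assoc, mul_assoc]
    have e3' : ∀ t, A i * (x i * t) = a ^ 2 • (x i * (A i * t)) := fun t => by
      rw [← mul_assoc, e3, smul_mul_assoc, mul_assoc]
    -- With every x moved to the left of every A, the coefficient of each mixed monomial vanishes
    -- once [2]_q is written as a + a⁻¹.
    rw [haq]
    simp only [mul_add, add_mul, e1, e2, e3, e1', e2', e3', mul_smul_comm, smul_add, smul_smul]
    match_scalars <;> field_simp <;> ring
  · rw [h4.1, zpow_neg_one] at e1 e2
    rw [h4.2, zpow_one] at e3
    have e1' : ∀ t, A i * (x j * t) = a⁻¹ • (x j * (A i * t)) := fun t => by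
      rw [← mul_assoc, e1, smul_mul_assoc, mul_assoc]
    have e2' : ∀ t, A j * (x i * t) = a⁻¹ • (x i * (A j * t)) := fun t => by
      rw [← mul_assoc, e2, smul_mul_assoc, mul_assoc]
    have e3' : ∀ t, A i * (x i * t) = a • (x i * (A i * t)) := fun t => by
      rw [← mul_assoc, e3, smul_mul_assoc, mul_assoc]
    rw [h3]
    simp only [mul_add, add_mul, e1, e2, e3, e1', e2', e3', mul_smul_comm, smul_add, smul_smul]
    match_scalars <;> field_simp <;> ring
  · simp

theorem isSerre_iff_serreOps {X : Type*} [AddCommGroup X] [Module ℂ X]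
    {φ : ℕ → Module.End ℂ X} : IsSerre hb N φ ↔ SerreOps hb N 0 φ := by
  constructor
  · intro h
    refine ⟨fun i j h1 h2 h3 h4 hij h0 x => ?_, fun i j h1 h2 h3 h4 h5 h6 x => ?_,
      fun i j h1 h2 h3 h4 h5 h6 x => ?_⟩
    · have := h i j h1 h2 h3 h4 hij
      rw [serreEl, if_pos h0] at this
      exact sub_eq_zero.mp (LinearMap.congr_fun this x)
    · have := h i j h1 h2 h3 h4 (by rintro rfl; omega)
      rw [serreEl, if_neg (by omega), if_pos ⟨h5, h6⟩] at this
      exact LinearMap.congr_fun this x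
    · have := h i j h1 h2 h3 h4 (by rintro rfl; omega)
      rw [serreEl, if_neg (by omega), if_neg (by omega), if_pos ⟨h5, h6⟩] at this
      exact LinearMap.congr_fun this x
  · intro h i j h1 h2 h3 h4 hij
    ext x
    simp only [serreEl]
    split_ifs with h5 h6 h7
    · exact sub_eq_zero.mpr (h.comm i j h1 h2 h3 h4 hij h5 x)
    · exact h.long i j h1 h2 h3 h4 h6.1 h6.2 x
    · exact h.short i j h1 h2 h3 h4 h7.1 h7.2 x
    · rfl

end SerreElement


/-! ### The module presented by the Serre relations and the Levi generators -/

section NegativePart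

variable (hb : ℂ) (N : ℕ)

/-- The quantum Serre relations on the free algebra with generators `f_1, f_2, …`. -/
inductive NegRel : FreeAlgebra ℂ ℕ → FreeAlgebra ℂ ℕ → Prop
  | serre (i j : ℕ) (h1 : 1 ≤ i) (h2 : i ≤ N / 2) (h3 : 1 ≤ j) (h4 : j ≤ N / 2) (h : i ≠ j) :
      NegRel (serreEl hb N (FreeAlgebra.ι ℂ) i j) 0

/-- The algebra generated by `f_1, f_2, …` subject to the quantum Serre relations. -/
def Neg : Type := RingQuot (NegRel hb N)

instance : Ring (Neg hb N) := inferInstanceAs (Ring (RingQuot (NegRel hb N)))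

instance : Algebra ℂ (Neg hb N) := inferInstanceAs (Algebra ℂ (RingQuot (NegRel hb N)))

/-- The projection of the free algebra. -/
def negMk : FreeAlgebra ℂ ℕ →ₐ[ℂ] Neg hb N := RingQuot.mkAlgHom ℂ (NegRel hb N)

theorem negMk_surjective : Function.Surjective (negMk hb N) :=
  RingQuot.mkAlgHom_surjective ℂ (NegRel hb N)

/-- The generator `f_i`. -/
def negGen (i : ℕ) : Neg hb N := negMk hb N (FreeAlgebra.ι ℂ i)

theorem isSerre_negGen : IsSerre hb N (negGen hb N) := fun i j h1 h2 h3 h4 h => by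
  have : negMk hb N _ = negMk hb N _ :=
    RingQuot.mkAlgHom_rel ℂ (NegRel.serre (hb := hb) (N := N) i j h1 h2 h3 h4 h)
  rwa [map_serreEl, map_zero] at this

variable {hb N} in
theorem exists_negLift {R : Type*} [Ring R] [Algebra ℂ R] {φ : ℕ → R} (h : IsSerre hb N φ) :
    ∃ ρ : Neg hb N →ₐ[ℂ] R, ∀ i, ρ (negGen hb N i) = φ i := by
  refine ⟨(RingQuot.liftAlgHom ℂ ⟨FreeAlgebra.lift ℂ φ, ?_⟩ : RingQuot (NegRel hb N) →ₐ[ℂ] R),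
    fun i => ?_⟩
  · rintro _ _ ⟨i, j, h1, h2, h3, h4, hij⟩
    rw [map_serreEl, map_zero]
    simp only [FreeAlgebra.lift_ι_apply]
    exact h i j h1 h2 h3 h4 hij
  · exact (RingQuot.liftAlgHom_mkAlgHom_apply _ _ _ _).trans (FreeAlgebra.lift_ι_apply _ _)

/-- The quotient of the algebra generated by the `f_i` by the left ideal generated by the `f_i`
with `i ∈ L`. -/
def NegVerma (L : Set ℕ) : Type := Neg hb N ⧸ Submodule.span (Neg hb N) (negGen hb N '' L)

variable (L : Set ℕ)

instance : AddCommGroup (NegVerma hb N L) :=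
  inferInstanceAs (AddCommGroup (Neg hb N ⧸ Submodule.span (Neg hb N) (negGen hb N '' L)))

instance : Module (Neg hb N) (NegVerma hb N L) :=
  inferInstanceAs (Module (Neg hb N) (Neg hb N ⧸ Submodule.span (Neg hb N) (negGen hb N '' L)))

instance : Module ℂ (NegVerma hb N L) :=
  inferInstanceAs (Module ℂ (Neg hb N ⧸ Submodule.span (Neg hb N) (negGen hb N '' L)))

instance : IsScalarTower ℂ (Neg hb N) (NegVerma hb N L) :=
  inferInstanceAs
    (IsScalarTower ℂ (Neg hb N) (Neg hb N ⧸ Submodule.span (Neg hb N) (negGen hb N '' L)))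

/-- The projection of the algebra. -/
def negVermaMk : Neg hb N →ₗ[Neg hb N] NegVerma hb N L :=
  (Submodule.span (Neg hb N) (negGen hb N '' L)).mkQ

theorem negVermaMk_surjective : Function.Surjective (negVermaMk hb N L) :=
  Submodule.mkQ_surjective _

/-- The canonical generator. -/
def negVac : NegVerma hb N L := negVermaMk hb N L 1

/-- The operator `f_i`. -/
def negF (i : ℕ) : Module.End ℂ (NegVerma hb N L) := Algebra.lsmul ℂ ℂ _ (negGen hb N i)

theorem isSerre_negF : IsSerre hb N (negF hb N L) := fun i j h1 h2 h3 h4 h => by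
  rw [show negF hb N L = fun i => Algebra.lsmul ℂ ℂ (NegVerma hb N L) (negGen hb N i) from rfl,
    ← map_serreEl, isSerre_negGen hb N i j h1 h2 h3 h4 h, map_zero]

variable {hb N L}

theorem negF_negVac {i : ℕ} (h : i ∈ L) : negF hb N L i (negVac hb N L) = 0 := by
  change negGen hb N i • negVermaMk hb N L 1 = _
  rw [← map_smul, smul_eq_mul, mul_one]
  exact (Submodule.Quotient.mk_eq_zero _).mpr (Submodule.subset_span ⟨i, h, rfl⟩)

theorem NegVerma.eq_top {p : Submodule ℂ (NegVerma hb N L)} (h0 : negVac hb N L ∈ p)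
    (hf : ∀ i, ∀ x ∈ p, negF hb N L i x ∈ p) (x : NegVerma hb N L) : x ∈ p := by
  have key : ∀ u : FreeAlgebra ℂ ℕ, ∀ y ∈ p, negMk hb N u • y ∈ p := by
    intro u
    induction u using FreeAlgebra.induction with
    | grade0 c =>
      intro y hy
      rw [AlgHom.commutes, algebraMap_smul]
      exact p.smul_mem c hy
    | grade1 i => exact fun y hy => hf i y hy
    | mul a b ha hb =>
      intro y hy
      rw [map_mul, mul_smul]
      exact ha _ (hb _ hy)
    | add a b ha hb =>
      intro y hy
      rw [map_add, add_smul]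
      exact p.add_mem (ha _ hy) (hb _ hy)
  obtain ⟨u, rfl⟩ := negVermaMk_surjective hb N L x
  obtain ⟨u, rfl⟩ := negMk_surjective hb N u
  have := key u _ h0
  rwa [negVac, ← map_smul, smul_eq_mul, mul_one] at this

/-- The operators φ need not satisfy any relations here; this allows twisted intertwining properties
to be compared. -/
theorem NegVerma.hom_ext {Y : Type*} [AddCommGroup Y] [Module ℂ Y]
    {T T' : NegVerma hb N L →ₗ[ℂ] Y} (φ : ℕ → Module.End ℂ Y)
    (h0 : T (negVac hb N L) = T' (negVac hb N L))
    (h : ∀ i x, T (negF hb N L i x) = φ i (T x)) (h' : ∀ i x, T' (negF hb N L i x) = φ i (T' x)) :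
    T = T' := by
  ext x
  refine NegVerma.eq_top (p := LinearMap.eqLocus T T') h0 (fun i x hx => ?_) x
  rw [LinearMap.mem_eqLocus] at hx ⊢
  rw [h, h', hx]

theorem NegVerma.exists_lift {Y : Type*} [AddCommGroup Y] [Module ℂ Y]
    {φ : ℕ → Module.End ℂ Y} (h : IsSerre hb N φ) {y : Y} (hy : ∀ i ∈ L, φ i y = 0) :
    ∃ T : NegVerma hb N L →ₗ[ℂ] Y, T (negVac hb N L) = y ∧
      ∀ i x, T (negF hb N L i x) = φ i (T x) := by
  obtain ⟨ρ, hρ⟩ := exists_negLift h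
  let I := Submodule.span (Neg hb N) (negGen hb N '' L)
  let g : Neg hb N →ₗ[ℂ] Y := (LinearMap.applyₗ y).comp ρ.toLinearMap
  have hg : ∀ u, g u = ρ u y := fun _ => rfl
  have hI : I.restrictScalars ℂ ≤ LinearMap.ker g := by
    intro u hu
    rw [LinearMap.mem_ker]
    refine Submodule.span_induction (p := fun u _ => g u = 0) ?_ (map_zero g) ?_ ?_ hu
    · rintro _ ⟨i, hi, rfl⟩
      rw [hg, hρ, hy i hi]
    · intro a b _ _ ha hb
      rw [map_add, ha, hb, add_zero]
    · intro a b _ hb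
      rw [hg] at hb ⊢
      rw [smul_eq_mul, map_mul, Module.End.mul_apply, hb, map_zero]
  let T : NegVerma hb N L →ₗ[ℂ] Y :=
    ((I.restrictScalars ℂ).liftQ g hI).comp
      (Submodule.Quotient.restrictScalarsEquiv ℂ I).symm.toLinearMap
  have hT : ∀ u, T (negVermaMk hb N L u) = ρ u y := fun _ => rfl
  refine ⟨T, ?_, fun i x => ?_⟩
  · rw [negVac, hT, map_one, Module.End.one_apply]
  · obtain ⟨u, rfl⟩ := negVermaMk_surjective hb N L x
    change T (negGen hb N i • negVermaMk hb N L u) = _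
    rw [← map_smul, smul_eq_mul, hT, hT, map_mul, hρ, Module.End.mul_apply]

end NegativePart

/-! ### The quantum group acts on the presented module -/

section Model

variable {hb : ℂ} {N : ℕ} {L : Set ℕ} (lam : Node N → ℂ)

theorem pair_add (μ ν : Lat N) : pair lam (μ + ν) = pair lam μ + pair lam ν := by
  simp [pair, mul_add, Finset.sum_add_distrib]

theorem pair_zero : pair lam (0 : Lat N) = 0 := by simp [pair]

theorem pair_neg (μ : Lat N) : pair lam (-μ) = -pair lam μ := by simp [pair]

theorem ip_add_left (μ ν α : Lat N) : ip (μ + ν) α = ip μ α + ip ν α := by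
  simp [ip, add_mul, Finset.sum_add_distrib]

theorem ip_zero_left (α : Lat N) : ip (0 : Lat N) α = 0 := by simp [ip]

theorem ip_neg_left (μ α : Lat N) : ip (-μ) α = -ip μ α := by simp [ip]

variable (hb L) in
-- The rescaled operators q^{-(μ,α_i)} f_i still satisfy the Serre relations, so the universal
-- property provides the map.
theorem exists_negK (μ : Lat N) : ∃ K : Module.End ℂ (NegVerma hb N L),
    K (negVac hb N L) = qpow hb (pair lam μ) • negVac hb N L ∧
    ∀ i x, K (negF hb N L i x) =
      qpow hb (-(ip μ (simpleRoot N i) : ℤ)) • negF hb N L i (K x) :=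
  NegVerma.exists_lift (φ := fun i => qpow hb (-(ip μ (simpleRoot N i) : ℤ)) • negF hb N L i)
    (fun i j h1 h2 h3 h4 h => serreEl_smul _ _ (isSerre_negF hb N L i j h1 h2 h3 h4 h))
    (fun i hi => by
      rw [LinearMap.smul_apply, map_smul, negF_negVac hi, smul_zero, smul_zero])

variable (hb L) in
/-- The operator `q^{h_μ}`. -/
def negK (μ : Lat N) : Module.End ℂ (NegVerma hb N L) := (exists_negK hb L lam μ).choose

theorem negK_negVac (μ : Lat N) :
    negK hb L lam μ (negVac hb N L) = qpow hb (pair lam μ) • negVac hb N L :=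
  (exists_negK hb L lam μ).choose_spec.1

theorem negK_negF (μ : Lat N) (i : ℕ) (x : NegVerma hb N L) : negK hb L lam μ (negF hb N L i x) =
    qpow hb (-(ip μ (simpleRoot N i) : ℤ)) • negF hb N L i (negK hb L lam μ x) :=
  (exists_negK hb L lam μ).choose_spec.2 i x

theorem negK_zero : negK hb L lam 0 = 1 := by
  refine NegVerma.hom_ext (negF hb N L) ?_ (fun i x => ?_) (fun i x => rfl)
  · rw [negK_negVac, pair_zero, qpow_zero, one_smul]; rfl
  · rw [negK_negF, ip_zero_left, Int.cast_zero, neg_zero, qpow_zero, one_smul]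

theorem negK_add (μ ν : Lat N) : negK hb L lam (μ + ν) = negK hb L lam μ * negK hb L lam ν := by
  refine NegVerma.hom_ext
    (fun i => qpow hb (-(ip (μ + ν) (simpleRoot N i) : ℤ)) • negF hb N L i) ?_
    (fun i x => negK_negF lam _ i x) (fun i x => ?_)
  · rw [Module.End.mul_apply, negK_negVac, negK_negVac, map_smul, negK_negVac, smul_smul, pair_add,
      qpow_add, mul_comm]
  · rw [Module.End.mul_apply, negK_negF, map_smul, negK_negF, smul_smul, LinearMap.smul_apply,
      ← qpow_add, Module.End.mul_apply, ip_add_left]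
    congr 2
    push_cast
    ring

/-- The operator `[h_{α_i}]`. -/
def negH (hb : ℂ) {N : ℕ} (L : Set ℕ) (lam : Node N → ℂ) (i : ℕ) :
    Module.End ℂ (NegVerma hb N L) :=
  (qpow hb 1 - qpow hb (-1))⁻¹ •
    (negK hb L lam (simpleRoot N i) - negK hb L lam (-simpleRoot N i))

/-- An upper triangular block operator, diagonal except for `u` if `i = k`. -/
def offDiag {X : Type*} [AddCommGroup X] [Module ℂ X] (u : Module.End ℂ X) (k i : ℕ) :
    Module.End ℂ (X × X) :=
  if i = k then (LinearMap.inl ℂ X X).comp (u.comp (LinearMap.snd ℂ X X)) else 0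

theorem offDiag_apply {X : Type*} [AddCommGroup X] [Module ℂ X] (u : Module.End ℂ X) (k i : ℕ)
    (x : X × X) : offDiag u k i x = if i = k then (u x.2, 0) else 0 := by
  rw [offDiag]; split_ifs <;> rfl

theorem qpow_intCast (c : ℂ) (z : ℤ) : qpow hb (c * z) = qpow hb c ^ z := by
  rw [qpow, qpow, ← Complex.exp_int_mul]; ring_nf

/-- The Serre elements of diagonal block operators with an off-diagonal part. -/
theorem serreEl_prodMap_add_offDiag {X : Type*} [AddCommGroup X] [Module ℂ X]
    (φ : ℕ → Module.End ℂ X) (k : ℕ) (u w : Module.End ℂ X) {a : ℂ} (ha : a ≠ 0)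
    (haq : qpow hb 1 + qpow hb (-1) = a + a⁻¹)
    (hu : ∀ i x, u (φ i x) = a ^ ip (simpleRoot N k) (simpleRoot N i) • φ i (u x))
    (hw : ∀ i x, w (φ i x) = a⁻¹ ^ ip (simpleRoot N k) (simpleRoot N i) • φ i (w x))
    {i j : ℕ} (hij : i ≠ j) :
    serreEl hb N (fun i => LinearMap.prodMap (φ i) (φ i) + offDiag u k i + offDiag w k i) i j =
      LinearMap.prodMap (serreEl hb N φ i j) (serreEl hb N φ i j) := by
  have hz : ∀ u : Module.End ℂ X, serreEl hb N (offDiag u k) i j = 0 := fun u => by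
    apply serreEl_of_eq_zero
    by_cases hi : i = k
    · exact Or.inr (by rw [offDiag, if_neg (by omega)])
    · exact Or.inl (by rw [offDiag, if_neg hi])
  rw [serreEl_add (a := a⁻¹) (inv_ne_zero ha) (by rw [haq, inv_inv, add_comm]), serreEl_add ha haq,
    hz, hz, add_zero, add_zero]
  · refine LinearMap.ext fun x => Prod.ext ?_ ?_
    · exact (serreEl_intertwine (LinearMap.fst ℂ X X) (fun _ => rfl) (fun _ => rfl) x)
    · exact (serreEl_intertwine (LinearMap.snd ℂ X X) (fun _ => rfl) (fun _ => rfl) x)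
  · intro i m
    refine LinearMap.ext fun x => ?_
    simp only [Module.End.mul_apply, LinearMap.smul_apply, offDiag_apply, LinearMap.prodMap_apply]
    split_ifs with h
    · subst h
      simp [hu]
    · simp [Prod.zero_eq_mk]
  · intro i m
    refine LinearMap.ext fun x => ?_
    simp only [Module.End.mul_apply, LinearMap.smul_apply, offDiag_apply, LinearMap.prodMap_apply,
      LinearMap.add_apply]
    split_ifs with h h'
    · subst h
      simp [hw]
    · subst h
      simp [hw]
    · simp [Prod.zero_eq_mk]
    · simp [Prod.zero_eq_mk]

section Raising

variable (hL : ∀ i ∈ L, pair lam (simpleRoot N i) = 0)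

theorem negK_negF_zpow (k i : ℕ) (x : NegVerma hb N L) :
    negK hb L lam (simpleRoot N k) (negF hb N L i x) =
      (qpow hb (-1)) ^ ip (simpleRoot N k) (simpleRoot N i) •
        negF hb N L i (negK hb L lam (simpleRoot N k) x) := by
  rw [negK_negF, ← qpow_intCast]
  congr 2; ring

theorem negK_neg_negF_zpow (k i : ℕ) (x : NegVerma hb N L) :
    negK hb L lam (-simpleRoot N k) (negF hb N L i x) =
      (qpow hb (-1))⁻¹ ^ ip (simpleRoot N k) (simpleRoot N i) •
        negF hb N L i (negK hb L lam (-simpleRoot N k) x) := by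
  rw [negK_negF, ← qpow_neg, ← qpow_intCast, ip_neg_left]
  congr 2; push_cast; ring

theorem negH_negVac {i : ℕ} (h : pair lam (simpleRoot N i) = 0) :
    negH hb L lam i (negVac hb N L) = 0 := by
  simp [negH, negK_negVac, pair_neg, h]

theorem negH_apply (i : ℕ) (x : NegVerma hb N L) : negH hb L lam i x =
    (((qpow hb 1 - qpow hb (-1))⁻¹ • negK hb L lam (simpleRoot N i)) x +
      (-(qpow hb 1 - qpow hb (-1))⁻¹ • negK hb L lam (-simpleRoot N i)) x) := by
  simp [negH, sub_eq_add_neg]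

include hL in
variable (hb) in
-- The operator is read off as the first component of a map x ↦ (E x, x). That map is the lift for
-- block triangular operators with f_i on the diagonal and, for i = k, [h_{α_k}] above it. They
-- satisfy the Serre relations because q^{±h_{α_k}} q-commute with the f_i. The condition `hL` makes
-- the generators with index in L kill the initial vector.
theorem exists_negE (k : ℕ) : ∃ E : Module.End ℂ (NegVerma hb N L), E (negVac hb N L) = 0 ∧
    ∀ i x, E (negF hb N L i x) = negF hb N L i (E x) + if i = k then negH hb L lam k x else 0 := by
  let c := (qpow hb 1 - qpow hb (-1))⁻¹
  let φ : ℕ → Module.End ℂ (NegVerma hb N L × NegVerma hb N L) := fun i =>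
    LinearMap.prodMap (negF hb N L i) (negF hb N L i) +
      offDiag (c • negK hb L lam (simpleRoot N k)) k i +
      offDiag (-c • negK hb L lam (-simpleRoot N k)) k i
  have hφ : ∀ i x, φ i x = (negF hb N L i x.1 + if i = k then negH hb L lam k x.2 else 0,
      negF hb N L i x.2) := by
    intro i x
    simp only [φ, LinearMap.add_apply, offDiag_apply, LinearMap.prodMap_apply]
    split_ifs with h
    · rw [negH_apply]; simp [c, add_assoc]
    · simp
  have hs : IsSerre hb N φ := by
    intro i j h1 h2 h3 h4 hij
    rw [serreEl_prodMap_add_offDiag _ k _ _ (qpow_ne_zero hb (-1))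
      (by rw [qpow_neg, inv_inv, add_comm]) _ _ hij, isSerre_negF hb N L i j h1 h2 h3 h4 hij]
    · rfl
    · intro i x
      rw [LinearMap.smul_apply, negK_negF_zpow, LinearMap.smul_apply, map_smul, smul_comm]
    · intro i x
      rw [LinearMap.smul_apply, negK_neg_negF_zpow, LinearMap.smul_apply, map_smul, smul_comm]
  obtain ⟨T, hT0, hT⟩ := NegVerma.exists_lift hs (y := (0, negVac hb N L)) (L := L) (by
    intro i hi
    rw [hφ, negF_negVac hi, map_zero, zero_add]
    split_ifs with h
    · subst h; rw [negH_negVac lam (hL i hi)]; rfl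
    · rfl)
  have h2 : (LinearMap.snd ℂ _ _).comp T = LinearMap.id :=
    NegVerma.hom_ext (negF hb N L) (by simp [hT0]) (fun i x => by simp [hT, hφ]) (fun i x => rfl)
  refine ⟨(LinearMap.fst ℂ _ _).comp T, by simp [hT0], fun i x => ?_⟩
  have h2' : (T x).2 = x := LinearMap.congr_fun h2 x
  simp [hT, hφ, h2']

variable (hb) in
/-- The operator `e_k`. -/
def negE (k : ℕ) : Module.End ℂ (NegVerma hb N L) := (exists_negE hb lam hL k).choose

theorem negE_negVac (k : ℕ) : negE hb lam hL k (negVac hb N L) = 0 :=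
  (exists_negE hb lam hL k).choose_spec.1

theorem negE_negF (k i : ℕ) (x : NegVerma hb N L) : negE hb lam hL k (negF hb N L i x) =
    negF hb N L i (negE hb lam hL k x) + if i = k then negH hb L lam k x else 0 :=
  (exists_negE hb lam hL k).choose_spec.2 i x

theorem negK_comm (μ ν : Lat N) (x : NegVerma hb N L) :
    negK hb L lam μ (negK hb L lam ν x) = negK hb L lam ν (negK hb L lam μ x) := by
  rw [← Module.End.mul_apply, ← negK_add, add_comm, negK_add, Module.End.mul_apply]

theorem negK_negE (μ : Lat N) (k : ℕ) (x : NegVerma hb N L) :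
    negK hb L lam μ (negE hb lam hL k x) =
      qpow hb (ip μ (simpleRoot N k) : ℤ) • negE hb lam hL k (negK hb L lam μ x) := by
  refine NegVerma.eq_top (p := LinearMap.eqLocus (negK hb L lam μ * negE hb lam hL k)
    (qpow hb (ip μ (simpleRoot N k) : ℤ) • (negE hb lam hL k * negK hb L lam μ))) ?_ ?_ x
  · simp [negE_negVac, negK_negVac]
  · intro i x hx
    simp only [LinearMap.mem_eqLocus, Module.End.mul_apply, LinearMap.smul_apply] at hx ⊢
    rw [negE_negF, map_add, negK_negF, hx, negK_negF, map_smul (negE hb lam hL k), negE_negF,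
      smul_add, smul_add, map_smul (negF hb N L i), smul_comm]
    congr 1
    split_ifs with h
    · subst h
      rw [smul_smul, ← qpow_add, add_neg_cancel, qpow_zero, one_smul]
      simp only [negH, LinearMap.smul_apply, LinearMap.sub_apply, map_smul, map_sub,
        negK_comm lam μ]
    · simp

/-- The Serre elements of the operators `e_i` commute with the operators `f_k`. -/
theorem serreEl_negE_negF {i j : ℕ} (hij : i ≠ j) (k : ℕ) (x : NegVerma hb N L) :
    serreEl hb N (negE hb lam hL) i j (negF hb N L k x) =
      negF hb N L k (serreEl hb N (negE hb lam hL) i j x) := by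
  let c := (qpow hb 1 - qpow hb (-1))⁻¹
  let φ : ℕ → Module.End ℂ (NegVerma hb N L × NegVerma hb N L) := fun i =>
    LinearMap.prodMap (negE hb lam hL i) (negE hb lam hL i) +
      offDiag (-c • negK hb L lam (simpleRoot N k)) k i +
      offDiag (c • negK hb L lam (-simpleRoot N k)) k i
  -- The graph x ↦ (f_k x, x) intertwines e_i with a block triangular operator whose corner is
  -- -[h_{α_k}] for i = k. As before, the corner does not affect the Serre elements.
  let T : NegVerma hb N L →ₗ[ℂ] NegVerma hb N L × NegVerma hb N L :=
    (negF hb N L k).prod LinearMap.id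
  have hT : ∀ i x, T (negE hb lam hL i x) = φ i (T x) := by
    intro i x
    simp only [φ, T, LinearMap.add_apply, offDiag_apply, LinearMap.prodMap_apply,
      LinearMap.prod_apply, Function.prod_apply, negE_negF, LinearMap.id_apply]
    by_cases h : i = k
    · subst h
      rw [if_pos rfl, if_pos rfl, if_pos rfl, negH_apply]
      simp only [neg_smul, LinearMap.neg_apply, LinearMap.smul_apply, Prod.mk_add_mk, add_zero, c]
      congr 1
      abel
    · rw [if_neg h, if_neg h, if_neg (Ne.symm h), add_zero, add_zero, add_zero]
  have := serreEl_intertwine (hb := hb) (N := N) T (hT i) (hT j) x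
  rw [serreEl_prodMap_add_offDiag _ k _ _ (qpow_ne_zero hb 1) (by rw [qpow_neg]) _ _ hij] at this
  · exact (congrArg Prod.fst this).symm
  · intro i x
    rw [LinearMap.smul_apply, negK_negE, LinearMap.smul_apply, map_smul, smul_comm, ← qpow_intCast,
      one_mul]
  · intro i x
    rw [LinearMap.smul_apply, negK_negE, LinearMap.smul_apply, map_smul, smul_comm, ← qpow_neg,
      ← qpow_intCast, ip_neg_left]
    congr 2
    push_cast
    ring_nf

/-- A Serre element of the e_i commutes with every f_k and kills the generator, hence it is zero. -/
theorem isSerre_negE : IsSerre hb N (negE hb lam hL) := by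
  intro i j _ _ _ _ hij
  refine NegVerma.hom_ext (negF hb N L) ?_ (serreEl_negE_negF lam hL hij) (fun i x => by simp)
  simp only [serreEl]
  split_ifs <;> simp [negE_negVac]

/-- The action of the generators on the model. -/
def negAct : Gen N → Module.End ℂ (NegVerma hb N L)
  | Gen.e i => negE hb lam hL i
  | Gen.f i => negF hb N L i
  | Gen.K μ => negK hb L lam μ

theorem negAct_rel {x y : Free N} (h : Rel hb N x y) :
    FreeAlgebra.lift ℂ (negAct lam hL) x = FreeAlgebra.lift ℂ (negAct (hb := hb) lam hL) y := by
  have hne : ∀ i j : Node N, i ≠ j → (i : ℕ) ≠ j := fun i j h h' => h (Subtype.ext h')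
  have hm := fun i : Node N => Finset.mem_Icc.mp i.2
  have he := fun i j : Node N => fun h : i ≠ j => isSerre_negE (hb := hb) lam hL i j (hm i).1 (hm i).2
    (hm j).1 (hm j).2 (hne _ _ h)
  have hf := fun i j : Node N => fun h : i ≠ j => isSerre_negF hb N L i j (hm i).1 (hm i).2
    (hm j).1 (hm j).2 (hne _ _ h)
  cases h with
  | K_zero => simp [negAct, negK_zero]
  | K_add μ ν => simp [negAct, negK_add]
  | K_e μ i => ext x; simp [negAct, negK_negE]
  | K_f μ i => ext x; simp [negAct, negK_negF]
  | e_f_same i => ext x; simp [negAct, negE_negF, negH]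
  | e_f_ne i j h => ext x; simp [negAct, negE_negF, (hne _ _ h).symm]
  | e_comm i j h h0 =>
    have := he i j h
    rw [serreEl, if_pos h0] at this
    simpa [negAct] using sub_eq_zero.mp this
  | f_comm i j h h0 =>
    have := hf i j h
    rw [serreEl, if_pos h0] at this
    simpa [negAct] using sub_eq_zero.mp this
  | e_long i j h1 h2 =>
    have := he i j (by rintro rfl; omega)
    rw [serreEl, if_neg (by omega), if_pos ⟨h1, h2⟩] at this
    simpa [negAct, serreLong, pow_succ, mul_assoc] using this
  | f_long i j h1 h2 =>
    have := hf i j (by rintro rfl; omega)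
    rw [serreEl, if_neg (by omega), if_pos ⟨h1, h2⟩] at this
    simpa [negAct, serreLong, pow_succ, mul_assoc] using this
  | e_short i j h1 h2 =>
    have := he i j (by rintro rfl; omega)
    rw [serreEl, if_neg (by omega), if_neg (by omega), if_pos ⟨h1, h2⟩] at this
    simpa [negAct, serreShort, pow_succ, mul_assoc] using this
  | f_short i j h1 h2 =>
    have := hf i j (by rintro rfl; omega)
    rw [serreEl, if_neg (by omega), if_neg (by omega), if_pos ⟨h1, h2⟩] at this
    simpa [negAct, serreShort, pow_succ, mul_assoc] using this

/-- The representation of the quantum group on the model. -/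
def negRep : Uq hb N →ₐ[ℂ] Module.End ℂ (NegVerma hb N L) :=
  RingQuot.liftAlgHom ℂ ⟨FreeAlgebra.lift ℂ (negAct lam hL), fun _ _ h => negAct_rel lam hL h⟩

theorem negRep_gen (g : Gen N) : negRep lam hL (gen hb N g) = negAct lam hL g :=
  (RingQuot.liftAlgHom_mkAlgHom_apply _ _ _ _).trans (FreeAlgebra.lift_ι_apply _ _)

end Raising

end Model

/-! ### Lifting linear maps from the parabolic Verma module -/

section VermaLift

variable {hb : ℂ} {l P : ℕ} {lam : Node (2 * l + 2 + P) → ℂ}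

/-- The nodes of the Levi subalgebra. -/
def leviNodes (l P : ℕ) : Set ℕ :=
  {i | i ∈ Finset.Icc 1 ((2 * l + 2 + P) / 2) ∧
    ∀ k : Node (2 * l + 2 + P), (k : ℕ) ≤ l + 1 → simpleRoot (2 * l + 2 + P) i k = 0}

/-- The universal property of the parabolic Verma module with respect to the operators `f_i`. -/
theorem Verma.exists_lift (hlam : ∀ i : Node (2 * l + 2 + P), l + 2 ≤ (i : ℕ) → lam i = 0)
    {Y : Type*} [AddCommGroup Y] [Module ℂ Y] {φ : ℕ → Module.End ℂ Y}
    (h : IsSerre hb (2 * l + 2 + P) φ) {y : Y} (hy : ∀ i ∈ leviNodes l P, φ i y = 0) :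
    ∃ T : Verma hb l P lam →ₗ[ℂ] Y, T (vacuum hb l P lam) = y ∧
      ∀ i, 1 ≤ i → i ≤ (2 * l + 2 + P) / 2 → ∀ x, T (fGen hb (2 * l + 2 + P) i • x) = φ i (T x) := by
  -- Levi roots are supported on the coordinates beyond l + 1, where λ vanishes.
  have hL : ∀ i ∈ leviNodes l P, pair lam (simpleRoot (2 * l + 2 + P) i) = 0 := by
    rintro i ⟨-, hi⟩
    refine Finset.sum_eq_zero fun k _ => ?_
    by_cases hk : (k : ℕ) ≤ l + 1
    · rw [hi k hk, Int.cast_zero, mul_zero]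
    · rw [hlam k (by omega), zero_mul]
  obtain ⟨T, hT0, hT⟩ := NegVerma.exists_lift h hy
  let ρ := negRep (hb := hb) lam hL
  let g : Uq hb (2 * l + 2 + P) →ₗ[ℂ] Y :=
    T.comp ((LinearMap.applyₗ (negVac hb _ (leviNodes l P))).comp ρ.toLinearMap)
  have hg : ∀ u, g u = T (ρ u (negVac hb _ _)) := fun _ => rfl
  -- The generator of the presented module satisfies all defining relations of v_λ, so the Verma
  -- module maps to it, and from there to Y.
  have hI : (vermaIdeal hb l P lam).restrictScalars ℂ ≤ LinearMap.ker g := by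
    intro u hu
    rw [LinearMap.mem_ker, hg]
    suffices ρ u (negVac hb _ _) = 0 by rw [this, map_zero]
    refine Submodule.span_induction (p := fun u _ => ρ u (negVac hb _ _) = 0) ?_ (by simp) ?_ ?_ hu
    · rintro _ ((⟨i, rfl⟩ | ⟨μ, rfl⟩) | ⟨i, hi, rfl⟩)
      · rw [eGen, dif_pos i.2, negRep_gen]
        exact negE_negVac lam hL i
      · rw [map_sub, map_smul, map_one, KGen, negRep_gen, LinearMap.sub_apply, LinearMap.smul_apply,
          Module.End.one_apply, sub_eq_zero]
        exact negK_negVac lam μ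
      · rw [fGen, dif_pos i.2, negRep_gen]
        exact negF_negVac ⟨i.2, hi⟩
    · intro a b _ _ ha hb
      rw [map_add, LinearMap.add_apply, ha, hb, add_zero]
    · intro a b _ hb
      rw [smul_eq_mul, map_mul, Module.End.mul_apply, hb, map_zero]
  let T' : Verma hb l P lam →ₗ[ℂ] Y :=
    (((vermaIdeal hb l P lam).restrictScalars ℂ).liftQ g hI).comp
      (Submodule.Quotient.restrictScalarsEquiv ℂ (vermaIdeal hb l P lam)).symm.toLinearMap
  have hT' : ∀ u, T' (Submodule.Quotient.mk u) = T (ρ u (negVac hb _ _)) := fun _ => rfl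
  refine ⟨T', ?_, fun i h1 h2 x => ?_⟩
  · rw [vacuum, hT', map_one, Module.End.one_apply, hT0]
  · obtain ⟨u, rfl⟩ := Submodule.Quotient.mk_surjective _ x
    rw [← Submodule.Quotient.mk_smul, hT', hT', smul_eq_mul, map_mul, Module.End.mul_apply, fGen,
      dif_pos (Finset.mem_Icc.mpr ⟨h1, h2⟩), negRep_gen]
    exact hT i _

end VermaLift


/-! ### Matrix elements of the natural representation -/

section NaturalShift

variable (N : ℕ)

/-- `f_j w_{a - natD j} = natS j a • w_a` in the natural representation. -/
def natD (j : ℕ) : ℕ := if 2 * j = N then 2 else 1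

/-- The matrix entries of `f_j` in the natural representation. -/
def natS (j a : ℕ) : ℂ := if a = j + 1 then 1 else if a = N - j + natD N j then -1 else 0

variable {N}

theorem natS_ne_zero {j a : ℕ} (h : natS N j a ≠ 0) : a = j + 1 ∨ a = N - j + natD N j := by
  by_contra! h'
  exact h (by rw [natS, if_neg h'.1, if_neg h'.2])

theorem natS_ne_zero_iff {j a : ℕ} : natS N j a ≠ 0 ↔ a = j + 1 ∨ a = N - j + natD N j := by
  refine ⟨natS_ne_zero, fun h => ?_⟩
  rw [natS]; split_ifs <;> simp_all

theorem natD_pos (j : ℕ) : 1 ≤ natD N j := by rw [natD]; split_ifs <;> omega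

theorem ip_eq_zero_nadj (hN : 3 ≤ N) {i j : ℕ} (h1 : 1 ≤ i) (h2 : i ≤ N / 2) (h3 : 1 ≤ j)
    (h4 : j ≤ N / 2) (h0 : ip (simpleRoot N i) (simpleRoot N j) = 0) :
    ¬AdjLt N i j ∧ ¬AdjLt N j i := by
  refine ⟨fun h => ?_, fun h => ?_⟩
  · rw [ip_adjLt hN h1 h4 h] at h0; omega
  · rw [ip_comm, ip_adjLt hN h3 h2 h] at h0; omega

theorem ip_two_long (hN : 3 ≤ N) {i : ℕ}
    (h2 : ip (simpleRoot N i) (simpleRoot N i) = 2) : ¬(2 * i + 1 = N) := by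
  intro h
  have := ip_short hN (show ¬Even N by rw [Nat.even_iff]; omega)
  rw [show N / 2 = i by omega, h2] at this
  omega

theorem ip_one_short (hN : 3 ≤ N) {i : ℕ} (h1 : 1 ≤ i) (hi : i ≤ N / 2)
    (h2 : ip (simpleRoot N i) (simpleRoot N i) = 1) : 2 * i + 1 = N := by
  by_contra h
  have := ip_long hN h1 hi (by rw [Nat.even_iff]; omega)
  omega

theorem natS_far {i j a : ℕ} (h1 : 1 ≤ i) (h2 : i ≤ N / 2) (h3 : 1 ≤ j) (h4 : j ≤ N / 2)
    (hij : i ≠ j) (hn : ¬AdjLt N i j ∧ ¬AdjLt N j i)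
    (hs : ¬((2 * j = N ∧ i + 1 = j) ∨ (2 * i = N ∧ j + 1 = i))) :
    natS N i a * natS N j (a - natD N i) = 0 := by
  by_contra h0
  obtain ⟨e1, e2⟩ := mul_ne_zero_iff.mp h0
  have e1 := natS_ne_zero e1
  have e2 := natS_ne_zero e2
  simp only [AdjLt, Nat.even_iff] at hn
  simp only [natD] at e1 e2
  split_ifs at e1 e2 <;> omega

/-- At the fork there are two paths from w_{n-1} to w_{n+2}, and both carry the sign -1. For other
indices both sides vanish. -/
theorem natS_fork {i a : ℕ} (h1 : 1 ≤ i) (h : 2 * (i + 1) = N) :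
    natS N i a * natS N (i + 1) (a - natD N i) =
      natS N (i + 1) a * natS N i (a - natD N (i + 1)) := by
  subst h
  rw [natD, natD, if_neg (by omega), if_pos rfl]
  by_cases ha : a = i + 3
  · subst ha
    simp [natS, natD, show 2 * (i + 1) - i + 1 = i + 3 by omega,
      show 2 * (i + 1) - (i + 1) + 2 = i + 3 by omega]
  · have h1 : natS (2 * (i + 1)) i a * natS (2 * (i + 1)) (i + 1) (a - 1) = 0 := by
      by_contra h0
      obtain ⟨e1, e2⟩ := mul_ne_zero_iff.mp h0
      have e1 := natS_ne_zero e1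
      have e2 := natS_ne_zero e2
      simp only [natD] at e1 e2
      split_ifs at e1 e2 <;> omega
    have h2 : natS (2 * (i + 1)) (i + 1) a * natS (2 * (i + 1)) i (a - 2) = 0 := by
      by_contra h0
      obtain ⟨e1, e2⟩ := mul_ne_zero_iff.mp h0
      have e1 := natS_ne_zero e1
      have e2 := natS_ne_zero e2
      simp only [natD] at e1 e2
      split_ifs at e1 e2 <;> omega
    rw [h1, h2]

theorem natS_comm {i j a : ℕ} (h1 : 1 ≤ i) (h2 : i ≤ N / 2) (h3 : 1 ≤ j) (h4 : j ≤ N / 2)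
    (hij : i ≠ j) (hn : ¬AdjLt N i j ∧ ¬AdjLt N j i) :
    natS N i a * natS N j (a - natD N i) = natS N j a * natS N i (a - natD N j) := by
  by_cases hs : (2 * j = N ∧ i + 1 = j) ∨ (2 * i = N ∧ j + 1 = i)
  · rcases hs with ⟨h, rfl⟩ | ⟨h, rfl⟩
    · exact natS_fork h1 h
    · exact (natS_fork h3 h).symm
  · rw [natS_far h1 h2 h3 h4 hij hn hs, natS_far h3 h4 h1 h2 hij.symm hn.symm (by tauto)]

/-- In this and the next lemmas the monomials of the higher Serre relations vanish one by one: each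
nonzero entry prescribes the index a, and the prescriptions are incompatible. -/
theorem natS_sq {i a : ℕ} (h1 : 1 ≤ i) (h2 : i ≤ N / 2) (h : ¬(2 * i + 1 = N)) :
    natS N i a * natS N i (a - natD N i) = 0 := by
  by_contra h0
  obtain ⟨e1, e2⟩ := mul_ne_zero_iff.mp h0
  have e1 := natS_ne_zero e1
  have e2 := natS_ne_zero e2
  simp only [natD] at e1 e2
  split_ifs at e1 e2 <;> omega

theorem natS_sandwich {i j a : ℕ} (h1 : 1 ≤ i) (h2 : i ≤ N / 2) (h3 : 1 ≤ j) (h4 : j ≤ N / 2)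
    (_ : i ≠ j) (_ : ¬(2 * i + 1 = N)) :
    natS N i a * (natS N j (a - natD N i) * natS N i (a - natD N i - natD N j)) = 0 := by
  by_contra h0
  obtain ⟨e1, e2, e3⟩ := by simpa only [mul_ne_zero_iff] using h0
  have e1 := natS_ne_zero e1
  have e2 := natS_ne_zero e2
  have e3 := natS_ne_zero e3
  simp only [natD] at e1 e2 e3
  split_ifs at e1 e2 e3 <;> omega

theorem natS_cube {i a : ℕ} (h1 : 1 ≤ i) (h2 : i ≤ N / 2) :
    natS N i a * (natS N i (a - natD N i) * natS N i (a - natD N i - natD N i)) = 0 := by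
  by_contra h0
  obtain ⟨e1, e2, e3⟩ := by simpa only [mul_ne_zero_iff] using h0
  have e1 := natS_ne_zero e1
  have e2 := natS_ne_zero e2
  have e3 := natS_ne_zero e3
  simp only [natD] at e1 e2 e3
  split_ifs at e1 e2 e3 <;> omega

theorem natS_short {i j a : ℕ} (h3 : 1 ≤ j) (h4 : j ≤ N / 2)
    (_ : i ≠ j) (h : 2 * i + 1 = N) :
    natS N i a * (natS N i (a - natD N i) * (natS N j (a - natD N i - natD N i) *
      natS N i (a - natD N i - natD N i - natD N j))) = 0 ∧
    natS N i a * (natS N j (a - natD N i) * (natS N i (a - natD N i - natD N j) *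
      natS N i (a - natD N i - natD N j - natD N i))) = 0 := by
  constructor
  all_goals
    by_contra h0
    obtain ⟨e1, e2, e3, e4⟩ := by simpa only [mul_ne_zero_iff] using h0
    have e1 := natS_ne_zero e1
    have e2 := natS_ne_zero e2
    have e3 := natS_ne_zero e3
    have e4 := natS_ne_zero e4
    simp only [natD] at e1 e2 e3 e4
    split_ifs at e1 e2 e3 e4 <;> omega

end NaturalShift

/-! ### The coproduct of the f_j on the tensor product -/

section TensorF

variable (hb : ℂ) (N : ℕ) (X : Type*) [AddCommGroup X] [Module ℂ X] [Module (Uq hb N) X]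
  [IsScalarTower ℂ (Uq hb N) X]

/-- The operator `1 ⊗ f_j` on the tensor product of the natural representation and `X`. -/
def fDiag (j : ℕ) : Module.End ℂ (ℕ → X) :=
  LinearMap.pi fun a => (fOp hb N X j).comp (LinearMap.proj a)

/-- The operator `f_j ⊗ q^{-h_{α_j}}`. -/
def fShift (j : ℕ) : Module.End ℂ (ℕ → X) :=
  LinearMap.pi fun a => natS N j a •
    ((Algebra.lsmul ℂ ℂ X (KGen hb N (-simpleRoot N j))).comp (LinearMap.proj (a - natD N j)))

variable {hb N X}

theorem fDiag_apply (j : ℕ) (g : ℕ → X) (a : ℕ) : fDiag hb N X j g a = fGen hb N j • g a := rfl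

theorem fShift_apply (j : ℕ) (g : ℕ → X) (a : ℕ) : fShift hb N X j g a =
    natS N j a • KGen hb N (-simpleRoot N j) • g (a - natD N j) := rfl

theorem isSerre_fDiag : IsSerre hb N (fDiag hb N X) := by
  intro i j h1 h2 h3 h4 h
  refine LinearMap.ext fun g => funext fun a => ?_
  have := serreEl_intertwine (hb := hb) (N := N) (φ := fDiag hb N X) (ψ := fOp hb N X) (i := i)
    (j := j) (LinearMap.proj a) (fun _ => rfl) (fun _ => rfl) g
  rw [isSerre_iff_serreOps.mpr fOp_serre i j h1 h2 h3 h4 h] at this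
  exact this

omit [Module ℂ X] [IsScalarTower ℂ (Uq hb N) X] in
theorem KGen_smul_comm (μ ν : Lat N) (x : X) :
    KGen hb N μ • KGen hb N ν • x = KGen hb N ν • KGen hb N μ • x := by
  rw [← mul_smul, ← mul_smul, ← KGen_add, ← KGen_add, add_comm]

theorem KGen_smul_fGen_smul (μ : Lat N) (i : ℕ) (x : X) : KGen hb N μ • fGen hb N i • x =
    qpow hb (-(ip μ (simpleRoot N i) : ℤ)) • fGen hb N i • KGen hb N μ • x := by
  rw [← mul_smul, KGen_mul_fGen, smul_assoc, mul_smul]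

theorem KGen_smul_eGen_smul (μ : Lat N) (i : ℕ) (x : X) : KGen hb N μ • eGen hb N i • x =
    qpow hb (ip μ (simpleRoot N i) : ℤ) • eGen hb N i • KGen hb N μ • x := by
  rw [← mul_smul, KGen_mul_eGen, smul_assoc, mul_smul]

omit [Module ℂ X] [IsScalarTower ℂ (Uq hb N) X] in
theorem KGen_neg_smul_KGen_smul (μ : Lat N) (x : X) : KGen hb N (-μ) • KGen hb N μ • x = x := by
  rw [← mul_smul, ← KGen_add, neg_add_cancel, KGen_zero, one_smul]

theorem isSerre_fShift (hN : 3 ≤ N) : IsSerre hb N (fShift hb N X) := by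
  intro i j h1 h2 h3 h4 hij
  refine LinearMap.ext fun g => funext fun a => ?_
  have hs : ∀ (c d : ℂ) (x : X), c • d • x = (c * d) • x := smul_smul
  simp only [serreEl]
  split_ifs with h h h
  · simp only [LinearMap.sub_apply, Module.End.mul_apply, Pi.sub_apply, fShift_apply,
      smul_smul_comm, hs, LinearMap.zero_apply, Pi.zero_apply, sub_eq_zero]
    rw [natS_comm h1 h2 h3 h4 hij (ip_eq_zero_nadj hN h1 h2 h3 h4 h), KGen_smul_comm,
      Nat.sub_right_comm]
  · have e1 := fun a => natS_sq (a := a) h1 h2 (ip_two_long hN h.2)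
    have e2 := natS_sandwich (a := a) h1 h2 h3 h4 hij (ip_two_long hN h.2)
    simp only [LinearMap.sub_apply, LinearMap.add_apply, LinearMap.smul_apply, Pi.add_apply,
      Pi.smul_apply, Module.End.mul_apply, Pi.sub_apply, fShift_apply,
      smul_smul_comm, hs, LinearMap.zero_apply, Pi.zero_apply, mul_assoc, e1, e2, mul_zero,
      zero_smul, ← mul_assoc, zero_mul, sub_zero, add_zero, smul_zero]
  · obtain ⟨e1, e2⟩ := natS_short (a := a) h3 h4 hij (ip_one_short hN h1 h2 h.2)
    have e3 := fun a => natS_cube (a := a) h1 h2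
    have e1 := congrArg ((qpow hb 1 + 1 + qpow hb (-1)) * ·) e1
    have e2 := congrArg ((qpow hb 1 + 1 + qpow hb (-1)) * ·) e2
    simp only [← mul_assoc, mul_zero] at e1 e2 e3
    have e3' : natS N j a * natS N i (a - natD N j) * natS N i (a - natD N j - natD N i) *
        natS N i (a - natD N j - natD N i - natD N i) = 0 := by
      rw [mul_assoc, mul_assoc, ← mul_assoc (natS N i _), e3, mul_zero]
    simp only [LinearMap.sub_apply, LinearMap.add_apply, LinearMap.smul_apply, Pi.add_apply,
      Pi.smul_apply, Module.End.mul_apply, Pi.sub_apply, fShift_apply,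
      smul_smul_comm, hs, LinearMap.zero_apply, Pi.zero_apply, ← mul_assoc]
    simp only [e1, e2, e3, e3', zero_mul, zero_smul, sub_zero, add_zero]
  · rfl

variable (hb N X) in
/-- The operator `Δ(f_j) = 1 ⊗ f_j + f_j ⊗ q^{-h_{α_j}}`. -/
def fHat (j : ℕ) : Module.End ℂ (ℕ → X) := fDiag hb N X j + fShift hb N X j

theorem fHat_apply (j : ℕ) (g : ℕ → X) (a : ℕ) : fHat hb N X j g a =
    fGen hb N j • g a + natS N j a • KGen hb N (-simpleRoot N j) • g (a - natD N j) := rfl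

/-- The two summands 1 ⊗ f_j and f_j ⊗ q^{-h} q-commute with a = q, so their Serre elements simply
add. -/
theorem isSerre_fHat (hN : 3 ≤ N) : IsSerre hb N (fHat hb N X) := by
  intro i j h1 h2 h3 h4 h
  have := serreEl_add (hb := hb) (N := N) (x := fDiag hb N X) (A := fShift hb N X)
    (qpow_ne_zero hb 1) (by rw [qpow_neg]) (fun i k => ?_) i j
  · refine this.trans ?_
    rw [isSerre_fDiag i j h1 h2 h3 h4 h, isSerre_fShift hN i j h1 h2 h3 h4 h, add_zero]
  · refine LinearMap.ext fun g => funext fun a => ?_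
    simp only [Module.End.mul_apply, LinearMap.smul_apply, Pi.smul_apply, fShift_apply, fDiag_apply]
    rw [KGen_smul_fGen_smul, smul_smul_comm, ip_neg_left, ← qpow_intCast, smul_comm]
    congr 3
    push_cast
    ring

end TensorF


/-! ### Weights and commutators in the natural representation -/

section NaturalWeight

variable {N : ℕ}

theorem eps_eq_zero {i : ℕ} (h : ¬(1 ≤ i ∧ i ≤ N / 2)) : eps N i = 0 := by
  funext k
  have := Finset.mem_Icc.mp k.2
  simp only [eps, Pi.zero_apply, ite_eq_right_iff, one_ne_zero, imp_false]
  rintro rfl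
  exact h this

theorem natWeight_of_natS {i a : ℕ} (h1 : 1 ≤ i) (h2 : i ≤ N / 2) (h : natS N i a ≠ 0) :
    natWeight N a = natWeight N (a - natD N i) - simpleRoot N i := by
  by_cases hi : i < N / 2
  · have hd : natD N i = 1 := if_neg (by omega)
    rcases natS_ne_zero h with rfl | rfl
    · simp [natWeight, simpleRoot, hd, hi, show i + 1 ≤ N / 2 by omega, h2]
    · rw [hd, natWeight, natWeight, simpleRoot, if_neg (by omega), if_neg (by omega), if_pos hi,
        show N + 1 - (N - i + 1) = i by omega, show N + 1 - (N - i + 1 - 1) = i + 1 by omega]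
      abel
  · obtain rfl : i = N / 2 := by omega
    by_cases he : Even N
    · have he' := Nat.even_iff.mp he
      have hd : natD N (N / 2) = 2 := if_pos (by omega)
      rcases natS_ne_zero h with rfl | rfl
      · rw [hd, natWeight, natWeight, simpleRoot, if_neg (by omega), if_pos (by omega),
          if_neg (by omega), if_pos he, show N + 1 - (N / 2 + 1) = N / 2 by omega,
          show N / 2 + 1 - 2 = N / 2 - 1 by omega]
        abel
      · rw [hd, natWeight, natWeight, simpleRoot, if_neg (by omega), if_pos (by omega),
          if_neg (by omega), if_pos he, show N + 1 - (N - N / 2 + 2) = N / 2 - 1 by omega,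
          show N - N / 2 + 2 - 2 = N / 2 by omega]
        abel
    · have ho := Nat.even_iff.not.mp he
      have hd : natD N (N / 2) = 1 := if_neg (by omega)
      rcases natS_ne_zero h with rfl | rfl
      · rw [hd, natWeight, natWeight, simpleRoot, if_neg (by omega), if_pos (by omega),
          if_neg (by omega), if_neg he, show N + 1 - (N / 2 + 1) = N / 2 + 1 by omega,
          eps_eq_zero (i := N / 2 + 1) (by omega), show N / 2 + 1 - 1 = N / 2 by omega]
        abel
      · rw [hd, natWeight, natWeight, simpleRoot, if_neg (by omega), if_neg (by omega),
          if_neg (by omega), if_neg he, show N + 1 - (N - N / 2 + 1) = N / 2 by omega,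
          show N + 1 - (N - N / 2 + 1 - 1) = N / 2 + 1 by omega,
          eps_eq_zero (i := N / 2 + 1) (by omega)]
        abel

theorem ip_sub_right (μ α β : Lat N) : ip μ (α - β) = ip μ α - ip μ β := by
  simp [ip, mul_sub, Finset.sum_sub_distrib]

theorem ip_natWeight_of_natS {i a : ℕ} (h1 : 1 ≤ i) (h2 : i ≤ N / 2) (h : natS N i a ≠ 0)
    (μ : Lat N) :
    ip μ (natWeight N a) = ip μ (natWeight N (a - natD N i)) - ip μ (simpleRoot N i) := by
  rw [natWeight_of_natS h1 h2 h, ip_sub_right]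

/-- This is e_j f_i = f_i e_j in the natural representation, in matrix entries. The only nonzero
instances occur at the fork. -/
theorem natS_mul_natS_ne {i j a : ℕ} (h1 : 1 ≤ i) (h2 : i ≤ N / 2) (h3 : 1 ≤ j) (h4 : j ≤ N / 2)
    (hij : i ≠ j) : natS N j (a + natD N j) * natS N i (a + natD N j) =
      natS N i a * natS N j (a - natD N i + natD N j) := by
  by_cases hs : (2 * j = N ∧ i + 1 = j ∧ a = j) ∨ (2 * i = N ∧ j + 1 = i ∧ a = i + 1)
  · rcases hs with ⟨h, rfl, rfl⟩ | ⟨rfl, rfl, rfl⟩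
    · subst h
      simp [natS, natD, show 2 * (i + 1) - (i + 1) + 2 = i + 3 by omega,
        show 2 * (i + 1) - i + 1 = i + 3 by omega]
    · simp [natS, natD, show 2 * (j + 1) - (j + 1) + 2 = j + 3 by omega,
        show 2 * (j + 1) - j + 1 = j + 3 by omega, show j + 1 + 1 ≠ j by omega]
  · have e1 : natS N j (a + natD N j) * natS N i (a + natD N j) = 0 := by
      by_contra h0
      obtain ⟨e1, e2⟩ := mul_ne_zero_iff.mp h0
      have e1 := natS_ne_zero e1
      have e2 := natS_ne_zero e2
      simp only [natD] at e1 e2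
      split_ifs at e1 e2 <;> omega
    have e2 : natS N i a * natS N j (a - natD N i + natD N j) = 0 := by
      by_contra h0
      obtain ⟨e1, e2⟩ := mul_ne_zero_iff.mp h0
      have e1 := natS_ne_zero e1
      have e2 := natS_ne_zero e2
      simp only [natD] at e1 e2
      split_ifs at e1 e2 <;> omega
    rw [e1, e2]

theorem ip_eps_right (μ : Lat N) {i : ℕ} (h1 : 1 ≤ i) (h2 : i ≤ N / 2) :
    ip μ (eps N i) = μ ⟨i, Finset.mem_Icc.mpr ⟨h1, h2⟩⟩ := by
  rw [ip, Finset.sum_eq_single (⟨i, Finset.mem_Icc.mpr ⟨h1, h2⟩⟩ : Node N)]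
  · simp [eps]
  · intro b _ hb
    have : (b : ℕ) ≠ i := fun h' => hb (Subtype.ext h')
    simp [eps, this]
  · simp

theorem simpleRoot_apply (j : ℕ) (k : Node N) : simpleRoot N j k =
    if j < N / 2 then (if (k : ℕ) = j then 1 else 0) - (if (k : ℕ) = j + 1 then 1 else 0)
    else if N % 2 = 0 then (if (k : ℕ) = j - 1 then 1 else 0) + (if (k : ℕ) = j then 1 else 0)
    else if (k : ℕ) = j then 1 else 0 := by
  simp only [simpleRoot, Nat.even_iff]
  split_ifs <;> simp only [eps, Pi.sub_apply, Pi.add_apply] <;> split_ifs <;> omega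

theorem ip_simpleRoot_eps (j : ℕ) {i : ℕ} (h1 : 1 ≤ i) (h2 : i ≤ N / 2) :
    ip (simpleRoot N j) (eps N i) =
      if j < N / 2 then (if i = j then 1 else 0) - (if i = j + 1 then 1 else 0)
      else if N % 2 = 0 then (if i = j - 1 then 1 else 0) + (if i = j then 1 else 0)
      else if i = j then 1 else 0 := by
  rw [ip_eps_right _ h1 h2, simpleRoot_apply]

theorem ip_simpleRoot_natWeight (hN : 3 ≤ N) {j : ℕ} (h1 : 1 ≤ j) (h2 : j ≤ N / 2) (a : ℕ) :
    ip (simpleRoot N j) (natWeight N a) =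
      (if a + natD N j = j + 1 ∨ a + natD N j = N - j + natD N j then 1 else 0)
      - (if a = j + 1 ∨ a = N - j + natD N j then 1 else 0) := by
  have h0 : ip (simpleRoot N j) 0 = 0 := by simp [ip]
  simp only [natWeight, natD]
  by_cases ha : a ≤ N / 2
  · rw [if_pos ha]
    by_cases ha1 : 1 ≤ a
    · rw [ip_simpleRoot_eps _ ha1 ha]
      split_ifs <;> omega
    · rw [eps_eq_zero (by omega), h0]
      split_ifs <;> omega
  · rw [if_neg ha, ← zero_sub, ip_sub_right, h0]
    by_cases ha1 : 1 ≤ N + 1 - a ∧ N + 1 - a ≤ N / 2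
    · rw [ip_simpleRoot_eps _ ha1.1 ha1.2]
      split_ifs <;> omega
    · rw [eps_eq_zero ha1, h0]
      split_ifs <;> omega

theorem natS_sq_eq (j a : ℕ) : natS N j a * natS N j a =
    if a = j + 1 ∨ a = N - j + natD N j then 1 else 0 := by
  rw [natS]
  split_ifs <;> first | tauto | simp

/-- This is [e_j, f_j] = [h_{α_j}]_q in the natural representation, where h_{α_j} takes only the
values 0 and ±1. -/
theorem natS_sq_sub {hb : ℂ} (hq : NotRoot hb) (hN : 3 ≤ N) {j : ℕ} (h1 : 1 ≤ j) (h2 : j ≤ N / 2)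
    (a : ℕ) : natS N j (a + natD N j) * natS N j (a + natD N j) - natS N j a * natS N j a =
      qnum hb (ip (simpleRoot N j) (natWeight N a) : ℤ) := by
  rw [ip_simpleRoot_natWeight hN h1 h2, natS_sq_eq, natS_sq_eq]
  split_ifs <;> simp [qnum_zero, qnum_one hq, qnum_neg]

end NaturalWeight

/-! ### The maps θ_k to the tensor product -/

section Theta

variable {hb : ℂ} {l P : ℕ} {X : Type*} [AddCommGroup X] [Module ℂ X]
  [Module (Uq hb (2 * l + 2 + P)) X] [IsScalarTower ℂ (Uq hb (2 * l + 2 + P)) X]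

local notation "fN" => fGen hb (2 * l + 2 + P)
local notation "eN" => eGen hb (2 * l + 2 + P)
local notation "KN" => KGen hb (2 * l + 2 + P)

/-- Vectors that generate the module under the operators `f_i`. -/
def Generates (hb : ℂ) (N : ℕ) {X : Type*} [AddCommGroup X] [Module ℂ X] [Module (Uq hb N) X]
    (v : X) : Prop :=
  ∀ p : Submodule ℂ X, v ∈ p →
    (∀ i, 1 ≤ i → i ≤ N / 2 → ∀ x ∈ p, fGen hb N i • x ∈ p) → ∀ x, x ∈ p

/-- A linear map to the tensor product with the natural representation, sending `v` to `w_k ⊗ v`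
and commuting with the operators `f_i`. -/
structure IsTheta (hb : ℂ) (l P k : ℕ) {X : Type*} [AddCommGroup X] [Module ℂ X]
    [Module (Uq hb (2 * l + 2 + P)) X] [IsScalarTower ℂ (Uq hb (2 * l + 2 + P)) X]
    (v : X) (T : X →ₗ[ℂ] ℕ → X) : Prop where
  pos : 1 ≤ k
  le : k ≤ l + 1
  vac : T v = Pi.single k v
  f : ∀ i, 1 ≤ i → i ≤ (2 * l + 2 + P) / 2 → ∀ x,
    T (fGen hb (2 * l + 2 + P) i • x) = fHat hb (2 * l + 2 + P) X i (T x)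

namespace IsTheta

variable {k : ℕ} {v : X} {T : X →ₗ[ℂ] ℕ → X} (h : IsTheta hb l P k v T)
  (hv : Generates hb (2 * l + 2 + P) v)
include h hv

/-- The operator f_i moves w_a only to larger indices. So nothing appears below w_k, and at w_k the
map commutes with f_i and fixes v. -/
theorem comp_lt_and (x : X) : (∀ a < k, T x a = 0) ∧ T x k = x := by
  let p : Submodule ℂ X :=
    { carrier := {x | (∀ a < k, T x a = 0) ∧ T x k = x}
      zero_mem' := by simp
      add_mem' := fun {x y} hx hy => by
        refine ⟨fun a ha => ?_, ?_⟩
        · rw [map_add, Pi.add_apply, hx.1 a ha, hy.1 a ha, add_zero]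
        · rw [map_add, Pi.add_apply, hx.2, hy.2]
      smul_mem' := fun c x hx => by
        refine ⟨fun a ha => ?_, ?_⟩
        · rw [map_smul, Pi.smul_apply, hx.1 a ha, smul_zero]
        · rw [map_smul, Pi.smul_apply, hx.2] }
  refine hv p ⟨fun a ha => ?_, ?_⟩ (fun i h1 h2 x hx => ?_) x
  · rw [h.vac, Pi.single_eq_of_ne (by omega)]
  · rw [h.vac, Pi.single_eq_same]
  · have key : ∀ a ≤ k, T (fN i • x) a = fN i • T x a := by
      intro a ha
      rw [h.f i h1 h2, fHat_apply]
      by_cases hs : natS (2 * l + 2 + P) i a = 0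
      · rw [hs, zero_smul, add_zero]
      · have := natD_pos (N := 2 * l + 2 + P) i
        rw [hx.1 (a - natD (2 * l + 2 + P) i) (by have := natS_ne_zero hs; omega), smul_zero,
          smul_zero, add_zero]
    exact ⟨fun a ha => by rw [key a ha.le, hx.1 a ha, smul_zero], by rw [key k le_rfl, hx.2]⟩

theorem comp_self (x : X) : T x k = x := (h.comp_lt_and hv x).2

/-- The vector w_k ⊗ v has weight ν + ε_k rather than ν, so the map intertwines q^{h_μ} only up to
the factor q^{(μ,ε_k)}. -/
theorem comp_K {ν : ℕ → ℂ} (hw : IsWt hb (2 * l + 2 + P) ν v) (x : X)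
    (μ : Lat (2 * l + 2 + P)) (a : ℕ) : T (KN μ • x) a =
      qpow hb ((ip μ (natWeight _ a) - ip μ (natWeight _ k) : ℤ)) • KN μ • T x a := by
  let p : Submodule ℂ X :=
    { carrier := {x | ∀ μ a, T (KN μ • x) a =
        qpow hb ((ip μ (natWeight _ a) - ip μ (natWeight _ k) : ℤ)) • KN μ • T x a}
      zero_mem' := by simp
      add_mem' := fun {x y} hx hy μ a => by
        rw [smul_add, map_add, map_add, Pi.add_apply, Pi.add_apply, hx, hy, smul_add, smul_add]
      smul_mem' := fun c x hx μ a => by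
        rw [smul_smul_comm, map_smul T c, map_smul T c, Pi.smul_apply, Pi.smul_apply, hx,
          smul_smul_comm, smul_comm] }
  refine hv p (fun μ a => ?_) (fun i h1 h2 x hx μ a => ?_) x μ a
  · rw [hw, map_smul, h.vac, Pi.smul_apply]
    obtain rfl | ha := eq_or_ne a k
    · rw [Pi.single_eq_same, hw, sub_self, Int.cast_zero, qpow_zero, one_smul]
    · rw [Pi.single_eq_of_ne ha, smul_zero, smul_zero, smul_zero]
  · rw [KGen_smul_fGen_smul, map_smul, Pi.smul_apply, h.f i h1 h2, h.f i h1 h2, fHat_apply,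
      fHat_apply, hx, hx, smul_add, smul_add, smul_add, KGen_smul_fGen_smul]
    congr 1
    · rw [smul_smul_comm, smul_comm]
    · by_cases hs : natS (2 * l + 2 + P) i a = 0
      · simp [hs]
      · rw [smul_smul_comm, smul_smul_comm (natS _ i a), KGen_smul_comm,
          smul_comm _ (natS (2 * l + 2 + P) i a), smul_comm _ (natS (2 * l + 2 + P) i a)]
        congr 1
        rw [smul_smul, ← qpow_add, ip_natWeight_of_natS h1 h2 hs]
        congr 2
        push_cast
        ring

theorem comp_wt {ν : ℕ → ℂ} (hw : IsWt hb (2 * l + 2 + P) ν v) {ω : ℕ → ℂ} {x : X}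
    (hx : IsWt hb (2 * l + 2 + P) ω x) (μ : Lat (2 * l + 2 + P)) (a : ℕ) : KN μ • T x a =
      qpow hb (wsum _ ω μ + ip μ (natWeight _ k) - ip μ (natWeight _ a)) • T x a := by
  have := h.comp_K hv hw x μ a
  rw [hx, map_smul, Pi.smul_apply] at this
  rw [add_sub_assoc, qpow_add, mul_comm (qpow hb _), mul_smul, this, smul_smul, ← qpow_add]
  rw [show ((ip μ (natWeight (2 * l + 2 + P) k) : ℂ) - ip μ (natWeight (2 * l + 2 + P) a)
    + ((ip μ (natWeight _ a) - ip μ (natWeight _ k) : ℤ) : ℂ)) = 0 by push_cast; ring, qpow_zero,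
    one_smul]

/-- This is θ_k e_j = Δ(e_j) θ_k. It holds on v, where both sides vanish, and it propagates along
the f_i provided [h_{α_j}] is intertwined too. The latter requires (α_j, ε_k) = 0, which for j > k
fails only in the excluded case at the fork. -/
theorem comp_e (hq : NotRoot hb) (hP : 1 ≤ P) {ν : ℕ → ℂ} (hw : IsWt hb (2 * l + 2 + P) ν v) {j : ℕ} (hkj : k < j)
    (hj : j ≤ (2 * l + 2 + P) / 2) (hx : ¬(2 * j = 2 * l + 2 + P ∧ j = k + 1))
    (hev : eN j • v = 0) (x : X) (a : ℕ) : T (eN j • x) a =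
      natS (2 * l + 2 + P) j (a + natD (2 * l + 2 + P) j) • T x (a + natD (2 * l + 2 + P) j)
      + qpow hb (ip (simpleRoot _ j) (natWeight (2 * l + 2 + P) a) : ℤ) • eN j • T x a := by
  have hN : 3 ≤ 2 * l + 2 + P := by omega
  have hk1 := h.pos
  have hk2 := h.le
  let p : Submodule ℂ X :=
    { carrier := {x | ∀ a, T (eN j • x) a =
        natS (2 * l + 2 + P) j (a + natD (2 * l + 2 + P) j) • T x (a + natD (2 * l + 2 + P) j)
          + qpow hb (ip (simpleRoot _ j) (natWeight (2 * l + 2 + P) a) : ℤ) • eN j • T x a}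
      zero_mem' := by simp
      add_mem' := fun {x y} hx hy a => by
        rw [smul_add, map_add, map_add, Pi.add_apply, Pi.add_apply, Pi.add_apply, hx, hy]
        simp only [smul_add]
        abel
      smul_mem' := fun c x hx a => by
        rw [smul_smul_comm, map_smul T c, map_smul T c, Pi.smul_apply, Pi.smul_apply, Pi.smul_apply, hx,
          smul_smul_comm, smul_add, smul_comm c, smul_comm c] }
  refine hv p (fun a => ?_) (fun i h1 h2 x hx a => ?_) x a
  · rw [hev, map_zero, h.vac, Pi.zero_apply]
    have e1 : natS (2 * l + 2 + P) j (a + natD (2 * l + 2 + P) j) •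
        (Pi.single k v : ℕ → X) (a + natD (2 * l + 2 + P) j) = 0 := by
      by_cases hs : natS (2 * l + 2 + P) j (a + natD (2 * l + 2 + P) j) = 0
      · rw [hs, zero_smul]
      · rw [Pi.single_eq_of_ne, smul_zero]
        have := natS_ne_zero hs
        omega
    rw [e1, zero_add]
    obtain rfl | ha := eq_or_ne a k
    · rw [Pi.single_eq_same, hev, smul_zero]
    · rw [Pi.single_eq_of_ne ha, smul_zero, smul_zero]
  · have hKe : ∀ y : X, qpow hb (ip (simpleRoot _ j) (natWeight (2 * l + 2 + P) a) : ℤ) •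
        eN j • natS (2 * l + 2 + P) i a • KN (-simpleRoot _ i) • y =
        natS (2 * l + 2 + P) i a • KN (-simpleRoot _ i) •
          qpow hb (ip (simpleRoot _ j)
            (natWeight (2 * l + 2 + P) (a - natD (2 * l + 2 + P) i)) : ℤ) • eN j • y := by
      intro y
      by_cases hs : natS (2 * l + 2 + P) i a = 0
      · rw [hs, zero_smul, zero_smul, smul_zero, smul_zero]
      · rw [smul_smul_comm, smul_smul_comm (qpow hb _) (KN _), KGen_smul_eGen_smul, smul_comm,
          smul_smul (qpow hb _) (qpow hb _), ← qpow_add, ip_natWeight_of_natS h1 h2 hs, ip_neg_left,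
          ip_comm (simpleRoot _ i)]
        congr 3
        push_cast
        ring
    have step : T (eN j • fN i • x) a = T (fN i • eN j • x) a +
        if i = j then T (hnum hb (2 * l + 2 + P) (simpleRoot _ j) 0 • x) a else 0 := by
      split_ifs with hij
      · subst hij
        rw [← mul_smul, eGen_mul_fGen_same hb _ h1 h2, add_smul, map_add, Pi.add_apply, mul_smul]
      · rw [e_f_smul_ne (Ne.symm hij), add_zero]
    rw [step, h.f i h1 h2, fHat_apply, hx, hx, h.f i h1 h2, fHat_apply, fHat_apply]
    simp only [smul_add, hKe]
    have hd : natS (2 * l + 2 + P) i a ≠ 0 → natD (2 * l + 2 + P) i ≤ a := fun hs => by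
      have := natS_ne_zero hs
      rw [natD]; split_ifs <;> omega
    split_ifs with hij
    · subst hij
      have hik : ip (simpleRoot (2 * l + 2 + P) i) (natWeight (2 * l + 2 + P) k) = 0 := by
        rw [ip_simpleRoot_natWeight hN h1 h2, natD]
        split_ifs <;> omega
      have hsq : ∀ y : ℕ → X, natS (2 * l + 2 + P) i a • KN (-simpleRoot _ i) •
          natS (2 * l + 2 + P) i (a - natD (2 * l + 2 + P) i + natD (2 * l + 2 + P) i) •
            y (a - natD (2 * l + 2 + P) i + natD (2 * l + 2 + P) i) =
          (natS (2 * l + 2 + P) i a * natS (2 * l + 2 + P) i a) • KN (-simpleRoot _ i) • y a := by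
        intro y
        by_cases hs : natS (2 * l + 2 + P) i a = 0
        · rw [hs, zero_smul, zero_mul, zero_smul]
        · rw [Nat.sub_add_cancel (hd hs), smul_smul_comm, smul_smul]
      have hT : T (hnum hb (2 * l + 2 + P) (simpleRoot _ i) 0 • x) a = (qpow hb 1 - qpow hb (-1))⁻¹ •
          (qpow hb (ip (simpleRoot _ i) (natWeight (2 * l + 2 + P) a) : ℤ) •
              KN (simpleRoot _ i) • T x a
            - qpow hb (-(ip (simpleRoot _ i) (natWeight (2 * l + 2 + P) a) : ℤ)) •
              KN (-simpleRoot _ i) • T x a) := by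
        rw [hnum, neg_zero, qpow_zero, one_smul, one_smul, smul_assoc, sub_smul, map_smul, map_sub,
          Pi.smul_apply, Pi.sub_apply, h.comp_K hv hw, h.comp_K hv hw, hik, sub_zero, ip_neg_left,
          ip_neg_left, hik, neg_zero, sub_zero, Int.cast_neg]
      have hef : eN i • fN i • T x a = fN i • eN i • T x a + (qpow hb 1 - qpow hb (-1))⁻¹ •
          (KN (simpleRoot _ i) • T x a - KN (-simpleRoot _ i) • T x a) := by
        rw [← mul_smul, eGen_mul_fGen_same hb _ h1 h2, add_smul, mul_smul, hnum, neg_zero, qpow_zero,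
          one_smul, one_smul, smul_assoc, sub_smul]
      rw [hsq, hT, hef, Nat.add_sub_cancel, smul_smul_comm, smul_smul_comm]
      have hs := natS_sq_sub hq hN h1 h2 a
      rw [qnum, div_eq_mul_inv] at hs
      generalize KN (-simpleRoot _ i) • T x a = y1
      generalize KN (simpleRoot _ i) • T x a = y2
      generalize fN i • eN i • T x a = y3
      generalize fN i • T x (a + natD (2 * l + 2 + P) i) = y4
      generalize KN (-simpleRoot _ i) • (_ : X) = y5
      match_scalars <;> first | ring1 | linear_combination -hs
    · have hs := natS_mul_natS_ne (a := a) h1 h2 (by omega) hj hij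
      have hsq : natS (2 * l + 2 + P) i a • KN (-simpleRoot _ i) •
          natS (2 * l + 2 + P) j (a - natD (2 * l + 2 + P) i + natD (2 * l + 2 + P) j) •
            T x (a - natD (2 * l + 2 + P) i + natD (2 * l + 2 + P) j) =
          natS (2 * l + 2 + P) j (a + natD (2 * l + 2 + P) j) •
            natS (2 * l + 2 + P) i (a + natD (2 * l + 2 + P) j) •
              KN (-simpleRoot _ i) •
                T x (a + natD (2 * l + 2 + P) j - natD (2 * l + 2 + P) i) := by
        rw [smul_smul_comm, smul_smul, smul_smul, hs]
        by_cases hs0 : natS (2 * l + 2 + P) i a = 0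
        · rw [hs0, zero_mul, zero_smul, zero_smul]
        · rw [Nat.sub_add_comm (hd hs0)]
      rw [hsq, smul_smul_comm, smul_smul_comm, e_f_smul_ne (Ne.symm hij)]
      abel

end IsTheta

end Theta


/-! ### The coefficient identity for the lowering step -/

section LowerCoefficients

variable {hb : ℂ}

/-- With this, `lower_coeff` becomes a combination of two instances of `raise_coeff`. -/
theorem qpow_neg_eq_qnum (hq : NotRoot hb) (x : ℂ) :
    qpow hb (-x) = qnum hb (x + 1) - qpow hb 1 * qnum hb x := by
  have := qpow_one_sub_ne hq
  rw [qnum, qnum, neg_add, qpow_add, qpow_add]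
  field_simp
  ring

theorem qnum_sub_qpow_mul (hq : NotRoot hb) (x : ℂ) :
    qnum hb x - qpow hb 1 * qnum hb (x - 1) = qpow hb (1 - x) := by
  rw [show 1 - x = -(x - 1) by ring, qpow_neg_eq_qnum hq, sub_add_cancel]

theorem lower_coeff (P : ℕ) (h : ℂ) (hq : NotRoot hb) (z c : ℂ) {m : ℕ} (hm : 1 ≤ m)
    (hc : c = (-1) ^ m * (qpow hb (m - P / 2) + qpow hb (-(m - P / 2)))) :
    qpow hb (-(z + 2)) * lCoeff hb P h m
      + qpow hb (-(z + 1)) * (c * (qnum hb (h + (P / 2 - 1)) * qnum hb (h + P / 2)))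
      + qpow hb (-z) * rCoeff hb P h m = qpow hb (-(z + 2 * h + P)) * dCoeff hb P m := by
  have e1 := raise_coeff P h hq (z + 1) c hm hc
  have e2 := raise_coeff P h hq z c hm hc
  simp only [qpow_neg_eq_qnum hq]
  rw [show z + 2 + 1 = z + 1 + 2 by ring, show z + 2 * h + P + 1 = z + 1 + 2 * h + P by ring]
  linear_combination e1 - qpow hb 1 * e2

end LowerCoefficients

/-! ### The component at w_{k+1} and nonvanishing -/

section Lower

variable {hb : ℂ} {l P : ℕ} {X : Type*} [AddCommGroup X] [Module ℂ X]
  [Module (Uq hb (2 * l + 2 + P)) X] [IsScalarTower ℂ (Uq hb (2 * l + 2 + P)) X]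

local notation "fN" => fGen hb (2 * l + 2 + P)
local notation "eN" => eGen hb (2 * l + 2 + P)
local notation "KN" => KGen hb (2 * l + 2 + P)
local notation "aN" => aW (hb := hb) (N := 2 * l + 2 + P) l
local notation "sN" => aSum hb (2 * l + 2 + P) l

theorem aW_succ_right {N : ℕ} {X : Type*} [AddCommGroup X] [Module (Uq hb N) X] (l m : ℕ) (x : X) :
    aW (hb := hb) (N := N) l (m + 1) x = aW (hb := hb) (N := N) (l + 1) m (fGen hb N (l + 1) • x) := by
  induction m with
  | zero => rw [aW_succ, aW_zero, aW_zero, add_zero]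
  | succ m IH => rw [aW_succ, IH, aW_succ, show l + 1 + 1 + m = l + 1 + (m + 1) by omega]

/-- The component at `w_{k+1}`. -/
def lowerOp (k : ℕ) (T : X →ₗ[ℂ] ℕ → X) : X →ₗ[ℂ] X := (LinearMap.proj (k + 1)).comp T

namespace IsTheta

variable {k : ℕ} {v : X} {T : X →ₗ[ℂ] ℕ → X} (h : IsTheta hb l P k v T)
include h

theorem lower_vac : lowerOp k T v = 0 := by
  change T v (k + 1) = 0
  rw [h.vac, Pi.single_eq_of_ne (by omega)]

theorem natS_succ (hP : 1 ≤ P) {i : ℕ} (h1 : 1 ≤ i) (h2 : i ≤ (2 * l + 2 + P) / 2) :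
    natS (2 * l + 2 + P) i (k + 1) = if i = k then 1 else 0 := by
  have := h.pos
  have := h.le
  simp only [natS, natD]
  split_ifs <;> first | rfl | omega

theorem natD_self (hP : 1 ≤ P) : natD (2 * l + 2 + P) k = 1 := by
  have := h.le
  exact if_neg (by omega)

variable (hv : Generates hb (2 * l + 2 + P) v) (hP : 1 ≤ P)
include hv hP

/-- Only f_k leads into w_{k+1}, and it does so from w_k, where the component of θ_k(x) is x. The
operator is thus a twisted derivation that removes one letter f_k. -/
theorem lower_f (i : ℕ) (x : X) : lowerOp k T (fN i • x) = fN i • lowerOp k T x +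
    if i = k then KN (-simpleRoot _ k) • x else 0 := by
  have h3 := h.pos
  have h4 := h.le
  by_cases hi : 1 ≤ i ∧ i ≤ (2 * l + 2 + P) / 2
  · change T (fN i • x) (k + 1) = fN i • T x (k + 1) + _
    rw [h.f i hi.1 hi.2, fHat_apply, h.natS_succ hP hi.1 hi.2]
    split_ifs with hik
    · subst hik
      rw [h.natD_self hP, Nat.add_sub_cancel, h.comp_self hv, one_smul]
    · rw [zero_smul]
  · rw [fGen, dif_neg (by rwa [Finset.mem_Icc]), zero_smul, map_zero, zero_smul, if_neg (by omega),
      add_zero]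

theorem lower_f_wt {ω : ℕ → ℂ} {x : X} (hx : IsWt hb (2 * l + 2 + P) ω x) :
    lowerOp k T (fN k • x) = fN k • lowerOp k T x + qpow hb (-dval (2 * l + 2 + P) ω k) • x := by
  have h3 := h.pos
  have h4 := h.le
  rw [h.lower_f hv hP, if_pos rfl, hx, wsum_neg, wsum_simpleRoot (by omega) _ h3 (by omega)]

theorem lower_f_ne {i : ℕ} (hi : i ≠ k) (x : X) :
    lowerOp k T (fN i • x) = fN i • lowerOp k T x := by
  rw [h.lower_f hv hP, if_neg hi, add_zero]

omit hv in
theorem ip_natWeight_succ (μ : Lat (2 * l + 2 + P)) :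
    ip μ (natWeight _ (k + 1)) = ip μ (natWeight _ k) - ip μ (simpleRoot _ k) := by
  have h3 := h.pos
  have h4 := h.le
  rw [ip_natWeight_of_natS h3 (by omega), h.natD_self hP, Nat.add_sub_cancel]
  rw [h.natS_succ hP h3 (by omega), if_pos rfl]
  exact one_ne_zero

variable {ν : ℕ → ℂ} (hw : IsWt hb (2 * l + 2 + P) ν v)
include hw

theorem lower_K (x : X) {μ : Lat (2 * l + 2 + P)} (hμ : ip μ (simpleRoot _ k) = 0) :
    lowerOp k T (KN μ • x) = KN μ • lowerOp k T x := by
  refine (h.comp_K hv hw x μ (k + 1)).trans ?_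
  rw [h.ip_natWeight_succ hP, hμ, sub_zero, sub_self, Int.cast_zero, qpow_zero, one_smul]
  rfl

theorem lower_wt {ω : ℕ → ℂ} {x : X} (hx : IsWt hb (2 * l + 2 + P) ω x) :
    IsWt hb (2 * l + 2 + P) (ω + rt (2 * l + 2 + P) k) (lowerOp k T x) := fun μ => by
  refine (h.comp_wt hv hw hx μ (k + 1)).trans ?_
  rw [h.ip_natWeight_succ hP, wsum_add_left, wsum_rt]
  congr 2
  push_cast
  ring

/-- The operator at `w_{k+1}` lowers `f_{ε_k+ε_{l+1}} v` to `f_{ε_{k+1}+ε_{l+1}} v`. -/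
theorem lower_fDesc (hq : NotRoot hb) (hHW : HW hb l P ν v) {d : ℕ} (hd : d + 2 ≤ l)
    (hk : k = l - 1 - d) :
    ∃ c : ℂ, c ≠ 0 ∧ lowerOp k T (fDesc hb l P (d + 2) • v) = c • fDesc hb l P (d + 1) • v := by
  have hcomm : Commute (lowerOp k T : Module.End ℂ X)
      (Algebra.lsmul ℂ ℂ X (fDesc hb l P (d + 1))) := by
    refine commute_fDesc (Algebra.lsmul ℂ ℂ X) (by omega) (fun j hj => ?_) (fun μ c hμ => ?_)
    · exact LinearMap.ext fun x => h.lower_f_ne hv hP (by omega) x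
    · have hip : ip μ (simpleRoot _ k) = 0 :=
        ip_simpleRoot_eq_zero (by omega) fun j hj => hμ j (by omega)
      refine LinearMap.ext fun x => ?_
      change lowerOp k T (hnum hb _ μ c • x) = hnum hb _ μ c • lowerOp k T x
      simp only [hnum, smul_assoc, sub_smul, map_smul, map_sub, h.lower_K hv hP hw _ hip,
        h.lower_K hv hP hw _ (show ip (-μ) (simpleRoot _ k) = 0 by rw [ip_neg_left, hip, neg_zero])]
  have hc : ∀ x, lowerOp k T (fDesc hb l P (d + 1) • x) = fDesc hb l P (d + 1) • lowerOp k T x :=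
    fun x => LinearMap.congr_fun hcomm.eq x
  have hwF := HW.wt_fDesc hq hHW hP (d := d + 1) (by omega)
  set z := ν (l - d) + ν (l + 1) + P + d
  -- The bracket is q^{-z}, so the factor is a power of q; the corresponding factor for e_k is a
  -- q-number and may vanish.
  refine ⟨qpow hb (-(ν k - ν (k + 1) + 1)) * (qnum hb (z + 1) - qpow hb 1 * qnum hb z), ?_, ?_⟩
  · rw [← qpow_neg_eq_qnum hq]
    exact mul_ne_zero (qpow_ne_zero _ _) (qpow_ne_zero _ _)
  · rw [fDesc_succ_smul hd hw, map_sub, LinearMap.map_smul, LinearMap.map_smul, hc, ← hk, h.lower_f_wt hv hP hwF,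
      h.lower_f_wt hv hP hw, hc, h.lower_vac, smul_zero, smul_zero, zero_add, zero_add,
      smul_smul_comm]
    have hk1 : k + 1 = l - d := by omega
    have e1 : dval (2 * l + 2 + P) (ν - Pi.single (l + 1 - (d + 1)) 1 - Pi.single (l + 1) 1) k =
        ν k - ν (k + 1) + 1 := by
      rw [dval, if_pos (by omega)]
      simp [show l - d = k + 1 by omega, show k ≠ l + 1 by omega, show k ≠ l by omega]
      ring
    have e2 : dval (2 * l + 2 + P) ν k = ν k - ν (k + 1) := by rw [dval, if_pos (by omega)]
    rw [e1, e2, smul_smul, smul_smul, ← sub_smul]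
    congr 1
    rw [show -(ν k - ν (k + 1)) = -(ν k - ν (k + 1) + 1) + 1 by ring, qpow_add hb _ 1]
    ring

theorem lower_fNext (hq : NotRoot hb) (hHW : HW hb l P ν v) (hk : k = l) :
    ∃ c : ℂ, c ≠ 0 ∧ lowerOp k T (fNext hb l P • v) = c • fDouble hb l P • v := by
  subst hk
  have := hHW.map_fNext hq hP h.pos (T := lowerOp k T) (c := fun x => qpow hb (-x))
    (fun j hj x => h.lower_f_ne hv hP (by omega) x)
    (fun ω x hx => h.lower_f_wt hv hP hx) h.lower_vac
  refine ⟨qpow hb (-(ν k - ν (k + 1) + 2 * ν (k + 1) + P)), qpow_ne_zero _ _, this.trans ?_⟩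
  rw [fDouble_smul, aSum, aSum, Finset.smul_sum]
  refine Finset.sum_congr rfl fun m hm => ?_
  rw [smul_smul]
  congr 1
  rw [Finset.mem_Icc] at hm
  exact lower_coeff P (ν (k + 1)) hq (ν k - ν (k + 1)) _ hm.1 rfl

section Last

variable (hk : k = l + 1)
include hk

omit hw in
theorem lower_aW {x : X} (hx : lowerOp k T x = 0) (m : ℕ) : lowerOp k T (aN (m + 1) x) =
    aW (hb := hb) (N := 2 * l + 2 + P) (l + 1) m (KN (-simpleRoot _ k) • x) := by
  induction m with
  | zero =>
    rw [aW_succ, aW_zero, aW_zero, add_zero, h.lower_f hv hP, hx, if_pos hk.symm, smul_zero, zero_add]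
  | succ m IH =>
    rw [aW_succ, h.lower_f_ne hv hP (by omega), IH, aW_succ,
      show l + 1 + 1 + m = l + 1 + (m + 1) by omega]

theorem f_vac_ne_zero (hv0 : v ≠ 0) : fN (l + 1) • v ≠ 0 := by
  intro h0
  have := h.lower_f_wt hv hP hw
  rw [hk, h0, map_zero, ← hk, h.lower_vac, smul_zero, zero_add] at this
  exact smul_ne_zero (qpow_ne_zero _ _) hv0 this.symm

/-- The word of b_m contains f_{l+1} once, next to v. Removing it lets a Levi generator act on v. -/
theorem lower_bW (hHW : HW hb l P ν v) (hP3 : 3 ≤ P) {m : ℕ} (hm : 1 ≤ m)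
    (hm' : m ≤ (P + 1) / 2) : lowerOp k T (bW hb l P m v) = 0 := by
  have hword : ∀ (w : List ℕ) (r : ℕ), (∀ i ∈ w, l + 2 ≤ i ∧ i ≤ (2 * l + 2 + P) / 2) →
      1 ≤ w.length + r → lowerOp k T (fWord hb (2 * l + 2 + P) (w ++ down l (r + 1)) • v) = 0 := by
    intro w r hwl hlen
    rw [fWord_append, mul_smul, ← aW]
    have e1 : ∀ x, lowerOp k T (fWord hb (2 * l + 2 + P) w • x) =
        fWord hb (2 * l + 2 + P) w • lowerOp k T x := by
      clear hlen
      induction w with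
      | nil => intro x; rw [fWord_nil, one_smul, one_smul]
      | cons i w IH =>
        intro x
        have hi := hwl i (by simp)
        rw [fWord_cons, mul_smul, mul_smul, h.lower_f_ne hv hP (by omega),
          IH fun j hj => hwl j (by simp [hj])]
    rw [e1, h.lower_aW hv hP hk h.lower_vac, hw, aW_smul, smul_smul_comm]
    cases r with
    | succ r =>
      rw [aW_succ_right, hHW.f (by omega) _ le_rfl (by omega), aW_apply_zero, smul_zero, smul_zero]
    | zero =>
      obtain rfl | ⟨w', j, rfl⟩ := w.eq_nil_or_concat
      · simp at hlen
      · have hj := hwl j (by simp)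
        rw [aW_zero, List.concat_eq_append, fWord_append, mul_smul, fWord_cons, fWord_nil, mul_one,
          hHW.f (by omega) _ hj.1 hj.2, smul_zero, smul_zero]
  have hrange : ∀ i ∈ List.range' (l + m + 1) (P / 2 + 1 - m),
      l + 2 ≤ i ∧ i ≤ (2 * l + 2 + P) / 2 := fun i hi => by
    rw [List.mem_range'_1] at hi; omega
  rw [bW, rightWord]
  split_ifs with he he'
  · have h2 := Nat.even_iff.mp he
    omega
  · have h2 := Nat.even_iff.mp he
    rw [show P / 2 - 1 = P / 2 - 2 + 1 by omega]
    exact hword _ _ hrange (by rw [List.length_range']; omega)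
  · exact hword _ _ hrange (by omega)

/-- The raising operators lead back up the chain with coefficient 1 to f_{l+1} v, which the map to
the tensor product shows to be nonzero. -/
theorem bW_ne_zero (hq : NotRoot hb) (hHW : HW hb l P ν v) (hP3 : 3 ≤ P) (hv0 : v ≠ 0) {m : ℕ}
    (hm : 1 ≤ m) (hm' : m ≤ (P + 1) / 2) : bW hb l P m v ≠ 0 := by
  have hup : ∀ r, l + 1 + r + 1 ≤ (2 * l + 2 + P) / 2 → aN (r + 1) v ≠ 0 := by
    intro r hr
    induction r with
    | zero => rw [aW_succ, aW_zero, add_zero]; exact h.f_vac_ne_zero hv hP hw hk hv0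
    | succ r IH =>
      intro h0
      have := hHW.e_aW_up hq hP3 (j := l + (r + 1 + 1)) (m := r + 1 + 1) (by omega) (by omega)
        (by omega) (by omega)
      rw [h0, smul_zero, if_pos rfl] at this
      exact IH (by omega) this.symm
  by_cases he : Even P
  · have h2 := Nat.even_iff.mp he
    obtain ⟨t, ht⟩ : ∃ t, t = P / 2 - m := ⟨_, rfl⟩
    induction t generalizing m with
    | zero =>
      obtain rfl : m = P / 2 := by omega
      intro h0
      have := hHW.e_last_bW_even hq hP3 he hm le_rfl
      rw [h0, smul_zero, if_neg (by omega), if_pos rfl, show P / 2 - 1 = P / 2 - 2 + 1 by omega]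
        at this
      exact hup _ (by omega) this.symm
    | succ t IH =>
      intro h0
      have := (hHW.family_even hq hP3 he).e m (m + 1) hm (by omega) (by omega) (by omega)
      rw [h0, smul_zero, if_pos rfl] at this
      exact IH (m := m + 1) (by omega) (by omega) (by omega) this.symm
  · have h2 := Nat.even_iff.not.mp he
    obtain ⟨t, ht⟩ : ∃ t, t = P / 2 + 1 - m := ⟨_, rfl⟩
    induction t generalizing m with
    | zero =>
      obtain rfl : m = P / 2 + 1 := by omega
      intro h0
      have := hHW.e_last_bW_odd hq hP3 he hm le_rfl
      rw [h0, smul_zero, if_neg (by omega), if_pos rfl, show P / 2 = P / 2 - 1 + 1 by omega]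
        at this
      exact hup _ (by omega) this.symm
    | succ t IH =>
      intro h0
      by_cases hm2 : m = P / 2
      · subst hm2
        have := hHW.e_last_bW_odd hq hP3 he (m := P / 2) hm (by omega)
        rw [h0, smul_zero, if_pos rfl] at this
        exact IH (m := P / 2 + 1) (by omega) (by omega) (by omega) this.symm
      · have := (hHW.family_odd hq hP3 he).e m (m + 1) hm (by omega) (by omega) (by omega)
        rw [h0, smul_zero, if_pos rfl] at this
        exact IH (m := m + 1) (by omega) (by omega) (by omega) this.symm

/-- The lowering of a combination of the monomials `φ_m` applied to the generator. -/
theorem lower_aSum (hq : NotRoot hb) (hHW : HW hb l P ν v) (hP3 : 3 ≤ P) (c : ℕ → ℂ) :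
    lowerOp k T (sN ((P + 1) / 2) c (fun m => bW hb l P m v)) =
      (qpow hb (-ν (l + 1)) * (c 1 + qpow hb 1 * c 2)) • bW hb l P 1 v := by
  have hM : 2 ≤ (P + 1) / 2 := by omega
  have hf : ∀ m, 1 ≤ m → m ≤ (P + 1) / 2 → ∀ s, 2 ≤ s → l + s ≤ (2 * l + 2 + P) / 2 →
      fN (l + s) • bW hb l P m v = if s = m then bW hb l P (m - 1) v else 0 := by
    intro m h1 h2 s h3 h4
    by_cases he : Even P
    · have h2 := Nat.even_iff.mp he
      exact (hHW.family_even hq hP3 he).f m s h1 (by omega) h3 h4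
    · have h2 := Nat.even_iff.not.mp he
      exact (hHW.family_odd hq hP3 he).f m s h1 (by omega) h3 h4
  have hterm : ∀ m, 1 ≤ m → m ≤ (P + 1) / 2 → lowerOp k T (aN m (bW hb l P m v)) =
      if m = 1 then qpow hb (-ν (l + 1)) • bW hb l P 1 v
      else if m = 2 then (qpow hb (-ν (l + 1)) * qpow hb 1) • bW hb l P 1 v else 0 := by
    intro m h1 h2
    obtain ⟨m, rfl⟩ : ∃ t, m = t + 1 := ⟨m - 1, by omega⟩
    rw [h.lower_aW hv hP hk (h.lower_bW hv hP hw hk hHW hP3 h1 h2), hHW.wt_bW hq hP h1 h2,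
      wsum_neg, wsum_simpleRoot (by omega) _ h.pos (by omega), aW_smul, hk, dval,
      if_pos (by omega)]
    have hz := hHW.zero (l + 1 + 1) (by omega) (by omega)
    rcases m with _ | _ | m
    · rw [if_pos rfl, aW_zero]
      congr 2
      simp [hz]
    · rw [if_neg (by omega), if_pos rfl, aW_succ, aW_zero, add_zero, hf 2 (by omega) h2 2 le_rfl
        (by omega), if_pos rfl, ← qpow_add]
      congr 2
      simp [hz]
      ring
    · rw [if_neg (by omega), if_neg (by omega), aW_succ_right, hf _ h1 h2 2 le_rfl (by omega),
        if_neg (by omega), aW_apply_zero, smul_zero]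
  rw [aSum, map_sum]
  rw [Finset.sum_eq_add_of_mem 1 2 (by simp; omega) (by simp; omega) (by omega)]
  · rw [map_smul, map_smul, hterm 1 le_rfl (by omega), hterm 2 (by omega) hM, if_pos rfl,
      if_neg (by omega), if_pos rfl, smul_smul, smul_smul, ← add_smul]
    congr 1
    ring
  · intro m hm hne
    rw [Finset.mem_Icc] at hm
    rw [map_smul, hterm m hm.1 hm.2, if_neg hne.1, if_neg hne.2, smul_zero]

omit hv hP in
-- For P = 2 the node l + 2 is the last one and carries w_{l+1} to w_{l+3}, so the component there
-- is inspected instead of the one at w_{l+2}.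
theorem f_vac_two_ne_zero (hP2 : P = 2) (hv0 : v ≠ 0) : fN (l + 2) • v ≠ 0 := by
  intro h0
  have := congrFun (h.f (l + 2) (by omega) (by omega) v) (l + 3)
  have hd : natD (2 * l + 2 + P) (l + 2) = 2 := if_pos (by omega)
  have hs : natS (2 * l + 2 + P) (l + 2) (l + 3) = 1 := if_pos rfl
  rw [h0, map_zero, fHat_apply, h.vac, Pi.single_eq_of_ne (by omega), hd, hs,
    show l + 3 - 2 = k by omega, Pi.single_eq_same, hw, smul_zero, zero_add, one_smul] at this
  exact smul_ne_zero (qpow_ne_zero _ _) hv0 this.symm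

/-- For P ≥ 3 only φ_1 and φ_2 contribute, and their coefficients combine to [P/2] - q [P/2-1] =
q^{1-P/2}, up to a power of q. For P = 1 the factor is [1/2](1 + q), again up to a power of q. -/
theorem lower_fDouble (hq : NotRoot hb) (hHW : HW hb l P ν v) (hP2 : P ≠ 2) :
    ∃ c : ℂ, c ≠ 0 ∧ lowerOp k T (fDouble hb l P • v) = c • phiDel hb l P 1 • v := by
  obtain rfl | hP3 : P = 1 ∨ 3 ≤ P := by omega
  · have hn : (2 * l + 2 + 1) / 2 = l + 1 := by omega
    have hd : ∀ ω, dval (2 * l + 2 + 1) ω k = ω (l + 1) := fun ω => by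
      simp [dval, hn, even_iff, hk]
    have hr : rt (2 * l + 2 + 1) (l + 1) (l + 1) = 1 := by simp [rt, hn, even_iff]
    have e1 := h.lower_f_wt hv hP hw
    have e2 := h.lower_f_wt hv hP (hw.f (l + 1))
    rw [h.lower_vac, smul_zero, zero_add, hd] at e1
    rw [hd, ← hk, e1, hk, smul_smul_comm, ← add_smul, Pi.sub_apply, hr,
      show -(ν (l + 1) - 1) = -ν (l + 1) + 1 by ring, qpow_add, ← mul_one_add] at e2
    rw [fDouble_smul, aSum, phiDel_one_smul (by decide), show (1 + 1) / 2 = 1 from rfl,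
      Finset.Icc_self, Finset.sum_singleton, bW, rightWord_top_odd (P := 1) l (by decide),
      show 1 / 2 + 1 = 1 from rfl, ← aW, aW_succ, aW_zero, aW_succ, aW_zero, add_zero, map_smul, hk,
      e2, smul_smul]
    refine ⟨_, mul_ne_zero ?_ (mul_ne_zero (qpow_ne_zero _ _) fun h1 => ?_), rfl⟩
    · have := qnum_half_ne hq 1 le_rfl
      rw [dCoeff, pow_zero, one_mul]
      convert this using 2
      ring
    · apply qpow_one_sub_ne hq
      rw [qpow_neg, eq_neg_of_add_eq_zero_right h1]
      norm_num
  · rw [fDouble_smul, h.lower_aSum hv hP hw hk hq hHW hP3, phiDel_one_smul (by omega)]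
    refine ⟨_, mul_ne_zero (qpow_ne_zero _ _) ?_, rfl⟩
    rw [dCoeff, dCoeff, show (P : ℂ) / 2 - (1 : ℕ) + 1 = P / 2 by push_cast; ring,
      show (P : ℂ) / 2 - (2 : ℕ) + 1 = P / 2 - 1 by push_cast; ring]
    rw [show (-1 : ℂ) ^ (1 - 1) * qnum hb (P / 2) + qpow hb 1 * ((-1) ^ (2 - 1) * qnum hb (P / 2 - 1))
      = qnum hb (P / 2) - qpow hb 1 * qnum hb (P / 2 - 1) by norm_num; ring,
      qnum_sub_qpow_mul hq ((P : ℂ) / 2)]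
    exact qpow_ne_zero _ _

theorem fDouble_ne_zero (hq : NotRoot hb) (hHW : HW hb l P ν v) (hv0 : v ≠ 0) :
    fDouble hb l P • v ≠ 0 := by
  intro h0
  by_cases hP2 : P = 2
  · have hS : fDouble hb l P • v = fN (l + 1) • fN (l + 2) • v := by
      rw [fDouble_smul, aSum, show (P + 1) / 2 = 1 by omega, Finset.Icc_self, Finset.sum_singleton,
        bW_one_two hq hP2, aW_succ, aW_zero, add_zero]
      rw [dCoeff, show (P : ℂ) / 2 - (1 : ℕ) + 1 = 1 by rw [hP2]; norm_num, qnum_one hq]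
      simp
    have := h.lower_f_wt hv hP (hw.f (l + 2))
    rw [hk, ← hS, h0, map_zero, ← hk, h.lower_f_ne hv hP (by omega), h.lower_vac, smul_zero,
      smul_zero, zero_add] at this
    exact smul_ne_zero (qpow_ne_zero _ _) (h.f_vac_two_ne_zero hw hk hP2 hv0) this.symm
  · obtain ⟨c, hc, e⟩ := h.lower_fDouble hv hP hw hk hq hHW hP2
    rw [h0, map_zero] at e
    refine smul_ne_zero hc ?_ e.symm
    obtain rfl | hP3 : P = 1 ∨ 3 ≤ P := by omega
    · rw [phiDel_one_smul (by decide), bW, rightWord_top_odd (P := 1) l (by decide),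
        show 1 / 2 + 1 = 1 from rfl, ← aW, aW_succ, aW_zero, add_zero]
      exact h.f_vac_ne_zero hv hP hw hk hv0
    · rw [phiDel_one_smul (by omega)]
      exact h.bW_ne_zero hv hP hw hk hq hHW hP3 hv0 le_rfl (by omega)

end Last

end IsTheta

end Lower


/-! ### Weight spaces and rearrangements of words -/

/-- A combination of eigenvectors that is an eigenvector is a combination of those eigenvectors
that have the same eigenvalue. -/
theorem mem_span_of_eigenvector {X : Type*} [AddCommGroup X] [Module ℂ X] {ι : Type*} {s : Set ι}
    {x : ι → X} {θ : ι → ℂ} {T : Module.End ℂ X} (hT : ∀ i ∈ s, T (x i) = θ i • x i) {y : X}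
    {t : ℂ} (hy : y ∈ Submodule.span ℂ (x '' s)) (hty : T y = t • y) :
    y ∈ Submodule.span ℂ (x '' {i ∈ s | θ i = t}) := by
  have hs : s = {i ∈ s | θ i = t} ∪ {i ∈ s | θ i ≠ t} := by ext i; simp; tauto
  rw [hs, Set.image_union, Submodule.span_union, Submodule.mem_sup] at hy
  obtain ⟨a, ha, b, hb, rfl⟩ := hy
  have ha' : T a = t • a := by
    refine Submodule.span_induction (p := fun a _ => T a = t • a) ?_ (by simp) ?_ ?_ ha
    · rintro _ ⟨i, hi, rfl⟩
      rw [hT i hi.1, hi.2]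
    · intro a b _ _ ha hb
      rw [map_add, ha, hb, smul_add]
    · intro c a _ ha
      rw [map_smul, ha, smul_comm]
  have hb' : b ∈ T.eigenspace t := by
    rw [Module.End.mem_eigenspace_iff]
    rw [map_add, ha', smul_add] at hty
    exact add_left_cancel hty
  have hb'' : b ∈ ⨆ μ ≠ t, T.eigenspace μ := by
    refine Submodule.span_le.mpr ?_ hb
    rintro _ ⟨i, hi, rfl⟩
    exact Submodule.mem_iSup_of_mem (θ i) (Submodule.mem_iSup_of_mem hi.2
      (Module.End.mem_eigenspace_iff.mpr (hT i hi.1)))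
  have := (Module.End.eigenspaces_iSupIndep T t).le_bot ⟨hb', hb''⟩
  rw [Submodule.mem_bot] at this
  rwa [this, add_zero]

theorem qpow_int_inj {hb : ℂ} (hq : NotRoot hb) {c : ℂ} {m n : ℤ}
    (h : qpow hb (c - m) = qpow hb (c - n)) : m = n := by
  have key : ∀ r : ℤ, qpow hb r = 1 → r = 0 := by
    intro r hr
    by_contra h0
    have hr' : qpow hb (-r) = 1 := by rw [qpow_neg, hr, inv_one]
    apply hq r.natAbs (Int.natAbs_pos.mpr h0)
    rw [← qpow_natCast]
    rcases Int.natAbs_eq r with h | h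
    · rw [h] at hr; simpa using hr
    · rw [h] at hr'; simpa using hr'
  have := key (n - m) (by
    push_cast
    rw [show ((n : ℂ) - m) = (c - m) - (c - n) by ring, qpow_sub, h,
      mul_inv_cancel₀ (qpow_ne_zero _ _)])
  omega

section Words

variable {hb : ℂ} {N : ℕ} {X : Type*} [AddCommGroup X] [Module ℂ X] [Module (Uq hb N) X]
  [IsScalarTower ℂ (Uq hb N) X]

/-- The sum of the simple roots `α_i` over the letters of a word. -/
def wordRoot (N : ℕ) (w : List ℕ) : Lat N := (w.map (simpleRoot N)).sum

theorem wordRoot_nil : wordRoot N [] = 0 := rfl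

theorem wordRoot_cons (i : ℕ) (w : List ℕ) : wordRoot N (i :: w) = simpleRoot N i + wordRoot N w :=
  List.sum_cons

theorem ip_add_right (μ α β : Lat N) : ip μ (α + β) = ip μ α + ip μ β := by
  rw [ip_comm, ip_add_left, ip_comm α, ip_comm β]

theorem KGen_smul_fWord {ν : ℕ → ℂ} {v : X} (hw : IsWt hb N ν v) (μ : Lat N) (w : List ℕ) :
    KGen hb N μ • fWord hb N w • v =
      qpow hb (wsum N ν μ - (ip μ (wordRoot N w) : ℤ)) • fWord hb N w • v := by
  induction w with
  | nil => simp [fWord_nil, wordRoot_nil, ip, hw μ]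
  | cons i w IH =>
    rw [fWord_cons, mul_smul, KGen_smul_fGen_smul, IH, smul_smul_comm, smul_smul, ← qpow_add,
      wordRoot_cons, ip_add_right]
    congr 2
    push_cast
    ring

theorem mem_span_fWord {v : X} (hv : Generates hb N v) (x : X) :
    x ∈ Submodule.span ℂ ((fun w => fWord hb N w • v) '' {w | ∀ i ∈ w, 1 ≤ i ∧ i ≤ N / 2}) := by
  refine hv (Submodule.span ℂ ((fun w => fWord hb N w • v) '' {w | ∀ i ∈ w, 1 ≤ i ∧ i ≤ N / 2}))
    (Submodule.subset_span ⟨[], by simp, by simp [fWord_nil]⟩) (fun i h1 h2 x hx => ?_) x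
  refine Submodule.span_induction (p := fun x _ => fGen hb N i • x ∈ Submodule.span ℂ
    ((fun w => fWord hb N w • v) '' {w | ∀ i ∈ w, 1 ≤ i ∧ i ≤ N / 2})) ?_ ?_ ?_ ?_ hx
  · rintro _ ⟨w, hw, rfl⟩
    refine Submodule.subset_span ⟨i :: w, ?_, by simp [fWord_cons, mul_smul]⟩
    intro j hj
    rcases List.mem_cons.mp hj with rfl | hj
    · exact ⟨h1, h2⟩
    · exact hw j hj
  · rw [smul_zero]; exact Submodule.zero_mem _
  · intro a b _ _ ha hb
    rw [smul_add]; exact Submodule.add_mem _ ha hb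
  · intro c a _ ha
    rw [smul_smul_comm]; exact Submodule.smul_mem _ c ha

/-- A weight vector is a combination of words of the right weight. -/
theorem mem_span_fWord_of_wt (hq : NotRoot hb) {ν : ℕ → ℂ} {v : X} (hv : Generates hb N v)
    (hw : IsWt hb N ν v) {y : X} {β : Lat N}
    (hy : ∀ μ : Lat N, KGen hb N μ • y = qpow hb (wsum N ν μ - (ip μ β : ℤ)) • y) :
    y ∈ Submodule.span ℂ ((fun w => fWord hb N w • v) ''
      {w | (∀ i ∈ w, 1 ≤ i ∧ i ≤ N / 2) ∧ wordRoot N w = β}) := by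
  -- The coordinates of the weight are imposed one at a time: q^{h_{ε_k}} is diagonal on words, and
  -- its eigenvalues separate integers since q is not a root of unity.
  have key : ∀ F : Finset (Node N), y ∈ Submodule.span ℂ ((fun w => fWord hb N w • v) ''
      {w | (∀ i ∈ w, 1 ≤ i ∧ i ≤ N / 2) ∧ ∀ k ∈ F, wordRoot N w k = β k}) := by
    intro F
    induction F using Finset.induction_on with
    | empty => simpa using mem_span_fWord hv y
    | insert k F _ IH =>
      have := mem_span_of_eigenvector (T := Algebra.lsmul ℂ ℂ X (KGen hb N (eps N k)))
        (θ := fun w => qpow hb (wsum N ν (eps N k) - (ip (eps N k) (wordRoot N w) : ℤ)))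
        (fun w _ => KGen_smul_fWord hw _ w) IH (hy (eps N k))
      refine Submodule.span_mono (Set.image_mono ?_) this
      rintro w ⟨⟨h1, h2⟩, h3⟩
      refine ⟨h1, fun j hj => ?_⟩
      rcases Finset.mem_insert.mp hj with rfl | hj
      · have hm := Finset.mem_Icc.mp j.2
        have := qpow_int_inj hq h3
        rwa [ip_comm, ip_comm _ β, ip_eps_right _ hm.1 hm.2, ip_eps_right _ hm.1 hm.2] at this
      · exact h2 j hj
  refine Submodule.span_mono (Set.image_mono ?_) (key Finset.univ)
  exact fun w hw => ⟨hw.1, funext fun k => hw.2 k (Finset.mem_univ k)⟩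

theorem wordRoot_apply (hN : 3 ≤ N) {w : List ℕ} (hw : ∀ i ∈ w, 1 ≤ i ∧ i ≤ N / 2) (k : Node N) :
    wordRoot N w k = w.count (k : ℕ) - w.count ((k : ℕ) - 1)
      + if N % 2 = 0 ∧ (k : ℕ) + 1 = N / 2 then (w.count (N / 2) : ℤ) else 0 := by
  have hk := Finset.mem_Icc.mp k.2
  induction w with
  | nil => simp [wordRoot_nil]
  | cons i w IH =>
    have hi := hw i (by simp)
    have IH := IH fun j hj => hw j (by simp [hj])
    rw [wordRoot_cons, Pi.add_apply, IH, simpleRoot_apply]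
    simp only [List.count_cons, beq_iff_eq]
    push_cast
    split_ifs <;> omega

/-- Words with the same weight have the same letters. -/
theorem perm_of_wordRoot_eq (hN : 3 ≤ N) {w w' : List ℕ} (hw : ∀ i ∈ w, 1 ≤ i ∧ i ≤ N / 2)
    (hw' : ∀ i ∈ w', 1 ≤ i ∧ i ≤ N / 2) (h : wordRoot N w = wordRoot N w') : w.Perm w' := by
  rw [List.perm_iff_count]
  have hout : ∀ w : List ℕ, (∀ i ∈ w, 1 ≤ i ∧ i ≤ N / 2) → ∀ i, ¬(1 ≤ i ∧ i ≤ N / 2) →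
      w.count i = 0 := fun w hw i hi => List.count_eq_zero.mpr fun h => hi (hw i h)
  have hc : ∀ k, 1 ≤ k → k ≤ N / 2 → (w.count k : ℤ) - w.count (k - 1)
      + (if N % 2 = 0 ∧ k + 1 = N / 2 then (w.count (N / 2) : ℤ) else 0) =
      w'.count k - w'.count (k - 1)
      + if N % 2 = 0 ∧ k + 1 = N / 2 then (w'.count (N / 2) : ℤ) else 0 := by
    intro k h1 h2
    have := congrFun h ⟨k, Finset.mem_Icc.mpr ⟨h1, h2⟩⟩
    rwa [wordRoot_apply hN hw, wordRoot_apply hN hw'] at this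
  -- Multiplicities are recovered from left to right. For even N the last two letters share the
  -- coordinates n - 1 and n and are solved for together afterwards.
  have hlow : ∀ k, ¬(N % 2 = 0 ∧ N / 2 ≤ k + 1) → k ≤ N / 2 → w.count k = w'.count k := by
    intro k
    induction k with
    | zero => intro _ _; rw [hout w hw 0 (by omega), hout w' hw' 0 (by omega)]
    | succ k IH =>
      intro h1 h2
      have := hc (k + 1) (by omega) h2
      have := IH (by omega) (by omega)
      rw [if_neg (by omega), if_neg (by omega)] at *
      simp only [Nat.add_sub_cancel] at *
      omega
  intro k
  by_cases hk : 1 ≤ k ∧ k ≤ N / 2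
  · by_cases he : N % 2 = 0 ∧ N / 2 ≤ k + 1
    · have h1 := hc (N / 2 - 1) (by omega) (by omega)
      have h2 := hc (N / 2) (by omega) (by omega)
      have h3 := hlow (N / 2 - 1 - 1) (by omega) (by omega)
      rw [if_pos (by omega), if_pos (by omega)] at h1
      rw [if_neg (by omega), if_neg (by omega)] at h2
      obtain rfl | rfl : k = N / 2 ∨ k = N / 2 - 1 := by omega
      · omega
      · omega
    · exact hlow k he hk.2
  · rw [hout w hw k hk, hout w' hw' k hk]

theorem mem_span_perm (hq : NotRoot hb) (hN : 3 ≤ N) {ν : ℕ → ℂ} {v : X} (hv : Generates hb N v)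
    (hw : IsWt hb N ν v) {y : X} {L : List ℕ} (hL : ∀ i ∈ L, 1 ≤ i ∧ i ≤ N / 2)
    (hy : ∀ μ : Lat N, KGen hb N μ • y =
      qpow hb (wsum N ν μ - (ip μ (wordRoot N L) : ℤ)) • y) :
    y ∈ Submodule.span ℂ ((fun w => fWord hb N w • v) '' {w | w.Perm L}) :=
  Submodule.span_mono (Set.image_mono fun _ h => perm_of_wordRoot_eq hN h.1 hL h.2)
    (mem_span_fWord_of_wt hq hv hw hy)

end Words


/-! ### Exhausting all rearrangements of a word -/

section Fill

variable {hb : ℂ} {N : ℕ} {X : Type*} [AddCommGroup X] [Module ℂ X] [Module (Uq hb N) X]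
  [IsScalarTower ℂ (Uq hb N) X]

/-- All Chevalley monomials in a rearrangement of the letters of `R` send `x` to `B`. -/
def Fill (hb : ℂ) (N : ℕ) {X : Type*} [AddCommGroup X] [Module ℂ X] [Module (Uq hb N) X]
    (B : Submodule ℂ X) (R : List ℕ) (x : X) : Prop :=
  ∀ w : List ℕ, w.Perm R → fWord hb N w • x ∈ B

variable {B : Submodule ℂ X} {R : List ℕ} {x : X}

omit [IsScalarTower ℂ (Uq hb N) X] in
theorem Fill.nil (hx : x ∈ B) : Fill hb N B [] x := fun w hw => by
  rw [List.perm_nil.mp hw, fWord_nil, one_smul]; exact hx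

theorem Fill.smul (h : Fill hb N B R x) (c : ℂ) : Fill hb N B R (c • x) := fun w hw => by
  rw [smul_smul_comm]; exact B.smul_mem _ (h w hw)

omit [IsScalarTower ℂ (Uq hb N) X] in
-- The rightmost letter acts first. Checking all rearrangements thus becomes a walk through the
-- vectors reached so far, with many branches ending at zero.
theorem Fill.step (hR : R ≠ []) (h : ∀ j ∈ R, fGen hb N j • x = 0 ∨
    ∃ R', R.Perm (j :: R') ∧ Fill hb N B R' (fGen hb N j • x)) : Fill hb N B R x := by
  intro w hw
  obtain rfl | ⟨w, j, rfl⟩ := List.eq_nil_or_concat w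
  · exact absurd (List.nil_perm.mp hw) hR
  · rw [List.concat_eq_append] at hw ⊢
    rw [fWord_append, fWord_cons, fWord_nil, mul_one, mul_smul]
    obtain h0 | ⟨R', h1, h2⟩ := h j (hw.subset (by simp))
    · rw [h0, smul_zero]; exact B.zero_mem
    · refine h2 w (List.Perm.cons_inv (a := j) ?_)
      exact ((List.perm_append_singleton j w).symm.trans hw).trans h1

variable {l : ℕ}

theorem range'_cons {a m : ℕ} (h : a < m) :
    List.range' (l + 1 + a) (m - a) = (l + 1 + a) :: List.range' (l + 1 + (a + 1)) (m - (a + 1)) := by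
  rw [show m - a = m - (a + 1) + 1 by omega, List.range'_succ]; rfl

/-- At a_a y_m the letters left are l + a + 1, …, l + m. The lowest lengthens a_a, the highest turns
y_m into y_{m-1}, and any other gives zero, so the walk always ends at some a_m y_m. -/
theorem Family.fill {M : ℕ} {ω : ℕ → ℂ} {y : ℕ → X} (h : Family hb N l M ω y) (hN : 3 ≤ N)
    (hB : ∀ m, 1 ≤ m → m ≤ M → aW (hb := hb) (N := N) l m (y m) ∈ B) {a m : ℕ} (h1 : 1 ≤ m)
    (h2 : m ≤ M) (ha : a ≤ m) :
    Fill hb N B (List.range' (l + 1 + a) (m - a)) (aW (hb := hb) (N := N) l a (y m)) := by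
  obtain ⟨d, hd⟩ : ∃ d, d = m - a := ⟨_, rfl⟩
  induction d generalizing a m with
  | zero =>
    obtain rfl : a = m := by omega
    rw [← hd]; exact Fill.nil (hB a h1 h2)
  | succ d IH =>
    refine Fill.step (by rw [← hd]; simp) fun j hj => ?_
    rw [List.mem_range'_1] at hj
    have h3 := h.le m h2
    obtain ⟨s, rfl⟩ : ∃ s, j = l + s := ⟨j - l, by omega⟩
    obtain hs | hs : s = a + 1 ∨ a + 1 < s := by omega
    · refine Or.inr ⟨_, by rw [range'_cons (by omega), show l + s = l + 1 + a by omega], ?_⟩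
      rw [show l + s = l + 1 + a by omega, ← aW_succ]
      exact IH h1 h2 (by omega) (by omega)
    · rw [aW_f_comm hN (by omega) (by omega) fun he => by have := h.even_le he m h2; omega,
        h.f m s h1 h2 (by omega) (by omega)]
      split_ifs with hsm
      · refine Or.inr ⟨_, ?_, IH (m := m - 1) (by omega) (by omega) (by omega) (by omega)⟩
        rw [show m - a = m - 1 - a + 1 by omega, List.range'_concat,
          show l + 1 + a + 1 * (m - 1 - a) = l + s by omega]
        exact List.perm_append_singleton _ _
      · exact Or.inl (aW_apply_zero _ _)

end Fill

/-! ### The weight space of weight ν - 2ε_{l+1} -/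

section Base

variable {hb : ℂ} {l P : ℕ} {X : Type*} [AddCommGroup X] [Module ℂ X]
  [Module (Uq hb (2 * l + 2 + P)) X] [IsScalarTower ℂ (Uq hb (2 * l + 2 + P)) X]
  {B : Submodule ℂ X} {ν : ℕ → ℂ} {v : X}

local notation "fN" => fGen hb (2 * l + 2 + P)
local notation "eN" => eGen hb (2 * l + 2 + P)
local notation "aN" => aW (hb := hb) (N := 2 * l + 2 + P) l
local notation "sN" => aSum hb (2 * l + 2 + P) l

/-- A word of weight `2ε_{l+1}`. -/
def baseWord (l P : ℕ) : List ℕ :=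
  if Even P then List.range' (l + 1) (P / 2 - 1) ++ (List.range' (l + 1) (P / 2 - 1) ++
    [l + P / 2, l + P / 2 + 1])
  else List.range' (l + 1) (P / 2 + 1) ++ List.range' (l + 1) (P / 2 + 1)

theorem perm_left {A A' C : List ℕ} {j : ℕ} (h : A = j :: A') : (A ++ C).Perm (j :: (A' ++ C)) := by
  rw [h]; rfl

theorem perm_right {A C C' : List ℕ} {j : ℕ} (h : C.Perm (j :: C')) :
    (A ++ C).Perm (j :: (A ++ C')) :=
  (h.append_left A).trans List.perm_middle

variable (hq : NotRoot hb) (h : HW hb l P ν v) (hP : 3 ≤ P)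
include hq h hP

/-- The vectors reached are a_a a_t v with a ≤ t, and a letter lengthens one of the two words or
gives zero. When a = t > 0 the next letter is moved to the inner word by `f_aW_aW`, at the cost of a
scalar, so that a ≤ t persists. Once the inner word is complete, `Family.fill` takes over. -/
theorem HW.fill_odd (ho : ¬Even P)
    (hB : ∀ m, 1 ≤ m → m ≤ P / 2 + 1 → aN m (bW hb l P m v) ∈ B) {a t : ℕ} (hat : a ≤ t)
    (ht : t ≤ P / 2 + 1) :
    Fill hb (2 * l + 2 + P) B (List.range' (l + 1 + a) (P / 2 + 1 - a) ++
      List.range' (l + 1 + t) (P / 2 + 1 - t)) (aN a (aN t v)) := by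
  have h2 := Nat.even_iff.not.mp ho
  have hc := h.oddChain hP ho
  have hoN : ¬Even (2 * l + 2 + P) := by rwa [even_iff]
  obtain ⟨d, hd⟩ : ∃ d, d = (P / 2 + 1 - a) + (P / 2 + 1 - t) := ⟨_, rfl⟩
  induction d using Nat.strong_induction_on generalizing a t with
  | _ d IH =>
  obtain rfl | ht' : t = P / 2 + 1 ∨ t < P / 2 + 1 := by omega
  · have := (h.family_odd hq hP ho).fill (by omega) hB (a := a) (m := P / 2 + 1) (by omega) le_rfl hat
    rw [bW, rightWord_top_odd l ho, ← aW] at this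
    rwa [Nat.sub_self, List.range'_zero, List.append_nil]
  have hUp : ∀ s, 2 ≤ s → l + s ≤ (2 * l + 2 + P) / 2 → s ≠ t + 1 → fN (l + s) • aN t v = 0 := by
    intro s hs hs' hst
    obtain rfl | ht0 := Nat.eq_zero_or_pos t
    · rw [aW_zero]; exact h.f (by omega) _ (by omega) hs'
    · have := hc.fU hq (by omega) (i := l + 1 + t) (j := l + s) (by omega) (by omega) (by omega) hs'
        (by omega)
      rwa [show l + 1 + t - l - 1 = t by omega] at this
  have hnext : ∀ s, s = t + 1 → fN (l + s) • aN t v = aN (t + 1) v := fun s hs => by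
    rw [aW_succ, show l + s = l + 1 + t by omega]
  have hright : ∀ x, x = aN a (aN (t + 1) v) → ∀ s, s = t + 1 → ∃ R',
      (List.range' (l + 1 + a) (P / 2 + 1 - a) ++ List.range' (l + 1 + t) (P / 2 + 1 - t)).Perm
        ((l + s) :: R') ∧ Fill hb (2 * l + 2 + P) B R' x := fun x hx s hs => by
    refine ⟨_, perm_right (j := l + s)
      (C' := List.range' (l + 1 + (t + 1)) (P / 2 + 1 - (t + 1))) ?_, ?_⟩
    · rw [range'_cons ht', show l + s = l + 1 + t by omega]
    · rw [hx]; exact IH _ (by omega) (by omega) (by omega) rfl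
  refine Fill.step (by rw [range'_cons ht']; simp) fun j hj => ?_
  rw [List.mem_append, List.mem_range'_1, List.mem_range'_1] at hj
  obtain ⟨s, rfl⟩ : ∃ s, j = l + s := ⟨j - l, by omega⟩
  have hcomm : a + 1 < s → fN (l + s) • aN a (aN t v) = aN a (fN (l + s) • aN t v) := fun hs =>
    aW_f_comm (by omega) (by omega) (by omega) (fun he => absurd he hoN) _
  obtain hlt | rfl : a < t ∨ a = t := by omega
  · obtain hs | hs : s = a + 1 ∨ a + 1 < s := by omega
    · refine Or.inr ⟨_, perm_left (A' := List.range' (l + 1 + (a + 1)) (P / 2 + 1 - (a + 1))) ?_, ?_⟩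
      · rw [range'_cons (by omega), show l + s = l + 1 + a by omega]
      · rw [show l + s = l + 1 + a by omega, ← aW_succ]
        exact IH _ (by omega) (by omega) (by omega) rfl
    · rw [hcomm hs]
      by_cases hst : s = t + 1
      · exact Or.inr (hright _ (by rw [hnext s hst]) s hst)
      · rw [hUp s (by omega) (by omega) hst, aW_apply_zero]; exact Or.inl rfl
  · obtain hs | hs : s = a + 1 ∨ a + 1 < s := by omega
    · right
      obtain rfl | ha := Nat.eq_zero_or_pos a
      · exact hright _ (by rw [aW_zero, hnext s hs, aW_zero]) s hs
      · obtain ⟨r, rfl⟩ : ∃ r, a = r + 1 := ⟨a - 1, by omega⟩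
        obtain ⟨R', h3, h4⟩ := hright _ rfl s hs
        refine ⟨R', h3, ?_⟩
        rw [f_aW_aW hq (by omega) (h.f (by omega)) (by omega) (by omega)
          (Or.inl ⟨by omega, fun h' => hoN h'.1⟩), hnext s hs]
        exact h4.smul _
    · rw [hcomm hs, hUp s (by omega) (by omega) (by omega), aW_apply_zero]; exact Or.inl rfl

/-- The inner word has taken the branch n - 1 of the fork and f_n is still pending. Applied before
the outer word is complete, f_n produces b_{P/2-1} v; applied last, it gives φ_{p+1} v = φ_p v. -/
theorem HW.fill_even_last (he : Even P)
    (hB : ∀ m, 1 ≤ m → m ≤ P / 2 → aN m (bW hb l P m v) ∈ B) {a : ℕ} (ha : a ≤ P / 2 - 1) :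
    Fill hb (2 * l + 2 + P) B (List.range' (l + 1 + a) (P / 2 - 1 - a) ++ [l + P / 2 + 1])
      (aN a (aN (P / 2) v)) := by
  have h2 := Nat.even_iff.mp he
  have hc := h.evenChain hP he
  have hF := h.family_even hq hP he
  obtain ⟨d, hd⟩ : ∃ d, d = P / 2 - 1 - a := ⟨_, rfl⟩
  induction d generalizing a with
  | zero =>
    obtain rfl : a = P / 2 - 1 := by omega
    refine Fill.step (by simp) fun j hj => Or.inr ⟨[], ?_, Fill.nil ?_⟩
    · rw [Nat.sub_self, List.range'_zero, List.nil_append] at hj ⊢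
      rw [List.mem_singleton.mp hj]
    · rw [Nat.sub_self, List.range'_zero, List.nil_append] at hj
      rw [List.mem_singleton.mp hj, show l + P / 2 + 1 = l + 1 + P / 2 by omega,
        ← phi_extra_smul he, h.phi_extra hq (by omega) he, phi_smul _ (fun _ => le_rfl)]
      exact hB _ (by omega) le_rfl
  | succ d IH =>
    refine Fill.step (by simp) fun j hj => ?_
    rw [List.mem_append, List.mem_range'_1, List.mem_singleton] at hj
    obtain ⟨s, rfl⟩ : ∃ s, j = l + s := ⟨j - l, by omega⟩
    obtain hs | hs : s = a + 1 ∨ a + 1 < s := by omega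
    · refine Or.inr ⟨_, perm_left (A' := List.range' (l + 1 + (a + 1)) (P / 2 - 1 - (a + 1))) ?_, ?_⟩
      · rw [range'_cons (by omega), show l + s = l + 1 + a by omega]
      · rw [show l + s = l + 1 + a by omega, ← aW_succ]
        exact IH (by omega) (by omega)
    · rw [aW_f_comm (by omega) (by omega) (by omega) (fun _ => by omega)]
      by_cases hsp : s = P / 2 + 1
      · refine Or.inr ⟨_, by rw [hsp]; exact List.perm_append_singleton _ _, ?_⟩
        have := hc.f_last (by omega)
        rw [show (2 * l + 2 + P) / 2 - l - 1 = P / 2 by omega,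
          show (2 * l + 2 + P) / 2 - 1 - l - 1 = P / 2 - 1 by omega] at this
        rw [show l + s = (2 * l + 2 + P) / 2 by omega, this]
        exact hF.fill (by omega) hB (by omega) (by omega) (by omega)
      · have := hc.fU hq (by omega) (i := l + 1 + P / 2) (j := l + s) (by omega) (by omega)
          (by omega) (by omega) (by omega) (by omega)
        rw [show l + 1 + P / 2 - l - 1 = P / 2 by omega] at this
        rw [this, aW_apply_zero]; exact Or.inl rfl

theorem HW.fill_even (he : Even P)
    (hB : ∀ m, 1 ≤ m → m ≤ P / 2 → aN m (bW hb l P m v) ∈ B) {a t : ℕ} (hat : a ≤ t)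
    (ht : t ≤ P / 2 - 1) :
    Fill hb (2 * l + 2 + P) B (List.range' (l + 1 + a) (P / 2 - 1 - a) ++
      (List.range' (l + 1 + t) (P / 2 - 1 - t) ++ [l + P / 2, l + P / 2 + 1])) (aN a (aN t v)) := by
  have h2 := Nat.even_iff.mp he
  have hc := h.evenChain hP he
  have hF := h.family_even hq hP he
  have heN : Even (2 * l + 2 + P) := by rwa [even_iff]
  obtain ⟨d, hd⟩ : ∃ d, d = (P / 2 - 1 - a) + (P / 2 - 1 - t) := ⟨_, rfl⟩
  induction d using Nat.strong_induction_on generalizing a t with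
  | _ d IH =>
  have hUp : ∀ s, 2 ≤ s → l + s ≤ (2 * l + 2 + P) / 2 → s ≠ t + 1 →
      ¬(s = P / 2 + 1 ∧ t = P / 2 - 1) → fN (l + s) • aN t v = 0 := by
    intro s hs hs' hst hlast
    obtain rfl | ht0 := Nat.eq_zero_or_pos t
    · rw [aW_zero]; exact h.f (by omega) _ (by omega) hs'
    · have := hc.fU hq (by omega) (i := l + 1 + t) (j := l + s) (by omega) (by omega) (by omega) hs'
        (by omega) (by omega)
      rwa [show l + 1 + t - l - 1 = t by omega] at this
  have hnext : ∀ s, s = t + 1 → fN (l + s) • aN t v = aN (t + 1) v := fun s hs => by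
    rw [aW_succ, show l + s = l + 1 + t by omega]
  have hright : ∀ x, ∀ s, l + s ∈ (List.range' (l + 1 + a) (P / 2 - 1 - a) ++
      (List.range' (l + 1 + t) (P / 2 - 1 - t) ++ [l + P / 2, l + P / 2 + 1])) →
      x = aN a (fN (l + s) • aN t v) → (a + 1 < s ∨ (s = a + 1 ∧ a = t)) → x = 0 ∨ ∃ R',
      (List.range' (l + 1 + a) (P / 2 - 1 - a) ++
      (List.range' (l + 1 + t) (P / 2 - 1 - t) ++ [l + P / 2, l + P / 2 + 1])).Perm
        ((l + s) :: R') ∧ Fill hb (2 * l + 2 + P) B R' x := fun x s hj hx hs => by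
    simp only [List.mem_append, List.mem_range'_1, List.mem_cons, List.not_mem_nil, or_false] at hj
    by_cases h3 : s = t + 1 ∧ t < P / 2 - 1
    · refine Or.inr ⟨_, perm_right (perm_left (j := l + s)
        (A' := List.range' (l + 1 + (t + 1)) (P / 2 - 1 - (t + 1))) ?_), ?_⟩
      · rw [range'_cons h3.2, show l + s = l + 1 + t by omega]
      · rw [hx, hnext s h3.1]; exact IH _ (by omega) (by omega) (by omega) rfl
    by_cases h4 : s = P / 2 ∧ t = P / 2 - 1
    · refine Or.inr ⟨_, perm_right (C' := [l + P / 2 + 1]) ?_, ?_⟩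
      · rw [h4.2, h4.1, Nat.sub_self, List.range'_zero, List.nil_append]
      · rw [hx, hnext s (by omega), h4.2, show P / 2 - 1 + 1 = P / 2 by omega]
        exact h.fill_even_last hq hP he hB (by omega)
    by_cases h5 : s = P / 2 + 1 ∧ t = P / 2 - 1
    · refine Or.inr ⟨_, perm_right (C' := [l + P / 2]) ?_, ?_⟩
      · rw [h5.2, h5.1, Nat.sub_self, List.range'_zero, List.nil_append]
        exact List.Perm.swap _ _ _
      · have h6 := hc.mid
        rw [show (2 * l + 2 + P) / 2 - l - 1 = P / 2 by omega,
          show (2 * l + 2 + P) / 2 - 1 - l - 1 = P / 2 - 1 by omega] at h6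
        have h7 := hF.fill (by omega) hB (a := a) (m := P / 2) (by omega) le_rfl (by omega)
        rw [show P / 2 - a = P / 2 - 1 - a + 1 by omega, List.range'_concat,
          show l + 1 + a + 1 * (P / 2 - 1 - a) = l + P / 2 by omega] at h7
        rw [hx, h5.2, show l + s = (2 * l + 2 + P) / 2 by omega, ← h6]
        exact h7
    · left
      rw [hx, hUp s (by omega) (by omega) (by omega) h5, aW_apply_zero]
  refine Fill.step (by simp) fun j hj => ?_
  have hj' := hj
  simp only [List.mem_append, List.mem_range'_1, List.mem_cons, List.not_mem_nil, or_false] at hj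
  obtain ⟨s, rfl⟩ : ∃ s, j = l + s := ⟨j - l, by omega⟩
  have hcomm : a + 1 < s → ¬(s = P / 2 + 1 ∧ a = P / 2 - 1) →
      fN (l + s) • aN a (aN t v) = aN a (fN (l + s) • aN t v) := fun hs hs' =>
    aW_f_comm (by omega) (by omega) (by omega) (fun _ _ => by omega) _
  obtain hlt | rfl : a < t ∨ a = t := by omega
  · obtain hs | hs : s = a + 1 ∨ a + 1 < s := by omega
    · refine Or.inr ⟨_, perm_left (A' := List.range' (l + 1 + (a + 1)) (P / 2 - 1 - (a + 1))) ?_, ?_⟩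
      · rw [range'_cons (by omega), show l + s = l + 1 + a by omega]
      · rw [show l + s = l + 1 + a by omega, ← aW_succ]
        exact IH _ (by omega) (by omega) (by omega) rfl
    · exact hright _ s hj' (hcomm hs (by omega)) (Or.inl hs)
  · by_cases hs : a + 1 < s ∧ ¬(s = P / 2 + 1 ∧ a = P / 2 - 1)
    · exact hright _ s hj' (hcomm hs.1 hs.2) (Or.inl hs.1)
    · obtain rfl | ha := Nat.eq_zero_or_pos a
      · exact hright _ s hj' (by simp only [aW_zero]) (by omega)
      · obtain ⟨r, rfl⟩ : ∃ r, a = r + 1 := ⟨a - 1, by omega⟩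
        rw [f_aW_aW hq (by omega) (h.f (by omega)) (by omega) (by omega)]
        · obtain h0 | ⟨R', h3, h4⟩ := hright _ s hj' rfl (by omega)
          · rw [h0, smul_zero]; exact Or.inl rfl
          · exact Or.inr ⟨R', h3, h4.smul _⟩
        · obtain hs' | hs' : s = r + 2 ∨ s = P / 2 + 1 ∧ r + 1 = P / 2 - 1 := by omega
          · exact Or.inl ⟨by omega, by omega⟩
          · exact Or.inr ⟨heN, by omega, by omega⟩

end Base


/-! ### The weight of a word -/

section WordWeights

variable {hb : ℂ} {N : ℕ} {X : Type*} [AddCommGroup X] [Module ℂ X] [Module (Uq hb N) X]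
  [IsScalarTower ℂ (Uq hb N) X]

theorem wsum_sum_rt (w : List ℕ) (μ : Lat N) :
    wsum N (w.map (rt N)).sum μ = (ip μ (wordRoot N w) : ℤ) := by
  induction w with
  | nil => simp [wsum, wordRoot_nil, ip]
  | cons i w IH =>
    rw [List.map_cons, List.sum_cons, wsum_add_left, IH, wsum_rt, wordRoot_cons, ip_add_right]
    push_cast; rfl

theorem IsWt.mem_span_perm (hq : NotRoot hb) (hN : 3 ≤ N) {ν ω : ℕ → ℂ} {v : X}
    (hv : Generates hb N v) (hw : IsWt hb N ν v) {y : X} (hy : IsWt hb N ω y) {L : List ℕ}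
    (hL : ∀ i ∈ L, 1 ≤ i ∧ i ≤ N / 2)
    (hω : ∀ i, 1 ≤ i → i ≤ N / 2 → ω i = ν i - (L.map (rt N)).sum i) :
    y ∈ Submodule.span ℂ ((fun w => fWord hb N w • v) '' {w | w.Perm L}) :=
  QuantumSO.mem_span_perm hq hN hv hw hL fun μ => by
    rw [hy μ, wsum_congr (ν' := ν - (L.map (rt N)).sum) hω, wsum_sub_left, wsum_sum_rt]

theorem sum_rt_range' {a m : ℕ} (h : a + m ≤ N / 2) :
    ((List.range' a m).map (rt N)).sum = Pi.single a 1 - Pi.single (a + m) 1 := by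
  induction m generalizing a with
  | zero => simp
  | succ m IH =>
    rw [List.range'_succ, List.map_cons, List.sum_cons, IH (by omega), rt, if_pos (by omega),
      show a + 1 + m = a + (m + 1) by omega]
    abel

theorem sum_rt_baseWord {l P : ℕ} (hP : 1 ≤ P) :
    ((baseWord l P).map (rt (2 * l + 2 + P))).sum = Pi.single (l + 1) 2 := by
  have h2 : (Pi.single (l + 1) 2 : ℕ → ℂ) = Pi.single (l + 1) 1 + Pi.single (l + 1) 1 := by
    rw [← Pi.single_add]; norm_num
  by_cases he : Even P
  · have h3 := Nat.even_iff.mp he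
    have h1 : (List.map (rt (2 * l + 2 + P)) [l + P / 2, l + P / 2 + 1]).sum =
        Pi.single (l + P / 2) 1 + Pi.single (l + P / 2) 1 := by
      rw [List.map_cons, List.map_cons, List.map_nil, List.sum_cons, List.sum_cons, List.sum_nil,
        rt, if_pos (by omega), rt, if_neg (by omega), if_pos (by rwa [even_iff]),
        Nat.add_sub_cancel]
      abel
    rw [baseWord, if_pos he, List.map_append, List.sum_append, List.map_append, List.sum_append,
      sum_rt_range' (by omega), h1, h2, show l + 1 + (P / 2 - 1) = l + P / 2 by omega]
    abel
  · have h3 := Nat.even_iff.not.mp he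
    rw [baseWord, if_neg he, List.map_append, List.sum_append, List.range'_concat, List.map_append,
      List.sum_append, sum_rt_range' (by omega), h2, List.map_cons, List.map_nil, List.sum_singleton,
      rt, if_neg (by omega), if_neg (by rwa [even_iff]), show l + 1 + 1 * (P / 2) = l + 1 + P / 2 by omega]
    abel

theorem mem_baseWord {l P i : ℕ} (hP : 1 ≤ P) (h : i ∈ baseWord l P) :
    l + 1 ≤ i ∧ i ≤ (2 * l + 2 + P) / 2 := by
  unfold baseWord at h
  split_ifs at h with he
  · have h3 := Nat.even_iff.mp he
    simp only [List.mem_append, List.mem_range'_1, List.mem_cons, List.not_mem_nil, or_false] at h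
    omega
  · simp only [List.mem_append, List.mem_range'_1] at h
    omega

end WordWeights

/-! ### Uniqueness in weight ν - 2ε_{l+1} -/

section BaseUnique

variable {hb : ℂ} {l P : ℕ} {X : Type*} [AddCommGroup X] [Module ℂ X]
  [Module (Uq hb (2 * l + 2 + P)) X] [IsScalarTower ℂ (Uq hb (2 * l + 2 + P)) X]
  {ν : ℕ → ℂ} {v : X}

local notation "fN" => fGen hb (2 * l + 2 + P)
local notation "eN" => eGen hb (2 * l + 2 + P)
local notation "aN" => aW (hb := hb) (N := 2 * l + 2 + P) l
local notation "sN" => aSum hb (2 * l + 2 + P) l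

omit [IsScalarTower ℂ (Uq hb (2 * l + 2 + P)) X] in
theorem exists_aSum_of_mem_span {M : ℕ} {y : ℕ → X} {x : X}
    (hx : x ∈ Submodule.span ℂ ((fun m => aN m (y m)) '' ↑(Finset.Icc 1 M))) :
    ∃ c, x = sN M c y := by
  obtain ⟨c, hc⟩ := (Submodule.mem_span_image_finset_iff_exists_fun' ℂ).mp hx
  exact ⟨c, hc.symm⟩

variable (hq : NotRoot hb) (h : HW hb l P ν v)
include hq h

/-- The vector space of weight `ν - 2ε_{l+1}` is spanned by the vectors `φ_m v`. -/
theorem HW.exists_aSum (hv : Generates hb (2 * l + 2 + P) v) (hP : 1 ≤ P) {y : X}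
    (hy : IsWt hb (2 * l + 2 + P) (ν - Pi.single (l + 1) 2) y) :
    ∃ c, y = sN ((P + 1) / 2) c (fun m => bW hb l P m v) := by
  refine exists_aSum_of_mem_span ?_
  have hB : ∀ m, 1 ≤ m → m ≤ (P + 1) / 2 → aN m (bW hb l P m v) ∈
      Submodule.span ℂ ((fun m => aN m (bW hb l P m v)) '' ↑(Finset.Icc 1 ((P + 1) / 2))) :=
    fun m h1 h2 => Submodule.subset_span ⟨m, by simpa using ⟨h1, h2⟩, rfl⟩
  generalize Submodule.span ℂ ((fun m => aN m (bW hb l P m v)) '' ↑(Finset.Icc 1 ((P + 1) / 2))) = B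
    at hB ⊢
  have hfill : Fill hb (2 * l + 2 + P) B (baseWord l P) v := by
    by_cases he : Even P
    · have h3 := Nat.even_iff.mp he
      rw [baseWord, if_pos he]
      obtain rfl | hP3 : P = 2 ∨ 3 ≤ P := by omega
      · have h4 := hB 1 le_rfl le_rfl
        rw [bW_one_two hq rfl, aW_succ, aW_zero, add_zero] at h4
        refine Fill.step (by simp) fun j hj => Or.inr ?_
        obtain rfl | rfl : j = l + 1 ∨ j = l + 2 := by simpa using hj
        · refine ⟨[l + 2], List.Perm.refl _, Fill.step (by simp) fun j hj => Or.inr ⟨[], ?_, ?_⟩⟩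
          · rw [List.mem_singleton.mp hj]
          · rw [List.mem_singleton.mp hj, ← f_comm_two hq rfl]; exact Fill.nil h4
        · refine ⟨[l + 1], List.Perm.swap _ _ _, Fill.step (by simp) fun j hj => Or.inr ⟨[], ?_, ?_⟩⟩
          · rw [List.mem_singleton.mp hj]
          · rw [List.mem_singleton.mp hj]; exact Fill.nil h4
      · have := h.fill_even hq hP3 he (a := 0) (t := 0) (fun m h1 h2 => hB m h1 (by omega)) le_rfl
          (Nat.zero_le _)
        rwa [aW_zero, aW_zero, Nat.sub_zero] at this
    · have h3 := Nat.even_iff.not.mp he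
      rw [baseWord, if_neg he]
      obtain rfl | hP3 : P = 1 ∨ 3 ≤ P := by omega
      · have h4 := hB 1 le_rfl le_rfl
        rw [bW, rightWord_top_odd (P := 1) l he, ← aW, show 1 / 2 + 1 = 0 + 1 from rfl, aW_succ,
          aW_zero, aW_succ, aW_zero, add_zero] at h4
        refine Fill.step (by simp) fun j hj => Or.inr ⟨[l + 1], ?_,
          Fill.step (by simp) fun j' hj' => Or.inr ⟨[], ?_, ?_⟩⟩
        · obtain rfl : j = l + 1 := by simpa using hj
          rfl
        · rw [List.mem_singleton.mp hj']
        · obtain rfl : j = l + 1 := by simpa using hj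
          rw [List.mem_singleton.mp hj']; exact Fill.nil h4
      · have := h.fill_odd hq hP3 he (a := 0) (t := 0) (fun m h1 h2 => hB m h1 (by omega)) le_rfl
          (Nat.zero_le _)
        rwa [aW_zero, aW_zero, Nat.sub_zero] at this
  have hmem := h.wt.mem_span_perm hq (by omega) hv hy (L := baseWord l P)
    (fun i hi => ⟨by have := mem_baseWord hP hi; omega, (mem_baseWord hP hi).2⟩)
    (fun i _ _ => by rw [sum_rt_baseWord hP]; rfl)
  refine (Submodule.span_le.mpr ?_) hmem
  rintro _ ⟨w, hw, rfl⟩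
  exact hfill w hw

variable {T : X →ₗ[ℂ] ℕ → X} (hT : IsTheta hb l P (l + 1) v T)
  (hv : Generates hb (2 * l + 2 + P) v) (hv0 : v ≠ 0)
include hT hv hv0

/-- The raising operator of the top letter shortens the word with coefficient [1]_q = 1, down to
f_{l+1} b_s v. There the component at w_{l+2} is a nonzero multiple of b_s v. -/
theorem HW.aW_bW_ne_zero (hP : 3 ≤ P) {m s : ℕ} (hm : m + 1 < s) (hs : s ≤ (P + 1) / 2) :
    aN (m + 1) (bW hb l P s v) ≠ 0 := by
  obtain ⟨M, hF, hM⟩ : ∃ M, Family hb (2 * l + 2 + P) l M (ν - Pi.single (l + 1) 1)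
      (fun m => bW hb l P m v) ∧ M = (P + 1) / 2 := by
    by_cases he : Even P
    · exact ⟨_, h.family_even hq hP he, by have := Nat.even_iff.mp he; omega⟩
    · exact ⟨_, h.family_odd hq hP he, by have := Nat.even_iff.not.mp he; omega⟩
  have hle := hF.le s (by omega)
  induction m with
  | zero =>
    intro h0
    have := hT.lower_aW hv (by omega) rfl (hT.lower_bW hv (by omega) h.wt rfl h hP
      (m := s) (by omega) hs) 0
    rw [h0, map_zero, aW_zero, hF.wt s (by omega) (by omega)] at this
    exact smul_ne_zero (qpow_ne_zero _ _)
      (hT.bW_ne_zero hv (by omega) h.wt rfl hq h hP hv0 (by omega) hs) this.symm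
  | succ m IH =>
    intro h0
    have h1 := e_aW_top (hF.wt s (by omega) (by omega)) (by omega) l (m + 1) (by omega)
    have h2 := hF.e s (m + 2) (by omega) (by omega) (by omega) (by omega)
    rw [if_neg (by omega)] at h2
    have hd : dval (2 * l + 2 + P) (ν - Pi.single (l + 1) 1 - Pi.single (l + 1 + s) 1 -
        Pi.single (l + 1) 1 + Pi.single (l + 1 + (m + 1)) 1) (l + 1 + (m + 1)) = 1 := by
      rw [dval, if_pos (by omega)]
      simp [h.zero (l + 1 + (m + 1)) (by omega) (by omega),
        show m + 1 ≠ s by omega, show l + 1 + (m + 1) ≠ l by omega,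
        show l + 1 + (m + 1) + 1 ≠ l + 1 + s by omega, h.zero (l + 1 + (m + 1) + 1) (by omega) (by omega)]
    rw [h0, smul_zero, show l + 1 + (m + 1) = l + (m + 2) by omega, h2, aW_apply_zero, zero_add] at h1
    rw [show l + (m + 2) = l + 1 + (m + 1) by omega, hd, qnum_one hq, one_smul] at h1
    exact IH (by omega) h1.symm

/-- The recurrence is run from the top index down. After subtracting the multiple of f_{2ε_{l+1}} v
with the same top coefficient, the boundary relation annihilates the next coefficient and each
further relation the one before. The vectors multiplied by these relations are nonzero by
`HW.aW_bW_ne_zero`. For P ≤ 2 there is a single monomial. -/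
theorem HW.base_unique (hP : 1 ≤ P) {y : X}
    (hy : IsWt hb (2 * l + 2 + P) (ν - Pi.single (l + 1) 2) y)
    (he : P ≠ 2 → ∀ j, l + 2 ≤ j → j ≤ (2 * l + 2 + P) / 2 → eN j • y = 0) :
    ∃ c : ℂ, y = c • fDouble hb l P • v := by
  obtain ⟨c, rfl⟩ := h.exists_aSum hq hv hP hy
  -- The top coefficient is ±[1] for even P and ±[1/2] for odd P.
  have hD : dCoeff hb P ((P + 1) / 2) ≠ 0 := by
    refine mul_ne_zero (pow_ne_zero _ (by norm_num)) ?_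
    obtain hp | hp : P % 2 = 0 ∨ P % 2 = 1 := by omega
    · obtain ⟨p, rfl⟩ : ∃ p, P = 2 * p := ⟨P / 2, by omega⟩
      rw [show (2 * p + 1) / 2 = p by omega, show (((2 * p : ℕ) : ℂ) / 2 - p + 1) = 1 by
        push_cast; ring, qnum_one hq]
      exact one_ne_zero
    · obtain ⟨p, rfl⟩ : ∃ p, P = 2 * p + 1 := ⟨P / 2, by omega⟩
      rw [show (2 * p + 1 + 1) / 2 = p + 1 by omega,
        show (((2 * p + 1 : ℕ) : ℂ) / 2 - (p + 1 : ℕ) + 1) = 1 / 2 by push_cast; ring]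
      exact_mod_cast qnum_half_ne hq 1 le_rfl
  refine ⟨c ((P + 1) / 2) / dCoeff hb P ((P + 1) / 2), ?_⟩
  rw [fDouble_smul]
  obtain hP2 | hP3 : P ≤ 2 ∨ 3 ≤ P := by omega
  · have hM : (P + 1) / 2 = 1 := by omega
    rw [hM] at hD ⊢
    simp only [aSum, Finset.Icc_self, Finset.sum_singleton]
    rw [smul_smul, div_mul_cancel₀ _ hD]
  set κ := c ((P + 1) / 2) / dCoeff hb P ((P + 1) / 2) with hκ
  have hlin : ∀ c' : ℕ → ℂ, sN ((P + 1) / 2) (c - κ • c') (fun m => bW hb l P m v) =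
      sN ((P + 1) / 2) c (fun m => bW hb l P m v)
        - κ • sN ((P + 1) / 2) c' (fun m => bW hb l P m v) := fun c' => by
    simp only [aSum, Pi.sub_apply, Pi.smul_apply, smul_eq_mul, sub_smul, mul_smul,
      Finset.sum_sub_distrib, Finset.smul_sum]
  have hsing : ∀ j, l + 2 ≤ j → j ≤ (2 * l + 2 + P) / 2 →
      eN j • sN ((P + 1) / 2) (c - κ • dCoeff hb P) (fun m => bW hb l P m v) = 0 := by
    intro j h1 h2
    rw [hlin, smul_sub, he (by omega) j h1 h2, smul_smul_comm, ← fDouble_smul,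
      h.e_fDouble hq hP3 (by omega) h2, if_neg (by omega), zero_smul, smul_zero, sub_zero]
  have htop : (c - κ • dCoeff hb P) ((P + 1) / 2) = 0 := by
    rw [Pi.sub_apply, Pi.smul_apply, smul_eq_mul, hκ, div_mul_cancel₀ _ hD, sub_self]
  rw [← sub_eq_zero, ← hlin]
  generalize c - κ • dCoeff hb P = c' at hsing htop
  have hne := fun m s hm hs => h.aW_bW_ne_zero hq hT hv hv0 hP3 (m := m) (s := s) hm hs
  have htop' : c' ((P + 1) / 2 - 1) = 0 := by
    by_cases hev : Even P
    · have h3 := Nat.even_iff.mp hev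
      have hF := h.family_even hq hP3 hev
      rw [show P / 2 = (P + 1) / 2 by omega] at hF
      have h4 := hF.e_aSum_top hq (by omega) c' (by omega) (by omega)
      rw [hsing _ (by omega) (by omega), htop, mul_zero, add_zero] at h4
      refine (smul_eq_zero.mp h4.symm).resolve_right ?_
      rw [show (P + 1) / 2 - 1 = (P + 1) / 2 - 2 + 1 by omega]
      exact hne _ _ (by omega) le_rfl
    · have h3 := Nat.even_iff.not.mp hev
      have hF := h.family_odd hq hP3 hev
      rw [show P / 2 + 1 = (P + 1) / 2 by omega] at hF
      have h4 := hF.e_last_odd hq (by omega) c' (by omega) (by rwa [even_iff]) (by omega)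
        (z := aN (P / 2) v) (fun m h1 h2 => by
          rw [h.e_last_bW_odd hq hP3 hev h1 (by omega), show P / 2 + 1 = (P + 1) / 2 by omega])
      rw [hsing _ (by omega) le_rfl, htop, zero_smul, add_zero, add_zero] at h4
      refine (smul_eq_zero.mp h4.symm).resolve_right ?_
      rw [show (P + 1) / 2 - 1 = (P + 1) / 2 - 2 + 1 by omega]
      exact hne _ _ (by omega) le_rfl
  have hall : ∀ d, d + 2 ≤ (P + 1) / 2 → c' ((P + 1) / 2 - d) = 0 ∧ c' ((P + 1) / 2 - d - 1) = 0 := by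
    intro d
    induction d with
    | zero => exact fun _ => ⟨htop, htop'⟩
    | succ d IH =>
      intro hd
      obtain ⟨h1, h2⟩ := IH (by omega)
      refine ⟨h2, ?_⟩
      obtain ⟨s, hs⟩ : ∃ s, s = (P + 1) / 2 - d - 1 := ⟨_, rfl⟩
      have h4 : eN (l + s) • sN ((P + 1) / 2) c' (fun m => bW hb l P m v) =
          (c' (s - 1) + (qpow hb 1 + qpow hb (-1)) * c' s + c' (s + 1)) •
            aN (s - 1) (bW hb l P s v) := by
        by_cases hev : Even P
        · have h3 := Nat.even_iff.mp hev
          have hF := h.family_even hq hP3 hev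
          rw [show P / 2 = (P + 1) / 2 by omega] at hF
          exact hF.e_aSum hq (by omega) c' (by omega) (by omega) (by omega)
        · have h3 := Nat.even_iff.not.mp hev
          have hF := h.family_odd hq hP3 hev
          rw [show P / 2 + 1 = (P + 1) / 2 by omega] at hF
          exact hF.e_aSum hq (by omega) c' (by omega) (by omega) (by omega)
      rw [hsing _ (by omega) (by omega), hs, h2, show (P + 1) / 2 - d - 1 + 1 = (P + 1) / 2 - d by omega,
        h1, mul_zero, add_zero, add_zero] at h4
      rw [show (P + 1) / 2 - (d + 1) - 1 = (P + 1) / 2 - d - 1 - 1 by omega]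
      refine (smul_eq_zero.mp h4.symm).resolve_right ?_
      rw [show (P + 1) / 2 - d - 1 - 1 = (P + 1) / 2 - d - 1 - 2 + 1 by omega]
      exact hne _ _ (by omega) (by omega)
  refine Finset.sum_eq_zero fun m hm => ?_
  rw [Finset.mem_Icc] at hm
  have : c' m = 0 := by
    obtain hm' | hm' : m = (P + 1) / 2 ∨ m < (P + 1) / 2 := by omega
    · rw [hm', htop]
    · have := (hall ((P + 1) / 2 - m - 1) (by omega)).2
      rwa [show (P + 1) / 2 - ((P + 1) / 2 - m - 1) - 1 = m by omega] at this
  rw [this, zero_smul]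

end BaseUnique


/-! ### The canonical generator of the parabolic Verma module -/

/-- The properties of the canonical generator of a parabolic Verma module that determine its
singular vectors. -/
structure IsVacuum (hb : ℂ) (l P : ℕ) {X : Type*} [AddCommGroup X] [Module ℂ X]
    [Module (Uq hb (2 * l + 2 + P)) X] [IsScalarTower ℂ (Uq hb (2 * l + 2 + P)) X]
    (ν : ℕ → ℂ) (v : X) : Prop extends HW hb l P ν v where
  e_all : ∀ j, eGen hb (2 * l + 2 + P) j • v = 0
  gen : Generates hb (2 * l + 2 + P) v
  ne_zero : v ≠ 0
  theta : ∀ k, 1 ≤ k → k ≤ l + 1 → ∃ T, IsTheta hb l P k v T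

section Generation

variable {hb : ℂ} {N : ℕ} {X : Type*} [AddCommGroup X] [Module ℂ X] [Module (Uq hb N) X]
  [IsScalarTower ℂ (Uq hb N) X]

theorem smul_mem_of_gen {p : Submodule ℂ X} (hp : ∀ g, ∀ x ∈ p, gen hb N g • x ∈ p) (u : Uq hb N) :
    ∀ x ∈ p, u • x ∈ p := by
  obtain ⟨u, rfl⟩ := RingQuot.mkAlgHom_surjective ℂ (Rel hb N) u
  induction u using FreeAlgebra.induction with
  | grade0 r =>
    intro x hx
    rw [AlgHom.commutes, Algebra.algebraMap_eq_smul_one, smul_assoc, one_smul]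
    exact p.smul_mem _ hx
  | grade1 g => exact hp g
  | mul a b ha hb => intro x hx; rw [map_mul, mul_smul]; exact ha _ (hb x hx)
  | add a b ha hb => intro x hx; rw [map_add, add_smul]; exact p.add_mem (ha x hx) (hb x hx)

/-- The span of the f-words applied to v is stable under the e_i, by moving them to the right until
they meet v, and under the q^{h_μ}; so it is everything. -/
theorem generates_of_highest_weight (hN : 3 ≤ N) {ν : ℕ → ℂ} {v : X} (hw : IsWt hb N ν v)
    (he : ∀ j, eGen hb N j • v = 0) (hv : ∀ x : X, ∃ u : Uq hb N, x = u • v) :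
    Generates hb N v := by
  intro p hp hf x
  have hword : ∀ w : List ℕ, fWord hb N w • v ∈ p := fun w => by
    induction w with
    | nil => rwa [fWord_nil, one_smul]
    | cons i w IH =>
      rw [fWord_cons, mul_smul]
      by_cases hi : 1 ≤ i ∧ i ≤ N / 2
      · exact hf i hi.1 hi.2 _ IH
      · rw [fGen, dif_neg (by rwa [Finset.mem_Icc]), zero_smul]; exact p.zero_mem
  set W := Submodule.span ℂ (Set.range fun w => fWord hb N w • v) with hW
  have hmem : ∀ w, fWord hb N w • v ∈ W := fun w => Submodule.subset_span ⟨w, rfl⟩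
  have hstable : ∀ u : Uq hb N, (∀ w, u • fWord hb N w • v ∈ W) → ∀ x ∈ W, u • x ∈ W := by
    intro u hu x hx
    refine Submodule.span_induction (p := fun x _ => u • x ∈ W) ?_ (by simp) ?_ ?_ hx
    · rintro _ ⟨w, rfl⟩; exact hu w
    · intro a b _ _ ha hb; rw [smul_add]; exact W.add_mem ha hb
    · intro c a _ ha; rw [smul_smul_comm]; exact W.smul_mem c ha
  have hF : ∀ i, ∀ x ∈ W, fGen hb N i • x ∈ W := fun i => hstable _ fun w => by
    rw [← mul_smul, ← fWord_cons]; exact hmem _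
  have hE : ∀ i, ∀ x ∈ W, eGen hb N i • x ∈ W := fun i => hstable _ fun w => by
    by_cases hi : 1 ≤ i ∧ i ≤ N / 2
    · induction w with
      | nil => rw [fWord_nil, one_smul, he]; exact W.zero_mem
      | cons j w IH =>
        rw [fWord_cons, mul_smul]
        obtain rfl | hij := eq_or_ne i j
        · have hwt : IsWt hb N (ν - (w.map (rt N)).sum) (fWord hb N w • v) := fun μ => by
            rw [KGen_smul_fWord hw, wsum_sub_left, wsum_sum_rt]
          rw [e_f_smul hwt hN hi.1 hi.2]
          exact W.add_mem (hF _ _ IH) (W.smul_mem _ (hmem w))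
        · rw [e_f_smul_ne hij]; exact hF _ _ IH
    · rw [eGen, dif_neg (by rwa [Finset.mem_Icc]), zero_smul]; exact W.zero_mem
  have hall : ∀ x ∈ W, x ∈ p := fun x hx => by
    refine (Submodule.span_le.mpr ?_) hx
    rintro _ ⟨w, rfl⟩; exact hword w
  obtain ⟨u, rfl⟩ := hv x
  refine hall _ (smul_mem_of_gen (fun g => ?_) u v (by simpa [fWord_nil] using hmem []))
  cases g with
  | e i => have := hE i; rwa [eGen, dif_pos i.2] at this
  | f i => have := hF i; rwa [fGen, dif_pos i.2] at this
  | K μ =>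
    refine hstable _ fun w => ?_
    have := KGen_smul_fWord hw μ w
    rw [KGen] at this
    rw [this]
    exact W.smul_mem _ (hmem w)

theorem fHat_single {j k : ℕ} {v : X} (hv : fGen hb N j • v = 0)
    (hs : ∀ a, a - natD N j = k → natS N j a = 0) : fHat hb N X j (Pi.single k v) = 0 := by
  funext a
  rw [fHat_apply, Pi.zero_apply]
  have e1 : fGen hb N j • (Pi.single k v : ℕ → X) a = 0 := by
    obtain rfl | hak := eq_or_ne a k
    · rw [Pi.single_eq_same, hv]
    · rw [Pi.single_eq_of_ne hak, smul_zero]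
  by_cases hak : a - natD N j = k
  · rw [e1, hs a hak, zero_smul, zero_add]
  · rw [e1, Pi.single_eq_of_ne hak, smul_zero, smul_zero, zero_add]

end Generation

section VermaVacuum

variable {hb : ℂ} {l P : ℕ} {lam : Node (2 * l + 2 + P) → ℂ}

/-- The coordinates of a weight, extended by zero. -/
def extWt {N : ℕ} (lam : Node N → ℂ) (i : ℕ) : ℂ :=
  if h : i ∈ Finset.Icc 1 (N / 2) then lam ⟨i, h⟩ else 0

theorem wsum_extWt {N : ℕ} (lam : Node N → ℂ) (μ : Lat N) : wsum N (extWt lam) μ = pair lam μ :=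
  Finset.sum_congr rfl fun k _ => by rw [extWt, dif_pos k.2]

theorem Verma.mk_mem (u : Uq hb (2 * l + 2 + P)) (hu : u ∈ vermaRel hb l P lam) :
    (Submodule.Quotient.mk u : Verma hb l P lam) = 0 :=
  (Submodule.Quotient.mk_eq_zero _).mpr (Submodule.subset_span hu)

theorem smul_vacuum (u : Uq hb (2 * l + 2 + P)) :
    u • vacuum hb l P lam = Submodule.Quotient.mk u := by
  rw [vacuum, ← Submodule.Quotient.mk_smul, smul_eq_mul, mul_one]

theorem mem_leviNodes (hP : P ≠ 2) {j : ℕ} (h1 : l + 2 ≤ j) (h2 : j ≤ (2 * l + 2 + P) / 2) :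
    j ∈ leviNodes l P := by
  refine ⟨Finset.mem_Icc.mpr ⟨by omega, h2⟩, fun k hk => ?_⟩
  have h3 := Nat.even_iff (n := 2 * l + 2 + P)
  simp only [simpleRoot]
  split_ifs with h4 h5
  · simp [eps, show (k : ℕ) ≠ j by omega, show (k : ℕ) ≠ j + 1 by omega]
  · have := h3.mp h5
    simp [eps, show (k : ℕ) ≠ j by omega, show (k : ℕ) ≠ j - 1 by omega]
  · simp [eps, show (k : ℕ) ≠ j by omega]

theorem leviNodes_natS (hP : 1 ≤ P) {j k : ℕ} (hj : j ∈ leviNodes l P) (h1 : 1 ≤ k) (h2 : k ≤ l + 1)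
    {a : ℕ} (ha : a - natD (2 * l + 2 + P) j = k) : natS (2 * l + 2 + P) j a = 0 := by
  obtain ⟨hj1, hj2⟩ := hj
  rw [Finset.mem_Icc] at hj1
  have h3 := Nat.even_iff (n := 2 * l + 2 + P)
  have h4 := hj2 ⟨k, Finset.mem_Icc.mpr ⟨h1, by omega⟩⟩ h2
  simp only [simpleRoot] at h4
  simp only [natS, natD] at ha ⊢
  split_ifs at h4 with h5 h6
  · simp only [eps, Pi.sub_apply] at h4
    split_ifs at h4 ha ⊢ <;> first | rfl | omega
  · have := h3.mp h6
    simp only [eps, Pi.add_apply] at h4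
    split_ifs at h4 ha ⊢ <;> first | rfl | omega
  · simp only [eps] at h4
    have := h3.not.mp h6
    split_ifs at h4 ha ⊢ <;> first | rfl | omega

theorem isVacuum_vacuum (hP : 1 ≤ P)
    (hlam : ∀ i : Node (2 * l + 2 + P), l + 2 ≤ (i : ℕ) → lam i = 0) :
    IsVacuum hb l P (extWt lam) (vacuum hb l P lam) := by
  have hK : IsWt hb (2 * l + 2 + P) (extWt lam) (vacuum hb l P lam) := fun μ => by
    have := Verma.mk_mem (hb := hb) (lam := lam) _ (Or.inl (Or.inr ⟨μ, rfl⟩))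
    rw [← smul_vacuum, sub_smul, smul_assoc, one_smul, sub_eq_zero] at this
    rw [this, wsum_extWt]
  have hE : ∀ j, eGen hb (2 * l + 2 + P) j • vacuum hb l P lam = 0 := fun j => by
    by_cases hj : j ∈ Finset.Icc 1 ((2 * l + 2 + P) / 2)
    · rw [smul_vacuum]; exact Verma.mk_mem _ (Or.inl (Or.inl ⟨⟨j, hj⟩, rfl⟩))
    · rw [eGen, dif_neg hj, zero_smul]
  have hF : ∀ j ∈ leviNodes l P, fGen hb (2 * l + 2 + P) j • vacuum hb l P lam = 0 := fun j hj => by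
    rw [smul_vacuum]
    exact Verma.mk_mem _ (Or.inr ⟨⟨j, hj.1⟩, hj.2, rfl⟩)
  refine ⟨⟨hK, fun j _ _ => hE j, fun hP2 j h1 h2 => hF j (mem_leviNodes hP2 h1 h2),
    fun i h1 h2 => ?_⟩, hE, ?_, ?_, fun k h1 h2 => ?_⟩
  · rw [extWt, dif_pos (Finset.mem_Icc.mpr ⟨by omega, h2⟩)]
    exact hlam _ h1
  · refine generates_of_highest_weight (by omega) hK hE fun x => ?_
    obtain ⟨u, rfl⟩ := Submodule.Quotient.mk_surjective _ x
    exact ⟨u, (smul_vacuum u).symm⟩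
  -- The zero operators on ℂ satisfy the Serre relations, so v_λ maps to 1 ∈ ℂ and is nonzero.
  · intro h0
    obtain ⟨T, hT, -⟩ := Verma.exists_lift (hb := hb) hlam (Y := ℂ) (φ := 0) (y := 1)
      (fun i j _ _ _ _ _ => by simp [serreEl]) (fun i _ => rfl)
    rw [h0, map_zero] at hT
    exact zero_ne_one hT
  -- For k ≤ l + 1 the Levi generators kill both w_k and v_λ, so the universal property yields θ_k.
  · obtain ⟨T, hT, hT'⟩ := Verma.exists_lift (hb := hb) hlam (y := Pi.single k (vacuum hb l P lam))
      (isSerre_fHat (X := Verma hb l P lam) (by omega)) fun i hi =>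
        fHat_single (hF i hi) fun a => leviNodes_natS hP hi h1 h2
    exact ⟨T, h1, h2, hT, hT'⟩

end VermaVacuum

/-! ### Nonvanishing of f_{ε_k+ε_{l+1}} v -/

section Nonvanishing

variable {hb : ℂ} {l P : ℕ} {X : Type*} [AddCommGroup X] [Module ℂ X]
  [Module (Uq hb (2 * l + 2 + P)) X] [IsScalarTower ℂ (Uq hb (2 * l + 2 + P)) X]
  {ν : ℕ → ℂ} {v : X} (hq : NotRoot hb) (h : IsVacuum hb l P ν v) (hP : 1 ≤ P)
include hq h hP

theorem IsVacuum.lower_fDesc {d k : ℕ} (hd : d + 1 ≤ l) (hk : k = l - d) {T : X →ₗ[ℂ] ℕ → X}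
    (hT : IsTheta hb l P k v T) :
    ∃ c : ℂ, c ≠ 0 ∧ lowerOp k T (fDesc hb l P (d + 1) • v) = c • fDesc hb l P d • v := by
  cases d with
  | zero => exact hT.lower_fNext h.gen hP h.wt hq h.toHW (by omega)
  | succ d => exact hT.lower_fDesc h.gen hP h.wt hq h.toHW (by omega) (by omega)

theorem IsVacuum.fDesc_ne_zero {d : ℕ} (hd : d ≤ l) : fDesc hb l P d • v ≠ 0 := by
  induction d with
  | zero =>
    obtain ⟨T, hT⟩ := h.theta (l + 1) (by omega) le_rfl
    exact hT.fDouble_ne_zero h.gen hP h.wt rfl hq h.toHW h.ne_zero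
  | succ d IH =>
    obtain ⟨T, hT⟩ := h.theta (l - d) (by omega) (by omega)
    obtain ⟨c, hc, e⟩ := h.lower_fDesc hq hP (by omega) rfl hT
    intro h0
    rw [h0, map_zero] at e
    exact smul_ne_zero hc (IH (by omega)) e.symm

end Nonvanishing


/-! ### The adjoint action of the f_j -/

section Twist

variable {hb : ℂ} {N : ℕ} {R : Type*} [Ring R] [Algebra ℂ R]

/-- Twisting a family with Serre relations by commuting elements. -/
theorem IsSerre.twist {B H : ℕ → R} (hB : IsSerre hb N B) {a : ℂ}
    (hH : ∀ i j, H i * H j = H j * H i)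
    (hHB : ∀ i j, H i * B j = a ^ ip (simpleRoot N i) (simpleRoot N j) • (B j * H i)) :
    IsSerre hb N (fun i => B i * H i) := by
  intro i j h1 h2 h3 h4 hij
  have hs := hB i j h1 h2 h3 h4 hij
  have e : ∀ i j x, H i * (B j * x) =
      a ^ ip (simpleRoot N i) (simpleRoot N j) • (B j * (H i * x)) := fun i j x => by
    rw [← mul_assoc, hHB, smul_mul_assoc, mul_assoc]
  have c : ∀ x, H j * (H i * x) = H i * (H j * x) := fun x => by
    rw [← mul_assoc, hH, mul_assoc]
  have hji : ip (simpleRoot N j) (simpleRoot N i) = ip (simpleRoot N i) (simpleRoot N j) :=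
    ip_comm _ _
  simp only [serreEl] at hs ⊢
  split_ifs at hs ⊢ with h h h
  -- In each case moving all H to the right multiplies every monomial of the relation by the same
  -- power of a, so the relation for B factors out.
  · have := congrArg (· * (H i * H j)) hs
    simp only [sub_mul, zero_mul, mul_assoc] at this
    simp only [mul_assoc, e, hji, mul_smul_comm, hH j i]
    linear_combination (norm := module)
      a ^ ip (simpleRoot N i) (simpleRoot N j) • this
  · have := congrArg (· * (H i * (H i * H j))) hs
    simp only [sub_mul, add_mul, zero_mul, smul_mul_assoc, mul_assoc] at this
    simp only [mul_assoc, e, hji, mul_smul_comm, hH j i, c, smul_smul]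
    linear_combination (norm := module) (a ^ ip (simpleRoot N i) (simpleRoot N j) *
      a ^ ip (simpleRoot N i) (simpleRoot N j) * a ^ ip (simpleRoot N i) (simpleRoot N i)) • this
  · have := congrArg (· * (H i * (H i * (H i * H j)))) hs
    simp only [sub_mul, add_mul, zero_mul, smul_mul_assoc, mul_assoc] at this
    simp only [mul_assoc, e, hji, mul_smul_comm, hH j i, c, smul_smul]
    linear_combination (norm := module) (a ^ ip (simpleRoot N i) (simpleRoot N j) *
      a ^ ip (simpleRoot N i) (simpleRoot N j) * a ^ ip (simpleRoot N i) (simpleRoot N j) *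
      a ^ ip (simpleRoot N i) (simpleRoot N i) * a ^ ip (simpleRoot N i) (simpleRoot N i) *
      a ^ ip (simpleRoot N i) (simpleRoot N i)) • this
  · rfl

end Twist

section Adjoint

variable (hb : ℂ) (N : ℕ)

/-- The adjoint action of `f_j`, which is `x ↦ f_j x - K x K⁻¹ f_j` with `K = q^{h_{α_j}}`. -/
def adF (j : ℕ) : Module.End ℂ (Uq hb N) :=
  fOp hb N (Uq hb N) j + (-1 : ℂ) • (LinearMap.mulRight ℂ (fGen hb N j) *
    (LinearMap.mulLeft ℂ (KGen hb N (simpleRoot N j)) *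
      LinearMap.mulRight ℂ (KGen hb N (-simpleRoot N j))))

variable {hb N}

theorem adF_apply (j : ℕ) (x : Uq hb N) : adF hb N j x =
    fGen hb N j * x + (-1 : ℂ) • (KGen hb N (simpleRoot N j) *
      (x * KGen hb N (-simpleRoot N j)) * fGen hb N j) := rfl

/-- Right multiplication reverses products, and the Serre relations are symmetric under reversal up
to sign. -/
theorem isSerre_mulRight :
    IsSerre hb N (fun j => LinearMap.mulRight ℂ (fGen hb N j)) := by
  have hS := fOp_serre (hb := hb) (N := N) (X := Uq hb N)
  rw [isSerre_iff_serreOps]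
  refine ⟨fun i j h1 h2 h3 h4 hij h0 x => ?_, fun i j h1 h2 h3 h4 h5 h6 x => ?_,
    fun i j h1 h2 h3 h4 h5 h6 x => ?_⟩
  · have := congrArg (x * ·) (hS.comm i j h1 h2 h3 h4 hij h0 1)
    simp only [fOp_apply, smul_eq_mul, mul_one] at this
    simpa only [LinearMap.mulRight_apply, mul_assoc] using this.symm
  · have := congrArg (x * ·) (hS.long i j h1 h2 h3 h4 h5 h6 1)
    simp only [fOp_apply, smul_eq_mul, mul_one, mul_sub, mul_add, mul_zero, mul_smul_comm] at this
    simp only [LinearMap.mulRight_apply, mul_assoc]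
    linear_combination (norm := module) this
  · have := congrArg (x * ·) (hS.short i j h1 h2 h3 h4 h5 h6 1)
    simp only [fOp_apply, smul_eq_mul, mul_one, mul_sub, mul_add, mul_zero, mul_smul_comm] at this
    simp only [LinearMap.mulRight_apply, mul_assoc]
    linear_combination (norm := module) -this

theorem isSerre_adF : IsSerre hb N (adF hb N) := by
  have hz : ∀ m : ℤ, (qpow hb (-1)) ^ m = qpow hb (-(m : ℂ)) := fun m => by
    rw [← qpow_intCast]; congr 1; ring
  have hH : IsSerre hb N (fun j => (-1 : ℂ) • (LinearMap.mulRight ℂ (fGen hb N j) *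
      (LinearMap.mulLeft ℂ (KGen hb N (simpleRoot N j)) *
        LinearMap.mulRight ℂ (KGen hb N (-simpleRoot N j))))) := by
    refine fun i j h1 h2 h3 h4 h5 => serreEl_smul (fun _ => -1) _ ?_
    refine (isSerre_mulRight (hb := hb) (N := N)).twist (a := qpow hb (-1)) (fun i j => ?_) (fun i j => ?_)
      i j h1 h2 h3 h4 h5
    · refine LinearMap.ext fun x => ?_
      have e : ∀ μ ν : Lat N, ∀ x, KGen hb N μ * (KGen hb N ν * x) = KGen hb N ν * (KGen hb N μ * x) :=
        fun μ ν x => by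
          rw [← mul_assoc, ← mul_assoc, ← KGen_add, ← KGen_add, add_comm]
      have e' : ∀ μ ν : Lat N, KGen hb N μ * KGen hb N ν = KGen hb N ν * KGen hb N μ := fun μ ν => by
        simpa using e μ ν 1
      simp only [Module.End.mul_apply, LinearMap.mulLeft_apply,
        LinearMap.mulRight_apply, mul_assoc]
      rw [e, e' (-simpleRoot N i)]
    · refine LinearMap.ext fun x => ?_
      rw [hz]
      have e := KGen_mul_fGen hb N (-simpleRoot N i) j
      rw [ip_neg_left] at e
      push_cast at e
      rw [neg_neg] at e
      simp only [Module.End.mul_apply, LinearMap.smul_apply, LinearMap.mulLeft_apply,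
        LinearMap.mulRight_apply, mul_assoc, e, mul_smul_comm, smul_smul, ← qpow_add]
      rw [neg_add_cancel, qpow_zero, one_smul]
  intro i j h1 h2 h3 h4 hij
  have hL := isSerre_iff_serreOps.mpr (fOp_serre (hb := hb) (N := N) (X := Uq hb N))
  refine (serreEl_add (a := qpow hb (-1)) (qpow_ne_zero _ _) ?_ (fun i k => ?_) i j).trans ?_
  · rw [qpow_neg, inv_inv, add_comm]
  · refine LinearMap.ext fun x => ?_
    rw [hz]
    simp only [Module.End.mul_apply, LinearMap.smul_apply, fOp_apply, LinearMap.mulLeft_apply,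
      LinearMap.mulRight_apply, smul_eq_mul]
    rw [mul_assoc (fGen hb N k) x, ← mul_assoc (KGen hb N _) (fGen hb N k), KGen_mul_fGen]
    simp only [smul_mul_assoc, mul_smul_comm, mul_assoc]
    rw [smul_comm]
  · rw [hL i j h1 h2 h3 h4 hij, hH i j h1 h2 h3 h4 hij, add_zero]

/-- `x` is an element of weight `β`. -/
def HasWt (β : Lat N) (x : Uq hb N) : Prop :=
  ∀ μ, KGen hb N μ * x = qpow hb (ip μ β : ℤ) • (x * KGen hb N μ)

theorem HasWt.fGen (j : ℕ) : HasWt (-simpleRoot N j) (fGen hb N j) := fun μ => by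
  rw [KGen_mul_fGen, ip_comm μ (-simpleRoot N j), ip_neg_left, ip_comm, Int.cast_neg]

theorem HasWt.adF_eq {β : Lat N} {x : Uq hb N} (h : HasWt β x) (j : ℕ) : adF hb N j x =
    QuantumSO.fGen hb N j * x +
      (-qpow hb (ip (simpleRoot N j) β : ℤ)) • (x * QuantumSO.fGen hb N j) := by
  rw [adF_apply, ← mul_assoc, h, smul_mul_assoc, smul_mul_assoc, mul_assoc x, ← KGen_add,
    add_neg_cancel, KGen_zero, mul_one, smul_smul, neg_one_mul]

theorem HasWt.adF {β : Lat N} {x : Uq hb N} (h : HasWt β x) (j : ℕ) :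
    HasWt (β - simpleRoot N j) (adF hb N j x) := fun μ => by
  have e : qpow hb (ip μ (β - simpleRoot N j) : ℤ) =
      qpow hb (ip μ β : ℤ) * qpow hb (-(ip μ (simpleRoot N j) : ℤ)) := by
    rw [ip_sub_right, ← qpow_add]; push_cast; rw [sub_eq_add_neg]
  rw [h.adF_eq, e, mul_add, ← mul_assoc, KGen_mul_fGen, smul_mul_assoc, mul_assoc, h, mul_smul_comm,
    mul_smul_comm, ← mul_assoc (KGen hb N μ) x, h, smul_mul_assoc, mul_assoc, KGen_mul_fGen]
  simp only [mul_smul_comm, add_mul, smul_mul_assoc, mul_assoc, smul_smul, smul_add]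
  congr 2 <;> ring

end Adjoint


/-! ### Adjoint images of f_k as a natural representation -/

section Chain

variable {hb : ℂ} {N : ℕ}

theorem adF_fGen_eq_zero {j k : ℕ} (hjk : j ≠ k) (h : ip (simpleRoot N j) (simpleRoot N k) = 0) :
    adF hb N j (fGen hb N k) = 0 := by
  have e : ip (simpleRoot N j) (-simpleRoot N k) = 0 := by rw [ip_comm, ip_neg_left, ip_comm, h, neg_zero]
  rw [(HasWt.fGen k).adF_eq, e, Int.cast_zero, qpow_zero, fGen_comm hb N hjk h]
  module

/-- Written out with the weight factors, the iterated adjoint action is the Serre relation itself;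
likewise for the cubic relation below. -/
theorem adF_adF_fGen {j k : ℕ} (hj : 1 ≤ j ∧ j ≤ N / 2) (hk : 1 ≤ k ∧ k ≤ N / 2)
    (h1 : ip (simpleRoot N j) (simpleRoot N k) = -1)
    (h2 : ip (simpleRoot N j) (simpleRoot N j) = 2) :
    adF hb N j (adF hb N j (fGen hb N k)) = 0 := by
  have e : ip (simpleRoot N j) (-simpleRoot N k) = 1 := by
    rw [ip_comm, ip_neg_left, ip_comm, h1, neg_neg]
  have hw := HasWt.fGen (hb := hb) (N := N) k
  rw [(hw.adF j).adF_eq, hw.adF_eq, ip_sub_right, e, h2]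
  have := fGen_long hb N (Finset.mem_Icc.mpr hj) (Finset.mem_Icc.mpr hk) h1 h2
  have hq : qpow hb ((1 - 2 : ℤ) : ℂ) * qpow hb ((1 : ℤ) : ℂ) = 1 := by
    rw [← qpow_add]; norm_num [qpow_zero]
  have hq' : qpow hb ((1 - 2 : ℤ) : ℂ) = qpow hb (-1) := by norm_num
  rw [hq'] at hq ⊢
  rw [Int.cast_one] at hq ⊢
  simp only [mul_add, add_mul, mul_smul_comm, smul_mul_assoc, smul_add, smul_smul, neg_mul_neg, hq,
    mul_assoc, pow_two] at this ⊢
  linear_combination (norm := module) this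

theorem adF_adF_adF_fGen {j k : ℕ} (hj : 1 ≤ j ∧ j ≤ N / 2) (hk : 1 ≤ k ∧ k ≤ N / 2)
    (h1 : ip (simpleRoot N j) (simpleRoot N k) = -1)
    (h2 : ip (simpleRoot N j) (simpleRoot N j) = 1) :
    adF hb N j (adF hb N j (adF hb N j (fGen hb N k))) = 0 := by
  have e : ip (simpleRoot N j) (-simpleRoot N k) = 1 := by
    rw [ip_comm, ip_neg_left, ip_comm, h1, neg_neg]
  have hw := HasWt.fGen (hb := hb) (N := N) k
  rw [((hw.adF j).adF j).adF_eq, (hw.adF j).adF_eq, hw.adF_eq, ip_sub_right, ip_sub_right, ip_sub_right, e, h2]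
  have := fGen_short hb N (Finset.mem_Icc.mpr hj) (Finset.mem_Icc.mpr hk) h1 h2
  have hq : qpow hb 1 * qpow hb (-1) = 1 := by rw [← qpow_add, add_neg_cancel, qpow_zero]
  have h0 : qpow hb ((1 - 1 : ℤ) : ℂ) = 1 := by norm_num [qpow_zero]
  have h3 : qpow hb ((1 - 1 - 1 : ℤ) : ℂ) = qpow hb (-1) := by norm_num
  rw [h0, h3, Int.cast_one]
  simp only [mul_add, add_mul, mul_smul_comm, smul_mul_assoc, smul_add, smul_smul, mul_assoc,
    pow_succ, pow_zero, one_mul] at this ⊢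
  linear_combination (norm := skip) this
  match_scalars <;> first | ring1 | linear_combination hq | linear_combination -hq

theorem adF_serreOps (k : ℕ) : SerreOps hb N k (adF hb N) :=
  (isSerre_iff_serreOps.mp isSerre_adF).mono (Nat.zero_le k)

/-- The label of the arrow from the preceding vector of the natural representation to `w_a`. -/
def arrow (N a : ℕ) : ℕ := if a ≤ N / 2 then a - 1 else min (N / 2) (N + 1 - a)

/-- The iterated adjoint images of `f_k`, indexed by the natural representation. -/
def adChain (hb : ℂ) (N k a : ℕ) : Uq hb N :=
  if _h : k + 1 < a then adF hb N (arrow N a) (adChain hb N k (a - natD N (arrow N a)))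
  else fGen hb N k
termination_by a
decreasing_by have := natD_pos (N := N) (arrow N a); omega

theorem adChain_base (k : ℕ) : adChain hb N k (k + 1) = fGen hb N k := by
  rw [adChain, dif_neg (lt_irrefl _)]

theorem adChain_step {k a : ℕ} (h : k + 1 < a) : adChain hb N k a =
    adF hb N (arrow N a) (adChain hb N k (a - natD N (arrow N a))) := by
  rw [adChain, dif_pos h]

variable (hq : NotRoot hb) {k : ℕ} (hk : 1 ≤ k) (hn : k < N / 2) (hn' : Even N → k + 1 < N / 2)

include hn hn' in
-- Within w_{k+1}, …, w_{N-k} every vector but the first has a predecessor under some f_j with j >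
-- k. All inductions over coordinates follow these arrows.
theorem arrow_spec {a : ℕ} (h1 : k + 1 < a) (h2 : a + k ≤ N) :
    k < arrow N a ∧ arrow N a ≤ N / 2 ∧ k + 1 ≤ a - natD N (arrow N a) ∧
      natD N (arrow N a) ≤ a ∧ natS N (arrow N a) a ≠ 0 := by
  rw [natS_ne_zero_iff]
  have h3 := Nat.even_iff (n := N)
  rw [h3] at hn'
  simp only [natD, arrow]
  split_ifs <;> omega

include hq hk hn hn' in
-- The chain lemmas for `SerreOps` are applied to the adjoint operators: under ad f_j with j > k,
-- the element f_k starts a copy of the natural representation of so(N - 2k). The sequences U and D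
-- are the two halves of `adChain`, D_i sitting at index N + 1 - i.
theorem adF_adChain {j a : ℕ} (hj : k < j) (hj' : j ≤ N / 2) (h1 : k + 1 ≤ a) (h2 : a + k ≤ N) :
    adF hb N j (adChain hb N k a) = 0 ∨ ∃ b, k + 1 ≤ b ∧ b + k ≤ N ∧
      adF hb N j (adChain hb N k a) = adChain hb N k b := by
  have hS := adF_serreOps (hb := hb) (N := N) k
  have hN : 3 ≤ N := by omega
  have hstep : ∀ a j, k + 1 < a → arrow N a = j → ∀ b, a = b + natD N j →
      adChain hb N k a = adF hb N j (adChain hb N k b) := fun a j ha hj b hb => by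
    rw [adChain_step ha, hj, hb, Nat.add_sub_cancel]
  have hsq : ∀ j, k < j → j ≤ N / 2 → AdjLt N k j → ¬(2 * j + 1 = N) →
      adF hb N j (adF hb N j (fGen hb N k)) = 0 := fun j h3 h4 h5 h6 =>
    adF_adF_fGen ⟨by omega, h4⟩ ⟨hk, hn.le⟩ (by rw [ip_comm]; exact ip_adjLt hN hk h4 h5)
      (ip_long hN (by omega) h4 (by rw [Nat.even_iff]; omega))
  have hzero : ∀ j, k < j → j ≤ N / 2 → ¬AdjLt N k j → adF hb N j (fGen hb N k) = 0 :=
    fun j h3 h4 h5 => adF_fGen_eq_zero (by omega) (by rw [ip_comm]; exact ip_far hN hk h4 h3 h5)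
  have goodb : ∀ b, k + 1 < b → b + k ≤ N → arrow N b = j → b = a + natD N j →
      ∃ b, k + 1 ≤ b ∧ b + k ≤ N ∧ adF hb N j (adChain hb N k a) = adChain hb N k b :=
    fun b h3 h4 h5 h6 => ⟨b, h3.le, h4, (hstep b j h3 h5 a h6).symm⟩
  by_cases he : Even N
  · have h2' := Nat.even_iff.mp he
    have hn1 := hn' he
    have hU : ∀ i, k < i → i < N / 2 → adChain hb N k (i + 1) = adF hb N i (adChain hb N k i) :=
      fun i h3 h4 => hstep _ _ (by omega) (by simp only [arrow]; split_ifs <;> omega) _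
        (by simp only [natD]; split_ifs <;> omega)
    have hD : ∀ i, k < i → i < N / 2 → adChain hb N k (N + 1 - i) =
        adF hb N i (adChain hb N k (N + 1 - (i + 1))) :=
      fun i h3 h4 => hstep _ _ (by omega) (by simp only [arrow]; split_ifs <;> omega) _
        (by simp only [natD]; split_ifs <;> omega)
    have hD0 : adChain hb N k (N + 1 - N / 2) = adF hb N (N / 2) (adChain hb N k (N / 2 - 1)) :=
      hstep _ _ (by omega) (by simp only [arrow]; split_ifs <;> omega) _
        (by simp only [natD]; split_ifs <;> omega)
    have g0 : ∀ j, k + 1 < j → j ≤ N / 2 → ¬(j = N / 2 ∧ k + 2 = N / 2) →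
        adF hb N j (adChain hb N k (k + 1)) = 0 := fun j h3 h4 h5 => by
      rw [adChain_base]
      exact hzero j (by omega) h4 (by rintro (h' | h') <;> omega)
    have g1 : adF hb N (k + 1) (adF hb N (k + 1) (adChain hb N k (k + 1))) = 0 := by
      rw [adChain_base]
      exact hsq _ (by omega) (by omega) (Or.inl ⟨rfl, by omega⟩) (by omega)
    have g2 : k + 2 = N / 2 →
        adF hb N (N / 2) (adF hb N (N / 2) (adChain hb N k (k + 1))) = 0 := fun h3 => by
      rw [adChain_base]
      exact hsq _ (by omega) (by omega) (Or.inr ⟨he, by omega, rfl⟩) (by omega)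
    obtain ha | ha : a ≤ N / 2 ∨ N / 2 < a := by omega
    · by_cases h3 : j = a ∧ j < N / 2
      · right
        exact goodb (a + 1) (by omega) (by omega) (by simp only [arrow]; split_ifs <;> omega)
          (by simp only [natD]; split_ifs <;> omega)
      by_cases h4 : j = N / 2 ∧ a + 1 = N / 2
      · right
        exact goodb (a + 2) (by omega) (by omega) (by simp only [arrow]; split_ifs <;> omega)
          (by simp only [natD]; split_ifs <;> omega)
      by_cases h5 : j = N / 2 ∧ a = N / 2
      · right
        refine ⟨N + 1 - (N / 2 - 1), by omega, by omega, ?_⟩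
        rw [h5.1, h5.2]
        exact hS.even_last hN he hU hD0 hD hn1
      · exact Or.inl (hS.even_up hq hN he hU g0 g1 (by omega) ha hj hj' (by omega) (by omega))
    · obtain ⟨i, hi⟩ : ∃ i, i = N + 1 - a := ⟨_, rfl⟩
      obtain rfl : a = N + 1 - i := by omega
      by_cases h3 : j + 1 = i
      · right
        exact goodb (N + 1 - j) (by omega) (by omega) (by simp only [arrow]; split_ifs <;> omega)
          (by simp only [natD]; split_ifs <;> omega)
      · exact Or.inl (hS.even_down (D := fun i => adChain hb N k (N + 1 - i)) hq hN he hU hD0 hD hn1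
          g0 g1 g2 (by omega) (by omega) hj hj' h3)
  · have h2' := Nat.even_iff.not.mp he
    have hU : ∀ i, k < i → i < N / 2 → adChain hb N k (i + 1) = adF hb N i (adChain hb N k i) :=
      fun i h3 h4 => hstep _ _ (by omega) (by simp only [arrow]; split_ifs <;> omega) _
        (by simp only [natD]; split_ifs <;> omega)
    have hZ : adChain hb N k (N / 2 + 1) = adF hb N (N / 2) (adChain hb N k (N / 2)) :=
      hstep _ _ (by omega) (by simp only [arrow]; split_ifs <;> omega) _
        (by simp only [natD]; split_ifs <;> omega)
    have hD : ∀ i, k < i → i < N / 2 → adChain hb N k (N + 1 - i) =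
        adF hb N i (adChain hb N k (N + 1 - (i + 1))) :=
      fun i h3 h4 => hstep _ _ (by omega) (by simp only [arrow]; split_ifs <;> omega) _
        (by simp only [natD]; split_ifs <;> omega)
    have hD0 : adChain hb N k (N + 1 - N / 2) = adF hb N (N / 2) (adChain hb N k (N / 2 + 1)) :=
      hstep _ _ (by omega) (by simp only [arrow]; split_ifs <;> omega) _
        (by simp only [natD]; split_ifs <;> omega)
    have g0 : ∀ j, k + 1 < j → j ≤ N / 2 → adF hb N j (adChain hb N k (k + 1)) = 0 :=
      fun j h3 h4 => by
        rw [adChain_base]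
        exact hzero j (by omega) h4 (by rintro (h' | h') <;> [omega; exact he h'.1])
    have g1 : k + 1 < N / 2 → adF hb N (k + 1) (adF hb N (k + 1) (adChain hb N k (k + 1))) = 0 :=
      fun h3 => by
        rw [adChain_base]
        exact hsq _ (by omega) (by omega) (Or.inl ⟨rfl, fun h' => he h'.1⟩) (by omega)
    have g2 : k + 1 = N / 2 → adF hb N (k + 1) (adF hb N (k + 1) (adF hb N (k + 1)
        (adChain hb N k (k + 1)))) = 0 := fun h3 => by
      rw [adChain_base]
      refine adF_adF_adF_fGen ⟨by omega, by omega⟩ ⟨hk, hn.le⟩ ?_ (by rw [h3]; exact ip_short hN he)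
      rw [ip_comm]
      exact ip_adjLt hN hk (by omega) (Or.inl ⟨rfl, fun h' => he h'.1⟩)
    obtain ha | rfl | ha : a ≤ N / 2 ∨ a = N / 2 + 1 ∨ N / 2 + 1 < a := by omega
    · by_cases h3 : j = a
      · right
        exact goodb (a + 1) (by omega) (by omega) (by simp only [arrow]; split_ifs <;> omega)
          (by simp only [natD]; split_ifs <;> omega)
      · exact Or.inl (hS.odd_up hq hN he hU g0 g1 (by omega) ha hj hj' h3)
    · by_cases h3 : j = N / 2
      · right
        exact goodb (N / 2 + 1 + 1) (by omega) (by omega)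
          (by simp only [arrow]; split_ifs <;> omega) (by simp only [natD]; split_ifs <;> omega)
      · exact Or.inl (hS.odd_mid hq hN he hU hZ hn g0 g1 hj (by omega))
    · obtain ⟨i, hi⟩ : ∃ i, i = N + 1 - a := ⟨_, rfl⟩
      obtain rfl : a = N + 1 - i := by omega
      by_cases h3 : j + 1 = i
      · right
        exact goodb (N + 1 - j) (by omega) (by omega) (by simp only [arrow]; split_ifs <;> omega)
          (by simp only [natD]; split_ifs <;> omega)
      · exact Or.inl (hS.odd_down (D := fun i => adChain hb N k (N + 1 - i)) hq hN he hU hZ hD0 hD hn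
          g0 g1 g2 (by omega) (by omega) hj hj' h3)

end Chain


/-! ### Vectors detected by their intermediate components -/

section Injectivity

variable {hb : ℂ} {l P : ℕ} {X : Type*} [AddCommGroup X] [Module ℂ X]
  [Module (Uq hb (2 * l + 2 + P)) X] [IsScalarTower ℂ (Uq hb (2 * l + 2 + P)) X]

local notation "fN" => fGen hb (2 * l + 2 + P)
local notation "eN" => eGen hb (2 * l + 2 + P)
local notation "KN" => KGen hb (2 * l + 2 + P)
local notation "gN" => adChain hb (2 * l + 2 + P)

theorem fHat_single_eq (j : ℕ) {a : ℕ} (ha : 1 ≤ a) (x : X) :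
    fHat hb (2 * l + 2 + P) X j (Pi.single a x) = Pi.single a (fN j • x) +
      Pi.single (a + natD (2 * l + 2 + P) j) (natS (2 * l + 2 + P) j (a + natD (2 * l + 2 + P) j) •
        KN (-simpleRoot _ j) • x) := by
  funext b
  have h1 := natD_pos (N := 2 * l + 2 + P) j
  rw [fHat_apply, Pi.add_apply]
  congr 1
  · obtain rfl | hb := eq_or_ne b a
    · simp
    · rw [Pi.single_eq_of_ne hb, Pi.single_eq_of_ne hb, smul_zero]
  · obtain rfl | hb := eq_or_ne b (a + natD (2 * l + 2 + P) j)
    · rw [Pi.single_eq_same, Nat.add_sub_cancel, Pi.single_eq_same]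
    · rw [Pi.single_eq_of_ne hb, Pi.single_eq_of_ne (by omega), smul_zero, smul_zero]

theorem natS_eq_zero_of_lt {k j : ℕ} (hkj : k < j) (hj : j ≤ (2 * l + 2 + P) / 2)
    (hne : ¬(2 * j = 2 * l + 2 + P ∧ j = k + 1)) :
    natS (2 * l + 2 + P) j (k + natD (2 * l + 2 + P) j) = 0 := by
  by_contra h
  rw [← ne_eq, natS_ne_zero_iff] at h
  simp only [natD] at h
  split_ifs at h <;> omega

variable {k : ℕ} {v : X} {T : X →ₗ[ℂ] ℕ → X} (h : IsTheta hb l P k v T) (hk : k ≤ l) (hP : 1 ≤ P)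
include h hk hP

/-- For k ≤ l and j > k the operator f_j kills w_k, so the vectors with no component away from w_k
form a subspace stable under these f_j. -/
theorem IsTheta.fixed_f {m : X} (hm : T m = Pi.single k m) {j : ℕ} (hkj : k < j)
    (hj : j ≤ (2 * l + 2 + P) / 2) : T (fN j • m) = Pi.single k (fN j • m) := by
  rw [h.f j (by omega) hj, hm, fHat_single_eq _ h.pos, natS_eq_zero_of_lt hkj hj (by omega), zero_smul,
    Pi.single_zero, add_zero]

/-- Induction along the arrows. The commutator form of the adjoint action cancels the contributions
at the preceding index b, and only the new component survives. -/
theorem IsTheta.map_adChain {a : ℕ} (h1 : k + 1 ≤ a) (h2 : a + k ≤ 2 * l + 2 + P) :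
    ∃ β, HasWt β (gN k a) ∧ ∃ c : ℂ, c ≠ 0 ∧ ∀ m, T m = Pi.single k m →
      T (gN k a • m) = Pi.single k (gN k a • m) + Pi.single a (c • KN β • m) := by
  have hk1 := h.pos
  induction a using Nat.strong_induction_on with
  | _ a IH =>
  obtain rfl | h3 : a = k + 1 ∨ k + 1 < a := by omega
  · refine ⟨_, by rw [adChain_base]; exact HasWt.fGen k, 1, one_ne_zero, fun m hm => ?_⟩
    rw [adChain_base, h.f k hk1 (by omega), hm, fHat_single_eq _ hk1, h.natD_self hP,
      h.natS_succ hP hk1 (by omega), if_pos rfl]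
  · obtain ⟨g1, g2, g3, g4, g5⟩ := arrow_spec (by omega)
      (fun he => by have := Nat.even_iff.mp he; omega) h3 h2
    have hpos := natD_pos (N := 2 * l + 2 + P) (arrow (2 * l + 2 + P) a)
    obtain ⟨β, hβ, c, hc, hT⟩ := IH _ (by omega) g3 (by omega)
    rw [adChain_step h3]
    generalize arrow (2 * l + 2 + P) a = j at *
    obtain ⟨b, hb'⟩ : ∃ b, b = a - natD (2 * l + 2 + P) j := ⟨_, rfl⟩
    rw [← hb'] at g3 hβ hT ⊢
    obtain rfl : a = b + natD (2 * l + 2 + P) j := by omega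
    refine ⟨_, hβ.adF j, _, mul_ne_zero g5 hc, fun m hm => ?_⟩
    have e1 : KN (β - simpleRoot _ j) • m = KN (-simpleRoot _ j) • KN β • m := by
      rw [← mul_smul, ← KGen_add, neg_add_eq_sub]
    have e2 : c • fN j • KN β • m =
        qpow hb (ip (simpleRoot _ j) β : ℤ) • c • KN β • fN j • m := by
      rw [KGen_smul_fGen_smul, ip_comm β, smul_comm c (qpow hb _)]
      refine Eq.trans ?_ (smul_smul (qpow hb _) (qpow hb _) (c • fN j • KN β • m)).symm
      rw [← qpow_add, add_neg_cancel, qpow_zero, one_smul]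
    have f1 : T (fN j • gN k b • m) = Pi.single k (fN j • gN k b • m) +
        (Pi.single b (c • fN j • KN β • m) + Pi.single (b + natD (2 * l + 2 + P) j)
          ((natS (2 * l + 2 + P) j (b + natD (2 * l + 2 + P) j) * c) •
            KN (β - simpleRoot _ j) • m)) := by
      rw [h.f j (by omega) g2, hT m hm, map_add, fHat_single_eq _ hk1, fHat_single_eq _ (by omega),
        natS_eq_zero_of_lt g1 g2 (by omega), zero_smul, Pi.single_zero, add_zero, smul_smul_comm c,
        smul_smul_comm c, e1, mul_smul]
    have e3 : adF hb _ j (gN k b) • m = fN j • gN k b • m +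
        (-qpow hb (ip (simpleRoot _ j) β : ℤ)) • gN k b • fN j • m := by
      rw [hβ.adF_eq, add_smul, smul_assoc, mul_smul, mul_smul]
    rw [e3, map_add, T.map_smul, f1, hT _ (h.fixed_f hk hP hm g1 g2), e2]
    have hs : ∀ (a : ℕ) (c : ℂ) (x : X), (Pi.single a (c • x) : ℕ → X) = c • Pi.single a x :=
      fun a c x => (LinearMap.single ℂ (fun _ : ℕ => X) a).map_smul c x
    simp only [Pi.single_add, hs]
    generalize (Pi.single k (fN j • gN k b • m) : ℕ → X) = z1
    generalize (Pi.single k (gN k b • fN j • m) : ℕ → X) = z2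
    generalize (Pi.single b (KN β • fN j • m) : ℕ → X) = z3
    generalize (Pi.single _ (KN (β - simpleRoot _ j) • m) : ℕ → X) = z4
    module

/-- A vector of weight `ν - ε_k - ε_{l+1}` is determined by its intermediate components. -/
theorem IsTheta.eq_zero_of_comp (hq : NotRoot hb) {ν ω : ℕ → ℂ} (hw : IsWt hb (2 * l + 2 + P) ν v)
    (hv : Generates hb (2 * l + 2 + P) v) {y : X} (hy : IsWt hb (2 * l + 2 + P) ω y)
    (hω : ω = ν - Pi.single k 1 - Pi.single (l + 1) 1)
    (h0 : ∀ a, k + 1 ≤ a → a + k ≤ 2 * l + 2 + P → T y a = 0) : y = 0 := by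
  have hk1 := h.pos
  let M : Submodule ℂ X := LinearMap.eqLocus T (LinearMap.single ℂ (fun _ => X) k)
  have hM : ∀ m, m ∈ M ↔ T m = Pi.single k m := fun _ => Iff.rfl
  let I := Finset.Icc (k + 1) (2 * l + 2 + P - k)
  have hI : ∀ a, a ∈ I ↔ k + 1 ≤ a ∧ a + k ≤ 2 * l + 2 + P := fun a => by
    rw [Finset.mem_Icc]; omega
  -- The range consists of the sums ∑ g_a m_a, with g_a the adjoint images of f_k and m_a having no
  -- component away from w_k.
  let Ψ : (ℕ → M) →ₗ[ℂ] X := ∑ a ∈ I,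
    (Algebra.lsmul ℂ ℂ X (gN k a)).comp (M.subtype.comp (LinearMap.proj a))
  have hΨ : ∀ m, Ψ m = ∑ a ∈ I, gN k a • (m a : X) := fun m => by
    simp only [Ψ, LinearMap.sum_apply]; rfl
  have hmem : ∀ a ∈ I, ∀ m ∈ M, gN k a • m ∈ LinearMap.range Ψ := fun a ha m hm => by
    refine ⟨Pi.single a ⟨m, hm⟩, ?_⟩
    rw [hΨ, Finset.sum_eq_single_of_mem a ha fun b _ hb => by
      rw [Pi.single_eq_of_ne hb, Submodule.coe_zero, smul_zero], Pi.single_eq_same]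
  have hf : ∀ j, k < j → j ≤ (2 * l + 2 + P) / 2 → ∀ x ∈ LinearMap.range Ψ,
      fN j • x ∈ LinearMap.range Ψ := by
    rintro j hj hj' _ ⟨m, rfl⟩
    rw [hΨ, Finset.smul_sum]
    refine Submodule.sum_mem _ fun a ha => ?_
    have ha' := (hI a).mp ha
    obtain ⟨β, hβ, -⟩ := h.map_adChain hk hP ha'.1 ha'.2
    have e : fN j • gN k a • (m a : X) = adF hb _ j (gN k a) • (m a : X) +
        qpow hb (ip (simpleRoot _ j) β : ℤ) • gN k a • fN j • (m a : X) := by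
      rw [hβ.adF_eq, add_smul, smul_assoc, mul_smul, mul_smul, neg_smul, neg_add_cancel_right]
    rw [e]
    refine Submodule.add_mem _ ?_ (Submodule.smul_mem _ _
      (hmem a ha _ (h.fixed_f hk hP (m a).2 hj hj')))
    obtain e0 | ⟨b, hb1, hb2, e0⟩ := adF_adChain hq hk1 (by omega)
      (fun he => by have := Nat.even_iff.mp he; omega) hj hj' ha'.1 ha'.2
    · rw [e0, zero_smul]; exact Submodule.zero_mem _
    · rw [e0]; exact hmem b ((hI b).mpr ⟨hb1, hb2⟩) _ (m a).2
  have hword : ∀ w : List ℕ, (∀ i ∈ w, k < i ∧ i ≤ (2 * l + 2 + P) / 2) → ∀ p : Submodule ℂ X,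
      (∀ j, k < j → j ≤ (2 * l + 2 + P) / 2 → ∀ x ∈ p, fN j • x ∈ p) → ∀ x ∈ p,
      fWord hb (2 * l + 2 + P) w • x ∈ p := fun w hw p hp x hx => by
    induction w with
    | nil => rwa [fWord_nil, one_smul]
    | cons i w IH =>
      rw [fWord_cons, mul_smul]
      exact hp i (hw i (by simp)).1 (hw i (by simp)).2 _ (IH fun j hj => hw j (by simp [hj]))
  have hbase : ∀ i ∈ List.range' (k + 1) (l - k) ++ baseWord l P,
      k < i ∧ i ≤ (2 * l + 2 + P) / 2 := fun i hi => by
    rw [List.mem_append, List.mem_range'_1] at hi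
    obtain hi | hi := hi
    · omega
    · have := mem_baseWord hP hi; omega
  have hspan := hw.mem_span_perm hq (by omega) hv hy
    (L := k :: (List.range' (k + 1) (l - k) ++ baseWord l P))
    (fun i hi => by
      obtain rfl | hi := List.mem_cons.mp hi
      · omega
      · have := hbase i hi; omega)
    (fun i _ _ => by
      rw [hω, ← List.cons_append, show k :: List.range' (k + 1) (l - k) = List.range' k (l + 1 - k) by
        rw [show l + 1 - k = l - k + 1 by omega, List.range'_succ], List.map_append, List.sum_append,
        sum_rt_baseWord hP, sum_rt_range' (by omega), show k + (l + 1 - k) = l + 1 by omega,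
        show (2 : ℂ) = 1 + 1 by norm_num, Pi.single_add]
      simp only [Pi.sub_apply, Pi.add_apply]
      ring)
  have hrange : y ∈ LinearMap.range Ψ := by
    refine (Submodule.span_le.mpr ?_) hspan
    rintro _ ⟨w, hw', rfl⟩
    -- By its weight a word contributing to y contains the letter k exactly once. The letters to the
    -- right of it keep v in M, and those to the left preserve the range of Ψ.
    obtain ⟨u, u', rfl⟩ := List.append_of_mem ((hw' : w.Perm _).mem_iff.mpr (List.mem_cons_self ..))
    have hp := (List.perm_middle.symm.trans hw').cons_inv
    have hlet : ∀ i ∈ u ++ u', k < i ∧ i ≤ (2 * l + 2 + P) / 2 := fun i hi => hbase i (hp.subset hi)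
    change fWord hb (2 * l + 2 + P) (u ++ k :: u') • v ∈ _
    rw [fWord_append, fWord_cons, mul_smul, mul_smul]
    refine hword u (fun i hi => hlet i (by simp [hi])) _ hf _ ?_
    rw [← adChain_base]
    refine hmem _ ((hI _).mpr ⟨le_rfl, by omega⟩) _ ?_
    exact hword u' (fun i hi => hlet i (by simp [hi])) M
      (fun j hj hj' x hx => h.fixed_f hk hP hx hj hj') _ h.vac
  obtain ⟨m, rfl⟩ := hrange
  rw [hΨ] at h0 ⊢
  refine Finset.sum_eq_zero fun a ha => ?_
  have ha' := (hI a).mp ha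
  have h3 := h0 a ha'.1 ha'.2
  -- The component at w_a sees only the summand with index a, and there it is a nonzero multiple of
  -- q^{h_β} m_a; hence m_a = 0.
  have h4 : ∀ b ∈ I, b ≠ a → T (gN k b • (m b : X)) a = 0 := fun b hb hba => by
    have hb' := (hI b).mp hb
    obtain ⟨β, -, c, -, e⟩ := h.map_adChain hk hP hb'.1 hb'.2
    rw [e _ (m b).2, Pi.add_apply, Pi.single_eq_of_ne (by omega), Pi.single_eq_of_ne hba.symm, add_zero]
  obtain ⟨β, -, c, hc, e⟩ := h.map_adChain hk hP ha'.1 ha'.2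
  rw [map_sum, Finset.sum_apply, Finset.sum_eq_single_of_mem a ha h4, e _ (m a).2, Pi.add_apply,
    Pi.single_eq_of_ne (by omega), Pi.single_eq_same, zero_add, smul_eq_zero] at h3
  have h5 := h3.resolve_left hc
  rw [← KGen_neg_smul_KGen_smul (hb := hb) β (m a : X), h5, smul_zero, smul_zero]

end Injectivity


/-! ### Uniqueness of the vector killed by e_j, j > k -/

section Uniqueness

variable {hb : ℂ} {l P : ℕ} {X : Type*} [AddCommGroup X] [Module ℂ X]
  [Module (Uq hb (2 * l + 2 + P)) X] [IsScalarTower ℂ (Uq hb (2 * l + 2 + P)) X]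

local notation "eN" => eGen hb (2 * l + 2 + P)

variable {ν : ℕ → ℂ} {v : X} (h : IsVacuum hb l P ν v) (hq : NotRoot hb) (hP : 1 ≤ P)
include h hq hP

/-- A vector of weight `ν - ε_k - ε_{l+1}` killed by the `e_j`, `j > k`, is proportional to
`f_{ε_k+ε_{l+1}} v`. -/
theorem IsVacuum.sing_unique {d k : ℕ} (hd : d ≤ l) (hk : k = l + 1 - d) {y : X}
    (hy : IsWt hb (2 * l + 2 + P) (ν - Pi.single k 1 - Pi.single (l + 1) 1) y)
    (he : ∀ j, k < j → j ≤ (2 * l + 2 + P) / 2 → ¬(P = 2 ∧ k = l + 1) → eN j • y = 0) :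
    ∃ c : ℂ, y = c • fDesc hb l P d • v := by
  induction d generalizing k y with
  | zero =>
    obtain rfl : k = l + 1 := hk
    obtain ⟨T, hT⟩ := h.theta (l + 1) (by omega) le_rfl
    refine h.base_unique hq hT h.gen h.ne_zero hP ?_ fun h2 j h1 h3 => he j h1 h3 (by omega)
    rwa [show (2 : ℂ) = 1 + 1 by norm_num, Pi.single_add, ← sub_sub]
  | succ d IH =>
    obtain ⟨T, hT⟩ := h.theta k (by omega) (by omega)
    have hw := h.toHW.wt
    have hk1 := hT.pos
    have hrow : ∀ {x : X}, (∀ j, k < j → j ≤ (2 * l + 2 + P) / 2 → eN j • x = 0) → ∀ j, k < j →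
        j ≤ (2 * l + 2 + P) / 2 → ∀ a, natS (2 * l + 2 + P) j (a + natD (2 * l + 2 + P) j) •
          T x (a + natD (2 * l + 2 + P) j) + qpow hb (ip (simpleRoot _ j)
            (natWeight (2 * l + 2 + P) a) : ℤ) • eN j • T x a = 0 := fun {x} hx j h1 h2 a => by
      rw [← hT.comp_e h.gen hq hP hw h1 h2 (by omega) (h.e_all j) x a, hx j h1 h2, map_zero,
        Pi.zero_apply]
    have hwt := hT.lower_wt h.gen hP hw hy
    -- The component at w_{k+1} is killed by e_j for j > k + 1 and has the weight required for k +
    -- 1. The exemption at P = 2, k = l + 1 covers the node where the row equation has an additional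
    -- term.
    obtain ⟨c, hc⟩ := IH (k := k + 1) (by omega) (by omega) (y := lowerOp k T y) (by
      convert hwt using 1
      rw [rt, if_pos (by omega)]
      abel) fun j h1 h2 h3 => by
        have := hrow (fun j h1 h2 => he j h1 h2 (by omega)) j (by omega) h2 (k + 1)
        rw [natS_eq_zero_of_lt h1 h2 (by omega), zero_smul, zero_add] at this
        exact (smul_eq_zero.mp this).resolve_left (qpow_ne_zero _ _)
    obtain ⟨c', hc', e'⟩ := h.lower_fDesc hq hP hd (by omega : k = l - d) hT
    refine ⟨c / c', sub_eq_zero.mp ?_⟩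
    have hwd := HW.wt_fDesc hq h.toHW hP hd
    rw [show l + 1 - (d + 1) = k by omega] at hwd
    -- The difference has no component at w_{k+1}, by the choice of the scalar. The row equations
    -- carry this zero along the arrows to all indices up to N - k.
    refine hT.eq_zero_of_comp (by omega) hP hq hw h.gen (hy.sub (hwd.smul (c / c'))) rfl fun a ha ha' => ?_
    induction a using Nat.strong_induction_on with
    | _ a IHa =>
    obtain rfl | h3 : a = k + 1 ∨ k + 1 < a := by omega
    · change lowerOp k T _ = 0
      rw [map_sub, map_smul, e', hc, smul_smul, div_mul_cancel₀ _ hc', sub_self]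
    · obtain ⟨g1, g2, g3, g4, g5⟩ := arrow_spec (by omega)
        (fun he => by have := Nat.even_iff.mp he; omega) h3 ha'
      have hpos := natD_pos (N := 2 * l + 2 + P) (arrow (2 * l + 2 + P) a)
      have := hrow (x := y - (c / c') • fDesc hb l P (d + 1) • v) (fun j h1 h2 => by
        rw [smul_sub, he j h1 h2 (by omega), smul_smul_comm]
        rw [HW.e_fDesc hq h.toHW hP hd (fun j _ _ => h.e_all j) (by omega) h2, if_neg (by omega),
          zero_smul, smul_zero, sub_zero]) _ g1 g2 (a - natD (2 * l + 2 + P) (arrow (2 * l + 2 + P) a))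
      rw [Nat.sub_add_cancel g4, IHa _ (by omega) g3 (by omega), smul_zero, smul_zero,
        add_zero] at this
      exact (smul_eq_zero.mp this).resolve_left g5

end Uniqueness


/-! ### Singular vectors in coordinates -/

/-- The vector has weight `ν - β`. -/
def WtBelow (hb : ℂ) (N : ℕ) {X : Type*} [AddCommGroup X] [Module ℂ X] [Module (Uq hb N) X]
    (ν : ℕ → ℂ) (β : Lat N) (x : X) : Prop :=
  ∀ μ : Lat N, KGen hb N μ • x = qpow hb (wsum N ν μ - (ip μ β : ℤ)) • x

/-- The coordinates of a vector of weight `ν - ε_{l+1}` killed by the `e_j` in the tensor product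
with the natural representation. -/
structure IsSing (hb : ℂ) (N l : ℕ) {X : Type*} [AddCommGroup X] [Module ℂ X]
    [Module (Uq hb N) X] (ν : ℕ → ℂ) (Y : ℕ → X) : Prop where
  wt : ∀ a, 1 ≤ a → a ≤ N → WtBelow hb N ν (eps N (l + 1) + natWeight N a) (Y a)
  row : ∀ j, 1 ≤ j → j ≤ N / 2 → ∀ a, 1 ≤ a → a ≤ N →
    natS N j (a + natD N j) • Y (a + natD N j) +
      qpow hb (ip (simpleRoot N j) (natWeight N a) : ℤ) • eGen hb N j • Y a = 0

/-! ### Construction of a singular vector -/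

section Existence

variable {hb : ℂ} {l P : ℕ} {X : Type*} [AddCommGroup X] [Module ℂ X]
  [Module (Uq hb (2 * l + 2 + P)) X] [IsScalarTower ℂ (Uq hb (2 * l + 2 + P)) X]

local notation "eN" => eGen hb (2 * l + 2 + P)
local notation "KN" => KGen hb (2 * l + 2 + P)

variable {ν : ℕ → ℂ} {β : Lat (2 * l + 2 + P)} {x : X}

theorem wsum_single {N : ℕ} (i : ℕ) (μ : Lat N) :
    wsum N (Pi.single i 1) μ = (ip μ (eps N i) : ℤ) := by
  rw [wsum, ip, Int.cast_sum]
  refine Finset.sum_congr rfl fun k _ => ?_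
  rw [Int.cast_mul, eps_eq, mul_comm]

section

variable {N : ℕ} [Module (Uq hb N) X] [IsScalarTower ℂ (Uq hb N) X] {β : Lat N}

theorem WtBelow.smul (hx : WtBelow hb N ν β x) (c : ℂ) : WtBelow hb N ν β (c • x) := fun μ => by
  rw [smul_smul_comm, hx μ, smul_comm]

theorem WtBelow.e (hx : WtBelow hb N ν β x) (j : ℕ) :
    WtBelow hb N ν (β - simpleRoot _ j) (eGen hb N j • x) := fun μ => by
  rw [KGen_smul_eGen_smul, hx μ, smul_smul_comm, smul_smul, ← qpow_add, ip_sub_right]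
  congr 2
  push_cast
  ring

end

variable {v : X} (h : IsVacuum hb l P ν v) (hq : NotRoot hb) (hP : 1 ≤ P)
include h hq hP

omit hP in
theorem WtBelow.eq_zero_of_words (hx : WtBelow hb (2 * l + 2 + P) ν β x)
    (hβ : ∀ w : List ℕ, (∀ i ∈ w, 1 ≤ i ∧ i ≤ (2 * l + 2 + P) / 2) → wordRoot _ w = β →
      fWord hb (2 * l + 2 + P) w • v = 0) : x = 0 := by
  refine (Submodule.mem_bot ℂ).mp ((Submodule.span_le (p := ⊥)).mpr ?_
    (mem_span_fWord_of_wt hq h.gen h.wt hx))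
  rintro _ ⟨w, ⟨hw, hw'⟩, rfl⟩
  exact hβ w hw hw'

theorem WtBelow.eq_zero_of_first (hx : WtBelow hb (2 * l + 2 + P) ν β x)
    (hβ : β ⟨1, Finset.mem_Icc.mpr ⟨le_rfl, by omega⟩⟩ < 0) : x = 0 :=
  hx.eq_zero_of_words h hq fun w hw e => by
    have h0 : w.count 0 = 0 := List.count_eq_zero.mpr fun h0 => by have := hw _ h0; omega
    rw [← e, wordRoot_apply (by omega) hw] at hβ
    simp only [Nat.sub_self, h0] at hβ
    split_ifs at hβ <;> omega

theorem WtBelow.e_top (hx : WtBelow hb (2 * l + 2 + P) ν 0 x) {j : ℕ} (h1 : 1 ≤ j)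
    (h2 : j ≤ (2 * l + 2 + P) / 2) : eN j • x = 0 :=
  (hx.e j).eq_zero_of_words h hq fun w hw e => by
    have := perm_of_wordRoot_eq (N := 2 * l + 2 + P) (w := j :: w) (w' := []) (by omega)
      (fun i hi => by
        obtain rfl | hi := List.mem_cons.mp hi
        exacts [⟨h1, h2⟩, hw i hi]) (by simp) (by rw [wordRoot_cons, e, wordRoot_nil]; abel)
    exact absurd this.length_eq (by simp)

/-- With l = 0 the first coordinate of β excludes the letter 1. For P ≠ 2 the letter next to v is
then a Levi generator and kills it; for P = 2 the letter 2 is excluded as well. -/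
theorem WtBelow.eq_zero_of_last (hx : WtBelow hb (2 * l + 2 + P) ν β x) (hl : l = 0)
    (hβ : β ⟨1, Finset.mem_Icc.mpr ⟨le_rfl, by omega⟩⟩ = 0) (hβ' : β ≠ 0) : x = 0 :=
  hx.eq_zero_of_words h hq fun w hw e => by
    have h0 : w.count 0 = 0 := List.count_eq_zero.mpr fun h0 => by have := hw _ h0; omega
    rw [← e, wordRoot_apply (by omega) hw] at hβ
    simp only [Nat.sub_self, h0] at hβ
    have h1 : w.count 1 = 0 := by split_ifs at hβ <;> omega
    obtain rfl | ⟨w, i, rfl⟩ := w.eq_nil_or_concat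
    · exact absurd e.symm hβ'
    · rw [List.concat_eq_append] at *
      have hi := hw i (by simp)
      have hi1 : i ≠ 1 := by
        rintro rfl
        simp at h1
      by_cases hP2 : P = 2
      · obtain rfl : i = 2 := by omega
        rw [if_pos (by omega), h1, show (2 * l + 2 + P) / 2 = 2 by omega, List.count_append] at hβ
        simp at hβ
        omega
      · rw [fWord_append, fWord_cons, fWord_nil, mul_one, mul_smul,
          h.f hP2 i (by omega) hi.2, smul_zero]

omit h hq [IsScalarTower ℂ (Uq hb (2 * l + 2 + P)) X] in
-- Along the arrows with k = 0, each coordinate is a multiple of some e_j applied to an earlier one.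
theorem IsSing.eq_zero {Y : ℕ → X} (hY : IsSing hb (2 * l + 2 + P) l ν Y) (h1 : Y 1 = 0) {a : ℕ} (ha : 1 ≤ a)
    (ha' : a ≤ 2 * l + 2 + P) : Y a = 0 := by
  induction a using Nat.strong_induction_on with
  | _ a IH =>
  obtain rfl | h3 : a = 1 ∨ 0 + 1 < a := by omega
  · exact h1
  · obtain ⟨g1, g2, g3, g4, g5⟩ := arrow_spec (k := 0) (N := 2 * l + 2 + P) (by omega)
      (fun he => by have := Nat.even_iff.mp he; omega) h3 ha'
    have hpos := natD_pos (N := 2 * l + 2 + P) (arrow (2 * l + 2 + P) a)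
    have := hY.row _ g1 g2 (a - natD (2 * l + 2 + P) (arrow (2 * l + 2 + P) a)) g3 (by omega)
    rw [Nat.sub_add_cancel g4, IH _ (by omega) g3 (by omega), smul_zero, smul_zero,
      add_zero] at this
    exact (smul_eq_zero.mp this).resolve_left g5

omit h hq hP in
theorem eGen_comm {N : ℕ} {i j : ℕ} (h1 : i ≠ j) (h0 : ip (simpleRoot N i) (simpleRoot N j) = 0) :
    eGen hb N i * eGen hb N j = eGen hb N j * eGen hb N i := by
  rw [eGen, eGen]
  split_ifs with hi hj
  · have := gen_rel hb N (Rel.e_comm ⟨i, hi⟩ ⟨j, hj⟩ (by simpa using h1) h0)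
    rwa [map_mul, map_mul] at this
  all_goals simp

/-- For so(4) the map θ_1 does not intertwine e_2, because (α_2, ε_1) ≠ 0. The four coordinates are
therefore written down directly; the equations hold since e_1 and e_2 commute and the remaining
terms vanish for weight reasons. -/
theorem IsVacuum.exists_isSing_two (hl : l = 0) (hP2 : P = 2) :
    ∃ Y : ℕ → X, IsSing hb (2 * l + 2 + P) l ν Y ∧ Y 1 = fDesc hb l P l • v := by
  subst hl hP2
  change ∃ Y : ℕ → X, IsSing hb 4 0 ν Y ∧ Y 1 = fDouble hb 0 2 • v
  have hy : WtBelow hb 4 ν (eps _ 1 + natWeight 4 1) (fDouble hb 0 2 • v) := fun μ => by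
    have h1 := HW.wt_fDesc hq h.toHW hP le_rfl μ
    refine h1.trans ?_
    rw [wsum_sub_left, wsum_sub_left, wsum_single, ip_add_right, natWeight, if_pos (by omega)]
    congr 2
    push_cast
    ring
  generalize fDouble hb 0 2 • v = y at *
  have hcomm : eGen hb 4 1 • eGen hb 4 2 • y = eGen hb 4 2 • eGen hb 4 1 • y := by
    rw [← mul_smul, ← mul_smul, eGen_comm (by omega) (by decide)]
  have hcast : ∀ {β β' : Lat 4} {x : X}, WtBelow hb 4 ν β x → β = β' → WtBelow hb 4 ν β' x :=
    fun hx e => e ▸ hx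
  have h12 : WtBelow hb 4 ν 0 (eGen hb 4 1 • eGen hb 4 2 • y) := hcast (β' := 0) ((hy.e 2).e 1) (by decide)
  have h11 : eGen hb 4 1 • eGen hb 4 1 • y = 0 :=
    ((hy.e 1).e 1).eq_zero_of_last h hq hP rfl rfl (by decide)
  have h22 : eGen hb 4 2 • eGen hb 4 2 • y = 0 :=
    ((hy.e 2).e 2).eq_zero_of_last h hq hP rfl rfl (by decide)
  refine ⟨fun a => if a = 1 then y else if a = 2 then (-qpow hb 1) • eGen hb 4 1 • y else
    if a = 3 then (-qpow hb 1) • eGen hb 4 2 • y else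
      (-(qpow hb 1 * qpow hb 1)) • eGen hb 4 1 • eGen hb 4 2 • y,
    ⟨fun a h1 h2 => ?_, fun j h1 h2 a h3 h4 => ?_⟩, rfl⟩
  · obtain rfl | rfl | rfl | rfl : a = 1 ∨ a = 2 ∨ a = 3 ∨ a = 4 := by omega
    · exact hy
    · exact hcast ((hy.e 1).smul _) (by decide)
    · exact hcast ((hy.e 2).smul _) (by decide)
    · exact hcast (h12.smul _) (by decide)
  · have e1 := h12.e_top h hq hP (j := 1) (by omega) (by omega)
    have e2 := h12.e_top h hq hP (j := 2) (by omega) (by omega)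
    have t : ∀ j a : ℕ, ∀ t : ℤ, ip (simpleRoot 4 j) (natWeight 4 a) = t →
        ((ip (simpleRoot 4 j) (natWeight 4 a) : ℤ) : ℂ) = t := fun _ _ _ h => by rw [h]
    obtain rfl | rfl : j = 1 ∨ j = 2 := by omega
    · obtain rfl | rfl | rfl | rfl : a = 1 ∨ a = 2 ∨ a = 3 ∨ a = 4 := by omega
      · rw [t 1 1 1 (by decide)]
        simp [natS, natD]
      · simp [natS, natD, smul_smul_comm, h11]
      · rw [t 1 3 1 (by decide)]
        simp [natS, natD, smul_smul_comm, mul_smul]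
      · simp [natS, natD, smul_smul_comm, e1]
    · obtain rfl | rfl | rfl | rfl : a = 1 ∨ a = 2 ∨ a = 3 ∨ a = 4 := by omega
      · rw [t 2 1 1 (by decide)]
        simp [natS, natD]
      · rw [t 2 2 1 (by decide)]
        simp [natS, natD, smul_smul_comm, mul_smul, hcomm]
      · simp [natS, natD, smul_smul_comm, h22]
      · simp [natS, natD, smul_smul_comm, e2]

/-- With y = f_{ε_1+ε_{l+1}} v the intermediate coordinates are κ times those of θ_1(y). The rows of
e_j, j > 1, then hold because θ_1 intertwines these e_j, so only the rows of e_1 have to be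
arranged. -/
theorem IsVacuum.exists_isSing (hne : ¬(l = 0 ∧ P = 2)) :
    ∃ Y : ℕ → X, IsSing hb (2 * l + 2 + P) l ν Y ∧ Y 1 = fDesc hb l P l • v := by
  obtain ⟨T, hT⟩ := h.theta 1 le_rfl (by omega)
  have hN4 : ¬(2 * l + 2 + P = 4 ∧ l = 0) := by omega
  have hnat : ∀ {a : ℕ}, 2 ≤ a → a + 1 ≤ 2 * l + 2 + P →
      natWeight (2 * l + 2 + P) a ⟨1, Finset.mem_Icc.mpr ⟨le_rfl, by omega⟩⟩ = 0 := fun h1 h2 => by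
    rw [natWeight]
    split_ifs
    · rw [eps, if_neg (by simp; omega)]
    · rw [Pi.neg_apply, eps, if_neg (by simp; omega), neg_zero]
  obtain ⟨hy, hy', y', ⟨g, hg⟩, c, hc, hT2⟩ : WtBelow hb (2 * l + 2 + P) ν
      (eps _ (l + 1) + natWeight _ 1) (fDesc hb l P l • v) ∧
      (∀ j, 1 < j → j ≤ (2 * l + 2 + P) / 2 → eN j • fDesc hb l P l • v = 0) ∧ ∃ y' : X,
      (∃ g : ℂ, eN 1 • fDesc hb l P l • v = g • y') ∧ ∃ c : ℂ, c ≠ 0 ∧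
        T (fDesc hb l P l • v) (1 + 1) = c • y' := by
    refine ⟨fun μ => ?_, ?_⟩
    · have h1 := HW.wt_fDesc hq h.toHW hP le_rfl μ
      rw [h1, Nat.add_sub_cancel_left, wsum_sub_left, wsum_sub_left, wsum_single, wsum_single,
        ip_add_right, natWeight, if_pos (by omega)]
      congr 2
      push_cast
      ring
    · rcases l with _ | d
      · by_cases hP1 : P = 1
        · refine ⟨fun j h1 h2 => by omega, phiDel hb 0 P 1 • v, ⟨_, h.toHW.e_fDouble_one hq hP1⟩,
            hT.lower_fDouble h.gen hP h.wt rfl hq h.toHW (by omega)⟩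
        · refine ⟨fun j h1 h2 => ?_, phiDel hb 0 P 1 • v,
            ⟨_, HW.e_fDouble hq h.toHW (by omega) le_rfl (by omega)⟩,
            hT.lower_fDouble h.gen hP h.wt rfl hq h.toHW (by omega)⟩
          exact (HW.e_fDouble hq h.toHW (by omega) (by omega) h2).trans
            (by rw [if_neg (by omega), zero_smul])
      · refine ⟨fun j h1 h2 => ?_, fDesc hb (d + 1) P d • v, ?_, h.lower_fDesc hq hP le_rfl (by omega) hT⟩
        · rw [HW.e_fDesc hq h.toHW hP le_rfl (fun j _ _ => h.e_all j) (by omega) h2,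
            if_neg (by omega), zero_smul]
        · exact ⟨_, HW.e_fDesc hq h.toHW hP le_rfl (fun j _ _ => h.e_all j) (by omega) (by omega)⟩
  generalize fDesc hb l P l • v = y at *
  have hroot : simpleRoot (2 * l + 2 + P) 1 ⟨1, Finset.mem_Icc.mpr ⟨le_rfl, by omega⟩⟩ = 1 := by
    simp only [simpleRoot_apply]
    split_ifs <;> omega
  have hd1 : natD (2 * l + 2 + P) 1 = 1 := if_neg (by omega)
  have hTw : ∀ a, WtBelow hb (2 * l + 2 + P) ν (eps _ (l + 1) + natWeight _ a) (T y a) := fun a μ => by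
    have h1 := h.toHW.wt
    have h2 : ∀ μ, KN μ • y = qpow hb (wsum (2 * l + 2 + P)
        (ν - Pi.single 1 1 - Pi.single (l + 1) 1) μ) • y := fun μ => by
      rw [hy μ, wsum_sub_left, wsum_sub_left, wsum_single, wsum_single,
        ip_add_right, natWeight, if_pos (by omega)]
      congr 2
      push_cast
      ring
    rw [hT.comp_wt h.gen h1 h2, wsum_sub_left, wsum_sub_left, wsum_single, wsum_single,
      ip_add_right, natWeight, if_pos (by omega)]
    congr 2
    push_cast
    ring
  -- The scalar is chosen to satisfy the row of e_1 at w_1. This is possible because e_1 y and the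
  -- component of θ_1(y) at w_2 are multiples of one vector, the latter a nonzero one.
  obtain ⟨κ, hκ⟩ : ∃ κ : ℂ, κ * c + qpow hb (ip (simpleRoot (2 * l + 2 + P) 1)
      (natWeight (2 * l + 2 + P) 1) : ℤ) * g = 0 :=
    ⟨-(qpow hb (ip (simpleRoot (2 * l + 2 + P) 1) (natWeight (2 * l + 2 + P) 1) : ℤ) * g) / c, by
      rw [div_mul_cancel₀ _ hc, neg_add_cancel]⟩
  -- The last coordinate is forced by the row of e_1 at w_{N-1}.
  obtain ⟨z, hz⟩ : ∃ z, z = qpow hb (ip (simpleRoot (2 * l + 2 + P) 1)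
    (natWeight (2 * l + 2 + P) (2 * l + 1 + P)) : ℤ) • eN 1 • κ • T y (2 * l + 1 + P) := ⟨_, rfl⟩
  have hsN : natS (2 * l + 2 + P) 1 (2 * l + 2 + P) = -1 := by
    rw [natS, if_neg (by omega), hd1, if_pos (by omega)]
  have hzw : WtBelow hb (2 * l + 2 + P) ν
      (eps _ (l + 1) + natWeight _ (2 * l + 2 + P)) z := by
    rw [natWeight_of_natS le_rfl (by omega) (i := 1) (by rw [hsN]; norm_num), hd1,
      show 2 * l + 2 + P - 1 = 2 * l + 1 + P by omega, ← add_sub_assoc, hz]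
    exact (((hTw _).smul κ).e 1).smul _
  -- For l = 0 the vector z has the highest weight ν; for l > 0 its weight does not occur, so z = 0.
  have hze : ∀ j, 1 ≤ j → j ≤ (2 * l + 2 + P) / 2 → eN j • z = 0 := fun j h1 h2 => by
    obtain rfl | hl := Nat.eq_zero_or_pos l
    · refine WtBelow.e_top h hq hP ?_ h1 h2
      convert hzw using 1
      rw [natWeight, if_neg (by omega), Nat.add_sub_cancel_left, zero_add, add_neg_cancel]
    · rw [hzw.eq_zero_of_first h hq hP, smul_zero]
      rw [natWeight, if_neg (by omega), Nat.add_sub_cancel_left]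
      simp [eps]
      omega
  refine ⟨fun a => if a = 1 then y else if a = 2 * l + 2 + P then z else κ • T y a,
    ⟨fun a h1 h2 => ?_, fun j h1 h2 a h3 h4 => ?_⟩, if_pos rfl⟩
  · split_ifs with h5 h6
    · rwa [h5]
    · rwa [h6]
    · exact (hTw a).smul κ
  · have hpos := natD_pos (N := 2 * l + 2 + P) j
    have hD : natD (2 * l + 2 + P) j = if 2 * j = 2 * l + 2 + P then 2 else 1 := rfl
    have hS := natS_ne_zero (N := 2 * l + 2 + P) (j := j) (a := a + natD (2 * l + 2 + P) j)
    rw [if_neg (by omega : ¬(a + natD (2 * l + 2 + P) j = 1))]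
    by_cases h5 : a = 2 * l + 2 + P
    · have : natS (2 * l + 2 + P) j (a + natD (2 * l + 2 + P) j) = 0 := by
        by_contra h6
        have := hS h6
        omega
      rw [this, if_neg (by omega : ¬a = 1), if_pos h5, hze j h1 h2, zero_smul, smul_zero, add_zero]
    rw [if_neg h5]
    obtain rfl | hj : j = 1 ∨ 1 < j := by omega
    · by_cases h6 : a = 1
      · subst h6
        rw [hd1, if_neg (by omega), if_pos rfl, hT2, hg, natS, if_pos rfl, one_smul, smul_smul,
          smul_smul, ← add_smul, hκ, zero_smul]
      rw [if_neg h6]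
      by_cases h7 : a = 2 * l + 1 + P
      · subst h7
        rw [hd1, if_pos (by omega), show 2 * l + 1 + P + 1 = 2 * l + 2 + P by omega, hsN, hz, neg_one_smul,
          neg_add_cancel]
      · have : natS (2 * l + 2 + P) 1 (a + natD (2 * l + 2 + P) 1) = 0 := by
          by_contra h6
          have := hS h6
          omega
        -- For 1 < a < N - 1 the vector e_1 θ_1(y)_a vanishes because its weight space is zero.
        have h8 : eN 1 • κ • T y a = 0 := by
          have hw := ((hTw a).smul κ).e 1
          have h9 := hnat (a := a) (by omega) (by omega)
          obtain rfl | hl := Nat.eq_zero_or_pos l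
          · refine hw.eq_zero_of_last h hq hP rfl ?_ fun h0 => ?_
            · rw [Pi.sub_apply, Pi.add_apply, h9, hroot]
              simp [eps]
            · have := congrFun h0 ⟨2, Finset.mem_Icc.mpr ⟨by omega, by omega⟩⟩
              rw [Pi.sub_apply, Pi.add_apply, simpleRoot_apply, natWeight] at this
              simp only [eps, Pi.zero_apply] at this
              split_ifs at this <;> simp [eps] at this <;> omega
          · refine hw.eq_zero_of_first h hq hP ?_
            rw [Pi.sub_apply, Pi.add_apply, h9, hroot, eps, if_neg (by simp; omega)]
            norm_num
        rw [this, h8, zero_smul, smul_zero, add_zero]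
    · by_cases h6 : a = 1
      · subst h6
        rw [if_pos rfl, natS_eq_zero_of_lt hj h2 (by omega), hy' j hj h2, zero_smul, smul_zero,
          add_zero]
      · have h7 := hT.comp_e h.gen hq hP h.wt hj h2 (by omega) (h.e_all j) y a
        rw [hy' j hj h2, map_zero, Pi.zero_apply] at h7
        have h8 : natS (2 * l + 2 + P) j (a + natD (2 * l + 2 + P) j) •
            (if a + natD (2 * l + 2 + P) j = 2 * l + 2 + P then z
              else κ • T y (a + natD (2 * l + 2 + P) j)) =
            κ • natS (2 * l + 2 + P) j (a + natD (2 * l + 2 + P) j) •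
              T y (a + natD (2 * l + 2 + P) j) := by
          by_cases h9 : natS (2 * l + 2 + P) j (a + natD (2 * l + 2 + P) j) = 0
          · rw [h9, zero_smul, zero_smul, smul_zero]
          · have := hS h9
            rw [if_neg (by split_ifs at hD <;> omega), smul_comm]
        rw [h8, if_neg h6, smul_smul_comm, smul_comm _ κ, ← smul_add, ← h7, smul_zero]

end Existence


/-! ### Coordinates of tensors -/

section Coordinates

open TensorProduct

variable (hb : ℂ) (N : ℕ) (X : Type*) [AddCommGroup X] [Module ℂ X] [Module (Uq hb N) X]
  [IsScalarTower ℂ (Uq hb N) X]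

/-- The coefficient of `w_a`, zero for `a` outside `1, …, N`. -/
def coord (a : ℕ) : (Idx N → ℂ) ⊗[ℂ] X →ₗ[ℂ] X :=
  if h : a ∈ Finset.Icc 1 N then
    (TensorProduct.lid ℂ X).toLinearMap ∘ₗ LinearMap.rTensor X (LinearMap.proj (⟨a, h⟩ : Idx N))
  else 0

/-- The action of `e_{α_i}` on the tensor product with the natural representation. -/
def natTensorE (i : ℕ) : (Idx N → ℂ) ⊗[ℂ] X →ₗ[ℂ] (Idx N → ℂ) ⊗[ℂ] X :=
  TensorProduct.map (Matrix.toLin' (natE N i)) LinearMap.id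
    + TensorProduct.map (Matrix.toLin' (natK hb N (simpleRoot N i)))
        (Algebra.lsmul ℂ ℂ X (eGen hb N i))

/-- The action of `K μ` on the tensor product with the natural representation. -/
def natTensorK (μ : Lat N) : (Idx N → ℂ) ⊗[ℂ] X →ₗ[ℂ] (Idx N → ℂ) ⊗[ℂ] X :=
  TensorProduct.map (Matrix.toLin' (natK hb N μ)) (Algebra.lsmul ℂ ℂ X (KGen hb N μ))

variable {N X}

theorem coord_tmul (a : Idx N) (w : Idx N → ℂ) (x : X) : coord N X a (w ⊗ₜ[ℂ] x) = w a • x := by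
  rw [coord, dif_pos a.2]
  rfl

theorem coord_of_notMem {a : ℕ} (h : a ∉ Finset.Icc 1 N) (u : (Idx N → ℂ) ⊗[ℂ] X) :
    coord N X a u = 0 := by
  rw [coord, dif_neg h, LinearMap.zero_apply]

theorem sum_coord (u : (Idx N → ℂ) ⊗[ℂ] X) :
    ∑ a : Idx N, (Pi.single a 1 : Idx N → ℂ) ⊗ₜ[ℂ] coord N X a u = u := by
  induction u using TensorProduct.induction_on with
  | zero => simp
  | tmul w x =>
    simp only [coord_tmul, ← TensorProduct.smul_tmul, ← TensorProduct.sum_tmul]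
    congr 1
    funext b
    simp [Finset.sum_apply, Pi.single_apply]
  | add u u' h h' => simp only [map_add, TensorProduct.tmul_add, Finset.sum_add_distrib, h, h']

theorem coord_ext {u u' : (Idx N → ℂ) ⊗[ℂ] X} (h : ∀ a, 1 ≤ a → a ≤ N →
    coord N X a u = coord N X a u') : u = u' := by
  rw [← sum_coord u, ← sum_coord u']
  exact Finset.sum_congr rfl fun a _ => by
    rw [h a (Finset.mem_Icc.mp a.2).1 (Finset.mem_Icc.mp a.2).2]

theorem exists_coord (Y : ℕ → X) : ∃ u : (Idx N → ℂ) ⊗[ℂ] X, ∀ a, 1 ≤ a → a ≤ N →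
    coord N X a u = Y a := by
  refine ⟨∑ b : Idx N, (Pi.single b 1 : Idx N → ℂ) ⊗ₜ[ℂ] Y b, fun a h1 h2 => ?_⟩
  obtain ⟨a, rfl⟩ : ∃ b : Idx N, (b : ℕ) = a := ⟨⟨a, Finset.mem_Icc.mpr ⟨h1, h2⟩⟩, rfl⟩
  rw [map_sum, Finset.sum_eq_single a, coord_tmul, Pi.single_eq_same, one_smul]
  · intro b _ hb
    rw [coord_tmul, Pi.single_eq_of_ne hb.symm, zero_smul]
  · simp

theorem coord_natTensorK (μ : Lat N) (a : Idx N) (u : (Idx N → ℂ) ⊗[ℂ] X) :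
    coord N X a (natTensorK hb N X μ u) =
      qpow hb (ip μ (natWeight N a) : ℤ) • KGen hb N μ • coord N X a u := by
  induction u using TensorProduct.induction_on with
  | zero => simp
  | tmul w x =>
    rw [natTensorK, TensorProduct.map_tmul, coord_tmul, coord_tmul, natK, Matrix.toLin'_apply,
      Matrix.mulVec_diagonal, smul_smul_comm, smul_smul]
    rfl
  | add u u' h h' => simp only [map_add, h, h', smul_add]

theorem natE_apply {j : ℕ} (h1 : 1 ≤ j) (h2 : j ≤ N / 2) (a b : Idx N) :
    natE N j a b = if (b : ℕ) = a + natD N j then natS N j b else 0 := by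
  simp only [natE, natS, natD, Nat.even_iff]
  split_ifs <;> first | rfl | omega

theorem coord_natTensorE {j : ℕ} (h1 : 1 ≤ j) (h2 : j ≤ N / 2) (a : Idx N)
    (u : (Idx N → ℂ) ⊗[ℂ] X) : coord N X a (natTensorE hb N X j u) =
      natS N j (a + natD N j) • coord N X (a + natD N j) u +
      qpow hb (ip (simpleRoot N j) (natWeight N a) : ℤ) • eGen hb N j • coord N X a u := by
  induction u using TensorProduct.induction_on with
  | zero => simp
  | tmul w x =>
    rw [natTensorE, LinearMap.add_apply, TensorProduct.map_tmul, TensorProduct.map_tmul, map_add,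
      coord_tmul, coord_tmul, coord_tmul, natK, Matrix.toLin'_apply,
      Matrix.toLin'_apply, Matrix.mulVec_diagonal, smul_smul_comm, smul_smul]
    congr 1
    simp only [Matrix.mulVec, dotProduct, natE_apply h1 h2, ite_mul, zero_mul, LinearMap.id_apply]
    by_cases h3 : (a : ℕ) + natD N j ∈ Finset.Icc 1 N
    · obtain ⟨c, hc⟩ : ∃ c : Idx N, (c : ℕ) = a + natD N j := ⟨⟨_, h3⟩, rfl⟩
      rw [← hc, Finset.sum_eq_single c, if_pos rfl, coord_tmul, smul_smul]
      · intro b _ hb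
        rw [if_neg fun h => hb (Subtype.ext h)]
      · simp
    · rw [Finset.sum_eq_zero fun b _ => if_neg fun h => h3 (by
        rw [← h]; exact b.2), zero_smul,
        coord_of_notMem h3, smul_zero]
  | add u u' h h' =>
    simp only [map_add, h, h', smul_add]
    abel

theorem isSing_coord_iff {l : ℕ} {ν : ℕ → ℂ} (u : (Idx N → ℂ) ⊗[ℂ] X) :
    IsSing hb N l ν (fun a => coord N X a u) ↔
      (∀ μ, natTensorK hb N X μ u = qpow hb (wsum N ν μ - (ip μ (eps N (l + 1)) : ℤ)) • u) ∧
        ∀ i, 1 ≤ i → i ≤ N / 2 → natTensorE hb N X i u = 0 := by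
  have key : ∀ (μ : Lat N) (a : Idx N), qpow hb (ip μ (natWeight N a) : ℤ) • qpow hb (wsum N ν μ -
      (ip μ (eps N (l + 1) + natWeight N a) : ℤ)) • coord N X a u =
      qpow hb (wsum N ν μ - (ip μ (eps N (l + 1)) : ℤ)) • coord N X a u := fun μ a => by
    rw [smul_smul, ← qpow_add, ip_add_right]
    congr 2
    push_cast
    ring
  refine ⟨fun h => ⟨fun μ => coord_ext fun a h1 h2 => ?_, fun i hi hi' => coord_ext fun a h1 h2 => ?_⟩,
    fun h => ⟨fun a h1 h2 μ => ?_, fun j hj hj' a h1 h2 => ?_⟩⟩ <;>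
  obtain ⟨a, rfl⟩ : ∃ b : Idx N, (b : ℕ) = a := ⟨⟨a, Finset.mem_Icc.mpr ⟨h1, h2⟩⟩, rfl⟩
  · rw [coord_natTensorK, map_smul, h.wt a h1 h2 μ, key]
  · rw [coord_natTensorE _ hi hi', map_zero, h.row i hi hi' a h1 h2]
  · have := congrArg (coord N X a) (h.1 μ)
    rw [coord_natTensorK, map_smul, ← key] at this
    exact smul_right_injective X (qpow_ne_zero _ _) this
  · have := congrArg (coord N X a) (h.2 j hj hj')
    rwa [coord_natTensorE _ hj hj', map_zero] at this

end Coordinates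


/-! ### Singular vectors of ℂ^N ⊗ M_λ -/

section Singular

variable {hb : ℂ} {l P : ℕ} {lam : Node (2 * l + 2 + P) → ℂ}

theorem isSingular_iff (u : NatTensor hb l P lam) :
    IsSingular hb l P lam (targetWeight l P lam) u ↔
      u ≠ 0 ∧ IsSing hb (2 * l + 2 + P) l (extWt lam) (fun a => coord _ (Verma hb l P lam) a u) := by
  have hpair : ∀ μ, pair (targetWeight l P lam) μ =
      wsum _ (extWt lam) μ - (ip μ (eps _ (l + 1)) : ℤ) := fun μ => by
    rw [wsum_extWt]
    simp only [pair, ip, targetWeight, sub_mul, Finset.sum_sub_distrib, Int.cast_sum, Int.cast_mul]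
    simp only [mul_comm]
  rw [isSing_coord_iff, IsSingular]
  simp only [hpair]
  rfl

theorem coeff_firstIdx (u : NatTensor hb l P lam) :
    coeff hb l P lam (firstIdx l P) u = coord _ (Verma hb l P lam) 1 u := by
  rw [coord, dif_pos (Finset.mem_Icc.mpr ⟨le_rfl, by omega⟩)]
  rfl

end Singular

/-! ### The generating coefficient, existence and uniqueness -/

section First

variable {hb : ℂ} {l P : ℕ} {X : Type*} [AddCommGroup X] [Module ℂ X]
  [Module (Uq hb (2 * l + 2 + P)) X] [IsScalarTower ℂ (Uq hb (2 * l + 2 + P)) X]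
  {ν : ℕ → ℂ} {v : X} (h : IsVacuum hb l P ν v) (hq : NotRoot hb) (hP : 1 ≤ P)
include h hq hP

theorem IsVacuum.exists_smul_of_isSing {Y : ℕ → X} (hY : IsSing hb (2 * l + 2 + P) l ν Y) :
    ∃ c : ℂ, Y 1 = c • fDesc hb l P l • v := by
  refine h.sing_unique hq hP le_rfl (k := 1) (by omega) (fun μ => ?_) fun j h1 h2 h3 => ?_
  · rw [hY.wt 1 le_rfl (by omega) μ, wsum_sub_left, wsum_sub_left, wsum_single, wsum_single,
      ip_add_right, natWeight, if_pos (by omega)]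
    congr 2
    push_cast
    ring
  · have := hY.row j (by omega) h2 1 le_rfl (by omega)
    rw [natS_eq_zero_of_lt h1 h2 (by omega), zero_smul, zero_add] at this
    exact (smul_eq_zero.mp this).resolve_left (qpow_ne_zero _ _)

theorem IsVacuum.exists_tensor : ∃ u : TensorProduct ℂ (Idx (2 * l + 2 + P) → ℂ) X, u ≠ 0 ∧
    IsSing hb (2 * l + 2 + P) l ν (fun a => coord _ X a u) ∧ coord _ X 1 u = fDesc hb l P l • v := by
  obtain ⟨Y, hY, hY1⟩ : ∃ Y : ℕ → X, IsSing hb (2 * l + 2 + P) l ν Y ∧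
      Y 1 = fDesc hb l P l • v := by
    by_cases hne : l = 0 ∧ P = 2
    · exact h.exists_isSing_two hq hP hne.1 hne.2
    · exact h.exists_isSing hq hP hne
  obtain ⟨u, hu⟩ := exists_coord (N := 2 * l + 2 + P) Y
  have hu1 := (hu 1 le_rfl (by omega)).trans hY1
  refine ⟨u, fun h0 => h.fDesc_ne_zero hq hP le_rfl (by rw [← hu1, h0, map_zero]),
    ⟨fun a h1 h2 => ?_, fun j h1 h2 a h3 h4 => ?_⟩, hu1⟩
  · rw [hu a h1 h2]
    exact hY.wt a h1 h2
  · rw [hu a h3 h4, ← hY.row j h1 h2 a h3 h4]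
    congr 1
    -- The coordinates of u agree with Y only for indices up to N, which suffices: the matrix entry
    -- vanishes for larger ones.
    by_cases h5 : natS (2 * l + 2 + P) j (a + natD (2 * l + 2 + P) j) = 0
    · rw [h5, zero_smul, zero_smul]
    · have h6 := natS_ne_zero h5
      have h7 : natD (2 * l + 2 + P) j = if 2 * j = 2 * l + 2 + P then 2 else 1 := rfl
      rw [hu _ (by omega) (by split_ifs at h7 <;> omega)]

theorem IsVacuum.tensor_unique {u u' : TensorProduct ℂ (Idx (2 * l + 2 + P) → ℂ) X} (h0 : u ≠ 0)
    (hu : IsSing hb (2 * l + 2 + P) l ν (fun a => coord _ X a u))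
    (hu' : IsSing hb (2 * l + 2 + P) l ν (fun a => coord _ X a u')) : ∃ c : ℂ, u' = c • u := by
  have hfirst : ∀ u, IsSing hb (2 * l + 2 + P) l ν (fun a => coord _ X a u) →
      coord _ X 1 u = 0 → u = 0 :=
    fun u hu h0 => coord_ext fun a h1 h2 => by rw [hu.eq_zero hP h0 h1 h2, map_zero]
  obtain ⟨c, hc⟩ := h.exists_smul_of_isSing hq hP hu
  obtain ⟨c', hc'⟩ := h.exists_smul_of_isSing hq hP hu'
  have hc0 : c ≠ 0 := fun hc0 => h0 (hfirst u hu (by rw [hc, hc0, zero_smul]))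
  refine ⟨c' / c, sub_eq_zero.mp (hfirst _ ?_ ?_)⟩
  · rw [isSing_coord_iff] at *
    refine ⟨fun μ => ?_, fun i h1 h2 => ?_⟩
    · rw [map_sub, map_smul, hu.1, hu'.1, smul_sub, smul_comm (c' / c)]
    · rw [map_sub, map_smul, hu.2 i h1 h2, hu'.2 i h1 h2, smul_zero, sub_zero]
  · rw [map_sub, map_smul, hc, hc', smul_smul, div_mul_cancel₀ _ hc0, sub_self]

theorem IsVacuum.e_fDesc_all {d k j : ℕ} (hd : d + 1 ≤ l) (hk : k = l - d)
    (h2 : j ≤ (2 * l + 2 + P) / 2) : eGen hb (2 * l + 2 + P) j • fDesc hb l P (d + 1) • v =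
      (if j = k then qnum hb (ν k + ν (l + 1) + P + d) else 0) • fDesc hb l P d • v := by
  subst hk
  by_cases hj : l - d ≤ j
  · exact HW.e_fDesc hq h.toHW hP hd (fun j _ _ => h.e_all j) hj h2
  · rw [← mul_smul, (eGen_commute_fDesc hd (by omega)).eq, mul_smul, h.e_all, smul_zero,
      if_neg (by omega), zero_smul]

theorem IsVacuum.e_fDouble_all {j : ℕ} (h1 : 1 ≤ j) (h2 : j ≤ (2 * l + 2 + P) / 2)
    (hne : ¬(P = 2 ∧ j = l + 2)) : eGen hb (2 * l + 2 + P) j • fDouble hb l P • v =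
      (if j = l + 1 then qnum hb (ν (l + 1) + P / 2 - 1) else 0) • phiDel hb l P 1 • v := by
  by_cases hj : j ≤ l
  · have := (eGen_commute_fDesc (hb := hb) (P := P) (Nat.zero_le l) hj).eq
    rw [fDesc] at this
    rw [← mul_smul, this, mul_smul, h.e_all, smul_zero, if_neg (by omega), zero_smul]
  obtain rfl | rfl | hP3 : P = 1 ∨ P = 2 ∨ 3 ≤ P := by omega
  · obtain rfl : j = l + 1 := by omega
    rw [if_pos rfl]
    exact h.toHW.e_fDouble_one hq rfl
  · obtain rfl : j = l + 1 := by omega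
    rw [if_pos rfl, (h.toHW.e_fDouble_two hq rfl).1, phiDel_one_smul (by omega), bW_one_two hq rfl]
    simp
  · exact HW.e_fDouble hq h.toHW hP3 (by omega) h2

end First

end QuantumSO
end

/-! ### The proposition -/

theorem mainTheorem4 (l P : ℕ) (hP : 1 ≤ P) (hb : ℂ)
    (hq : ∀ k : ℕ, 0 < k → Complex.exp hb ^ k ≠ 1)
    (lam : Node (2 * l + 2 + P) → ℂ)
    (hlam : ∀ i : Node (2 * l + 2 + P), l + 2 ≤ (i : ℕ) → lam i = 0) :
    (∀ k j : ℕ, 1 ≤ k → k ≤ l → 1 ≤ j → j ≤ (2 * l + 2 + P) / 2 →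
      eGen hb (2 * l + 2 + P) j • fP hb l P k • vacuum hb l P lam =
        (if j = k then
          qnum hb (pair lam (eps _ k) + pair lam (eps _ (l + 1)) + P + l - k) else 0) •
          (fP hb l P (k + 1) • vacuum hb l P lam)) ∧
    (∀ j : ℕ, 1 ≤ j → j ≤ (2 * l + 2 + P) / 2 → ¬(P = 2 ∧ j = l + 2) →
      eGen hb (2 * l + 2 + P) j • fP hb l P (l + 1) • vacuum hb l P lam =
        (if j = l + 1 then qnum hb (pair lam (eps _ (l + 1)) + (P : ℂ) / 2 - 1) else 0) •
          (phiDel hb l P 1 • vacuum hb l P lam)) ∧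
    (P = 2 →
      eGen hb (2 * l + 2 + P) (l + 2) • fP hb l P (l + 1) • vacuum hb l P lam =
        qnum hb (pair lam (eps _ (l + 1))) • (fGen hb (2 * l + 2 + P) (l + 1) • vacuum hb l P lam)) ∧
    IsGeneratingCoeff hb l P lam (fP hb l P 1 • vacuum hb l P lam) ∧
    (∀ y : Verma hb l P lam, IsGeneratingCoeff hb l P lam y →
      ∃ c : ℂ, y = c • (fP hb l P 1 • vacuum hb l P lam)) ∧
    (∀ u u' : NatTensor hb l P lam,
      IsSingular hb l P lam (targetWeight l P lam) u →
      IsSingular hb l P lam (targetWeight l P lam) u' → ∃ c : ℂ, u' = c • u) ∧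
    fP hb l P 1 • vacuum hb l P lam ≠ 0 := by
  have hq' : NotRoot hb := hq
  have h := isVacuum_vacuum hP hlam (hb := hb)
  have hpair : ∀ k, 1 ≤ k → k ≤ l + 1 → pair lam (eps _ k) = extWt lam k := fun k h1 h2 => by
    rw [← wsum_extWt, wsum_eps, if_pos (by omega)]
  have hl : fP hb l P (l + 1) = fDouble hb l P := by rw [fP, Nat.sub_self, fDesc]
  refine ⟨fun k j hk hkl hj hj' => ?_, fun j hj hj' hne => ?_, fun hP2 => ?_, ?_, ?_, ?_,
    h.fDesc_ne_zero hq' hP le_rfl⟩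
  · obtain ⟨d, hd⟩ : ∃ d, d = l - k := ⟨_, rfl⟩
    rw [fP, fP, show l + 1 - k = d + 1 by omega, show l + 1 - (k + 1) = d by omega,
      h.e_fDesc_all hq' hP (by omega) (by omega : k = l - d) hj', hpair k hk (by omega),
      hpair _ (by omega) le_rfl, hd, Nat.cast_sub hkl, add_sub_assoc]
  · rw [hl, h.e_fDouble_all hq' hP hj hj' hne, hpair _ (by omega) le_rfl]
  · rw [hl, (h.toHW.e_fDouble_two hq' hP2).2, hpair _ (by omega) le_rfl]
  · obtain ⟨u, h0, hu, hu1⟩ := h.exists_tensor hq' hP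
    exact ⟨u, (isSingular_iff u).mpr ⟨h0, hu⟩, (coeff_firstIdx u).trans hu1⟩
  · rintro _ ⟨u, hu, rfl⟩
    rw [coeff_firstIdx]
    exact h.exists_smul_of_isSing hq' hP ((isSingular_iff u).mp hu).2
  · intro u u' hu hu'
    obtain ⟨h0, hu⟩ := (isSingular_iff u).mp hu
    exact h.tensor_unique hq' hP h0 hu ((isSingular_iff u').mp hu').2
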